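/- Let $R\to\mathbb C$ be one of the two ring homomorphisms $\mathbb C[\varepsilon]/(\varepsilon^2)\to\mathbb C$, $\varepsilon\mapsto 0$, or $\mathbb C[[\hbar]]\to\mathbb C$, $\hbar\mapsto 0$. Let $\mathcal P_R$ be the 2-category whose objects are triples $(\mathcal C,\mathcal S,\Phi)$ consisting of a small $R$-linear category $\mathcal C$ with a distinguished object (an $E_0$-algebra in $R$-linear categories), a small $\mathbb C$-linear symmetric monoidal category $\mathcal S$ (with bilinear tensor product), and an equivalence $\Phi:\mathcal C\otimes_R\mathbb C\simeq\mathcal S$ of pointed $\mathbb C$-linear categories, where $\mathcal S$ is pointed by its unit. A 1-morphism is a triple $(F,G,\varphi)$ of a pointed $R$-linear functor $F$ (preserving the distinguished object up to a specified isomorphism), a $\mathbb C$-linear symmetric monoidal functor $G$, and a pointed natural isomorphism $\varphi$ filling the square formed by $F\otimes_R\mathbb C$, $G$ and the equivalences $\Phi$; a 2-morphism is a pair of a pointed natural transformation and a monoidal natural transformation compatible with the $\varphi$'s. Thus $\mathcal P_R$ is the pseudo-pullback of base change $-\otimes_R\mathbb C$ and the forgetful functor from $\mathbb C$-linear symmetric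 monoidal categories to pointed $\mathbb C$-linear categories. It carries the componentwise tensor product $(\mathcal C,\mathcal S,\Phi)\otimes(\mathcal C',\mathcal S',\Phi')=(\mathcal C\otimes_R\mathcal C',\mathcal S\otimes_{\mathbb C}\mathcal S',\Phi\otimes\Phi')$, where the linear tensor product of categories has pairs as objects and tensor products of Hom-modules as Hom-modules. We write $\mathrm{aP}_0\text{-}\mathrm{Cat}$ for $\mathcal P_R$ with $R=\mathbb C[\varepsilon]/(\varepsilon^2)$, and $\mathrm{BD}_0\text{-}\mathrm{Cat}$ for $\mathcal P_R$ with $R=\mathbb C[[\hbar]]$; both are regarded as $(2,1)$-categories, by discarding the non-invertible 2-morphisms. A small $(2,1)$-category $E$ is sifted if it is non-empty and its diagonal $E\to E\times E$ is cofinal with respect to diagrams in $(2,1)$-categories, i.e. for every pseudofunctor $J$ from $E\times E$ to a $(2,1)$-category and every object $X$ of the latter, restriction along the diagonal is an equivalence from the category of pseudo-cocones under $J$ with vertex $X$ to that of pseudo-cocones under the restriction of $J$ with vertex $X$. Then, as $(2,1)$-categories, both $\mathrm{aP}_0\text{-}\mathrm{Cat}$ and $\mathrm{BD}_0\text{-}\mathrm{Cat}$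 are tensor sifted cocomplete, which is the condition on a target of factorization homology: the bicolimit of every pseudofunctor from a small sifted $(2,1)$-category exists, and the functors $Y\otimes-$ and $-\otimes Y$ preserve these bicolimits for every object $Y$. Moreover these bicolimits are computed componentwise: a pseudo-cocone under a sifted diagram $J$ in $\mathcal P_R$ is a bicolimit if and only if its images in the $(2,1)$-category of small pointed $R$-linear categories and in the $(2,1)$-category of small $\mathbb C$-linear symmetric monoidal categories are both bicolimits. -/

import Mathlib

open CategoryTheory Bicategory
open scoped TensorProduct

universe u

set_option linter.unusedVariables false

noncomputable section

universe w₁ v₁ u₁ w₂ v₂ u₂ w₃ v₃ u₃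

/-! ### Bicolimits -/

section

variable {E : Type u₁} [Bicategory.{w₁, v₁} E] {B : Type u₂} [Bicategory.{w₂, v₂} B]
  {B' : Type u₃} [Bicategory.{w₃, v₃} B']

/-- A pseudo-cocone under `J` with vertex `X`, i.e. a pseudonatural transformation from `J` to the
constant pseudofunctor at `X`. -/
structure BiCocone (J : E ⥤ᵖ B) (X : B) where
  leg (e : E) : J.obj e ⟶ X
  legIso {e e' : E} (f : e ⟶ e') : J.map f ≫ leg e' ≅ leg e
  naturality {e e' : E} {f g : e ⟶ e'} (η : f ⟶ g) :
    J.map₂ η ▷ leg e' ≫ (legIso g).hom = (legIso f).hom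
  legIso_id (e : E) : (legIso (𝟙 e)).hom = (J.mapId e).hom ▷ leg e ≫ (λ_ (leg e)).hom
  legIso_comp {e e' e'' : E} (f : e ⟶ e') (g : e' ⟶ e'') :
    (legIso (f ≫ g)).hom = (J.mapComp f g).hom ▷ leg e'' ≫
      (α_ (J.map f) (J.map g) (leg e'')).hom ≫ J.map f ◁ (legIso g).hom ≫ (legIso f).hom

namespace BiCocone

variable {J : E ⥤ᵖ B}

/-- A morphism of pseudo-cocones with the same vertex, i.e. a modification. -/
@[ext] structure Hom {X : B} (c d : BiCocone J X) where
  app (e : E) : c.leg e ⟶ d.leg e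
  comm {e e' : E} (f : e ⟶ e') :
    J.map f ◁ app e' ≫ (d.legIso f).hom = (c.legIso f).hom ≫ app e

attribute [simp] Hom.comm

@[simps id_app comp_app]
instance (X : B) : Category (BiCocone J X) where
  Hom c d := Hom c d
  id c := { app := fun e => 𝟙 _, comm := by simp }
  comp φ ψ :=
    { app := fun e => φ.app e ≫ ψ.app e
      comm := fun f => by
        have h := φ.comm f
        simp [← reassoc_of% h] }

@[ext] lemma hom_ext {X : B} {c d : BiCocone J X} {φ ψ : c ⟶ d}
    (h : ∀ e, Hom.app φ e = Hom.app ψ e) : φ = ψ :=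
  Hom.ext (funext h)

/-- Whiskering a pseudo-cocone with a 1-cell out of its vertex. -/
@[simps] def whisker {X Y : B} (c : BiCocone J X) (h : X ⟶ Y) : BiCocone J Y where
  leg e := c.leg e ≫ h
  legIso f := (α_ _ _ _).symm ≪≫ whiskerRightIso (c.legIso f) h
  naturality η := by
    have := c.naturality η
    simp [← this]
  legIso_id e := by simp [c.legIso_id]
  legIso_comp f g := by simp [c.legIso_comp]

/-- Whiskering, as a functor from 1-cells `X ⟶ Y` to pseudo-cocones with vertex `Y`. -/
@[simps] def whiskering {X : B} (c : BiCocone J X) (Y : B) : (X ⟶ Y) ⥤ BiCocone J Y where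
  obj h := c.whisker h
  map {h h'} θ :=
    { app := fun e => c.leg e ◁ θ
      comm := fun {e e'} f => by
        change J.map f ◁ c.leg e' ◁ θ ≫ (α_ (J.map f) (c.leg e') h').inv ≫ (c.legIso f).hom ▷ h' =
          ((α_ (J.map f) (c.leg e') h).inv ≫ (c.legIso f).hom ▷ h) ≫ c.leg e ◁ θ
        rw [associator_inv_naturality_right_assoc, whisker_exchange, Category.assoc] }
  map_id h := hom_ext fun e => whiskerLeft_id _ _
  map_comp θ ψ := hom_ext fun e => whiskerLeft_comp _ _ _

/-- A pseudo-cocone with vertex `X` is a bicolimit if, for every object `Y`, whiskering is an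
equivalence from the category of 1-cells `X ⟶ Y` to that of pseudo-cocones with vertex `Y`. -/
def IsBicolimit {X : B} (c : BiCocone J X) : Prop :=
  ∀ Y : B, (c.whiskering Y).IsEquivalence

/-- The image of a pseudo-cocone under a pseudofunctor. -/
@[simps] def map (F : B ⥤ᵖ B') {X : B} (c : BiCocone J X) : BiCocone (J.comp F) (F.obj X) where
  leg e := F.map (c.leg e)
  legIso f := (F.mapComp _ _).symm ≪≫ F.map₂Iso (c.legIso f)
  naturality {e e' f g} η := by
    have h := congrArg F.map₂ (c.naturality η)
    simp only [F.map₂_comp, F.map₂_whisker_right, Category.assoc] at h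
    change F.map₂ (J.map₂ η) ▷ F.map (c.leg e') ≫ (F.mapComp _ _).inv ≫ F.map₂ (c.legIso g).hom =
      (F.mapComp _ _).inv ≫ F.map₂ (c.legIso f).hom
    simp [← h]
  legIso_id e := by
    change (F.mapComp _ _).inv ≫ F.map₂ (c.legIso (𝟙 e)).hom =
      (F.map₂ (J.mapId e).hom ≫ (F.mapId _).hom) ▷ F.map (c.leg e) ≫ (λ_ (F.map (c.leg e))).hom
    simp [c.legIso_id, F.map₂_left_unitor, F.map₂_whisker_right]
  legIso_comp {e e' e''} f g := by
    change (F.mapComp _ _).inv ≫ F.map₂ (c.legIso (f ≫ g)).hom =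
      (F.map₂ (J.mapComp f g).hom ≫ (F.mapComp _ _).hom) ▷ F.map (c.leg e'') ≫
        (α_ (F.map (J.map f)) (F.map (J.map g)) (F.map (c.leg e''))).hom ≫
          F.map (J.map f) ◁ ((F.mapComp _ _).inv ≫ F.map₂ (c.legIso g).hom) ≫
            (F.mapComp _ _).inv ≫ F.map₂ (c.legIso f).hom
    simp [c.legIso_comp, F.map₂_associator, F.map₂_whisker_left, F.map₂_whisker_right]

/-- The restriction of pseudo-cocones along a pseudofunctor `F : E' ⥤ᵖ E`. -/
@[simps] def restrict {E' : Type u₃} [Bicategory.{w₃, v₃} E'] (F : E' ⥤ᵖ E) (J : E ⥤ᵖ B) (X : B) :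
    BiCocone J X ⥤ BiCocone (F.comp J) X where
  obj c :=
    { leg := fun e => c.leg (F.obj e)
      legIso := fun f => c.legIso (F.map f)
      naturality := fun η => c.naturality (F.map₂ η)
      legIso_id := fun e => by
        rw [← c.naturality (F.mapId e).hom, c.legIso_id, ← Category.assoc, ← comp_whiskerRight]
        rfl
      legIso_comp := fun f g => by
        rw [← c.naturality (F.mapComp f g).hom, c.legIso_comp, ← Category.assoc,
          ← comp_whiskerRight]
        rfl }
  map φ := { app := fun e => Hom.app φ (F.obj e), comm := fun f => Hom.comm φ (F.map f) }

end BiCocone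

end

/-! ### Sifted (2,1)-categories -/

/-- The diagonal pseudofunctor. -/
@[simps! obj map map₂]
def diagonal (E : Type u₁) [Bicategory.{w₁, v₁} E] : E ⥤ᵖ E × E where
  obj e := (e, e)
  map f := (f, f)
  map₂ η := (η, η)
  mapId _ := Iso.refl _
  mapComp _ _ := Iso.refl _

/-- A pseudofunctor `F : E' ⥤ᵖ E` is cofinal if, for every diagram `J` of shape `E` in a
(2,1)-category, restriction along `F` is an equivalence from pseudo-cocones under `J` to
pseudo-cocones under the restriction of `J`. -/
def IsBicofinal {E' E : Type u} [Bicategory.{u, u} E'] [Bicategory.{u, u} E] (F : E' ⥤ᵖ E) : Prop :=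
  ∀ (B : Type (u + 1)) [Bicategory.{u, u} B] [IsLocallyGroupoid B] (J : E ⥤ᵖ B) (X : B),
    (BiCocone.restrict F J X).IsEquivalence

/-- A small (2,1)-category is sifted if it is nonempty and its diagonal is cofinal. -/
class IsSifted₂₁ (E : Type u) [Bicategory.{u, u} E] : Prop where
  locallyGroupoid : IsLocallyGroupoid E
  nonempty : Nonempty E
  cofinal_diagonal : IsBicofinal (diagonal E)

/-! ### Tensor sifted cocompleteness -/

/-- The pseudofunctor induced on the underlying (2,1)-categories, in which the 2-cells are the
invertible 2-cells. -/
def pithMap {B : Type u₁} [Bicategory.{w₁, v₁} B] {B' : Type u₂} [Bicategory.{w₂, v₂} B']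
    (F : B ⥤ᵖ B') : Pith B ⥤ᵖ Pith B' :=
  Pith.pseudofunctorToPith ((Pith.inclusion B).comp F)

/-- A bicategory `B` with a tensor product `T` is tensor sifted cocomplete, as a (2,1)-category, if
the (2,1)-category underlying `B` has the bicolimits of all small sifted diagrams, and if tensoring
with any object, on the left or on the right, preserves these bicolimits. -/
structure IsTensorSiftedCocomplete {B : Type (u + 1)} [Bicategory.{u, u} B] (T : B × B ⥤ᵖ B) :
    Prop where
  exists_bicolimit (E : Type u) [Bicategory.{u, u} E] [IsSifted₂₁ E] (J : E ⥤ᵖ Pith B) :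
    ∃ (X : Pith B) (c : BiCocone J X), c.IsBicolimit
  tensorLeft (E : Type u) [Bicategory.{u, u} E] [IsSifted₂₁ E] (J : E ⥤ᵖ Pith B)
    (X : Pith B) (c : BiCocone J X) (Y : B) (hc : c.IsBicolimit) :
    (c.map (pithMap ((Bicategory.Prod.sectR Y B).toPseudofunctor.comp T))).IsBicolimit
  tensorRight (E : Type u) [Bicategory.{u, u} E] [IsSifted₂₁ E] (J : E ⥤ᵖ Pith B)
    (X : Pith B) (c : BiCocone J X) (Y : B) (hc : c.IsBicolimit) :
    (c.map (pithMap ((Bicategory.Prod.sectL B Y).toPseudofunctor.comp T))).IsBicolimit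

/-! ### Pseudo-pullbacks of bicategories -/

/-- A 1-cell is an equivalence if it underlies an (adjoint) equivalence. -/
def IsEquivalence₁ {B : Type*} [Bicategory B] {a b : B} (f : a ⟶ b) : Prop :=
  ∃ e : Bicategory.Equivalence a b, e.hom = f

section

variable {B₁ : Type u₁} [Bicategory.{w₁, v₁} B₁] {B₂ : Type u₂} [Bicategory.{w₂, v₂} B₂]
  {A : Type u₃} [Bicategory.{w₃, v₃} A]

/-- Objects of the pseudo-pullback of `P : B₁ ⥤ᵖ A` and `Q : B₂ ⥤ᵖ A`: an object of `B₁`, an object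
of `B₂`, and an equivalence between their images in `A`. -/
structure PsPullback (P : B₁ ⥤ᵖ A) (Q : B₂ ⥤ᵖ A) where
  fst : B₁
  snd : B₂
  gl : P.obj fst ⟶ Q.obj snd
  isEquivalence : IsEquivalence₁ gl

namespace PsPullback

variable {P : B₁ ⥤ᵖ A} {Q : B₂ ⥤ᵖ A}

/-- 1-cells of the pseudo-pullback: pairs of 1-cells with an invertible 2-cell filling the square
formed with the gluing equivalences. -/
structure Hom (X Y : PsPullback P Q) where
  fst : X.fst ⟶ Y.fst
  snd : X.snd ⟶ Y.snd
  iso : P.map fst ≫ Y.gl ≅ X.gl ≫ Q.map snd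

@[simps id_fst id_snd comp_fst comp_snd]
instance : CategoryStruct (PsPullback P Q) where
  Hom X Y := Hom X Y
  id X :=
    { fst := 𝟙 X.fst
      snd := 𝟙 X.snd
      iso := whiskerRightIso (P.mapId X.fst) X.gl ≪≫ λ_ X.gl ≪≫ (ρ_ X.gl).symm ≪≫
        whiskerLeftIso X.gl (Q.mapId X.snd).symm }
  comp {X Y Z} F G :=
    { fst := F.fst ≫ G.fst
      snd := F.snd ≫ G.snd
      iso := whiskerRightIso (P.mapComp F.fst G.fst) Z.gl ≪≫ α_ _ _ _ ≪≫
        whiskerLeftIso (P.map F.fst) G.iso ≪≫ (α_ _ _ _).symm ≪≫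
        whiskerRightIso F.iso (Q.map G.snd) ≪≫ α_ _ _ _ ≪≫
        whiskerLeftIso X.gl (Q.mapComp F.snd G.snd).symm }

lemma id_iso_hom (X : PsPullback P Q) : (𝟙 X : X ⟶ X).iso.hom =
    (P.mapId X.fst).hom ▷ X.gl ≫ (λ_ X.gl).hom ≫ (ρ_ X.gl).inv ≫
      X.gl ◁ (Q.mapId X.snd).inv := rfl

lemma comp_iso_hom {X Y Z : PsPullback P Q} (F : X ⟶ Y) (G : Y ⟶ Z) : (F ≫ G).iso.hom =
    (P.mapComp F.fst G.fst).hom ▷ Z.gl ≫ (α_ _ _ _).hom ≫ P.map F.fst ◁ G.iso.hom ≫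
      (α_ _ _ _).inv ≫ F.iso.hom ▷ Q.map G.snd ≫ (α_ _ _ _).hom ≫
      X.gl ◁ (Q.mapComp F.snd G.snd).inv := rfl

/-- 2-cells of the pseudo-pullback: pairs of 2-cells compatible with the filling 2-cells. -/
@[ext] structure Hom₂ {X Y : PsPullback P Q} (F G : X ⟶ Y) where
  fst : F.fst ⟶ G.fst
  snd : F.snd ⟶ G.snd
  comm : P.map₂ fst ▷ Y.gl ≫ G.iso.hom = F.iso.hom ≫ X.gl ◁ Q.map₂ snd

instance homCategory (X Y : PsPullback P Q) : Category (X ⟶ Y) where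
  Hom F G := Hom₂ F G
  id F := { fst := 𝟙 _, snd := 𝟙 _, comm := by simp }
  comp α β :=
    { fst := α.fst ≫ β.fst
      snd := α.snd ≫ β.snd
      comm := by
        have h := α.comm
        simp [β.comm, reassoc_of% h] }

@[simp] lemma id₂_fst {X Y : PsPullback P Q} (F : X ⟶ Y) : Hom₂.fst (𝟙 F) = 𝟙 F.fst := rfl
@[simp] lemma id₂_snd {X Y : PsPullback P Q} (F : X ⟶ Y) : Hom₂.snd (𝟙 F) = 𝟙 F.snd := rfl
@[simp] lemma comp₂_fst {X Y : PsPullback P Q} {F G H : X ⟶ Y} (α : F ⟶ G) (β : G ⟶ H) :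
    Hom₂.fst (α ≫ β) = Hom₂.fst α ≫ Hom₂.fst β := rfl
@[simp] lemma comp₂_snd {X Y : PsPullback P Q} {F G H : X ⟶ Y} (α : F ⟶ G) (β : G ⟶ H) :
    Hom₂.snd (α ≫ β) = Hom₂.snd α ≫ Hom₂.snd β := rfl

@[ext] lemma hom₂_ext {X Y : PsPullback P Q} {F G : X ⟶ Y} {α β : F ⟶ G}
    (h₁ : Hom₂.fst α = Hom₂.fst β) (h₂ : Hom₂.snd α = Hom₂.snd β) : α = β :=
  Hom₂.ext h₁ h₂

/-- Construct an invertible 2-cell of the pseudo-pullback. -/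
@[simps] def isoMk {X Y : PsPullback P Q} {F G : X ⟶ Y} (e₁ : F.fst ≅ G.fst) (e₂ : F.snd ≅ G.snd)
    (h : P.map₂ e₁.hom ▷ Y.gl ≫ G.iso.hom = F.iso.hom ≫ X.gl ◁ Q.map₂ e₂.hom) : F ≅ G where
  hom := { fst := e₁.hom, snd := e₂.hom, comm := h }
  inv :=
    { fst := e₁.inv
      snd := e₂.inv
      comm := by
        have : F.iso.hom = P.map₂ e₁.hom ▷ Y.gl ≫ G.iso.hom ≫ X.gl ◁ Q.map₂ e₂.inv := by
          rw [reassoc_of% h, ← whiskerLeft_comp, ← Q.map₂_comp]; simp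
        rw [this, ← Category.assoc, ← comp_whiskerRight, ← P.map₂_comp, e₁.inv_hom_id]
        simp }

lemma associator_aux {a b c d a' b' c' d' : A} {p : a ⟶ b} {q : b ⟶ c} {r : c ⟶ d} {x : a ⟶ a'}
    {y : b ⟶ b'} {z : c ⟶ c'} {w : d ⟶ d'} {p' : a' ⟶ b'} {q' : b' ⟶ c'} {r' : c' ⟶ d'}
    (f : p ≫ y ⟶ x ≫ p') (g : q ≫ z ⟶ y ≫ q') (h : r ≫ w ⟶ z ≫ r') {t : a ⟶ d'}
    (e : x ≫ p' ≫ q' ≫ r' ⟶ t) :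
    (α_ p q (r ≫ w)).hom ≫ p ◁ q ◁ h ≫ p ◁ (α_ q z r').inv ≫ p ◁ g ▷ r' ≫
      p ◁ (α_ y q' r').hom ≫ (α_ p y (q' ≫ r')).inv ≫ f ▷ (q' ≫ r') ≫
        (α_ x p' (q' ≫ r')).hom ≫ e =
    (p ≫ q) ◁ h ≫ (α_ (p ≫ q) z r').inv ≫ (α_ p q z).hom ▷ r' ≫
      (α_ p (q ≫ z) r').hom ≫ p ◁ g ▷ r' ≫ (α_ p (y ≫ q') r').inv ≫
        (α_ p y q').inv ▷ r' ≫ f ▷ q' ▷ r' ≫ (α_ (x ≫ p') q' r').hom ≫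
          (α_ x p' (q' ≫ r')).hom ≫ e := by
  simp

/-- Left whiskering. -/
def whiskerL {X Y Z : PsPullback P Q} (F : X ⟶ Y) {G H : Y ⟶ Z} (α : G ⟶ H) :
    F ≫ G ⟶ F ≫ H where
  fst := F.fst ◁ α.fst
  snd := F.snd ◁ α.snd
  comm := by
    have h := congrArg (P.map F.fst ◁ ·) α.comm
    simp only [Bicategory.whiskerLeft_comp] at h
    simp [comp_iso_hom, reassoc_of% h]
    rw [associator_inv_naturality_right_assoc, whisker_exchange_assoc,
      associator_naturality_right_assoc]

/-- Right whiskering. -/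
def whiskerR {X Y Z : PsPullback P Q} {F G : X ⟶ Y} (α : F ⟶ G) (H : Y ⟶ Z) :
    F ≫ H ⟶ G ≫ H where
  fst := α.fst ▷ H.fst
  snd := α.snd ▷ H.snd
  comm := by
    have h := congrArg (· ▷ Q.map H.snd) α.comm
    simp only [Bicategory.comp_whiskerRight] at h
    simp [comp_iso_hom]
    rw [associator_naturality_left_assoc, ← whisker_exchange_assoc,
      associator_inv_naturality_left_assoc, reassoc_of% h]
    simp

/-- The associator. -/
def assoc {X Y Z W : PsPullback P Q} (F : X ⟶ Y) (G : Y ⟶ Z) (H : Z ⟶ W) :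
    (F ≫ G) ≫ H ≅ F ≫ G ≫ H := isoMk (α_ _ _ _) (α_ _ _ _) (by
    simp [comp_iso_hom]
    rw [associator_inv_naturality_right_assoc, whisker_exchange_assoc,
      associator_naturality_right_assoc, ← associator_inv_naturality_left_assoc,
      whisker_exchange_assoc, ← associator_naturality_left_assoc, associator_aux])

/-- The left unitor. -/
def leftUnit {X Y : PsPullback P Q} (F : X ⟶ Y) : 𝟙 X ≫ F ≅ F := isoMk (λ_ _) (λ_ _) (by
    simp [comp_iso_hom, id_iso_hom]
    rw [← associator_inv_naturality_left_assoc, whisker_exchange_assoc,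
      ← associator_naturality_left_assoc]
    simp)

/-- The right unitor. -/
def rightUnit {X Y : PsPullback P Q} (F : X ⟶ Y) : F ≫ 𝟙 Y ≅ F := isoMk (ρ_ _) (ρ_ _) (by
    simp [comp_iso_hom, id_iso_hom]
    rw [associator_inv_naturality_right_assoc, whisker_exchange_assoc,
      associator_naturality_right_assoc]
    simp)

instance : Bicategory (PsPullback P Q) where
  homCategory := homCategory
  whiskerLeft := whiskerL
  whiskerRight := whiskerR
  associator := assoc
  leftUnitor := leftUnit
  rightUnitor := rightUnit
  id_whiskerLeft := by
    intros
    exact hom₂_ext (Bicategory.id_whiskerLeft _) (Bicategory.id_whiskerLeft _)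
  comp_whiskerLeft := by
    intros
    exact hom₂_ext (Bicategory.comp_whiskerLeft _ _ _) (Bicategory.comp_whiskerLeft _ _ _)
  id_whiskerRight := by
    intros
    exact hom₂_ext (Bicategory.id_whiskerRight _ _) (Bicategory.id_whiskerRight _ _)
  comp_whiskerRight := by
    intros
    exact hom₂_ext (Bicategory.comp_whiskerRight _ _ _) (Bicategory.comp_whiskerRight _ _ _)
  whiskerRight_id := by
    intros
    exact hom₂_ext (Bicategory.whiskerRight_id _) (Bicategory.whiskerRight_id _)
  whiskerRight_comp := by
    intros
    exact hom₂_ext (Bicategory.whiskerRight_comp _ _ _) (Bicategory.whiskerRight_comp _ _ _)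
  whisker_assoc := by
    intros
    exact hom₂_ext (Bicategory.whisker_assoc _ _ _) (Bicategory.whisker_assoc _ _ _)
  whisker_exchange := by
    intros
    exact hom₂_ext (Bicategory.whisker_exchange _ _) (Bicategory.whisker_exchange _ _)
  pentagon := by
    intros
    exact hom₂_ext (Bicategory.pentagon _ _ _ _) (Bicategory.pentagon _ _ _ _)
  triangle := by
    intros
    exact hom₂_ext (Bicategory.triangle _ _) (Bicategory.triangle _ _)
  whiskerLeft_id := by
    intros
    exact hom₂_ext (Bicategory.whiskerLeft_id _ _) (Bicategory.whiskerLeft_id _ _)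
  whiskerLeft_comp := by
    intros
    exact hom₂_ext (Bicategory.whiskerLeft_comp _ _ _) (Bicategory.whiskerLeft_comp _ _ _)

end PsPullback

end

/-- The projection of the pseudo-pullback to its first factor. -/
@[simps obj map map₂]
def PsPullback.fstFunctor {B₁ : Type u₁} [Bicategory.{w₁, v₁} B₁] {B₂ : Type u₂}
    [Bicategory.{w₂, v₂} B₂] {A : Type u₃} [Bicategory.{w₃, v₃} A] (P : B₁ ⥤ᵖ A) (Q : B₂ ⥤ᵖ A) :
    PsPullback P Q ⥤ᵖ B₁ where
  obj X := X.fst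
  map F := F.fst
  map₂ α := α.fst
  mapId _ := Iso.refl _
  mapComp _ _ := Iso.refl _

/-- The projection of the pseudo-pullback to its second factor. -/
@[simps obj map map₂]
def PsPullback.sndFunctor {B₁ : Type u₁} [Bicategory.{w₁, v₁} B₁] {B₂ : Type u₂}
    [Bicategory.{w₂, v₂} B₂] {A : Type u₃} [Bicategory.{w₃, v₃} A] (P : B₁ ⥤ᵖ A) (Q : B₂ ⥤ᵖ A) :
    PsPullback P Q ⥤ᵖ B₂ where
  obj X := X.snd
  map F := F.snd
  map₂ α := α.snd
  mapId _ := Iso.refl _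
  mapComp _ _ := Iso.refl _

/-- Sifted bicolimits in the (2,1)-category underlying a pseudo-pullback are computed componentwise:
a pseudo-cocone is a bicolimit if and only if both of its projections are. -/
def PsPullback.SiftedBicolimitsComponentwise {B₁ B₂ A : Type (u + 1)} [Bicategory.{u, u} B₁]
    [Bicategory.{u, u} B₂] [Bicategory.{u, u} A] (P : B₁ ⥤ᵖ A) (Q : B₂ ⥤ᵖ A) : Prop :=
  ∀ (E : Type u) [Bicategory.{u, u} E] [IsSifted₂₁ E] (J : E ⥤ᵖ Pith (PsPullback P Q))
    (X : Pith (PsPullback P Q)) (c : BiCocone J X),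
    c.IsBicolimit ↔ (c.map (pithMap (PsPullback.fstFunctor P Q))).IsBicolimit ∧
      (c.map (pithMap (PsPullback.sndFunctor P Q))).IsBicolimit

/-! ### Linear categories: tensor product and base change -/

/-- The objects of the tensor product `C ⊗ D` of two `R`-linear categories: pairs of objects. -/
structure LinTensor (R : Type) (C D : Type u) where
  fst : C
  snd : D

namespace LinTensor

section

variable (R : Type) [CommRing R]
variable (C D : Type u) [Category.{u} C] [Preadditive C] [Linear R C]
  [Category.{u} D] [Preadditive D] [Linear R D]

/-- The hom-module of `C ⊗ D` from `(c, d)` to `(c', d')` is `C(c, c') ⊗[R] D(d, d')`. -/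
instance : Category.{u} (LinTensor R C D) where
  Hom X Y := (X.fst ⟶ Y.fst) ⊗[R] (X.snd ⟶ Y.snd)
  id X := 𝟙 X.fst ⊗ₜ 𝟙 X.snd
  comp {X Y Z} f g :=
    TensorProduct.map₂ (Linear.comp X.fst Y.fst Z.fst) (Linear.comp X.snd Y.snd Z.snd) f g
  id_comp f := by
    induction f using TensorProduct.induction_on with
    | zero => exact map_zero _
    | tmul a b => simp [TensorProduct.map₂_apply_tmul]
    | add a b ha hb => rw [map_add, ha, hb]
  comp_id f := by
    induction f using TensorProduct.induction_on with
    | zero => rw [map_zero, LinearMap.zero_apply]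
    | tmul a b => simp [TensorProduct.map₂_apply_tmul]
    | add a b ha hb => rw [map_add, LinearMap.add_apply, ha, hb]
  assoc {_ _ _ _} f g h := by
    induction f using TensorProduct.induction_on with
    | zero => simp only [map_zero, LinearMap.zero_apply]
    | add a b ha hb => simp only [map_add, LinearMap.add_apply, ha, hb]
    | tmul a b =>
      induction g using TensorProduct.induction_on with
      | zero => simp only [map_zero, LinearMap.zero_apply]
      | add a b ha hb => simp only [map_add, LinearMap.add_apply, ha, hb]
      | tmul a b =>
        induction h using TensorProduct.induction_on with
        | zero => simp only [map_zero]
        | add a b ha hb => simp only [map_add, ha, hb]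
        | tmul a b => simp [TensorProduct.map₂_apply_tmul]

instance : Preadditive (LinTensor R C D) where
  homGroup X Y := inferInstanceAs (AddCommGroup ((X.fst ⟶ Y.fst) ⊗[R] (X.snd ⟶ Y.snd)))
  add_comp X Y Z f g h := by
    change TensorProduct.map₂ _ _ _ _ = TensorProduct.map₂ _ _ _ _ + TensorProduct.map₂ _ _ _ _
    rw [map_add, LinearMap.add_apply]
  comp_add X Y Z f g h := map_add (TensorProduct.map₂ _ _ _) _ _

instance : Linear R (LinTensor R C D) where
  homModule X Y := inferInstanceAs (Module R ((X.fst ⟶ Y.fst) ⊗[R] (X.snd ⟶ Y.snd)))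
  smul_comp X Y Z r f g :=
    LinearMap.map_smul₂ (TensorProduct.map₂ (Linear.comp X.fst Y.fst Z.fst)
      (Linear.comp X.snd Y.snd Z.snd)) r f g
  comp_smul X Y Z f r g := map_smul (TensorProduct.map₂ _ _ _) r _

variable {R C D}

/-- A pure tensor `f ⊗ g`, as a morphism of `C ⊗ D`. -/
def tmul {X Y : LinTensor R C D} (f : X.fst ⟶ Y.fst) (g : X.snd ⟶ Y.snd) : X ⟶ Y :=
  (f ⊗ₜ[R] g : (X.fst ⟶ Y.fst) ⊗[R] (X.snd ⟶ Y.snd))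

lemma hom_induction {X Y : LinTensor R C D} {p : (X ⟶ Y) → Prop} (f : X ⟶ Y) (h0 : p 0)
    (ht : ∀ a b, p (tmul a b)) (ha : ∀ f g, p f → p g → p (f + g)) : p f :=
  TensorProduct.induction_on (motive := p) f h0 ht ha

@[simp] lemma tmul_comp {X Y Z : LinTensor R C D} (f : X.fst ⟶ Y.fst) (g : X.snd ⟶ Y.snd)
    (f' : Y.fst ⟶ Z.fst) (g' : Y.snd ⟶ Z.snd) :
    tmul f g ≫ tmul f' g' = (tmul (f ≫ f') (g ≫ g') : X ⟶ Z) := rfl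

@[simp] lemma tmul_comp_assoc {X Y Z W : LinTensor R C D} (f : X.fst ⟶ Y.fst) (g : X.snd ⟶ Y.snd)
    (f' : Y.fst ⟶ Z.fst) (g' : Y.snd ⟶ Z.snd) (h : Z ⟶ W) :
    tmul f g ≫ tmul f' g' ≫ h = (tmul (f ≫ f') (g ≫ g') : X ⟶ Z) ≫ h := by
  rw [← Category.assoc, tmul_comp]

@[simp] lemma tmul_id (X : LinTensor R C D) : tmul (𝟙 X.fst) (𝟙 X.snd) = 𝟙 X := rfl

lemma tmul_congr {X Y : LinTensor R C D} {a a' : X.fst ⟶ Y.fst} {b b' : X.snd ⟶ Y.snd}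
    (h : a = a') (h' : b = b') : (tmul a b : X ⟶ Y) = tmul a' b' := by rw [h, h']

/-- A pair of isomorphisms gives an isomorphism in the tensor product. -/
@[simps] def isoMk {X Y : LinTensor R C D} (e : X.fst ≅ Y.fst) (e' : X.snd ≅ Y.snd) : X ≅ Y where
  hom := tmul e.hom e'.hom
  inv := tmul e.inv e'.inv

end

section

variable {R : Type} [CommRing R]
variable {C C' D D' : Type u}
  [Category.{u} C] [Preadditive C] [Linear R C] [Category.{u} D] [Preadditive D] [Linear R D]
  [Category.{u} C'] [Preadditive C'] [Linear R C'] [Category.{u} D'] [Preadditive D'] [Linear R D']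

/-- A natural transformation of additive functors on a tensor product, with naturality checked on
pure tensors. -/
@[simps app] def natMk {E : Type u} [Category.{u} E] [Preadditive E] (F G : LinTensor R C D ⥤ E)
    [F.Additive] [G.Additive] (app : ∀ X, F.obj X ⟶ G.obj X)
    (h : ∀ (X Y : LinTensor R C D) (a : X.fst ⟶ Y.fst) (b : X.snd ⟶ Y.snd),
      F.map (tmul a b : X ⟶ Y) ≫ app Y = app X ≫ G.map (tmul a b : X ⟶ Y)) : F ⟶ G where
  app := app
  naturality X Y f := by
    induction f using hom_induction with
    | h0 => simp
    | ha a b ha hb => simp [ha, hb]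
    | ht a b => exact h X Y a b

/-- The version of `natMk` for natural isomorphisms. -/
@[simps!] def natIsoMk {E : Type u} [Category.{u} E] [Preadditive E] (F G : LinTensor R C D ⥤ E)
    [F.Additive] [G.Additive] (app : ∀ X, F.obj X ≅ G.obj X)
    (h : ∀ (X Y : LinTensor R C D) (a : X.fst ⟶ Y.fst) (b : X.snd ⟶ Y.snd),
      F.map (tmul a b : X ⟶ Y) ≫ (app Y).hom = (app X).hom ≫ G.map (tmul a b : X ⟶ Y)) : F ≅ G :=
  NatIso.ofComponents app (fun f => (natMk F G (fun X => (app X).hom) h).naturality f)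

/-- The tensor product `F ⊗ G` of two `R`-linear functors, `f ⊗ g ↦ F f ⊗ G g` on morphisms. -/
@[simps obj] def mapFunctor (F : C ⥤ C') [F.Additive] [F.Linear R] (G : D ⥤ D') [G.Additive]
    [G.Linear R] : LinTensor R C D ⥤ LinTensor R C' D' where
  obj X := ⟨F.obj X.fst, G.obj X.snd⟩
  map {X Y} f := TensorProduct.map (F.mapLinearMap R) (G.mapLinearMap R) f
  map_id X := by
    change tmul (R := R) (X := ⟨F.obj X.fst, G.obj X.snd⟩) (Y := ⟨F.obj X.fst, G.obj X.snd⟩)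
      (F.map (𝟙 X.fst)) (G.map (𝟙 X.snd)) = _
    rw [F.map_id, G.map_id]; rfl
  map_comp {X Y Z} f g := by
    induction f using hom_induction with
    | h0 => rw [Limits.zero_comp]; exact (map_zero _).trans (Limits.zero_comp.symm.trans
        (congrArg (· ≫ _) (map_zero (TensorProduct.map _ _)).symm))
    | ha a b ha hb =>
      rw [Preadditive.add_comp]
      refine (map_add (TensorProduct.map _ _) _ _).trans ?_
      rw [ha, hb, ← Preadditive.add_comp]
      exact congrArg (· ≫ _) (map_add (TensorProduct.map _ _) _ _).symm
    | ht a b =>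
      induction g using hom_induction with
      | h0 => rw [Limits.comp_zero]; exact (map_zero _).trans (Limits.comp_zero.symm.trans
          (congrArg (_ ≫ ·) (map_zero (TensorProduct.map _ _)).symm))
      | ha a b ha hb =>
        rw [Preadditive.comp_add]
        refine (map_add (TensorProduct.map _ _) _ _).trans ?_
        rw [ha, hb, ← Preadditive.comp_add]
        exact congrArg (_ ≫ ·) (map_add (TensorProduct.map _ _) _ _).symm
      | ht c d =>
        change tmul (R := R) (X := ⟨F.obj X.fst, G.obj X.snd⟩) (Y := ⟨F.obj Z.fst, G.obj Z.snd⟩)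
          (F.map (a ≫ c)) (G.map (b ≫ d)) = _
        rw [F.map_comp, G.map_comp]; rfl

variable (F : C ⥤ C') [F.Additive] [F.Linear R] (G : D ⥤ D') [G.Additive] [G.Linear R]

@[simp] lemma mapFunctor_map_tmul {X Y : LinTensor R C D} (f : X.fst ⟶ Y.fst) (g : X.snd ⟶ Y.snd) :
    (mapFunctor (R := R) F G).map (tmul f g : X ⟶ Y) = tmul (F.map f) (G.map g) := rfl

instance : (mapFunctor (R := R) F G).Additive where
  map_add := map_add (TensorProduct.map _ _) _ _

instance : (mapFunctor (R := R) F G).Linear R where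
  map_smul f r := map_smul (TensorProduct.map _ _) r f

instance [F.IsEquivalence] [G.IsEquivalence] :
    (mapFunctor (R := R) F G).IsEquivalence where
  faithful := ⟨fun {X Y} _ _ h => (TensorProduct.congr
    (LinearEquiv.ofBijective (F.mapLinearMap R : (X.fst ⟶ Y.fst) →ₗ[R] _)
      ⟨F.map_injective, F.map_surjective⟩)
    (LinearEquiv.ofBijective (G.mapLinearMap R : (X.snd ⟶ Y.snd) →ₗ[R] _)
      ⟨G.map_injective, G.map_surjective⟩)).injective h⟩
  full := ⟨fun {X Y} f => (TensorProduct.congr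
    (LinearEquiv.ofBijective (F.mapLinearMap R : (X.fst ⟶ Y.fst) →ₗ[R] _)
      ⟨F.map_injective, F.map_surjective⟩)
    (LinearEquiv.ofBijective (G.mapLinearMap R : (X.snd ⟶ Y.snd) →ₗ[R] _)
      ⟨G.map_injective, G.map_surjective⟩)).surjective f⟩
  essSurj := ⟨fun Y => ⟨⟨F.objPreimage Y.fst, G.objPreimage Y.snd⟩,
    ⟨isoMk (F.objObjPreimageIso Y.fst) (G.objObjPreimageIso Y.snd)⟩⟩⟩

/-- The tensor product of two natural transformations. -/
@[simps! app] def mapNat {F F' : C ⥤ C'} [F.Additive] [F.Linear R] [F'.Additive] [F'.Linear R]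
    {G G' : D ⥤ D'} [G.Additive] [G.Linear R] [G'.Additive] [G'.Linear R]
    (α : F ⟶ F') (β : G ⟶ G') : mapFunctor (R := R) F G ⟶ mapFunctor (R := R) F' G' :=
  natMk _ _ (fun X => tmul (α.app X.fst) (β.app X.snd)) (fun X Y a b => by
    change tmul (R := R) (X := ⟨F.obj X.fst, G.obj X.snd⟩) (Y := ⟨F'.obj Y.fst, G'.obj Y.snd⟩)
      (F.map a ≫ α.app _) (G.map b ≫ β.app _) = tmul (α.app _ ≫ F'.map a) (β.app _ ≫ G'.map b)
    rw [α.naturality, β.naturality])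

end

end LinTensor

/-- The objects of the base change `S ⊗[R] C` of an `R`-linear category: those of `C`. -/
structure BaseChange (R S : Type) (C : Type u) where
  of : C

namespace BaseChange

section

variable {R S : Type} [CommRing R] [CommRing S] [Algebra R S]
variable {C D : Type u} [Category.{u} C] [Preadditive C] [Linear R C]
  [Category.{u} D] [Preadditive D] [Linear R D]

/-- The hom-module of the base change from `c` to `c'` is `S ⊗[R] C(c, c')`. -/
instance : Category.{u} (BaseChange R S C) where
  Hom X Y := S ⊗[R] (X.of ⟶ Y.of)
  id X := 1 ⊗ₜ 𝟙 X.of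
  comp {X Y Z} f g := TensorProduct.map₂ (LinearMap.mul R S) (Linear.comp X.of Y.of Z.of) f g
  id_comp f := by
    induction f using TensorProduct.induction_on with
    | zero => exact map_zero _
    | tmul a b => simp [TensorProduct.map₂_apply_tmul]
    | add a b ha hb => rw [map_add, ha, hb]
  comp_id f := by
    induction f using TensorProduct.induction_on with
    | zero => rw [map_zero, LinearMap.zero_apply]
    | tmul a b => simp [TensorProduct.map₂_apply_tmul]
    | add a b ha hb => rw [map_add, LinearMap.add_apply, ha, hb]
  assoc {_ _ _ _} f g h := by
    induction f using TensorProduct.induction_on with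
    | zero => simp only [map_zero, LinearMap.zero_apply]
    | add a b ha hb => simp only [map_add, LinearMap.add_apply, ha, hb]
    | tmul a b =>
      induction g using TensorProduct.induction_on with
      | zero => simp only [map_zero, LinearMap.zero_apply]
      | add a b ha hb => simp only [map_add, LinearMap.add_apply, ha, hb]
      | tmul a b =>
        induction h using TensorProduct.induction_on with
        | zero => simp only [map_zero]
        | add a b ha hb => simp only [map_add, ha, hb]
        | tmul a b => simp [TensorProduct.map₂_apply_tmul, mul_assoc]

instance : Preadditive (BaseChange R S C) where
  homGroup X Y := inferInstanceAs (AddCommGroup (S ⊗[R] (X.of ⟶ Y.of)))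
  add_comp X Y Z f g h := LinearMap.map_add₂ (TensorProduct.map₂ (LinearMap.mul R S)
    (Linear.comp X.of Y.of Z.of)) f g h
  comp_add X Y Z f g h := map_add (TensorProduct.map₂ _ _ _) _ _

/-- A pure tensor `s ⊗ f`, as a morphism of the base change. -/
def tmul {X Y : BaseChange R S C} (s : S) (f : X.of ⟶ Y.of) : X ⟶ Y :=
  (s ⊗ₜ[R] f : S ⊗[R] (X.of ⟶ Y.of))

lemma hom_induction {X Y : BaseChange R S C} {p : (X ⟶ Y) → Prop} (f : X ⟶ Y) (h0 : p 0)
    (ht : ∀ s a, p (tmul s a)) (ha : ∀ f g, p f → p g → p (f + g)) : p f :=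
  TensorProduct.induction_on (motive := p) f h0 ht ha

@[simp] lemma tmul_comp {X Y Z : BaseChange R S C} (s t : S) (f : X.of ⟶ Y.of) (g : Y.of ⟶ Z.of) :
    tmul s f ≫ tmul t g = (tmul (s * t) (f ≫ g) : X ⟶ Z) := rfl

@[simp] lemma tmul_id (X : BaseChange R S C) : tmul 1 (𝟙 X.of) = 𝟙 X := rfl

lemma tmul_one_comp {X Y Z : BaseChange R S C} (f : X.of ⟶ Y.of) (g : Y.of ⟶ Z.of) :
    (tmul 1 (f ≫ g) : X ⟶ Z) = (tmul 1 f : X ⟶ Y) ≫ tmul 1 g := by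
  rw [tmul_comp, mul_one]

/-- An isomorphism gives an isomorphism in the base change. -/
@[simps] def isoMk {X Y : BaseChange R S C} (e : X.of ≅ Y.of) : X ≅ Y where
  hom := tmul 1 e.hom
  inv := tmul 1 e.inv
  hom_inv_id := by rw [← tmul_one_comp, e.hom_inv_id, tmul_id]
  inv_hom_id := by rw [← tmul_one_comp, e.inv_hom_id, tmul_id]

instance : Linear S (BaseChange R S C) where
  homModule X Y := inferInstanceAs (Module S (S ⊗[R] (X.of ⟶ Y.of)))
  smul_comp X Y Z r f g := by
    induction f using hom_induction with
    | h0 =>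
      refine (congrArg (· ≫ g) (smul_zero (A := S ⊗[R] (X.of ⟶ Y.of)) r)).trans ?_
      refine Limits.zero_comp.trans ((smul_zero (A := S ⊗[R] (X.of ⟶ Z.of)) r).symm.trans ?_)
      rw [Limits.zero_comp]
    | ha a b ha hb =>
      refine (congrArg (· ≫ g) (smul_add (A := S ⊗[R] (X.of ⟶ Y.of)) r a b)).trans ?_
      refine (Preadditive.add_comp _ _ _ _ _ _).trans ((congrArg₂ (· + ·) ha hb).trans ?_)
      refine (smul_add (A := S ⊗[R] (X.of ⟶ Z.of)) r (a ≫ g) (b ≫ g)).symm.trans ?_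
      rw [← Preadditive.add_comp]
    | ht s a =>
      induction g using hom_induction with
      | h0 =>
        rw [Limits.comp_zero, Limits.comp_zero]
        exact (smul_zero (A := S ⊗[R] (X.of ⟶ Z.of)) r).symm
      | ha c d hc hd =>
        rw [Preadditive.comp_add, Preadditive.comp_add, hc, hd]
        exact (smul_add (A := S ⊗[R] (X.of ⟶ Z.of)) r _ _).symm
      | ht t b => exact congrArg (· ⊗ₜ[R] (a ≫ b)) (mul_assoc r s t)
  comp_smul X Y Z f r g := by
    induction g using hom_induction with
    | h0 =>
      refine (congrArg (f ≫ ·) (smul_zero (A := S ⊗[R] (Y.of ⟶ Z.of)) r)).trans ?_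
      refine Limits.comp_zero.trans ((smul_zero (A := S ⊗[R] (X.of ⟶ Z.of)) r).symm.trans ?_)
      rw [Limits.comp_zero]
    | ha a b ha hb =>
      refine (congrArg (f ≫ ·) (smul_add (A := S ⊗[R] (Y.of ⟶ Z.of)) r a b)).trans ?_
      refine (Preadditive.comp_add _ _ _ _ _ _).trans ((congrArg₂ (· + ·) ha hb).trans ?_)
      refine (smul_add (A := S ⊗[R] (X.of ⟶ Z.of)) r (f ≫ a) (f ≫ b)).symm.trans ?_
      rw [← Preadditive.comp_add]
    | ht t b =>
      induction f using hom_induction with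
      | h0 =>
        rw [Limits.zero_comp, Limits.zero_comp]
        exact (smul_zero (A := S ⊗[R] (X.of ⟶ Z.of)) r).symm
      | ha c d hc hd =>
        rw [Preadditive.add_comp, Preadditive.add_comp, hc, hd]
        exact (smul_add (A := S ⊗[R] (X.of ⟶ Z.of)) r _ _).symm
      | ht s a => exact congrArg (· ⊗ₜ[R] (a ≫ b)) (mul_left_comm s r t)

/-- A natural transformation of additive functors on a base change, with naturality checked on
pure tensors. -/
@[simps app] def natMk {E : Type u} [Category.{u} E] [Preadditive E] (F G : BaseChange R S C ⥤ E)
    [F.Additive] [G.Additive] (app : ∀ X, F.obj X ⟶ G.obj X)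
    (h : ∀ (X Y : BaseChange R S C) (s : S) (a : X.of ⟶ Y.of),
      F.map (tmul s a : X ⟶ Y) ≫ app Y = app X ≫ G.map (tmul s a : X ⟶ Y)) : F ⟶ G where
  app := app
  naturality X Y f := by
    induction f using hom_induction with
    | h0 => simp
    | ha a b ha hb => simp [ha, hb]
    | ht s a => exact h X Y s a

/-- The version of `natMk` for natural isomorphisms. -/
@[simps!] def natIsoMk {E : Type u} [Category.{u} E] [Preadditive E] (F G : BaseChange R S C ⥤ E)
    [F.Additive] [G.Additive] (app : ∀ X, F.obj X ≅ G.obj X)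
    (h : ∀ (X Y : BaseChange R S C) (s : S) (a : X.of ⟶ Y.of),
      F.map (tmul s a : X ⟶ Y) ≫ (app Y).hom = (app X).hom ≫ G.map (tmul s a : X ⟶ Y)) : F ≅ G :=
  NatIso.ofComponents app (fun f => (natMk F G (fun X => (app X).hom) h).naturality f)

/-- The base change of an `R`-linear functor. -/
@[simps obj] def mapFunctor (S : Type) [CommRing S] [Algebra R S] (F : C ⥤ D) [F.Additive]
    [F.Linear R] : BaseChange R S C ⥤ BaseChange R S D where
  obj X := ⟨F.obj X.of⟩
  map {X Y} f := (F.mapLinearMap R : (X.of ⟶ Y.of) →ₗ[R] _).baseChange S f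
  map_id X := by
    change tmul (X := ⟨F.obj X.of⟩) (Y := ⟨F.obj X.of⟩) 1 (F.map (𝟙 X.of)) = _
    rw [F.map_id]; rfl
  map_comp {X Y Z} f g := by
    induction f using hom_induction with
    | h0 =>
      rw [Limits.zero_comp]
      exact (map_zero _).trans (Limits.zero_comp.symm.trans
        (congrArg (· ≫ _) (map_zero (LinearMap.baseChange _ _)).symm))
    | ha a b ha hb =>
      rw [Preadditive.add_comp]
      refine (map_add (LinearMap.baseChange _ _) _ _).trans ?_
      rw [ha, hb, ← Preadditive.add_comp]
      exact congrArg (· ≫ _) (map_add (LinearMap.baseChange _ _) _ _).symm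
    | ht s a =>
      induction g using hom_induction with
      | h0 =>
        rw [Limits.comp_zero]
        exact (map_zero _).trans (Limits.comp_zero.symm.trans
          (congrArg (_ ≫ ·) (map_zero (LinearMap.baseChange _ _)).symm))
      | ha a b ha hb =>
        rw [Preadditive.comp_add]
        refine (map_add (LinearMap.baseChange _ _) _ _).trans ?_
        rw [ha, hb, ← Preadditive.comp_add]
        exact congrArg (_ ≫ ·) (map_add (LinearMap.baseChange _ _) _ _).symm
      | ht t b =>
        change tmul (X := ⟨F.obj X.of⟩) (Y := ⟨F.obj Z.of⟩) (s * t) (F.map (a ≫ b)) = _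
        rw [F.map_comp]; rfl

variable (F : C ⥤ D) [F.Additive] [F.Linear R]

@[simp] lemma mapFunctor_map_tmul {X Y : BaseChange R S C} (s : S) (f : X.of ⟶ Y.of) :
    (mapFunctor (R := R) S F).map (tmul s f : X ⟶ Y) = tmul s (F.map f) := rfl

instance : (mapFunctor (R := R) S F).Additive where
  map_add := map_add (LinearMap.baseChange _ _) _ _

instance : (mapFunctor (R := R) S F).Linear S where
  map_smul f r := map_smul (LinearMap.baseChange S _) r f

variable {F} in
/-- The base change of a natural transformation, with components `1 ⊗ α`. -/
@[simps! app] def mapNat {G : C ⥤ D} [G.Additive] [G.Linear R] (α : F ⟶ G) :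
    mapFunctor (R := R) S F ⟶ mapFunctor (R := R) S G :=
  natMk _ _ (fun X => tmul 1 (α.app X.of)) (fun X Y s a => by
    change tmul (X := ⟨F.obj X.of⟩) (Y := ⟨G.obj Y.of⟩) (s * 1) (F.map a ≫ α.app _) =
      tmul (1 * s) (α.app _ ≫ G.map a)
    rw [α.naturality, mul_one, one_mul])

variable (R S C D) in
/-- The distributivity isomorphism `S ⊗ (M ⊗ N) ≃ (S ⊗ M) ⊗ (S ⊗ N)` on hom-modules,
`s ⊗ (f ⊗ g) ↦ (s ⊗ f) ⊗ (1 ⊗ g)`. -/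
abbrev distribEquiv (X Y : BaseChange R S (LinTensor R C D)) :=
  TensorProduct.AlgebraTensorModule.distribBaseChange R S
    (X.of.fst ⟶ Y.of.fst) (X.of.snd ⟶ Y.of.snd)

variable (R S C D) in
/-- Base change is monoidal: the functor `S ⊗ (C ⊗ D) ⥤ (S ⊗ C) ⊗ (S ⊗ D)` which is the identity on
objects and `s ⊗ (f ⊗ g) ↦ (s ⊗ f) ⊗ (1 ⊗ g)` on morphisms. -/
@[simps obj] def distrib :
    BaseChange R S (LinTensor R C D) ⥤ LinTensor S (BaseChange R S C) (BaseChange R S D) where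
  obj X := ⟨⟨X.of.fst⟩, ⟨X.of.snd⟩⟩
  map {X Y} f := distribEquiv R S C D X Y f
  map_id X := rfl
  map_comp {X Y Z} f g := by
    induction f using hom_induction with
    | h0 =>
      rw [Limits.zero_comp]
      exact (map_zero _).trans (Limits.zero_comp.symm.trans
        (congrArg (· ≫ _) (map_zero (distribEquiv R S C D X Y)).symm))
    | ha a b ha hb =>
      rw [Preadditive.add_comp]
      refine (map_add (distribEquiv R S C D X Z) _ _).trans ?_
      rw [ha, hb, ← Preadditive.add_comp]
      exact congrArg (· ≫ _) (map_add (distribEquiv R S C D X Y) _ _).symm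
    | ht s a =>
      induction g using hom_induction with
      | h0 =>
        rw [Limits.comp_zero]
        exact (map_zero _).trans (Limits.comp_zero.symm.trans
          (congrArg (_ ≫ ·) (map_zero (distribEquiv R S C D Y Z)).symm))
      | ha a b ha hb =>
        rw [Preadditive.comp_add]
        refine (map_add (distribEquiv R S C D X Z) _ _).trans ?_
        rw [ha, hb, ← Preadditive.comp_add]
        exact congrArg (_ ≫ ·) (map_add (distribEquiv R S C D Y Z) _ _).symm
      | ht t b =>
        induction a using LinTensor.hom_induction with
        | h0 =>
          have e : (tmul s (0 : X.of ⟶ Y.of) : X ⟶ Y) = 0 := TensorProduct.tmul_zero _ s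
          rw [e, Limits.zero_comp]
          exact (map_zero _).trans (Limits.zero_comp.symm.trans
            (congrArg (· ≫ _) (map_zero (distribEquiv R S C D X Y)).symm))
        | ha a b ha hb =>
          have e : (tmul s (a + b) : X ⟶ Y) = tmul s a + tmul s b := TensorProduct.tmul_add s a b
          rw [e, Preadditive.add_comp]
          refine (map_add (distribEquiv R S C D X Z) _ _).trans ?_
          rw [ha, hb, ← Preadditive.add_comp]
          exact congrArg (· ≫ _) (map_add (distribEquiv R S C D X Y) _ _).symm
        | ht a a' =>
          induction b using LinTensor.hom_induction with
          | h0 =>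
            have e : (tmul t (0 : Y.of ⟶ Z.of) : Y ⟶ Z) = 0 := TensorProduct.tmul_zero _ t
            rw [e, Limits.comp_zero]
            exact (map_zero _).trans (Limits.comp_zero.symm.trans
              (congrArg (_ ≫ ·) (map_zero (distribEquiv R S C D Y Z)).symm))
          | ha c d hc hd =>
            have e : (tmul t (c + d) : Y ⟶ Z) = tmul t c + tmul t d := TensorProduct.tmul_add t c d
            rw [e, Preadditive.comp_add]
            refine (map_add (distribEquiv R S C D X Z) _ _).trans ?_
            rw [hc, hd, ← Preadditive.comp_add]
            exact congrArg (_ ≫ ·) (map_add (distribEquiv R S C D Y Z) _ _).symm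
          | ht b b' =>
            exact congrArg (fun x : S => (((s * t) ⊗ₜ[R] (a ≫ b)) ⊗ₜ[S] (x ⊗ₜ[R] (a' ≫ b')) :
              (S ⊗[R] (X.of.fst ⟶ Z.of.fst)) ⊗[S] (S ⊗[R] (X.of.snd ⟶ Z.of.snd))))
              (mul_one (1 : S)).symm

instance : (distrib R S C D).Additive where
  map_add := map_add (distribEquiv R S C D _ _) _ _

instance : (distrib R S C D).Linear S where
  map_smul f r := map_smul (distribEquiv R S C D _ _) r f

instance : (distrib R S C D).Faithful where
  map_injective {X Y} _ _ h := (distribEquiv R S C D X Y).injective h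

instance : (distrib R S C D).Full where
  map_surjective {X Y} f := (distribEquiv R S C D X Y).surjective f

instance : (distrib R S C D).EssSurj where
  mem_essImage Y := ⟨⟨⟨Y.fst.of, Y.snd.of⟩⟩, ⟨Iso.refl _⟩⟩

instance : (distrib R S C D).IsEquivalence where

end

end BaseChange

/-! ### Pointed linear categories -/

/-- A small `R`-linear category with a distinguished object, i.e. an `E₀`-algebra in the symmetric
monoidal 2-category of small `R`-linear categories. -/
structure PtLin (R : Type) [CommRing R] where
  carrier : Type u
  [cat : Category.{u} carrier]
  [preadditive : Preadditive carrier]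
  [linear : Linear R carrier]
  /-- the distinguished object -/
  pt : carrier

namespace PtLin

attribute [instance] cat preadditive linear

section

variable {R : Type} [CommRing R]

/-- A pointed `R`-linear functor: an `R`-linear functor with an isomorphism from the
distinguished object to the image of the distinguished object. -/
structure Hom (C D : PtLin.{u} R) where
  functor : C.carrier ⥤ D.carrier
  [additive : functor.Additive]
  [linear : functor.Linear R]
  ptIso : D.pt ≅ functor.obj C.pt

attribute [instance] Hom.additive Hom.linear

@[simps id_functor id_ptIso comp_functor comp_ptIso]
instance : CategoryStruct (PtLin.{u} R) where
  Hom C D := Hom C D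
  id C := { functor := 𝟭 _, ptIso := Iso.refl _ }
  comp {C D E} F G :=
    { functor := F.functor ⋙ G.functor
      ptIso := G.ptIso ≪≫ G.functor.mapIso F.ptIso }

/-- A pointed natural transformation. -/
@[ext] structure Hom₂ {C D : PtLin.{u} R} (F G : C ⟶ D) where
  nat : F.functor ⟶ G.functor
  pt : F.ptIso.hom ≫ nat.app C.pt = G.ptIso.hom

attribute [simp] Hom₂.pt

@[simp] lemma Hom₂.pt_assoc {C D : PtLin.{u} R} {F G : C ⟶ D} (α : Hom₂ F G) {X : D.carrier}
    (f : G.functor.obj C.pt ⟶ X) : F.ptIso.hom ≫ α.nat.app C.pt ≫ f = G.ptIso.hom ≫ f := by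
  rw [← Category.assoc, α.pt]

instance homCategory (C D : PtLin.{u} R) : Category.{u} (C ⟶ D) where
  Hom F G := Hom₂ F G
  id F := { nat := 𝟙 F.functor, pt := by simp }
  comp α β := { nat := α.nat ≫ β.nat, pt := by simp }

@[simp] lemma id_nat {C D : PtLin.{u} R} (F : C ⟶ D) : Hom₂.nat (𝟙 F) = 𝟙 F.functor := rfl

@[simp] lemma comp_nat {C D : PtLin.{u} R} {F G H : C ⟶ D} (α : F ⟶ G) (β : G ⟶ H) :
    Hom₂.nat (α ≫ β) = Hom₂.nat α ≫ Hom₂.nat β := rfl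

@[ext] lemma hom₂_ext {C D : PtLin.{u} R} {F G : C ⟶ D} {α β : F ⟶ G}
    (h : ∀ X, (Hom₂.nat α).app X = (Hom₂.nat β).app X) : α = β :=
  Hom₂.ext (NatTrans.ext (funext h))

/-- Construct an invertible pointed natural transformation. -/
@[simps] def isoMk {C D : PtLin.{u} R} {F G : C ⟶ D} (e : F.functor ≅ G.functor)
    (h : F.ptIso.hom ≫ e.hom.app C.pt = G.ptIso.hom) : F ≅ G where
  hom := { nat := e.hom, pt := h }
  inv := { nat := e.inv, pt := by rw [← h]; simp }

/-- Small pointed `R`-linear categories, pointed `R`-linear functors and pointed natural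
transformations form a bicategory. -/
@[simps whiskerLeft_nat whiskerRight_nat associator leftUnitor rightUnitor]
instance : Bicategory (PtLin.{u} R) where
  homCategory := homCategory
  whiskerLeft {C D E} F {G H} α :=
    { nat := Functor.whiskerLeft F.functor α.nat
      pt := by
        have := (Hom₂.nat α).naturality F.ptIso.hom
        simp [this] }
  whiskerRight {C D E} {F G} α H :=
    { nat := Functor.whiskerRight α.nat H.functor
      pt := by simp [← Functor.map_comp] }
  associator F G H := isoMk (Functor.associator F.functor G.functor H.functor) (by simp)
  leftUnitor F := isoMk (Functor.leftUnitor F.functor) (by simp)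
  rightUnitor F := isoMk (Functor.rightUnitor F.functor) (by simp)

end

end PtLin

section

open MonoidalCategory

/-! ### Symmetric monoidal linear categories -/

/-- A small `k`-linear symmetric monoidal category (with `k`-bilinear tensor product), i.e. an
`E_∞`-algebra in the symmetric monoidal 2-category of small `k`-linear categories. -/
structure SMLin (k : Type) [CommRing k] where
  carrier : Type u
  [cat : Category.{u} carrier]
  [preadditive : Preadditive carrier]
  [linear : Linear k carrier]
  [monoidal : MonoidalCategory carrier]
  [symmetric : SymmetricCategory carrier]
  [monoidalPreadditive : MonoidalPreadditive carrier]
  [monoidalLinear : MonoidalLinear k carrier]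

namespace SMLin

attribute [instance] cat preadditive linear monoidal symmetric monoidalPreadditive monoidalLinear

section

variable {k : Type} [CommRing k]

/-- A `k`-linear (strong) symmetric monoidal functor. -/
structure Hom (C D : SMLin.{u} k) where
  functor : C.carrier ⥤ D.carrier
  [additive : functor.Additive]
  [linear : functor.Linear k]
  [braided : functor.Braided]

attribute [instance] Hom.additive Hom.linear Hom.braided

@[simps id_functor comp_functor]
instance : CategoryStruct (SMLin.{u} k) where
  Hom C D := Hom C D
  id C := { functor := 𝟭 C.carrier }
  comp {C D E} F G := { functor := F.functor ⋙ G.functor }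

/-- A monoidal natural transformation. -/
@[ext] structure Hom₂ {C D : SMLin.{u} k} (F G : C ⟶ D) where
  nat : F.functor ⟶ G.functor
  [isMonoidal : nat.IsMonoidal]

attribute [instance] Hom₂.isMonoidal

instance homCategory (C D : SMLin.{u} k) : Category.{u} (C ⟶ D) where
  Hom F G := Hom₂ F G
  id F := { nat := 𝟙 F.functor }
  comp α β := { nat := α.nat ≫ β.nat }

@[simp] lemma id_nat {C D : SMLin.{u} k} (F : C ⟶ D) : Hom₂.nat (𝟙 F) = 𝟙 F.functor := rfl

@[simp] lemma comp_nat {C D : SMLin.{u} k} {F G H : C ⟶ D} (α : F ⟶ G) (β : G ⟶ H) :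
    Hom₂.nat (α ≫ β) = Hom₂.nat α ≫ Hom₂.nat β := rfl

@[ext] lemma hom₂_ext {C D : SMLin.{u} k} {F G : C ⟶ D} {α β : F ⟶ G}
    (h : ∀ X, (Hom₂.nat α).app X = (Hom₂.nat β).app X) : α = β :=
  Hom₂.ext (NatTrans.ext (funext h))

instance {C D : SMLin.{u} k} {F G : C ⟶ D} (α : F ⟶ G) : (Hom₂.nat α).IsMonoidal := α.isMonoidal

/-- Construct an invertible monoidal natural transformation. -/
@[simps] def isoMk {C D : SMLin.{u} k} {F G : C ⟶ D} (e : F.functor ≅ G.functor)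
    (h : e.hom.IsMonoidal) : F ≅ G where
  hom := { nat := e.hom }
  inv := { nat := e.inv }

/-- Small `k`-linear symmetric monoidal categories, `k`-linear symmetric monoidal functors and
monoidal natural transformations form a bicategory. -/
@[simps whiskerLeft_nat whiskerRight_nat associator leftUnitor rightUnitor]
instance : Bicategory (SMLin.{u} k) where
  homCategory := homCategory
  whiskerLeft {C D E} F {G H} α :=
    { nat := Functor.whiskerLeft F.functor α.nat
      isMonoidal := NatTrans.IsMonoidal.whiskerLeft (F₁ := F.functor) α.nat }
  whiskerRight {C D E} {F G} α H :=
    { nat := Functor.whiskerRight α.nat H.functor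
      isMonoidal := NatTrans.IsMonoidal.whiskerRight (G₁ := H.functor) α.nat }
  associator F G H := isoMk (Functor.associator F.functor G.functor H.functor)
    (inferInstanceAs (Functor.associator F.functor G.functor H.functor).hom.IsMonoidal)
  leftUnitor F := isoMk (Functor.leftUnitor F.functor)
    (inferInstanceAs (Functor.leftUnitor F.functor).hom.IsMonoidal)
  rightUnitor F := isoMk (Functor.rightUnitor F.functor)
    (inferInstanceAs (Functor.rightUnitor F.functor).hom.IsMonoidal)

end

end SMLin

end

section

open MonoidalCategory

/-! ### Base change and forgetful pseudofunctors -/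

section

variable {R k : Type} [CommRing R] [CommRing k] [Algebra R k]

namespace BaseChange

variable {C D E : Type u} [Category.{u} C] [Preadditive C] [Linear R C]
  [Category.{u} D] [Preadditive D] [Linear R D] [Category.{u} E] [Preadditive E] [Linear R E]

variable (R k C) in
/-- Base change preserves identity functors. -/
@[simps!] def mapId : mapFunctor (R := R) k (𝟭 C) ≅ 𝟭 (BaseChange R k C) :=
  natIsoMk _ _ (fun X => Iso.refl X)
    (fun _ _ _ _ => (Category.comp_id _).trans (Category.id_comp _).symm)

variable (k) in
/-- Base change preserves composition of functors. -/
@[simps!] def mapComp (F : C ⥤ D) [F.Additive] [F.Linear R] (G : D ⥤ E) [G.Additive] [G.Linear R] :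
    mapFunctor (R := R) k (F ⋙ G) ≅ mapFunctor (R := R) k F ⋙ mapFunctor (R := R) k G :=
  natIsoMk _ _ (fun X => Iso.refl (⟨G.obj (F.obj X.of)⟩ : BaseChange R k E))
    (fun _ _ _ _ => (Category.comp_id _).trans (Category.id_comp _).symm)

end BaseChange

variable (R k) in
/-- Base change `C ↦ C ⊗_R k` of pointed linear categories. -/
@[simps! obj_pt map_functor map_ptIso map₂_nat mapId mapComp]
def baseChange : PtLin.{u} R ⥤ᵖ PtLin.{u} k where
  obj C := { carrier := BaseChange R k C.carrier, pt := ⟨C.pt⟩ }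
  map F :=
    { functor := BaseChange.mapFunctor (R := R) k F.functor
      ptIso := BaseChange.isoMk (R := R) (S := k) (X := ⟨_⟩) (Y := ⟨_⟩) F.ptIso }
  map₂ {C D F G} α :=
    { nat := BaseChange.mapNat α.nat
      pt := (BaseChange.tmul_one_comp (Y := ⟨F.functor.obj C.pt⟩) _ _).symm.trans
        (congrArg (BaseChange.tmul 1) α.pt) }
  map₂_id F := PtLin.hom₂_ext fun X => rfl
  map₂_comp {C D F G H} α β := PtLin.hom₂_ext fun X =>
    BaseChange.tmul_one_comp (Y := ⟨G.functor.obj X.of⟩) _ _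
  mapId C := PtLin.isoMk (BaseChange.mapId R k C.carrier) (Category.comp_id _)
  mapComp {C D E} F G := PtLin.isoMk (BaseChange.mapComp k F.functor G.functor)
    ((Category.comp_id _).trans
      (BaseChange.tmul_one_comp (Y := ⟨G.functor.obj D.pt⟩) _ _))
  map₂_whisker_left F G H η := PtLin.hom₂_ext fun X =>
    ((Category.id_comp _).trans (Category.comp_id _)).symm
  map₂_whisker_right η H := PtLin.hom₂_ext fun X =>
    ((Category.id_comp _).trans (Category.comp_id _)).symm
  map₂_associator F G H := PtLin.hom₂_ext fun X => by
    refine ((Category.id_comp _).trans ?_).symm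
    refine (congrArg (· ≫ _) ((BaseChange.mapFunctor (R := R) k H.functor).map_id
      ⟨G.functor.obj (F.functor.obj X.of)⟩)).trans ((Category.id_comp _).trans ?_)
    exact (Category.id_comp _).trans (Category.id_comp _)
  map₂_left_unitor F := PtLin.hom₂_ext fun X => by
    refine ((Category.id_comp _).trans ((Category.comp_id _).trans ?_)).symm
    exact (BaseChange.mapFunctor (R := R) k F.functor).map_id X
  map₂_right_unitor F := PtLin.hom₂_ext fun X =>
    ((Category.id_comp _).trans (Category.comp_id _)).symm

variable (k) in
/-- A symmetric monoidal linear category is pointed by its unit. -/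
@[simps! obj_pt map_functor map_ptIso map₂_nat mapId mapComp]
def toPt : SMLin.{u} k ⥤ᵖ PtLin.{u} k where
  obj C := { carrier := C.carrier, pt := 𝟙_ C.carrier }
  map F := { functor := F.functor, ptIso := Functor.Monoidal.εIso F.functor }
  map₂ α := { nat := α.nat, pt := NatTrans.IsMonoidal.unit }
  mapId C := PtLin.isoMk (Iso.refl _) (by simp)
  mapComp F G := PtLin.isoMk (Iso.refl _) (by simp)

end

end

section

open MonoidalCategory

/-! ### The tensor product of symmetric monoidal linear categories -/

namespace LinTensor

section

variable {k : Type} [CommRing k] {C D : Type u}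
  [Category.{u} C] [Preadditive C] [Linear k C] [MonoidalCategory C] [MonoidalPreadditive C]
  [MonoidalLinear k C]
  [Category.{u} D] [Preadditive D] [Linear k D] [MonoidalCategory D] [MonoidalPreadditive D]
  [MonoidalLinear k D]

/-- The tensor product of `C ⊗ D` is `(c, d) ⊗ (c', d') = (c ⊗ c', d ⊗ d')`, with whiskerings
`(c, d) ◁ (f ⊗ g) = (c ◁ f) ⊗ (d ◁ g)` and componentwise structure isomorphisms. -/
instance : MonoidalCategoryStruct (LinTensor k C D) where
  tensorObj X Y := ⟨X.fst ⊗ Y.fst, X.snd ⊗ Y.snd⟩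
  whiskerLeft X _ _ f :=
    (mapFunctor (R := k) (tensorLeft X.fst) (tensorLeft X.snd)).map f
  whiskerRight f Y := (mapFunctor (R := k) (tensorRight Y.fst) (tensorRight Y.snd)).map f
  tensorHom {X₁ Y₁ X₂ Y₂} f g :=
    (mapFunctor (R := k) (tensorRight X₂.fst) (tensorRight X₂.snd)).map f ≫
      (mapFunctor (R := k) (tensorLeft Y₁.fst) (tensorLeft Y₁.snd)).map g
  tensorUnit := ⟨𝟙_ C, 𝟙_ D⟩
  associator X Y Z := isoMk (α_ X.fst Y.fst Z.fst) (α_ X.snd Y.snd Z.snd)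
  leftUnitor X := isoMk (λ_ X.fst) (λ_ X.snd)
  rightUnitor X := isoMk (ρ_ X.fst) (ρ_ X.snd)

lemma wl_zero (X : LinTensor k C D) {Y Z : LinTensor k C D} : X ◁ (0 : Y ⟶ Z) = 0 :=
  Functor.map_zero (mapFunctor (R := k) (tensorLeft X.fst) (tensorLeft X.snd)) _ _

lemma wl_add (X : LinTensor k C D) {Y Z : LinTensor k C D} (f g : Y ⟶ Z) :
    X ◁ (f + g) = X ◁ f + X ◁ g :=
  Functor.map_add (mapFunctor (R := k) (tensorLeft X.fst) (tensorLeft X.snd))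

lemma wr_zero (X : LinTensor k C D) {Y Z : LinTensor k C D} : (0 : Y ⟶ Z) ▷ X = 0 :=
  Functor.map_zero (mapFunctor (R := k) (tensorRight X.fst) (tensorRight X.snd)) _ _

lemma wr_add (X : LinTensor k C D) {Y Z : LinTensor k C D} (f g : Y ⟶ Z) :
    (f + g) ▷ X = f ▷ X + g ▷ X :=
  Functor.map_add (mapFunctor (R := k) (tensorRight X.fst) (tensorRight X.snd))

lemma wl_tmul (X : LinTensor k C D) {Y Z : LinTensor k C D} (a : Y.fst ⟶ Z.fst)
    (b : Y.snd ⟶ Z.snd) : X ◁ (tmul a b : Y ⟶ Z) =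
      (tmul (X.fst ◁ a) (X.snd ◁ b) : X ⊗ Y ⟶ X ⊗ Z) := rfl

lemma wr_tmul (X : LinTensor k C D) {Y Z : LinTensor k C D} (a : Y.fst ⟶ Z.fst)
    (b : Y.snd ⟶ Z.snd) : (tmul a b : Y ⟶ Z) ▷ X =
      (tmul (a ▷ X.fst) (b ▷ X.snd) : Y ⊗ X ⟶ Z ⊗ X) := rfl

lemma wl_comp (X : LinTensor k C D) {Y Z W : LinTensor k C D} (f : Y ⟶ Z) (g : Z ⟶ W) :
    X ◁ (f ≫ g) = X ◁ f ≫ X ◁ g :=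
  (mapFunctor (R := k) (tensorLeft X.fst) (tensorLeft X.snd)).map_comp f g

lemma wr_comp (X : LinTensor k C D) {Y Z W : LinTensor k C D} (f : Y ⟶ Z) (g : Z ⟶ W) :
    (f ≫ g) ▷ X = f ▷ X ≫ g ▷ X :=
  (mapFunctor (R := k) (tensorRight X.fst) (tensorRight X.snd)).map_comp f g

lemma wl_id (X Y : LinTensor k C D) : X ◁ 𝟙 Y = 𝟙 (X ⊗ Y) :=
  (mapFunctor (R := k) (tensorLeft X.fst) (tensorLeft X.snd)).map_id Y

lemma wr_id (X Y : LinTensor k C D) : 𝟙 X ▷ Y = 𝟙 (X ⊗ Y) :=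
  (mapFunctor (R := k) (tensorRight Y.fst) (tensorRight Y.snd)).map_id X

lemma w_exchange {X Y Z W : LinTensor k C D} (f : X ⟶ Y) (g : Z ⟶ W) :
    X ◁ g ≫ f ▷ W = f ▷ Z ≫ Y ◁ g := by
  induction f using hom_induction with
  | h0 => simp [wr_zero]
  | ha a b ha hb => simp [wr_add, ha, hb]
  | ht a b =>
    induction g using hom_induction with
    | h0 => simp [wl_zero]
    | ha a b ha hb => simp [wl_add, ha, hb]
    | ht c d => exact tmul_congr (whisker_exchange a c) (whisker_exchange b d)

lemma th_def {X Y Z W : LinTensor k C D} (f : X ⟶ Y) (g : Z ⟶ W) :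
    f ⊗ₘ g = f ▷ Z ≫ Y ◁ g := rfl

lemma th_tmul {X Y Z W : LinTensor k C D} (a : X.fst ⟶ Y.fst) (b : X.snd ⟶ Y.snd)
    (c : Z.fst ⟶ W.fst) (d : Z.snd ⟶ W.snd) : (tmul a b : X ⟶ Y) ⊗ₘ (tmul c d : Z ⟶ W) =
      (tmul (a ⊗ₘ c) (b ⊗ₘ d) : X ⊗ Z ⟶ Y ⊗ W) := by
  rw [tensorHom_def a, tensorHom_def b]
  rfl

instance : MonoidalCategory (LinTensor k C D) where
  tensorHom_def _ _ := rfl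
  whiskerLeft_id := wl_id
  id_whiskerRight := wr_id
  id_tensorHom_id X Y := by rw [th_def, wr_id, wl_id, Category.comp_id]
  tensorHom_comp_tensorHom f₁ f₂ g₁ g₂ := by
    rw [th_def, th_def, th_def, wr_comp, wl_comp, Category.assoc, Category.assoc,
      ← Category.assoc (_ ◁ f₂), w_exchange, Category.assoc]
  associator_naturality f g h := by
    induction f using hom_induction with
    | h0 => simp [th_def, wr_zero]
    | ha a b ha hb =>
      simp only [th_def, wr_add, wr_comp, Preadditive.add_comp, Preadditive.comp_add] at ha hb ⊢
      rw [ha, hb]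
    | ht a a' =>
      induction g using hom_induction with
      | h0 => simp [th_def, wl_zero, wr_zero]
      | ha b c hb hc =>
        simp only [th_def, wl_add, wr_add, wr_comp, wl_comp, Preadditive.add_comp,
          Preadditive.comp_add] at hb hc ⊢
        rw [hb, hc]
      | ht b b' =>
        induction h using hom_induction with
        | h0 => simp [th_def, wl_zero]
        | ha c d hc hd =>
          simp only [th_def, wl_add, wl_comp, Preadditive.add_comp,
            Preadditive.comp_add] at hc hd ⊢
          rw [hc, hd]
        | ht c c' =>
          rw [th_tmul, th_tmul, th_tmul, th_tmul]
          exact tmul_congr (associator_naturality a b c) (associator_naturality a' b' c')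
  leftUnitor_naturality f := by
    induction f using hom_induction with
    | h0 => simp [wl_zero]
    | ha a b ha hb => simp [wl_add, ha, hb]
    | ht a b => exact tmul_congr (leftUnitor_naturality a) (leftUnitor_naturality b)
  rightUnitor_naturality f := by
    induction f using hom_induction with
    | h0 => simp [wr_zero]
    | ha a b ha hb => simp [wr_add, ha, hb]
    | ht a b => exact tmul_congr (rightUnitor_naturality a) (rightUnitor_naturality b)
  pentagon W X Y Z := tmul_congr (pentagon _ _ _ _) (pentagon _ _ _ _)
  triangle X Y := tmul_congr (triangle _ _) (triangle _ _)

instance : MonoidalPreadditive (LinTensor k C D) where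
  whiskerLeft_zero := wl_zero _
  zero_whiskerRight := wr_zero _
  whiskerLeft_add := wl_add _
  add_whiskerRight := wr_add _

instance : MonoidalLinear k (LinTensor k C D) where
  whiskerLeft_smul X _ _ r f :=
    Functor.map_smul (mapFunctor (R := k) (tensorLeft X.fst) (tensorLeft X.snd)) r f
  smul_whiskerRight r _ _ f X :=
    Functor.map_smul (mapFunctor (R := k) (tensorRight X.fst) (tensorRight X.snd)) r f

end

section

variable {k : Type} [CommRing k] {C D C' D' : Type u}
  [Category.{u} C] [Preadditive C] [Linear k C] [MonoidalCategory C] [MonoidalPreadditive C]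
  [MonoidalLinear k C] [SymmetricCategory C]
  [Category.{u} D] [Preadditive D] [Linear k D] [MonoidalCategory D] [MonoidalPreadditive D]
  [MonoidalLinear k D] [SymmetricCategory D]
  [Category.{u} C'] [Preadditive C'] [Linear k C'] [MonoidalCategory C'] [MonoidalPreadditive C']
  [MonoidalLinear k C'] [SymmetricCategory C']
  [Category.{u} D'] [Preadditive D'] [Linear k D'] [MonoidalCategory D'] [MonoidalPreadditive D']
  [MonoidalLinear k D'] [SymmetricCategory D']

instance : SymmetricCategory (LinTensor k C D) where
  braiding X Y := isoMk (β_ X.fst Y.fst) (β_ X.snd Y.snd)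
  braiding_naturality_right X Y Z f := by
    induction f using hom_induction with
    | h0 => simp
    | ha a b ha hb => rw [wl_add, wr_add, Preadditive.add_comp, Preadditive.comp_add, ha, hb]
    | ht a b =>
      exact tmul_congr (X := X ⊗ Y) (Y := Z ⊗ X)
        (BraidedCategory.braiding_naturality_right X.fst a)
        (BraidedCategory.braiding_naturality_right X.snd b)
  braiding_naturality_left {X Y} f Z := by
    induction f using hom_induction with
    | h0 => simp
    | ha a b ha hb => rw [wl_add, wr_add, Preadditive.add_comp, Preadditive.comp_add, ha, hb]
    | ht a b =>
      exact tmul_congr (X := X ⊗ Z) (Y := Z ⊗ Y)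
        (BraidedCategory.braiding_naturality_left a Z.fst)
        (BraidedCategory.braiding_naturality_left b Z.snd)
  hexagon_forward X Y Z := tmul_congr (X := (X ⊗ Y) ⊗ Z) (Y := Y ⊗ (Z ⊗ X))
    (BraidedCategory.hexagon_forward X.fst Y.fst Z.fst)
    (BraidedCategory.hexagon_forward X.snd Y.snd Z.snd)
  hexagon_reverse X Y Z := tmul_congr (X := X ⊗ (Y ⊗ Z)) (Y := (Z ⊗ X) ⊗ Y)
    (BraidedCategory.hexagon_reverse X.fst Y.fst Z.fst)
    (BraidedCategory.hexagon_reverse X.snd Y.snd Z.snd)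
  symmetry X Y := tmul_congr (SymmetricCategory.symmetry _ _) (SymmetricCategory.symmetry _ _)

variable (F : C ⥤ C') [F.Additive] [F.Linear k] [F.Braided] (G : D ⥤ D') [G.Additive] [G.Linear k]
  [G.Braided]

/-- The tensor product of symmetric monoidal functors is a monoidal functor. -/
def mapFunctorMonoidal : (mapFunctor (R := k) F G).CoreMonoidal where
  εIso := isoMk (R := k) (X := ⟨_, _⟩) (Y := ⟨_, _⟩) (Functor.Monoidal.εIso F)
    (Functor.Monoidal.εIso G)
  μIso X Y := isoMk (R := k) (X := ⟨_, _⟩) (Y := ⟨_, _⟩)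
    (Functor.Monoidal.μIso F X.fst Y.fst) (Functor.Monoidal.μIso G X.snd Y.snd)
  μIso_hom_natural_left {X Y} f Z := by
    induction f using hom_induction with
    | h0 => simp
    | ha a b ha hb =>
      rw [Functor.map_add, wr_add, wr_add, Functor.map_add, Preadditive.add_comp,
        Preadditive.comp_add, ha, hb]
    | ht a b =>
      exact tmul_congr (R := k) (X := ⟨F.obj X.fst ⊗ F.obj Z.fst, G.obj X.snd ⊗ G.obj Z.snd⟩)
        (Y := ⟨F.obj (Y.fst ⊗ Z.fst), G.obj (Y.snd ⊗ Z.snd)⟩)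
        (Functor.LaxMonoidal.μ_natural_left F a Z.fst)
        (Functor.LaxMonoidal.μ_natural_left G b Z.snd)
  μIso_hom_natural_right {X Y} Z f := by
    induction f using hom_induction with
    | h0 => simp
    | ha a b ha hb =>
      rw [Functor.map_add, wl_add, wl_add, Functor.map_add, Preadditive.add_comp,
        Preadditive.comp_add, ha, hb]
    | ht a b =>
      exact tmul_congr (R := k) (X := ⟨F.obj Z.fst ⊗ F.obj X.fst, G.obj Z.snd ⊗ G.obj X.snd⟩)
        (Y := ⟨F.obj (Z.fst ⊗ Y.fst), G.obj (Z.snd ⊗ Y.snd)⟩)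
        (Functor.LaxMonoidal.μ_natural_right F Z.fst a)
        (Functor.LaxMonoidal.μ_natural_right G Z.snd b)
  associativity X Y Z := tmul_congr (R := k)
    (X := ⟨(F.obj X.fst ⊗ F.obj Y.fst) ⊗ F.obj Z.fst, (G.obj X.snd ⊗ G.obj Y.snd) ⊗ G.obj Z.snd⟩)
    (Y := ⟨F.obj (X.fst ⊗ Y.fst ⊗ Z.fst), G.obj (X.snd ⊗ Y.snd ⊗ Z.snd)⟩)
    (Functor.LaxMonoidal.associativity F X.fst Y.fst Z.fst)
    (Functor.LaxMonoidal.associativity G X.snd Y.snd Z.snd)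
  left_unitality X := tmul_congr (R := k) (X := ⟨𝟙_ C' ⊗ F.obj X.fst, 𝟙_ D' ⊗ G.obj X.snd⟩)
    (Y := ⟨F.obj X.fst, G.obj X.snd⟩)
    (Functor.LaxMonoidal.left_unitality F X.fst) (Functor.LaxMonoidal.left_unitality G X.snd)
  right_unitality X := tmul_congr (R := k) (X := ⟨F.obj X.fst ⊗ 𝟙_ C', G.obj X.snd ⊗ 𝟙_ D'⟩)
    (Y := ⟨F.obj X.fst, G.obj X.snd⟩)
    (Functor.LaxMonoidal.right_unitality F X.fst) (Functor.LaxMonoidal.right_unitality G X.snd)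

instance : (mapFunctor (R := k) F G).Braided where
  toMonoidal := (mapFunctorMonoidal F G).toMonoidal
  braided X Y := tmul_congr (R := k)
    (X := ⟨F.obj X.fst ⊗ F.obj Y.fst, G.obj X.snd ⊗ G.obj Y.snd⟩)
    (Y := ⟨F.obj (Y.fst ⊗ X.fst), G.obj (Y.snd ⊗ X.snd)⟩)
    (Functor.LaxBraided.braided X.fst Y.fst) (Functor.LaxBraided.braided X.snd Y.snd)

instance mapNat_isMonoidal {F F' : C ⥤ C'} [F.Additive] [F.Linear k] [F.Braided]
    [F'.Additive] [F'.Linear k] [F'.Braided]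
    {G G' : D ⥤ D'} [G.Additive] [G.Linear k] [G.Braided]
    [G'.Additive] [G'.Linear k] [G'.Braided]
    (α : F ⟶ F') (β : G ⟶ G') [α.IsMonoidal] [β.IsMonoidal] :
    (mapNat (R := k) α β).IsMonoidal where
  unit := tmul_congr (R := k) (X := ⟨𝟙_ C', 𝟙_ D'⟩) (Y := ⟨F'.obj (𝟙_ C), G'.obj (𝟙_ D)⟩)
    (NatTrans.IsMonoidal.unit (τ := α)) (NatTrans.IsMonoidal.unit (τ := β))
  tensor X Y := by
    refine (tmul_congr (R := k)
      (X := ⟨F.obj X.fst ⊗ F.obj Y.fst, G.obj X.snd ⊗ G.obj Y.snd⟩)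
      (Y := ⟨F'.obj (X.fst ⊗ Y.fst), G'.obj (X.snd ⊗ Y.snd)⟩)
      (NatTrans.IsMonoidal.tensor (τ := α) X.fst Y.fst)
      (NatTrans.IsMonoidal.tensor (τ := β) X.snd Y.snd)).trans ?_
    exact congrArg (· ≫ ((mapFunctorMonoidal F' G').μIso X Y).hom)
      (th_tmul (k := k) (X := ⟨F.obj X.fst, G.obj X.snd⟩) (Y := ⟨F'.obj X.fst, G'.obj X.snd⟩)
        (Z := ⟨F.obj Y.fst, G.obj Y.snd⟩) (W := ⟨F'.obj Y.fst, G'.obj Y.snd⟩)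
        (α.app X.fst) (β.app X.snd) (α.app Y.fst) (β.app Y.snd)).symm

end

end LinTensor

end

section

open MonoidalCategory

namespace LinTensor

section

variable {R : Type} [CommRing R] (C D : Type u) {C' D' C'' D'' : Type u}
  [Category.{u} C] [Preadditive C] [Linear R C] [Category.{u} D] [Preadditive D] [Linear R D]
  [Category.{u} C'] [Preadditive C'] [Linear R C'] [Category.{u} D'] [Preadditive D'] [Linear R D']
  [Category.{u} C''] [Preadditive C''] [Linear R C'']
  [Category.{u} D''] [Preadditive D''] [Linear R D'']

variable (R) in
/-- The tensor product of identity functors is the identity functor. -/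
@[simps!] def mapFunctorId : mapFunctor (R := R) (𝟭 C) (𝟭 D) ≅ 𝟭 (LinTensor R C D) :=
  natIsoMk _ _ (fun X => Iso.refl X)
    (fun _ _ _ _ => (Category.comp_id _).trans (Category.id_comp _).symm)

variable {C D}

/-- The tensor product of functors is compatible with composition. -/
@[simps!] def mapFunctorComp (F : C ⥤ C') (F' : C' ⥤ C'') (G : D ⥤ D') (G' : D' ⥤ D'')
    [F.Additive] [F.Linear R] [F'.Additive] [F'.Linear R]
    [G.Additive] [G.Linear R] [G'.Additive] [G'.Linear R] :
    mapFunctor (R := R) (F ⋙ F') (G ⋙ G') ≅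
      mapFunctor (R := R) F G ⋙ mapFunctor (R := R) F' G' :=
  natIsoMk _ _ (fun X => Iso.refl (⟨F'.obj (F.obj X.fst), G'.obj (G.obj X.snd)⟩ :
      LinTensor R C'' D''))
    (fun _ _ _ _ => (Category.comp_id _).trans (Category.id_comp _).symm)

end

section

variable {k : Type} [CommRing k] (C D : Type u) {C' D' C'' D'' : Type u}
  [Category.{u} C] [Preadditive C] [Linear k C] [MonoidalCategory C] [MonoidalPreadditive C]
  [MonoidalLinear k C] [SymmetricCategory C]
  [Category.{u} D] [Preadditive D] [Linear k D] [MonoidalCategory D] [MonoidalPreadditive D]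
  [MonoidalLinear k D] [SymmetricCategory D]
  [Category.{u} C'] [Preadditive C'] [Linear k C'] [MonoidalCategory C'] [MonoidalPreadditive C']
  [MonoidalLinear k C'] [SymmetricCategory C']
  [Category.{u} D'] [Preadditive D'] [Linear k D'] [MonoidalCategory D'] [MonoidalPreadditive D']
  [MonoidalLinear k D'] [SymmetricCategory D']
  [Category.{u} C''] [Preadditive C''] [Linear k C''] [MonoidalCategory C'']
  [MonoidalPreadditive C''] [MonoidalLinear k C''] [SymmetricCategory C'']
  [Category.{u} D''] [Preadditive D''] [Linear k D''] [MonoidalCategory D'']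
  [MonoidalPreadditive D''] [MonoidalLinear k D''] [SymmetricCategory D'']

lemma mapFunctorId_isMonoidal : (mapFunctorId k C D).hom.IsMonoidal where
  unit := Category.comp_id _
  tensor _ _ := (Category.comp_id _).trans
    ((congrArg (· ≫ _) (id_tensorHom_id _ _)).trans (Category.id_comp _)).symm

variable {C D}

lemma mapFunctorComp_isMonoidal (F : C ⥤ C') (F' : C' ⥤ C'') (G : D ⥤ D') (G' : D' ⥤ D'')
    [F.Additive] [F.Linear k] [F'.Additive] [F'.Linear k] [G.Additive] [G.Linear k]
    [G'.Additive] [G'.Linear k] [F.Braided] [F'.Braided] [G.Braided] [G'.Braided] :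
    (mapFunctorComp (R := k) F F' G G').hom.IsMonoidal where
  unit := Category.comp_id _
  tensor _ _ := (Category.comp_id _).trans
    ((congrArg (· ≫ _) (id_tensorHom_id _ _)).trans (Category.id_comp _)).symm

end

end LinTensor

/-- The tensor product of pointed linear categories, as a pseudofunctor in two variables. -/
def PtLin.tensor (R : Type) [CommRing R] : PtLin.{u} R × PtLin.{u} R ⥤ᵖ PtLin.{u} R where
  obj X := { carrier := LinTensor R X.1.carrier X.2.carrier, pt := ⟨X.1.pt, X.2.pt⟩ }
  map F :=
    { functor := LinTensor.mapFunctor (R := R) F.1.functor F.2.functor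
      ptIso := LinTensor.isoMk (R := R) (X := ⟨_, _⟩) (Y := ⟨_, _⟩) F.1.ptIso F.2.ptIso }
  map₂ {X Y F G} α :=
    { nat := LinTensor.mapNat (R := R) α.1.nat α.2.nat
      pt := LinTensor.tmul_congr (R := R) (X := ⟨Y.1.pt, Y.2.pt⟩)
        (Y := ⟨G.1.functor.obj X.1.pt, G.2.functor.obj X.2.pt⟩) α.1.pt α.2.pt }
  map₂_id F := PtLin.hom₂_ext fun X => rfl
  map₂_comp α β := PtLin.hom₂_ext fun X => rfl
  mapId X := PtLin.isoMk (LinTensor.mapFunctorId R X.1.carrier X.2.carrier) (Category.comp_id _)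
  mapComp F G := PtLin.isoMk (LinTensor.mapFunctorComp F.1.functor G.1.functor
    F.2.functor G.2.functor) (Category.comp_id _)
  map₂_whisker_left F G H η := PtLin.hom₂_ext fun X =>
    ((Category.id_comp _).trans (Category.comp_id _)).symm
  map₂_whisker_right η H := PtLin.hom₂_ext fun X =>
    ((Category.id_comp _).trans (Category.comp_id _)).symm
  map₂_associator F G H := PtLin.hom₂_ext fun X => by
    refine ((Category.id_comp _).trans ?_).symm
    refine (congrArg (· ≫ _) ((LinTensor.mapFunctor (R := R) H.1.functor H.2.functor).map_id
      ⟨G.1.functor.obj (F.1.functor.obj X.fst), G.2.functor.obj (F.2.functor.obj X.snd)⟩)).trans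
        ((Category.id_comp _).trans ?_)
    exact (Category.id_comp _).trans (Category.id_comp _)
  map₂_left_unitor F := PtLin.hom₂_ext fun X => by
    refine ((Category.id_comp _).trans ((Category.comp_id _).trans ?_)).symm
    exact (LinTensor.mapFunctor (R := R) F.1.functor F.2.functor).map_id X
  map₂_right_unitor F := PtLin.hom₂_ext fun X =>
    ((Category.id_comp _).trans (Category.comp_id _)).symm

/-- The tensor product of symmetric monoidal linear categories, as a pseudofunctor in two
variables. -/
def SMLin.tensor (k : Type) [CommRing k] : SMLin.{u} k × SMLin.{u} k ⥤ᵖ SMLin.{u} k where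
  obj X := { carrier := LinTensor k X.1.carrier X.2.carrier }
  map F := { functor := LinTensor.mapFunctor (R := k) F.1.functor F.2.functor }
  map₂ α := { nat := LinTensor.mapNat (R := k) α.1.nat α.2.nat }
  map₂_id F := SMLin.hom₂_ext fun X => rfl
  map₂_comp α β := SMLin.hom₂_ext fun X => rfl
  mapId X := SMLin.isoMk (LinTensor.mapFunctorId k X.1.carrier X.2.carrier)
    (LinTensor.mapFunctorId_isMonoidal _ _)
  mapComp F G := SMLin.isoMk (LinTensor.mapFunctorComp F.1.functor G.1.functor
    F.2.functor G.2.functor)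
    (LinTensor.mapFunctorComp_isMonoidal _ _ _ _)
  map₂_whisker_left F G H η := SMLin.hom₂_ext fun X =>
    ((Category.id_comp _).trans (Category.comp_id _)).symm
  map₂_whisker_right η H := SMLin.hom₂_ext fun X =>
    ((Category.id_comp _).trans (Category.comp_id _)).symm
  map₂_associator F G H := SMLin.hom₂_ext fun X => by
    refine ((Category.id_comp _).trans ?_).symm
    refine (congrArg (· ≫ _) ((LinTensor.mapFunctor (R := k) H.1.functor H.2.functor).map_id
      ⟨G.1.functor.obj (F.1.functor.obj X.fst), G.2.functor.obj (F.2.functor.obj X.snd)⟩)).trans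
        ((Category.id_comp _).trans ?_)
    exact (Category.id_comp _).trans (Category.id_comp _)
  map₂_left_unitor F := SMLin.hom₂_ext fun X => by
    refine ((Category.id_comp _).trans ((Category.comp_id _).trans ?_)).symm
    exact (LinTensor.mapFunctor (R := k) F.1.functor F.2.functor).map_id X
  map₂_right_unitor F := SMLin.hom₂_ext fun X =>
    ((Category.id_comp _).trans (Category.comp_id _)).symm

end

section

open MonoidalCategory

namespace PtLin

variable {R : Type} [CommRing R]

lemma equivalence_aux₁ {C D : Type u} [Category.{u} C] [Category.{u} D] (e : C ≌ D)
    {c : C} {d : D} (i : d ≅ e.functor.obj c) :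
    e.unitIso.hom.app c = (e.unitIso.hom.app c ≫ e.inverse.map i.inv) ≫ e.inverse.map i.hom := by
  simp [← Functor.map_comp]

lemma equivalence_aux₂ {C D : Type u} [Category.{u} C] [Category.{u} D] (e : C ≌ D)
    {c : C} {d : D} (i : d ≅ e.functor.obj c) :
    (i.hom ≫ e.functor.map (e.unitIso.hom.app c ≫ e.inverse.map i.inv)) ≫
      e.counitIso.hom.app d = 𝟙 d := by
  simp

/-- A pointed linear functor whose underlying functor is an equivalence is an equivalence. -/
lemma isEquivalence₁ {C D : PtLin.{u} R} (F : C ⟶ D) [F.functor.IsEquivalence] :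
    IsEquivalence₁ F := by
  let e := F.functor.asEquivalence
  have : e.functor.Additive := F.additive
  have : e.functor.Linear R := F.linear
  have : F.functor.inv.Additive := e.inverse_additive
  have : F.functor.inv.Linear R := e.inverseLinear R
  let G : D ⟶ C :=
    { functor := F.functor.inv
      ptIso := F.functor.asEquivalence.unitIso.app C.pt ≪≫ F.functor.inv.mapIso F.ptIso.symm }
  refine ⟨Bicategory.Equivalence.mkOfAdjointifyCounit (f := F) (g := G)
    (PtLin.isoMk F.functor.asEquivalence.unitIso ?_)
    (PtLin.isoMk F.functor.asEquivalence.counitIso ?_), rfl⟩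
  · exact (Category.id_comp _).trans (equivalence_aux₁ e F.ptIso)
  · exact equivalence_aux₂ e F.ptIso

/-- The underlying functor of an equivalence of pointed linear categories is an equivalence. -/
lemma isEquivalence_functor {C D : PtLin.{u} R} {F : C ⟶ D} (h : IsEquivalence₁ F) :
    F.functor.IsEquivalence := by
  obtain ⟨e, rfl⟩ := h
  exact (CategoryTheory.Equivalence.mk e.hom.functor e.inv.functor
    { hom := Hom₂.nat e.unit.hom
      inv := Hom₂.nat e.unit.inv
      hom_inv_id := congrArg Hom₂.nat e.unit.hom_inv_id
      inv_hom_id := congrArg Hom₂.nat e.unit.inv_hom_id }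
    { hom := Hom₂.nat e.counit.hom
      inv := Hom₂.nat e.counit.inv
      hom_inv_id := congrArg Hom₂.nat e.counit.hom_inv_id
      inv_hom_id := congrArg Hom₂.nat e.counit.inv_hom_id }).isEquivalence_functor

end PtLin

namespace BaseChange

variable {R k : Type} [CommRing R] [CommRing k] [Algebra R k] {C D E : Type u}
  [Category.{u} C] [Preadditive C] [Linear R C] [Category.{u} D] [Preadditive D] [Linear R D]
  [Category.{u} E] [Preadditive E]

/-- The version of `natIsoMk` for functors on the base change of a tensor product. -/
@[simps!] def natIsoMk₂ (F G : BaseChange R k (LinTensor R C D) ⥤ E) [F.Additive] [G.Additive]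
    (app : ∀ X, F.obj X ≅ G.obj X)
    (h : ∀ (X Y : BaseChange R k (LinTensor R C D)) (s : k) (a : X.of.fst ⟶ Y.of.fst)
      (b : X.of.snd ⟶ Y.of.snd),
      F.map (tmul s (LinTensor.tmul a b) : X ⟶ Y) ≫ (app Y).hom =
        (app X).hom ≫ G.map (tmul s (LinTensor.tmul a b) : X ⟶ Y)) : F ≅ G :=
  natIsoMk F G app (fun X Y s f => by
    induction f using LinTensor.hom_induction with
    | h0 =>
      have e : (tmul s (0 : X.of ⟶ Y.of) : X ⟶ Y) = 0 := TensorProduct.tmul_zero _ s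
      simp [e]
    | ha a b ha hb =>
      have e : (tmul s (a + b) : X ⟶ Y) = tmul s a + tmul s b := TensorProduct.tmul_add s a b
      simp [e, ha, hb]
    | ht a b => exact h X Y s a b)

end BaseChange

/-! ### The 2-categories of almost-Poisson and Beilinson–Drinfeld categories -/

/-- The 2-category of triples of a pointed (i.e. `E₀`-monoidal) `R`-linear category `C_R`, a
`k`-linear symmetric monoidal category `C_SMC`, and an equivalence `C_R ⊗_R k ≃ C_SMC` of pointed
`k`-linear categories. -/
abbrev GluedCat (R k : Type) [CommRing R] [CommRing k] [Algebra R k] :=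
  PsPullback (baseChange.{u} R k) (toPt.{u} k)

namespace GluedCat

variable {R k : Type} [CommRing R] [CommRing k] [Algebra R k]

/-- The functor underlying the gluing equivalence. -/
def glFunctor (X : GluedCat.{u} R k) : BaseChange R k X.fst.carrier ⥤ X.snd.carrier :=
  X.gl.functor

instance (X : GluedCat.{u} R k) : X.glFunctor.Additive := X.gl.additive

instance (X : GluedCat.{u} R k) : X.glFunctor.Linear k := X.gl.linear

instance (X : GluedCat.{u} R k) : X.glFunctor.IsEquivalence :=
  PtLin.isEquivalence_functor X.isEquivalence

/-- The functor underlying the gluing equivalence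
`(C ⊗ D) ⊗_R k ≃ (C ⊗_R k) ⊗ (D ⊗_R k) ≃ C_SMC ⊗ D_SMC` of a tensor product of triples. -/
def tensorGl (X Y : GluedCat.{u} R k) : BaseChange R k (LinTensor R X.fst.carrier Y.fst.carrier) ⥤
    LinTensor k X.snd.carrier Y.snd.carrier :=
  BaseChange.distrib R k X.fst.carrier Y.fst.carrier ⋙
    LinTensor.mapFunctor (R := k) X.glFunctor Y.glFunctor

section

variable (X Y : GluedCat.{u} R k)

instance : (tensorGl X Y).Additive := inferInstanceAs (_ ⋙ _).Additive

instance : (tensorGl X Y).Linear k := inferInstanceAs ((_ ⋙ _).Linear k)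

instance : (tensorGl X Y).IsEquivalence := inferInstanceAs (_ ⋙ _).IsEquivalence

end

/-- The gluing 1-cell of a tensor product of triples. -/
def tensorGlHom (X Y : GluedCat.{u} R k) :
    (baseChange R k).obj ((PtLin.tensor R).obj (X.fst, Y.fst)) ⟶
      (toPt k).obj ((SMLin.tensor k).obj (X.snd, Y.snd)) where
  functor := tensorGl X Y
  additive := inferInstanceAs (tensorGl X Y).Additive
  linear := inferInstanceAs ((tensorGl X Y).Linear k)
  ptIso := LinTensor.isoMk (R := k) (X := ⟨𝟙_ _, 𝟙_ _⟩)
    (Y := ⟨X.glFunctor.obj ⟨X.fst.pt⟩, Y.glFunctor.obj ⟨Y.fst.pt⟩⟩) X.gl.ptIso Y.gl.ptIso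

/-- The tensor product of two triples, formed componentwise. -/
def tensorObj (X Y : GluedCat.{u} R k) : GluedCat.{u} R k where
  fst := (PtLin.tensor R).obj (X.fst, Y.fst)
  snd := (SMLin.tensor k).obj (X.snd, Y.snd)
  gl := tensorGlHom X Y
  isEquivalence := by
    have : (tensorGlHom X Y).functor.IsEquivalence :=
      inferInstanceAs (tensorGl X Y).IsEquivalence
    exact PtLin.isEquivalence₁ _

/-- The natural isomorphism underlying the invertible 2-cell of a 1-cell between triples. -/
def isoFunctor {X Y : GluedCat.{u} R k} (F : X ⟶ Y) :
    BaseChange.mapFunctor (R := R) k F.fst.functor ⋙ Y.glFunctor ≅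
      X.glFunctor ⋙ F.snd.functor where
  hom := PtLin.Hom₂.nat F.iso.hom
  inv := PtLin.Hom₂.nat F.iso.inv
  hom_inv_id := congrArg PtLin.Hom₂.nat F.iso.hom_inv_id
  inv_hom_id := congrArg PtLin.Hom₂.nat F.iso.inv_hom_id

/-- The natural isomorphism filling the square of a tensor product of 1-cells; its components are
the tensor products of the components of the given ones. -/
def tensorIso {X Y X' Y' : GluedCat.{u} R k} (F : X ⟶ X') (G : Y ⟶ Y') :
    BaseChange.mapFunctor (R := R) k (LinTensor.mapFunctor (R := R) F.fst.functor G.fst.functor) ⋙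
      tensorGl X' Y' ≅
    tensorGl X Y ⋙ LinTensor.mapFunctor (R := k) F.snd.functor G.snd.functor :=
  BaseChange.natIsoMk₂ _ _
    (fun Z => LinTensor.isoMk (R := k)
      (X := ⟨X'.glFunctor.obj ⟨F.fst.functor.obj Z.of.fst⟩,
        Y'.glFunctor.obj ⟨G.fst.functor.obj Z.of.snd⟩⟩)
      (Y := ⟨F.snd.functor.obj (X.glFunctor.obj ⟨Z.of.fst⟩),
        G.snd.functor.obj (Y.glFunctor.obj ⟨Z.of.snd⟩)⟩)
      ((isoFunctor F).app ⟨Z.of.fst⟩) ((isoFunctor G).app ⟨Z.of.snd⟩))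
    (fun Z W s a b => LinTensor.tmul_congr (R := k)
      (X := ⟨X'.glFunctor.obj ⟨F.fst.functor.obj Z.of.fst⟩,
        Y'.glFunctor.obj ⟨G.fst.functor.obj Z.of.snd⟩⟩)
      (Y := ⟨F.snd.functor.obj (X.glFunctor.obj ⟨W.of.fst⟩),
        G.snd.functor.obj (Y.glFunctor.obj ⟨W.of.snd⟩)⟩)
      ((isoFunctor F).hom.naturality (X := ⟨Z.of.fst⟩) (Y := ⟨W.of.fst⟩) (BaseChange.tmul s a))
      ((isoFunctor G).hom.naturality (X := ⟨Z.of.snd⟩) (Y := ⟨W.of.snd⟩) (BaseChange.tmul 1 b)))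

/-- The tensor product of two 1-cells, formed componentwise. -/
def tensorMap {X Y X' Y' : GluedCat.{u} R k} (F : X ⟶ X') (G : Y ⟶ Y') :
    tensorObj X Y ⟶ tensorObj X' Y' where
  fst := (PtLin.tensor R).map (X := (X.fst, Y.fst)) (Y := (X'.fst, Y'.fst)) (F.fst, G.fst)
  snd := (SMLin.tensor k).map (X := (X.snd, Y.snd)) (Y := (X'.snd, Y'.snd)) (F.snd, G.snd)
  iso := PtLin.isoMk (tensorIso F G) (LinTensor.tmul_congr (R := k)
      (X := ⟨𝟙_ _, 𝟙_ _⟩)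
      (Y := ⟨F.snd.functor.obj (X.glFunctor.obj ⟨X.fst.pt⟩),
        G.snd.functor.obj (Y.glFunctor.obj ⟨Y.fst.pt⟩)⟩)
      F.iso.hom.pt G.iso.hom.pt)

/-- The tensor product of two 2-cells, formed componentwise. -/
def tensorMap₂ {X Y X' Y' : GluedCat.{u} R k} {F F' : X ⟶ X'} {G G' : Y ⟶ Y'} (α : F ⟶ F')
    (β : G ⟶ G') : tensorMap F G ⟶ tensorMap F' G' where
  fst := (PtLin.tensor R).map₂ (a := (X.fst, Y.fst)) (b := (X'.fst, Y'.fst))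
    (f := (F.fst, G.fst)) (g := (F'.fst, G'.fst)) (α.fst, β.fst)
  snd := (SMLin.tensor k).map₂ (a := (X.snd, Y.snd)) (b := (X'.snd, Y'.snd))
    (f := (F.snd, G.snd)) (g := (F'.snd, G'.snd)) (α.snd, β.snd)
  comm := PtLin.hom₂_ext fun Z => LinTensor.tmul_congr (R := k)
      (X := ⟨X'.glFunctor.obj ⟨F.fst.functor.obj Z.of.fst⟩,
        Y'.glFunctor.obj ⟨G.fst.functor.obj Z.of.snd⟩⟩)
      (Y := ⟨F'.snd.functor.obj (X.glFunctor.obj ⟨Z.of.fst⟩),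
        G'.snd.functor.obj (Y.glFunctor.obj ⟨Z.of.snd⟩)⟩)
      (congrArg (fun γ => (PtLin.Hom₂.nat (C := (baseChange R k).obj X.fst) γ).app ⟨Z.of.fst⟩) α.comm)
      (congrArg (fun γ => (PtLin.Hom₂.nat (C := (baseChange R k).obj Y.fst) γ).app ⟨Z.of.snd⟩) β.comm)

/-- Compatibility of a pair of 2-cells, in terms of components. -/
lemma comm_of_app {X Y : GluedCat.{u} R k} {F G : X ⟶ Y} (α : F.fst ⟶ G.fst) (β : F.snd ⟶ G.snd)
    (h : ∀ x : BaseChange R k X.fst.carrier,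
      Y.glFunctor.map ((BaseChange.mapNat (R := R) (S := k) (PtLin.Hom₂.nat α)).app x) ≫
        (isoFunctor G).hom.app x =
      (isoFunctor F).hom.app x ≫ (SMLin.Hom₂.nat β).app (X.glFunctor.obj x)) :
    (baseChange R k).map₂ α ▷ Y.gl ≫ G.iso.hom = F.iso.hom ≫ X.gl ◁ (toPt k).map₂ β :=
  PtLin.hom₂_ext h

lemma isoFunctor_id_app (X : GluedCat.{u} R k) (x : BaseChange R k X.fst.carrier) :
    (isoFunctor (𝟙 X)).hom.app x = 𝟙 (X.glFunctor.obj x) := by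
  refine (congrArg (· ≫ _) (X.glFunctor.map_id x)).trans ((Category.id_comp _).trans ?_)
  exact (Category.id_comp _).trans (Category.id_comp _)

lemma isoFunctor_comp_app {X Y Z : GluedCat.{u} R k} (F : X ⟶ Y) (G : Y ⟶ Z)
    (x : BaseChange R k X.fst.carrier) :
    (isoFunctor (F ≫ G)).hom.app x =
      (isoFunctor G).hom.app ⟨F.fst.functor.obj x.of⟩ ≫
        G.snd.functor.map ((isoFunctor F).hom.app x) := by
  refine (congrArg (· ≫ _) (Z.glFunctor.map_id
    ⟨G.fst.functor.obj (F.fst.functor.obj x.of)⟩)).trans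
      ((Category.id_comp _).trans ((Category.id_comp _).trans ?_))
  refine congrArg ((isoFunctor G).hom.app ⟨F.fst.functor.obj x.of⟩ ≫ ·) ?_
  refine (Category.id_comp _).trans ?_
  refine (congrArg (G.snd.functor.map ((isoFunctor F).hom.app x) ≫ ·) ?_).trans
    (Category.comp_id _)
  exact Category.id_comp _

variable (R k) in
/-- The tensor product of triples, as a pseudofunctor in two variables. -/
def tensor : GluedCat.{u} R k × GluedCat.{u} R k ⥤ᵖ GluedCat.{u} R k where
  obj X := tensorObj X.1 X.2
  map F := tensorMap F.1 F.2
  map₂ α := tensorMap₂ α.1 α.2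
  map₂_id F := PsPullback.hom₂_ext (PtLin.hom₂_ext fun X => rfl) (SMLin.hom₂_ext fun X => rfl)
  map₂_comp α β := PsPullback.hom₂_ext (PtLin.hom₂_ext fun X => rfl) (SMLin.hom₂_ext fun X => rfl)
  mapId X := PsPullback.isoMk ((PtLin.tensor R).mapId (X.1.fst, X.2.fst))
    ((SMLin.tensor k).mapId (X.1.snd, X.2.snd)) (comm_of_app _ _ fun x => by
      refine (congrArg₂ (· ≫ ·) ((tensorObj X.1 X.2).glFunctor.map_id x)
        (isoFunctor_id_app (tensorObj X.1 X.2) x)).trans ?_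
      refine congrArg (· ≫ 𝟙 ((tensorObj X.1 X.2).glFunctor.obj x)) ?_
      exact (LinTensor.tmul_congr (R := k)
        (X := ⟨X.1.glFunctor.obj ⟨x.of.fst⟩, X.2.glFunctor.obj ⟨x.of.snd⟩⟩)
        (Y := ⟨X.1.glFunctor.obj ⟨x.of.fst⟩, X.2.glFunctor.obj ⟨x.of.snd⟩⟩)
        (isoFunctor_id_app X.1 ⟨x.of.fst⟩) (isoFunctor_id_app X.2 ⟨x.of.snd⟩)).symm)
  mapComp {X Y Z} F G := PsPullback.isoMk
    ((PtLin.tensor R).mapComp (a := (X.1.fst, X.2.fst)) (b := (Y.1.fst, Y.2.fst))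
      (c := (Z.1.fst, Z.2.fst)) (F.1.fst, F.2.fst) (G.1.fst, G.2.fst))
    ((SMLin.tensor k).mapComp (a := (X.1.snd, X.2.snd)) (b := (Y.1.snd, Y.2.snd))
      (c := (Z.1.snd, Z.2.snd)) (F.1.snd, F.2.snd) (G.1.snd, G.2.snd)) (comm_of_app _ _ fun x => by
      refine (congrArg₂ (· ≫ ·) ((tensorObj Z.1 Z.2).glFunctor.map_id
        ⟨⟨G.1.fst.functor.obj (F.1.fst.functor.obj x.of.fst),
          G.2.fst.functor.obj (F.2.fst.functor.obj x.of.snd)⟩⟩)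
        (isoFunctor_comp_app (tensorMap F.1 F.2) (tensorMap G.1 G.2) x)).trans ?_
      refine (Category.id_comp _).trans (Eq.trans ?_ (Category.comp_id _).symm)
      exact (LinTensor.tmul_congr (R := k)
        (X := ⟨Z.1.glFunctor.obj ⟨G.1.fst.functor.obj (F.1.fst.functor.obj x.of.fst)⟩,
          Z.2.glFunctor.obj ⟨G.2.fst.functor.obj (F.2.fst.functor.obj x.of.snd)⟩⟩)
        (Y := ⟨G.1.snd.functor.obj (F.1.snd.functor.obj (X.1.glFunctor.obj ⟨x.of.fst⟩)),
          G.2.snd.functor.obj (F.2.snd.functor.obj (X.2.glFunctor.obj ⟨x.of.snd⟩))⟩)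
        (isoFunctor_comp_app F.1 G.1 ⟨x.of.fst⟩) (isoFunctor_comp_app F.2 G.2 ⟨x.of.snd⟩)).symm)
  map₂_whisker_left F G H η := PsPullback.hom₂_ext
    (PtLin.hom₂_ext fun X => ((Category.id_comp _).trans (Category.comp_id _)).symm)
    (SMLin.hom₂_ext fun X => ((Category.id_comp _).trans (Category.comp_id _)).symm)
  map₂_whisker_right η H := PsPullback.hom₂_ext
    (PtLin.hom₂_ext fun X => ((Category.id_comp _).trans (Category.comp_id _)).symm)
    (SMLin.hom₂_ext fun X => ((Category.id_comp _).trans (Category.comp_id _)).symm)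
  map₂_associator {X Y Z W} F G H := PsPullback.hom₂_ext
    ((PtLin.tensor R).map₂_associator (a := (X.1.fst, X.2.fst)) (b := (Y.1.fst, Y.2.fst))
      (c := (Z.1.fst, Z.2.fst)) (d := (W.1.fst, W.2.fst)) (F.1.fst, F.2.fst) (G.1.fst, G.2.fst)
      (H.1.fst, H.2.fst))
    ((SMLin.tensor k).map₂_associator (a := (X.1.snd, X.2.snd)) (b := (Y.1.snd, Y.2.snd))
      (c := (Z.1.snd, Z.2.snd)) (d := (W.1.snd, W.2.snd)) (F.1.snd, F.2.snd) (G.1.snd, G.2.snd)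
      (H.1.snd, H.2.snd))
  map₂_left_unitor {X Y} F := PsPullback.hom₂_ext
    ((PtLin.tensor R).map₂_left_unitor (a := (X.1.fst, X.2.fst)) (b := (Y.1.fst, Y.2.fst))
      (F.1.fst, F.2.fst))
    ((SMLin.tensor k).map₂_left_unitor (a := (X.1.snd, X.2.snd)) (b := (Y.1.snd, Y.2.snd))
      (F.1.snd, F.2.snd))
  map₂_right_unitor {X Y} F := PsPullback.hom₂_ext
    ((PtLin.tensor R).map₂_right_unitor (a := (X.1.fst, X.2.fst)) (b := (Y.1.fst, Y.2.fst))
      (F.1.fst, F.2.fst))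
    ((SMLin.tensor k).map₂_right_unitor (a := (X.1.snd, X.2.snd)) (b := (Y.1.snd, Y.2.snd))
      (F.1.snd, F.2.snd))

end GluedCat

end

/-! ### Almost-Poisson and Beilinson–Drinfeld categories -/

/-- `ℂ` as an algebra over `ℂ[ε]/(ε²)`, via `ε ↦ 0`. -/
instance : Algebra (DualNumber ℂ) ℂ := TrivSqZeroExt.algebraBase ℂ ℂ

/-- `ℂ` as an algebra over `ℂ⟦ħ⟧`, via `ħ ↦ 0`. -/
instance : Algebra (PowerSeries ℂ) ℂ := (PowerSeries.constantCoeff (R := ℂ)).toAlgebra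

/-- The 2-category of `aP₀`-categories: triples of a pointed `ℂ[ε]/(ε²)`-linear category, a
`ℂ`-linear symmetric monoidal category, and an equivalence of the reduction of the former at `ε = 0`
with the latter. -/
abbrev AP0Cat := GluedCat.{u} (DualNumber ℂ) ℂ

/-- The 2-category of `BD₀`-categories: triples of a pointed `ℂ⟦ħ⟧`-linear category, a `ℂ`-linear
symmetric monoidal category, and an equivalence of the reduction of the former at `ħ = 0` with the
latter. -/
abbrev BD0Cat := GluedCat.{u} (PowerSeries ℂ) ℂ

/-- The tensor product of `aP₀`-categories. -/
abbrev AP0Cat.tensor : AP0Cat.{u} × AP0Cat.{u} ⥤ᵖ AP0Cat.{u} := GluedCat.tensor (DualNumber ℂ) ℂ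

/-- The tensor product of `BD₀`-categories. -/
abbrev BD0Cat.tensor : BD0Cat.{u} × BD0Cat.{u} ⥤ᵖ BD0Cat.{u} := GluedCat.tensor (PowerSeries ℂ) ℂ

end

set_option linter.unusedSectionVars false

noncomputable section

section

/-! ### Diagrams of linear categories and their cocones -/

/-- A diagram of small `R`-linear categories indexed by a bicategory, i.e. a pseudofunctor to the
2-category of small `R`-linear categories, described in terms of components. -/
structure LinDiag (R : Type) [CommRing R] (E : Type u) [Bicategory.{u, u} E] where
  C : E → Type u
  [cat (e : E) : Category.{u} (C e)]
  [preadditive (e : E) : Preadditive (C e)]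
  [linear (e : E) : Linear R (C e)]
  map {e e' : E} (f : e ⟶ e') : C e ⥤ C e'
  [map_additive {e e' : E} (f : e ⟶ e') : (map f).Additive]
  [map_linear {e e' : E} (f : e ⟶ e') : (map f).Linear R]
  map₂ {e e' : E} {f g : e ⟶ e'} (η : f ⟶ g) : map f ⟶ map g
  mapId (e : E) : map (𝟙 e) ≅ 𝟭 (C e)
  mapComp {e e' e'' : E} (f : e ⟶ e') (g : e' ⟶ e'') : map (f ≫ g) ≅ map f ⋙ map g
  map₂_id {e e' : E} (f : e ⟶ e') (x : C e) : (map₂ (𝟙 f)).app x = 𝟙 _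
  map₂_comp {e e' : E} {f g h : e ⟶ e'} (η : f ⟶ g) (θ : g ⟶ h) (x : C e) :
    (map₂ (η ≫ θ)).app x = (map₂ η).app x ≫ (map₂ θ).app x
  whiskerLeft {e e' e'' : E} (f : e ⟶ e') {g h : e' ⟶ e''} (η : g ⟶ h) (x : C e) :
    (map₂ (f ◁ η)).app x ≫ (mapComp f h).hom.app x =
      (mapComp f g).hom.app x ≫ (map₂ η).app ((map f).obj x)
  whiskerRight {e e' e'' : E} {f g : e ⟶ e'} (η : f ⟶ g) (h : e' ⟶ e'') (x : C e) :
    (map₂ (η ▷ h)).app x ≫ (mapComp g h).hom.app x =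
      (mapComp f h).hom.app x ≫ (map h).map ((map₂ η).app x)
  associator {e₁ e₂ e₃ e₄ : E} (f : e₁ ⟶ e₂) (g : e₂ ⟶ e₃) (h : e₃ ⟶ e₄) (x : C e₁) :
    (map₂ (α_ f g h).hom).app x ≫ (mapComp f (g ≫ h)).hom.app x ≫
        (mapComp g h).hom.app ((map f).obj x) =
      (mapComp (f ≫ g) h).hom.app x ≫ (map h).map ((mapComp f g).hom.app x)
  leftUnitor {e e' : E} (f : e ⟶ e') (x : C e) :
    (map₂ (λ_ f).hom).app x = (mapComp (𝟙 e) f).hom.app x ≫ (map f).map ((mapId e).hom.app x)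
  rightUnitor {e e' : E} (f : e ⟶ e') (x : C e) :
    (map₂ (ρ_ f).hom).app x = (mapComp f (𝟙 e')).hom.app x ≫ (mapId e').hom.app ((map f).obj x)

attribute [instance] LinDiag.cat LinDiag.preadditive LinDiag.linear LinDiag.map_additive
  LinDiag.map_linear

section

variable {R : Type} [CommRing R] {E : Type u} [Bicategory.{u, u} E]

/-- A pseudo-cocone under a diagram of linear categories. -/
structure LinCocone (D : LinDiag.{u} R E) (T : Type u) [Category.{u} T] [Preadditive T]
    [Linear R T] where
  leg (e : E) : D.C e ⥤ T
  [leg_additive (e : E) : (leg e).Additive]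
  [leg_linear (e : E) : (leg e).Linear R]
  iso {e e' : E} (f : e ⟶ e') : D.map f ⋙ leg e' ≅ leg e
  map₂ {e e' : E} {f g : e ⟶ e'} (η : f ⟶ g) (x : D.C e) :
    (leg e').map ((D.map₂ η).app x) ≫ (iso g).hom.app x = (iso f).hom.app x
  id (e : E) (x : D.C e) : (iso (𝟙 e)).hom.app x = (leg e).map ((D.mapId e).hom.app x)
  comp {e e' e'' : E} (f : e ⟶ e') (g : e' ⟶ e'') (x : D.C e) :
    (iso (f ≫ g)).hom.app x = (leg e'').map ((D.mapComp f g).hom.app x) ≫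
      (iso g).hom.app ((D.map f).obj x) ≫ (iso f).hom.app x

attribute [instance] LinCocone.leg_additive LinCocone.leg_linear

namespace LinCocone

variable {D : LinDiag.{u} R E}
variable {L : Type u} [Category.{u} L] [Preadditive L] [Linear R L]
variable {T : Type u} [Category.{u} T] [Preadditive T] [Linear R T]

lemma iso_naturality (d : LinCocone D L) {e e' : E} (f : e ⟶ e') {x y : D.C e} (g : x ⟶ y) :
    (d.leg e').map ((D.map f).map g) ≫ (d.iso f).hom.app y =
      (d.iso f).hom.app x ≫ (d.leg e).map g :=
  (d.iso f).hom.naturality g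

/-- Whiskering a cocone with a linear functor. -/
@[simps, reducible] def whisker (d : LinCocone D L) (F : L ⥤ T) [F.Additive] [F.Linear R] :
    LinCocone D T where
  leg e := d.leg e ⋙ F
  iso f := Functor.isoWhiskerRight (d.iso f) F
  map₂ η x := by simp [← Functor.map_comp, d.map₂]
  id e x := by simp [d.id]
  comp f g x := by simp [d.comp]

/-- A family of natural isomorphisms from the whiskering of `d` with `F` to `t` is compatible with
the structure isomorphisms. -/
def Desc (d : LinCocone D L) (F : L ⥤ T) (t : LinCocone D T) (σ : ∀ e, d.leg e ⋙ F ≅ t.leg e) :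
    Prop :=
  ∀ ⦃e e' : E⦄ (f : e ⟶ e') (x : D.C e),
    (σ e').hom.app ((D.map f).obj x) ≫ (t.iso f).hom.app x =
      F.map ((d.iso f).hom.app x) ≫ (σ e).hom.app x

/-- A family of natural isomorphisms between two whiskerings of `d` is compatible with the structure
isomorphisms. -/
def Modif (d : LinCocone D L) (F G : L ⥤ T) (θ : ∀ e, d.leg e ⋙ F ≅ d.leg e ⋙ G) : Prop :=
  ∀ ⦃e e' : E⦄ (f : e ⟶ e') (x : D.C e),
    (θ e').hom.app ((D.map f).obj x) ≫ G.map ((d.iso f).hom.app x) =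
      F.map ((d.iso f).hom.app x) ≫ (θ e).hom.app x

/-- A cocone of linear categories is a bicolimit of its diagram in the (2,1)-category of small
linear categories; moreover its legs are jointly essentially surjective. -/
structure IsColim (d : LinCocone D L) : Prop where
  ess (X : L) : ∃ (e : E) (x : D.C e), Nonempty ((d.leg e).obj x ≅ X)
  desc (T : Type u) [Category.{u} T] [Preadditive T] [Linear R T] (t : LinCocone D T) :
    ∃ (F : L ⥤ T) (_ : F.Additive) (_ : F.Linear R) (σ : ∀ e, d.leg e ⋙ F ≅ t.leg e),
      d.Desc F t σ
  ext (T : Type u) [Category.{u} T] [Preadditive T] [Linear R T] (F G : L ⥤ T) [F.Additive]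
    [F.Linear R] [G.Additive] [G.Linear R]
    (θ : ∀ e, d.leg e ⋙ F ≅ d.leg e ⋙ G) (hθ : d.Modif F G θ) :
    ∃ α : F ≅ G, ∀ e x, α.hom.app ((d.leg e).obj x) = (θ e).hom.app x

lemma IsColim.hom_ext {d : LinCocone D L} (h : d.IsColim) {T : Type u} [Category.{u} T]
    {F G : L ⥤ T} {α β : F ⟶ G}
    (H : ∀ e x, α.app ((d.leg e).obj x) = β.app ((d.leg e).obj x)) : α = β := by
  ext X
  obtain ⟨e, x, ⟨i⟩⟩ := h.ess X
  rw [← cancel_epi (F.map i.hom), α.naturality, β.naturality, H]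

end LinCocone

lemma exists_iso_of_precomp {C C' T : Type u} [Category.{u} C] [Category.{u} C'] [Category.{u} T]
    (G : C ⥤ C') [G.IsEquivalence] {F₁ F₂ : C' ⥤ T} (α : G ⋙ F₁ ≅ G ⋙ F₂) :
    ∃ β : F₁ ≅ F₂, ∀ x, β.hom.app (G.obj x) = α.hom.app x := by
  refine ⟨((Functor.whiskeringLeft C C' T).obj G).preimageIso α, fun x => ?_⟩
  have := congrArg (fun γ => γ.app x)
    (((Functor.whiskeringLeft C C' T).obj G).map_preimage α.hom)
  exact this

lemma nat_ext_of_precomp {C C' T : Type u} [Category.{u} C] [Category.{u} C'] [Category.{u} T]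
    (G : C ⥤ C') [G.EssSurj] {F₁ F₂ : C' ⥤ T} {α β : F₁ ⟶ F₂}
    (h : ∀ x, α.app (G.obj x) = β.app (G.obj x)) : α = β := by
  ext X
  rw [← cancel_epi (F₁.map (G.objObjPreimageIso X).hom), α.naturality, β.naturality, h]

namespace LinCocone

variable {D D' : LinDiag.{u} R E}
variable {L : Type u} [Category.{u} L] [Preadditive L] [Linear R L]
variable {L' : Type u} [Category.{u} L'] [Preadditive L'] [Linear R L']

/-- Bicolimits are invariant under equivalences of vertices. -/
lemma IsColim.of_equivalence {d : LinCocone D L} (h : d.IsColim) (d' : LinCocone D L')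
    (G : L ⥤ L') [G.Additive] [G.Linear R] [G.IsEquivalence]
    (τ : ∀ e, d.leg e ⋙ G ≅ d'.leg e) (hτ : d.Desc G d' τ) : d'.IsColim := by
  have : G.asEquivalence.functor.Additive := inferInstanceAs G.Additive
  have : G.asEquivalence.functor.Linear R := inferInstanceAs (G.Linear R)
  have : G.inv.Additive := G.asEquivalence.inverse_additive
  have : G.inv.Linear R := G.asEquivalence.inverseLinear R
  refine ⟨fun X => ?_, fun T _ _ _ t => ?_, fun T _ _ _ F₁ F₂ _ _ _ _ θ hθ => ?_⟩
  · obtain ⟨e, x, ⟨i⟩⟩ := h.ess (G.objPreimage X)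
    exact ⟨e, x, ⟨((τ e).app x).symm ≪≫ G.mapIso i ≪≫ G.objObjPreimageIso X⟩⟩
  · obtain ⟨F, _, _, σ, hσ⟩ := h.desc T t
    let κ (X : L) : G.inv.obj (G.obj X) ≅ X := (G.asEquivalence.unitIso.app X).symm
    have hκ {X Y : L} (f : X ⟶ Y) : G.inv.map (G.map f) ≫ (κ Y).hom = (κ X).hom ≫ f :=
      G.asEquivalence.unitIso.inv.naturality f
    refine ⟨G.inv ⋙ F, inferInstance, inferInstance,
      fun e => NatIso.ofComponents (fun x => F.mapIso (G.inv.mapIso ((τ e).app x).symm ≪≫ κ _) ≪≫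
        (σ e).app x) (fun {x y} f => ?_), fun e e' f x => ?_⟩
    · have h₁ := (τ e).inv.naturality f
      have h₂ := (σ e).hom.naturality f
      dsimp at h₁ h₂ ⊢
      simp only [Category.assoc]
      rw [← h₂]
      simp only [← F.map_comp_assoc, Category.assoc, ← hκ]
      simp only [← G.inv.map_comp_assoc, h₁]
    · have h₁ := hτ f x
      have h₂ := hσ f x
      dsimp at h₁ h₂ ⊢
      simp only [Category.assoc]
      rw [h₂]
      simp only [← F.map_comp_assoc, Category.assoc, ← hκ]
      simp only [← G.inv.map_comp_assoc]
      congr 4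
      rw [← cancel_epi ((τ e').hom.app ((D.map f).obj x)), reassoc_of% h₁]
      simp
  · obtain ⟨α, hα⟩ := h.ext T (G ⋙ F₁) (G ⋙ F₂)
      (fun e => Functor.isoWhiskerRight (τ e) F₁ ≪≫ θ e ≪≫ Functor.isoWhiskerRight (τ e).symm F₂)
      (fun e e' f x => by
        have h₁ := hτ f x
        have h₂ := hθ f x
        dsimp at h₁ h₂ ⊢
        have h₃ : (τ e').inv.app ((D.map f).obj x) ≫ G.map ((d.iso f).hom.app x) =
            (d'.iso f).hom.app x ≫ (τ e).inv.app x := by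
          rw [← cancel_epi ((τ e').hom.app ((D.map f).obj x)), reassoc_of% h₁]
          simp
        simp only [Category.assoc, ← F₂.map_comp, h₃]
        rw [F₂.map_comp, reassoc_of% h₂]
        simp only [← F₁.map_comp_assoc, h₁])
    obtain ⟨β, hβ⟩ := exists_iso_of_precomp G α
    refine ⟨β, fun e x => ?_⟩
    have := β.hom.naturality ((τ e).hom.app x)
    rw [← cancel_epi (F₁.map ((τ e).hom.app x)), this]
    erw [hβ, hα]
    simp [← F₂.map_comp]

end LinCocone

/-- A pointwise equivalence of diagrams of linear categories. -/
structure LinDiag.Equiv (D D' : LinDiag.{u} R E) where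
  F (e : E) : D.C e ⥤ D'.C e
  [additive (e : E) : (F e).Additive]
  [linear (e : E) : (F e).Linear R]
  [isEquivalence (e : E) : (F e).IsEquivalence]
  iso {e e' : E} (f : e ⟶ e') : D.map f ⋙ F e' ≅ F e ⋙ D'.map f
  map₂ {e e' : E} {f g : e ⟶ e'} (η : f ⟶ g) (x : D.C e) :
    (F e').map ((D.map₂ η).app x) ≫ (iso g).hom.app x =
      (iso f).hom.app x ≫ (D'.map₂ η).app ((F e).obj x)
  id (e : E) (x : D.C e) : (iso (𝟙 e)).hom.app x ≫ (D'.mapId e).hom.app ((F e).obj x) =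
    (F e).map ((D.mapId e).hom.app x)
  comp {e e' e'' : E} (f : e ⟶ e') (g : e' ⟶ e'') (x : D.C e) :
    (iso (f ≫ g)).hom.app x ≫ (D'.mapComp f g).hom.app ((F e).obj x) =
      (F e'').map ((D.mapComp f g).hom.app x) ≫ (iso g).hom.app ((D.map f).obj x) ≫
        (D'.map g).map ((iso f).hom.app x)

attribute [instance] LinDiag.Equiv.additive LinDiag.Equiv.linear LinDiag.Equiv.isEquivalence

namespace LinCocone

variable {D D' : LinDiag.{u} R E}
variable {L : Type u} [Category.{u} L] [Preadditive L] [Linear R L]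

/-- The restriction of a cocone along an equivalence of diagrams. -/
@[simps, reducible] def pullback (Φ : LinDiag.Equiv D D') (d : LinCocone D' L) : LinCocone D L where
  leg e := Φ.F e ⋙ d.leg e
  iso {e e'} f := NatIso.ofComponents (fun x => (d.leg e').mapIso ((Φ.iso f).app x) ≪≫
    (d.iso f).app ((Φ.F e).obj x)) (fun {x y} g => by
      have h₁ := (Φ.iso f).hom.naturality g
      have h₂ := d.iso_naturality f ((Φ.F e).map g)
      dsimp at h₁ h₂ ⊢
      rw [← Functor.map_comp_assoc, h₁, Functor.map_comp_assoc, h₂, Category.assoc])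
  map₂ {e e' f g} η x := by
    have h₁ := Φ.map₂ η x
    have h₂ := d.map₂ η ((Φ.F e).obj x)
    dsimp at h₁ h₂ ⊢
    rw [← Functor.map_comp_assoc, h₁, Functor.map_comp_assoc, h₂]
  id e x := by
    have h₁ := Φ.id e x
    simp [d.id, ← h₁]
  comp {e e' e''} f g x := by
    have h₁ := Φ.comp f g x
    have h₂ := d.iso_naturality g ((Φ.iso f).hom.app x)
    dsimp at h₁ h₂ ⊢
    rw [d.comp, ← Functor.map_comp_assoc, h₁]
    simp [reassoc_of% h₂]

/-- Every cocone is a restriction along a given equivalence of diagrams. -/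
lemma exists_pullback_iso (Φ : LinDiag.Equiv D D') (t : LinCocone D L) :
    ∃ (t' : LinCocone D' L) (σ : ∀ e, Φ.F e ⋙ t'.leg e ≅ t.leg e),
      ∀ ⦃e e' : E⦄ (f : e ⟶ e') (x : D.C e),
        (σ e').hom.app ((D.map f).obj x) ≫ (t.iso f).hom.app x =
          ((t'.leg e').map ((Φ.iso f).hom.app x) ≫ (t'.iso f).hom.app ((Φ.F e).obj x)) ≫
            (σ e).hom.app x := by
  have (e : E) : (Φ.F e).asEquivalence.functor.Additive := inferInstanceAs (Φ.F e).Additive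
  have (e : E) : (Φ.F e).asEquivalence.functor.Linear R := inferInstanceAs ((Φ.F e).Linear R)
  have (e : E) : (Φ.F e).inv.Additive := (Φ.F e).asEquivalence.inverse_additive
  have (e : E) : (Φ.F e).inv.Linear R := (Φ.F e).asEquivalence.inverseLinear R
  let l (e : E) : D'.C e ⥤ L := (Φ.F e).inv ⋙ t.leg e
  let σ (e : E) : Φ.F e ⋙ l e ≅ t.leg e :=
    (Functor.associator _ _ _).symm ≪≫
      Functor.isoWhiskerRight (Φ.F e).asEquivalence.unitIso.symm (t.leg e) ≪≫
        Functor.leftUnitor _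
  have key (e e' : E) (f : e ⟶ e') := exists_iso_of_precomp (Φ.F e)
    (F₁ := D'.map f ⋙ l e') (F₂ := l e)
    (Functor.isoWhiskerRight (Φ.iso f).symm (l e') ≪≫ Functor.isoWhiskerLeft (D.map f) (σ e') ≪≫
      t.iso f ≪≫ (σ e).symm)
  choose iso' hiso using key
  let iso {e e' : E} (f : e ⟶ e') : D'.map f ⋙ l e' ≅ l e := iso' e e' f
  have hiso' {e e' : E} (f : e ⟶ e') (x : D.C e) : (iso f).hom.app ((Φ.F e).obj x) =
    (l e').map ((Φ.iso f).inv.app x) ≫ (σ e').hom.app ((D.map f).obj x) ≫ (t.iso f).hom.app x ≫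
      (σ e).inv.app x := hiso e e' f x
  have hσ {e : E} {x y : D.C e} (f : x ⟶ y) : (l e).map ((Φ.F e).map f) ≫ (σ e).hom.app y =
      (σ e).hom.app x ≫ (t.leg e).map f := (σ e).hom.naturality f
  refine ⟨{ leg := l, iso := iso, map₂ := ?_, id := ?_, comp := ?_ }, σ, ?_⟩
  · intro e e' f g η x
    have : Functor.whiskerRight (D'.map₂ η) (l e') ≫ (iso g).hom = (iso f).hom := by
      refine nat_ext_of_precomp (Φ.F e) fun x => ?_
      have h₁ := Φ.map₂ η x
      have h₂ : (D'.map₂ η).app ((Φ.F e).obj x) ≫ (Φ.iso g).inv.app x =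
        (Φ.iso f).inv.app x ≫ (Φ.F e').map ((D.map₂ η).app x) := by
        rw [← cancel_epi ((Φ.iso f).hom.app x), ← reassoc_of% h₁]
        simp
      simp only [NatTrans.comp_app, Functor.whiskerRight_app, hiso']
      rw [← Functor.map_comp_assoc, h₂, Functor.map_comp_assoc, reassoc_of% hσ,
        reassoc_of% (t.map₂ η x)]
    exact congrArg (fun γ => γ.app x) this
  · intro e x
    have : (iso (𝟙 e)).hom = Functor.whiskerRight (D'.mapId e).hom (l e) ≫
        (Functor.leftUnitor _).hom := by
      refine nat_ext_of_precomp (Φ.F e) fun x => ?_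
      have h₁ := Φ.id e x
      have h₂ : (D'.mapId e).hom.app ((Φ.F e).obj x) = (Φ.iso (𝟙 e)).inv.app x ≫
          (Φ.F e).map ((D.mapId e).hom.app x) := by
        rw [← h₁]; simp
      simp only [hiso', t.id, NatTrans.comp_app, Functor.whiskerRight_app, h₂,
        Functor.leftUnitor_hom_app, Functor.map_comp]
      rw [← reassoc_of% hσ]
      simp
    simpa using congrArg (fun γ => γ.app x) this
  · intro e e' e'' f g x
    have : (iso (f ≫ g)).hom = Functor.whiskerRight (D'.mapComp f g).hom (l e'') ≫
        (Functor.associator _ _ _).hom ≫ Functor.whiskerLeft (D'.map f) (iso g).hom ≫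
          (iso f).hom := by
      refine nat_ext_of_precomp (Φ.F e) fun x => ?_
      have h₁ := Φ.comp f g x
      have h₂ : (D'.mapComp f g).hom.app ((Φ.F e).obj x) ≫ (D'.map g).map ((Φ.iso f).inv.app x) ≫
          (Φ.iso g).inv.app ((D.map f).obj x) = (Φ.iso (f ≫ g)).inv.app x ≫
            (Φ.F e'').map ((D.mapComp f g).hom.app x) := by
        rw [← cancel_epi ((Φ.iso (f ≫ g)).hom.app x), reassoc_of% h₁, ← Functor.map_comp_assoc]
        simp
      have h₃ := (iso g).hom.naturality ((Φ.iso f).inv.app x)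
      dsimp at h₃
      simp only [NatTrans.comp_app, Functor.whiskerRight_app, Functor.whiskerLeft_app,
        Functor.associator_hom_app, Category.id_comp, hiso' f]
      rw [← reassoc_of% h₃, hiso' (f ≫ g), hiso' g, t.comp]
      simp only [Category.assoc, Iso.inv_hom_id_app_assoc]
      rw [← Functor.map_comp_assoc, ← Functor.map_comp_assoc, Category.assoc, h₂,
        Functor.map_comp_assoc]
      have h₄ := hσ ((D.mapComp f g).hom.app x)
      dsimp only [Functor.comp_obj] at h₄
      rw [reassoc_of% h₄]
    simpa using congrArg (fun γ => γ.app x) this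
  · intro e e' f x
    change _ = ((l e').map ((Φ.iso f).hom.app x) ≫ (iso f).hom.app ((Φ.F e).obj x)) ≫ _
    rw [hiso', ← Functor.map_comp_assoc]
    simp

/-- Restriction along an equivalence of diagrams preserves bicolimits. -/
lemma IsColim.pullback {d : LinCocone D' L} (h : d.IsColim) (Φ : LinDiag.Equiv D D') :
    (d.pullback Φ).IsColim := by
  refine ⟨fun X => ?_, fun T _ _ _ t => ?_, fun T _ _ _ F₁ F₂ _ _ _ _ θ hθ => ?_⟩
  · obtain ⟨e, x, ⟨i⟩⟩ := h.ess X
    exact ⟨e, (Φ.F e).objPreimage x, ⟨(d.leg e).mapIso ((Φ.F e).objObjPreimageIso x) ≪≫ i⟩⟩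
  · obtain ⟨t', τ, hτ⟩ := exists_pullback_iso Φ t
    obtain ⟨F, _, _, σ, hσ⟩ := h.desc T t'
    refine ⟨F, inferInstance, inferInstance, fun e =>
      Functor.associator _ _ _ ≪≫ Functor.isoWhiskerLeft (Φ.F e) (σ e) ≪≫ τ e,
      fun e e' f x => ?_⟩
    have h₁ := hτ f x
    have h₂ := hσ f ((Φ.F e).obj x)
    have h₃ := (σ e').hom.naturality ((Φ.iso f).hom.app x)
    dsimp at h₁ h₂ h₃ ⊢
    simp only [Category.id_comp, Category.assoc, h₁, Functor.map_comp]
    rw [← reassoc_of% h₂, reassoc_of% h₃]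
  · have key (e : E) := exists_iso_of_precomp (Φ.F e) (F₁ := d.leg e ⋙ F₁) (F₂ := d.leg e ⋙ F₂)
      (θ e)
    choose ψ hψ using key
    obtain ⟨α, hα⟩ := h.ext T F₁ F₂ ψ (fun e e' f x => by
      have : Functor.whiskerLeft (D'.map f) (ψ e').hom ≫ Functor.whiskerRight (d.iso f).hom F₂ =
          Functor.whiskerRight (d.iso f).hom F₁ ≫ (ψ e).hom := by
        refine nat_ext_of_precomp (Φ.F e) fun x => ?_
        have h₁ := hθ f x
        have h₂ := (ψ e').hom.naturality ((Φ.iso f).inv.app x)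
        rw [← hψ, ← hψ] at h₁
        dsimp at h₁ h₂ ⊢
        simp only [Functor.map_comp, Category.assoc] at h₁
        rw [← cancel_epi (F₁.map ((d.leg e').map ((Φ.iso f).hom.app x))), ← h₁]
        have h₃ := (ψ e').hom.naturality ((Φ.iso f).hom.app x)
        dsimp at h₃
        rw [← reassoc_of% h₃]
      exact congrArg (fun γ => γ.app x) this)
    exact ⟨α, fun e x => (hα e _).trans (hψ e x)⟩

/-- The comparison functor between two bicolimits of a diagram is an equivalence. -/
lemma IsColim.exists_equivalence {L' : Type u} [Category.{u} L'] [Preadditive L'] [Linear R L']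
    {d : LinCocone D L} {d' : LinCocone D L'} (h : d.IsColim) (h' : d'.IsColim) (F : L ⥤ L')
    [F.Additive] [F.Linear R] (σ : ∀ e, d.leg e ⋙ F ≅ d'.leg e) (hσ : d.Desc F d' σ) :
    F.IsEquivalence := by
  obtain ⟨G, _, _, τ, hτ⟩ := h'.desc L d
  obtain ⟨α, -⟩ := h.ext L (F ⋙ G) (𝟭 L)
    (fun e => Functor.isoWhiskerRight (σ e) G ≪≫ τ e) (fun e e' f x => by
      have h₁ := hσ f x
      have h₂ := hτ f x
      dsimp at h₁ h₂ ⊢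
      simp only [Category.assoc, h₂, ← Functor.map_comp_assoc, h₁])
  obtain ⟨β, -⟩ := h'.ext L' (G ⋙ F) (𝟭 L')
    (fun e => Functor.isoWhiskerRight (τ e) F ≪≫ σ e) (fun e e' f x => by
      have h₁ := hσ f x
      have h₂ := hτ f x
      dsimp at h₁ h₂ ⊢
      simp only [Category.assoc, h₁, ← Functor.map_comp_assoc, h₂])
  exact (CategoryTheory.Equivalence.mk F G α.symm β).isEquivalence_functor

end LinCocone

end

end

section

/-! ### Existence of bicolimits of linear categories -/

namespace LinDiag

section

variable {R : Type} [CommRing R] {E : Type u} [Bicategory.{u, u} E]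

/-- The objects of the bicolimit of a diagram of linear categories. -/
structure Colim (D : LinDiag.{u} R E) where
  idx : E
  pt : D.C idx

variable (D : LinDiag.{u} R E)

/-- Formal expressions for the morphisms of the bicolimit of a diagram of linear categories. -/
inductive Pre : D.Colim → D.Colim → Type u
  | id (X : D.Colim) : Pre X X
  | comp {X Y Z : D.Colim} (f : Pre X Y) (g : Pre Y Z) : Pre X Z
  | zero (X Y : D.Colim) : Pre X Y
  | add {X Y : D.Colim} (f g : Pre X Y) : Pre X Y
  | neg {X Y : D.Colim} (f : Pre X Y) : Pre X Y
  | smul {X Y : D.Colim} (r : R) (f : Pre X Y) : Pre X Y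
  | of {e : E} {x y : D.C e} (f : x ⟶ y) : Pre ⟨e, x⟩ ⟨e, y⟩
  | iso {e e' : E} (f : e ⟶ e') (x : D.C e) : Pre ⟨e', (D.map f).obj x⟩ ⟨e, x⟩
  | inv {e e' : E} (f : e ⟶ e') (x : D.C e) : Pre ⟨e, x⟩ ⟨e', (D.map f).obj x⟩

variable {D}

/-- The relations between formal expressions for morphisms. -/
inductive Rel : ∀ {X Y : D.Colim}, Pre D X Y → Pre D X Y → Prop
  | refl {X Y : D.Colim} (f : Pre D X Y) : Rel f f
  | symm {X Y : D.Colim} {f g : Pre D X Y} : Rel f g → Rel g f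
  | trans {X Y : D.Colim} {f g h : Pre D X Y} : Rel f g → Rel g h → Rel f h
  | comp {X Y Z : D.Colim} {f f' : Pre D X Y} {g g' : Pre D Y Z} :
      Rel f f' → Rel g g' → Rel (f.comp g) (f'.comp g')
  | add {X Y : D.Colim} {f f' g g' : Pre D X Y} : Rel f f' → Rel g g' → Rel (f.add g) (f'.add g')
  | neg {X Y : D.Colim} {f f' : Pre D X Y} : Rel f f' → Rel f.neg f'.neg
  | smul {X Y : D.Colim} (r : R) {f f' : Pre D X Y} : Rel f f' → Rel (f.smul r) (f'.smul r)
  | id_comp {X Y : D.Colim} (f : Pre D X Y) : Rel ((Pre.id X).comp f) f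
  | comp_id {X Y : D.Colim} (f : Pre D X Y) : Rel (f.comp (Pre.id Y)) f
  | assoc {X Y Z W : D.Colim} (f : Pre D X Y) (g : Pre D Y Z) (h : Pre D Z W) :
      Rel ((f.comp g).comp h) (f.comp (g.comp h))
  | add_assoc {X Y : D.Colim} (f g h : Pre D X Y) : Rel ((f.add g).add h) (f.add (g.add h))
  | add_comm {X Y : D.Colim} (f g : Pre D X Y) : Rel (f.add g) (g.add f)
  | zero_add {X Y : D.Colim} (f : Pre D X Y) : Rel ((Pre.zero X Y).add f) f
  | neg_add {X Y : D.Colim} (f : Pre D X Y) : Rel (f.neg.add f) (Pre.zero X Y)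
  | one_smul {X Y : D.Colim} (f : Pre D X Y) : Rel (f.smul 1) f
  | mul_smul {X Y : D.Colim} (r s : R) (f : Pre D X Y) : Rel (f.smul (r * s)) ((f.smul s).smul r)
  | smul_add {X Y : D.Colim} (r : R) (f g : Pre D X Y) :
      Rel ((f.add g).smul r) ((f.smul r).add (g.smul r))
  | add_smul {X Y : D.Colim} (r s : R) (f : Pre D X Y) :
      Rel (f.smul (r + s)) ((f.smul r).add (f.smul s))
  | add_comp {X Y Z : D.Colim} (f f' : Pre D X Y) (g : Pre D Y Z) :
      Rel ((f.add f').comp g) ((f.comp g).add (f'.comp g))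
  | comp_add {X Y Z : D.Colim} (f : Pre D X Y) (g g' : Pre D Y Z) :
      Rel (f.comp (g.add g')) ((f.comp g).add (f.comp g'))
  | smul_comp {X Y Z : D.Colim} (r : R) (f : Pre D X Y) (g : Pre D Y Z) :
      Rel ((f.smul r).comp g) ((f.comp g).smul r)
  | comp_smul {X Y Z : D.Colim} (r : R) (f : Pre D X Y) (g : Pre D Y Z) :
      Rel (f.comp (g.smul r)) ((f.comp g).smul r)
  | of_id {e : E} (x : D.C e) : Rel (Pre.of (𝟙 x)) (Pre.id ⟨e, x⟩)
  | of_comp {e : E} {x y z : D.C e} (f : x ⟶ y) (g : y ⟶ z) :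
      Rel (Pre.of (f ≫ g)) ((Pre.of f).comp (Pre.of g))
  | of_add {e : E} {x y : D.C e} (f g : x ⟶ y) : Rel (Pre.of (f + g)) ((Pre.of f).add (Pre.of g))
  | of_smul {e : E} {x y : D.C e} (r : R) (f : x ⟶ y) : Rel (Pre.of (r • f)) ((Pre.of f).smul r)
  | iso_inv {e e' : E} (f : e ⟶ e') (x : D.C e) :
      Rel ((Pre.iso f x).comp (Pre.inv f x)) (Pre.id _)
  | inv_iso {e e' : E} (f : e ⟶ e') (x : D.C e) :
      Rel ((Pre.inv f x).comp (Pre.iso f x)) (Pre.id _)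
  | naturality {e e' : E} (f : e ⟶ e') {x y : D.C e} (g : x ⟶ y) :
      Rel ((Pre.of ((D.map f).map g)).comp (Pre.iso f y)) ((Pre.iso f x).comp (Pre.of g))
  | map₂ {e e' : E} {f g : e ⟶ e'} (η : f ⟶ g) (x : D.C e) :
      Rel ((Pre.of ((D.map₂ η).app x)).comp (Pre.iso g x)) (Pre.iso f x)
  | iso_id {e : E} (x : D.C e) : Rel (Pre.iso (𝟙 e) x) (Pre.of ((D.mapId e).hom.app x))
  | iso_comp {e e' e'' : E} (f : e ⟶ e') (g : e' ⟶ e'') (x : D.C e) :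
      Rel (Pre.iso (f ≫ g) x) ((Pre.of ((D.mapComp f g).hom.app x)).comp
        ((Pre.iso g ((D.map f).obj x)).comp (Pre.iso f x)))

instance setoid (X Y : D.Colim) : Setoid (Pre D X Y) :=
  ⟨Rel, Rel.refl, Rel.symm, Rel.trans⟩

instance : Category.{u} D.Colim where
  Hom X Y := Quotient (setoid X Y)
  id X := ⟦Pre.id X⟧
  comp := Quotient.map₂ Pre.comp fun _ _ h _ _ h' => h.comp h'
  id_comp f := Quotient.inductionOn f fun f => Quotient.sound (Rel.id_comp f)
  comp_id f := Quotient.inductionOn f fun f => Quotient.sound (Rel.comp_id f)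
  assoc f g h := Quotient.inductionOn₃ f g h fun f g h => Quotient.sound (Rel.assoc f g h)

namespace Colim

/-- The morphism represented by a formal expression. -/
def homMk {X Y : D.Colim} (f : Pre D X Y) : X ⟶ Y := Quotient.mk (setoid X Y) f

lemma homMk_surjective {X Y : D.Colim} (f : X ⟶ Y) : ∃ f', homMk f' = f := Quotient.exists_rep f

lemma sound {X Y : D.Colim} {f g : Pre D X Y} (h : Rel f g) : homMk f = homMk g := Quotient.sound h

instance (X Y : D.Colim) : Add (X ⟶ Y) where
  add := Quotient.map₂ Pre.add fun _ _ h _ _ h' => h.add h'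

instance (X Y : D.Colim) : Zero (X ⟶ Y) where
  zero := homMk (Pre.zero X Y)

instance (X Y : D.Colim) : Neg (X ⟶ Y) where
  neg := Quotient.map Pre.neg fun _ _ h => h.neg

instance (X Y : D.Colim) : AddCommGroup (X ⟶ Y) where
  add_assoc f g h := Quotient.inductionOn₃ f g h fun f g h => Quotient.sound (Rel.add_assoc f g h)
  zero_add f := Quotient.inductionOn f fun f => Quotient.sound (Rel.zero_add f)
  add_zero f := Quotient.inductionOn f fun f =>
    Quotient.sound ((Rel.add_comm _ _).trans (Rel.zero_add f))
  neg_add_cancel f := Quotient.inductionOn f fun f => Quotient.sound (Rel.neg_add f)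
  add_comm f g := Quotient.inductionOn₂ f g fun f g => Quotient.sound (Rel.add_comm f g)
  nsmul := nsmulRec
  zsmul := zsmulRec

instance : Preadditive D.Colim where
  homGroup := inferInstance
  add_comp _ _ _ f g h := Quotient.inductionOn₃ f g h fun f g h =>
    Quotient.sound (Rel.add_comp f g h)
  comp_add _ _ _ f g h := Quotient.inductionOn₃ f g h fun f g h =>
    Quotient.sound (Rel.comp_add f g h)

instance (X Y : D.Colim) : SMul R (X ⟶ Y) where
  smul r := Quotient.map (Pre.smul r) fun _ _ h => h.smul r

instance (X Y : D.Colim) : Module R (X ⟶ Y) :=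
  Module.ofMinimalAxioms
    (fun r f g => Quotient.inductionOn₂ f g fun f g => Quotient.sound (Rel.smul_add r f g))
    (fun r s f => Quotient.inductionOn f fun f => Quotient.sound (Rel.add_smul r s f))
    (fun r s f => Quotient.inductionOn f fun f => Quotient.sound (Rel.mul_smul r s f))
    (fun f => Quotient.inductionOn f fun f => Quotient.sound (Rel.one_smul f))

instance : Linear R D.Colim where
  homModule := inferInstance
  smul_comp _ _ _ r f g := Quotient.inductionOn₂ f g fun f g => Quotient.sound (Rel.smul_comp r f g)
  comp_smul _ _ _ f r g := Quotient.inductionOn₂ f g fun f g => Quotient.sound (Rel.comp_smul r f g)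

/-- The structure isomorphisms of the bicolimit. -/
def isoApp {e e' : E} (f : e ⟶ e') (x : D.C e) :
    (⟨e', (D.map f).obj x⟩ : D.Colim) ≅ ⟨e, x⟩ where
  hom := homMk (Pre.iso f x)
  inv := homMk (Pre.inv f x)
  hom_inv_id := sound (Rel.iso_inv f x)
  inv_hom_id := sound (Rel.inv_iso f x)

variable (D) in
/-- The universal cocone. -/
def cocone : LinCocone D D.Colim where
  leg e :=
    { obj := fun x => ⟨e, x⟩
      map := fun f => homMk (Pre.of f)
      map_id := fun x => sound (Rel.of_id x)
      map_comp := fun f g => sound (Rel.of_comp f g) }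
  leg_additive e := { map_add := sound (Rel.of_add _ _) }
  leg_linear e := { map_smul := fun f r => sound (Rel.of_smul r f) }
  iso f := NatIso.ofComponents (fun x => isoApp f x) (fun g => sound (Rel.naturality f g))
  map₂ η x := sound (Rel.map₂ η x)
  id e x := sound (Rel.iso_id x)
  comp f g x := sound (Rel.iso_comp f g x)

variable {T : Type u} [Category.{u} T] [Preadditive T] [Linear R T] (t : LinCocone D T)

/-- The value on formal expressions of the functor induced by a cocone. -/
def liftPre : ∀ {X Y : D.Colim} (_ : Pre D X Y),
    (t.leg X.idx).obj X.pt ⟶ (t.leg Y.idx).obj Y.pt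
  | _, _, Pre.id X => 𝟙 _
  | _, _, Pre.comp f g => liftPre f ≫ liftPre g
  | _, _, Pre.zero _ _ => 0
  | _, _, Pre.add f g => liftPre f + liftPre g
  | _, _, Pre.neg f => - liftPre f
  | _, _, Pre.smul r f => r • liftPre f
  | _, _, Pre.of f => (t.leg _).map f
  | _, _, Pre.iso f x => (t.iso f).hom.app x
  | _, _, Pre.inv f x => (t.iso f).inv.app x

lemma liftPre_rel {X Y : D.Colim} {f g : Pre D X Y} (h : Rel f g) : liftPre t f = liftPre t g := by
  induction h with
  | refl f => rfl
  | symm _ h => exact h.symm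
  | trans _ _ h h' => exact h.trans h'
  | comp _ _ h h' => simp only [liftPre, h, h']
  | add _ _ h h' => simp only [liftPre, h, h']
  | neg _ h => simp only [liftPre, h]
  | smul _ _ h => simp only [liftPre, h]
  | id_comp f => simp only [liftPre, Category.id_comp]
  | comp_id f => simp only [liftPre, Category.comp_id]
  | assoc f g h => simp only [liftPre, Category.assoc]
  | add_assoc f g h => simp only [liftPre, add_assoc]
  | add_comm f g => simp only [liftPre, add_comm]
  | zero_add f => simp only [liftPre, zero_add]
  | neg_add f => simp only [liftPre, neg_add_cancel]
  | one_smul f => simp only [liftPre, one_smul]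
  | mul_smul r s f => simp only [liftPre, mul_smul]
  | smul_add r f g => simp only [liftPre, smul_add]
  | add_smul r s f => simp only [liftPre, add_smul]
  | add_comp f f' g => simp only [liftPre, Preadditive.add_comp]
  | comp_add f g g' => simp only [liftPre, Preadditive.comp_add]
  | smul_comp r f g => simp only [liftPre, Linear.smul_comp]
  | comp_smul r f g => simp only [liftPre, Linear.comp_smul]
  | of_id x => exact (t.leg _).map_id x
  | of_comp f g => simp only [liftPre, Functor.map_comp]
  | of_add f g => simp only [liftPre, Functor.map_add]
  | of_smul r f => simp only [liftPre, Functor.map_smul]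
  | iso_inv f x => exact (t.iso f).hom_inv_id_app x
  | inv_iso f x => exact (t.iso f).inv_hom_id_app x
  | naturality f g => exact t.iso_naturality f g
  | map₂ η x => exact t.map₂ η x
  | iso_id x => exact t.id _ x
  | iso_comp f g x => exact t.comp f g x

/-- The functor induced by a cocone. -/
def lift : D.Colim ⥤ T where
  obj X := (t.leg X.idx).obj X.pt
  map f := Quotient.lift (liftPre t) (fun _ _ h => liftPre_rel t h) f
  map_id X := rfl
  map_comp f g := Quotient.inductionOn₂ f g fun f g => rfl

instance : (lift t).Additive where
  map_add {_ _ f g} := Quotient.inductionOn₂ f g fun f g => rfl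

instance : (lift t).Linear R where
  map_smul f r := Quotient.inductionOn f fun f => rfl

lemma naturality_of_generators {F G : D.Colim ⥤ T} [F.Additive] [F.Linear R] [G.Additive]
    [G.Linear R] (α : ∀ X, F.obj X ≅ G.obj X)
    (h₁ : ∀ (e : E) (x y : D.C e) (f : x ⟶ y),
      F.map (homMk (Pre.of f)) ≫ (α _).hom = (α _).hom ≫ G.map (homMk (Pre.of f)))
    (h₂ : ∀ (e e' : E) (f : e ⟶ e') (x : D.C e),
      F.map (homMk (Pre.iso f x)) ≫ (α _).hom = (α _).hom ≫ G.map (homMk (Pre.iso f x)))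
    {X Y : D.Colim} (f : X ⟶ Y) : F.map f ≫ (α Y).hom = (α X).hom ≫ G.map f := by
  obtain ⟨f, rfl⟩ := homMk_surjective f
  induction f with
  | id X =>
    have : homMk (Pre.id X) = 𝟙 X := rfl
    simp [this]
  | comp f g hf hg =>
    have : homMk (Pre.comp f g) = homMk f ≫ homMk g := rfl
    simp [this, hg, reassoc_of% hf]
  | zero X Y =>
    have : homMk (Pre.zero X Y) = 0 := rfl
    simp [this]
  | add f g hf hg =>
    have : homMk (Pre.add f g) = homMk f + homMk g := rfl
    simp [this, hf, hg]
  | neg f hf =>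
    have : homMk (Pre.neg f) = - homMk f := rfl
    simp [this, hf]
  | smul r f hf =>
    have : homMk (Pre.smul r f) = r • homMk f := rfl
    simp [this, hf, Functor.map_smul]
  | of f => exact h₁ _ _ _ f
  | iso f x => exact h₂ _ _ f x
  | inv f x =>
    have h := h₂ _ _ f x
    change F.map (isoApp f x).hom ≫ _ = _ ≫ G.map (isoApp f x).hom at h
    change F.map (isoApp f x).inv ≫ _ = _ ≫ G.map (isoApp f x).inv
    rw [← cancel_epi (F.map (isoApp f x).hom), ← Functor.map_comp_assoc, reassoc_of% h,
      ← Functor.map_comp]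
    simp

lemma isColim_cocone : (cocone D).IsColim := by
  refine ⟨fun X => ⟨X.idx, X.pt, ⟨Iso.refl _⟩⟩, fun T _ _ _ t => ?_,
    fun T _ _ _ F G _ _ _ _ θ hθ => ?_⟩
  · refine ⟨lift t, inferInstance, inferInstance, fun e =>
      NatIso.ofComponents (fun x => Iso.refl _) (fun f => ?_), fun e e' f x => ?_⟩
    · exact (Category.comp_id _).trans (Category.id_comp _).symm
    · exact (Category.id_comp _).trans (Category.comp_id _).symm
  · exact ⟨NatIso.ofComponents (fun X => (θ X.idx).app X.pt)
      (naturality_of_generators (F := F) (G := G) (fun X => (θ X.idx).app X.pt)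
        (fun e x y f => (θ e).hom.naturality f)
        (fun e e' f x => (hθ f x).symm)), fun e x => rfl⟩

end Colim

end

end LinDiag

end

section

/-! ### Functors out of tensor products -/

/-- The category of `R`-linear functors. -/
abbrev LinFun (R : Type) [CommRing R] (C D : Type u) [Category.{u} C] [Preadditive C] [Linear R C]
    [Category.{u} D] [Preadditive D] [Linear R D] : Type u :=
  ObjectProperty.FullSubcategory (fun F : C ⥤ D => ∃ _ : F.Additive, F.Linear R)

section

variable {R : Type} [CommRing R]
variable {C D T : Type u} [Category.{u} C] [Preadditive C] [Linear R C]
  [Category.{u} D] [Preadditive D] [Linear R D] [Category.{u} T] [Preadditive T] [Linear R T]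

instance (F : LinFun R C D) : F.obj.Additive := F.property.1

instance (F : LinFun R C D) : F.obj.Linear R := F.property.2

namespace LinTensor

lemma zero_tmul {X Y : LinTensor R C D} (b : X.snd ⟶ Y.snd) : (tmul 0 b : X ⟶ Y) = 0 :=
  TensorProduct.zero_tmul _ b

lemma tmul_zero {X Y : LinTensor R C D} (a : X.fst ⟶ Y.fst) : (tmul a 0 : X ⟶ Y) = 0 :=
  TensorProduct.tmul_zero _ a

lemma add_tmul {X Y : LinTensor R C D} (a a' : X.fst ⟶ Y.fst) (b : X.snd ⟶ Y.snd) :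
    (tmul (a + a') b : X ⟶ Y) = tmul a b + tmul a' b :=
  TensorProduct.add_tmul a a' b

lemma tmul_add {X Y : LinTensor R C D} (a : X.fst ⟶ Y.fst) (b b' : X.snd ⟶ Y.snd) :
    (tmul a (b + b') : X ⟶ Y) = tmul a b + tmul a b' :=
  TensorProduct.tmul_add a b b'

lemma smul_tmul' {X Y : LinTensor R C D} (r : R) (a : X.fst ⟶ Y.fst) (b : X.snd ⟶ Y.snd) :
    (tmul (r • a) b : X ⟶ Y) = r • tmul a b :=
  (TensorProduct.smul_tmul' r a b).symm

lemma tmul_smul {X Y : LinTensor R C D} (r : R) (a : X.fst ⟶ Y.fst) (b : X.snd ⟶ Y.snd) :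
    (tmul a (r • b) : X ⟶ Y) = r • tmul a b :=
  TensorProduct.tmul_smul r a b

/-- A functor out of a tensor product, from its values on pure tensors. -/
@[simps obj] def mkFunctor (obj : LinTensor R C D → T)
    (map : ∀ X Y : LinTensor R C D,
      (X.fst ⟶ Y.fst) →ₗ[R] (X.snd ⟶ Y.snd) →ₗ[R] (obj X ⟶ obj Y))
    (map_id : ∀ X, map X X (𝟙 _) (𝟙 _) = 𝟙 _)
    (map_comp : ∀ (X Y Z : LinTensor R C D) (a : X.fst ⟶ Y.fst) (b : X.snd ⟶ Y.snd)
      (a' : Y.fst ⟶ Z.fst) (b' : Y.snd ⟶ Z.snd),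
      map X Z (a ≫ a') (b ≫ b') = map X Y a b ≫ map Y Z a' b') : LinTensor R C D ⥤ T where
  obj := obj
  map {X Y} f := TensorProduct.lift (map X Y) f
  map_id := map_id
  map_comp {X Y Z} f g := by
    induction f using hom_induction with
    | h0 =>
      rw [Limits.zero_comp]
      exact (map_zero _).trans (Limits.zero_comp.symm.trans
        (congrArg (· ≫ _) (map_zero (TensorProduct.lift (map X Y))).symm))
    | ha a b ha hb =>
      rw [Preadditive.add_comp]
      refine (map_add (TensorProduct.lift (map X Z)) _ _).trans ?_
      rw [ha, hb, ← Preadditive.add_comp]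
      exact congrArg (· ≫ _) (map_add (TensorProduct.lift (map X Y)) _ _).symm
    | ht a b =>
      induction g using hom_induction with
      | h0 =>
        rw [Limits.comp_zero]
        exact (map_zero _).trans (Limits.comp_zero.symm.trans
          (congrArg (_ ≫ ·) (map_zero (TensorProduct.lift (map Y Z))).symm))
      | ha a b ha hb =>
        rw [Preadditive.comp_add]
        refine (map_add (TensorProduct.lift (map X Z)) _ _).trans ?_
        rw [ha, hb, ← Preadditive.comp_add]
        exact congrArg (_ ≫ ·) (map_add (TensorProduct.lift (map Y Z)) _ _).symm
      | ht c d => exact map_comp X Y Z a b c d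

section

variable (obj : LinTensor R C D → T)
    (map : ∀ X Y : LinTensor R C D,
      (X.fst ⟶ Y.fst) →ₗ[R] (X.snd ⟶ Y.snd) →ₗ[R] (obj X ⟶ obj Y))
    (map_id : ∀ X, map X X (𝟙 _) (𝟙 _) = 𝟙 _)
    (map_comp : ∀ (X Y Z : LinTensor R C D) (a : X.fst ⟶ Y.fst) (b : X.snd ⟶ Y.snd)
      (a' : Y.fst ⟶ Z.fst) (b' : Y.snd ⟶ Z.snd),
      map X Z (a ≫ a') (b ≫ b') = map X Y a b ≫ map Y Z a' b')

@[simp] lemma mkFunctor_map_tmul {X Y : LinTensor R C D} (a : X.fst ⟶ Y.fst) (b : X.snd ⟶ Y.snd) :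
    (mkFunctor obj map map_id map_comp).map (tmul a b : X ⟶ Y) = map X Y a b := rfl

instance : (mkFunctor obj map map_id map_comp).Additive where
  map_add := map_add (TensorProduct.lift (map _ _)) _ _

instance : (mkFunctor obj map map_id map_comp).Linear R where
  map_smul f r := map_smul (TensorProduct.lift (map _ _)) r f

end

/-- The functor out of a tensor product corresponding to a functor to a category of functors. -/
def uncurry (F : D ⥤ LinFun R C T) [F.Additive] [F.Linear R] : LinTensor R C D ⥤ T :=
  mkFunctor (fun X => (F.obj X.snd).obj.obj X.fst)
    (fun X Y => LinearMap.mk₂ R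
      (fun a b => (F.map b).hom.app X.fst ≫ (F.obj Y.snd).obj.map a)
      (fun a a' b => by simp) (fun r a b => by simp [Functor.map_smul])
      (fun a b b' => by
        rw [F.map_add]
        exact Preadditive.add_comp _ _ _ _ _ _)
      (fun r a b => by
        rw [F.map_smul]
        exact Linear.smul_comp _ _ _ _ _ _))
    (fun X => by simp)
    (fun X Y Z a b a' b' => by simp)

instance (F : D ⥤ LinFun R C T) [F.Additive] [F.Linear R] : (uncurry F).Additive :=
  inferInstanceAs (mkFunctor _ _ _ _).Additive

instance (F : D ⥤ LinFun R C T) [F.Additive] [F.Linear R] : (uncurry F).Linear R :=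
  inferInstanceAs ((mkFunctor _ _ _ _).Linear R)

@[simp] lemma uncurry_obj (F : D ⥤ LinFun R C T) [F.Additive] [F.Linear R] (X : LinTensor R C D) :
    (uncurry F).obj X = (F.obj X.snd).obj.obj X.fst := rfl

@[simp] lemma uncurry_map_tmul (F : D ⥤ LinFun R C T) [F.Additive] [F.Linear R]
    {X Y : LinTensor R C D} (a : X.fst ⟶ Y.fst) (b : X.snd ⟶ Y.snd) :
    (uncurry F).map (tmul a b : X ⟶ Y) = (F.map b).hom.app X.fst ≫ (F.obj Y.snd).obj.map a := rfl

/-- Fixing the second argument of a functor on a tensor product. -/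
@[simps, reducible] def fixSnd (G : LinTensor R C D ⥤ T) (d : D) : C ⥤ T where
  obj c := G.obj ⟨c, d⟩
  map a := G.map (tmul (X := ⟨_, d⟩) (Y := ⟨_, d⟩) a (𝟙 d))
  map_id c := G.map_id ⟨c, d⟩
  map_comp {c c' c''} a a' := by
    rw [← G.map_comp]
    exact congrArg (fun b => G.map (tmul (X := ⟨c, d⟩) (Y := ⟨c'', d⟩) (a ≫ a') b))
      (Category.id_comp (𝟙 d)).symm

instance (G : LinTensor R C D ⥤ T) [G.Additive] (d : D) : (fixSnd G d).Additive where
  map_add {c c' a a'} := by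
    rw [fixSnd_map, add_tmul, G.map_add]

instance (G : LinTensor R C D ⥤ T) [G.Additive] [G.Linear R] (d : D) : (fixSnd G d).Linear R where
  map_smul {c c'} a r := by
    rw [fixSnd_map, smul_tmul', G.map_smul]

/-- The functor to a category of functors corresponding to a functor out of a tensor product. -/
@[simps] def curry (G : LinTensor R C D ⥤ T) [G.Additive] [G.Linear R] : D ⥤ LinFun R C T where
  obj d := ⟨fixSnd G d, inferInstance, inferInstance⟩
  map {d d'} b := ObjectProperty.homMk
    { app := fun c => G.map (tmul (X := ⟨c, d⟩) (Y := ⟨c, d'⟩) (𝟙 c) b)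
      naturality := fun c c' a => by
        change G.map _ ≫ G.map _ = G.map _ ≫ G.map _
        rw [← G.map_comp, ← G.map_comp, tmul_comp, tmul_comp]
        simp }
  map_id d := by
    ext c
    exact G.map_id ⟨c, d⟩
  map_comp {d d' d''} b b' := by
    ext c
    refine Eq.trans ?_ (G.map_comp _ _)
    exact congrArg (fun a => G.map (tmul (X := ⟨c, d⟩) (Y := ⟨c, d''⟩) a (b ≫ b')))
      (Category.id_comp (𝟙 c)).symm

instance (G : LinTensor R C D ⥤ T) [G.Additive] [G.Linear R] : (curry G).Additive where
  map_add {d d' a a'} := by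
    ext c
    change G.map _ = G.map _ + G.map _
    rw [tmul_add, G.map_add]
    rfl

instance (G : LinTensor R C D ⥤ T) [G.Additive] [G.Linear R] : (curry G).Linear R where
  map_smul {d d'} a r := by
    ext c
    change G.map _ = r • G.map _
    rw [tmul_smul, G.map_smul]

lemma map_tmul_eq (G : LinTensor R C D ⥤ T) {X Y : LinTensor R C D} (a : X.fst ⟶ Y.fst)
    (b : X.snd ⟶ Y.snd) : G.map (tmul a b : X ⟶ Y) =
      G.map (tmul (X := X) (Y := ⟨X.fst, Y.snd⟩) (𝟙 _) b) ≫
        G.map (tmul (X := ⟨X.fst, Y.snd⟩) (Y := Y) a (𝟙 _)) := by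
  rw [← G.map_comp, tmul_comp]
  simp

/-- Exchanging the factors of a tensor product. -/
@[simps obj] def swap (R : Type) [CommRing R] (C D : Type u) [Category.{u} C] [Preadditive C]
    [Linear R C] [Category.{u} D] [Preadditive D] [Linear R D] :
    LinTensor R C D ⥤ LinTensor R D C where
  obj X := ⟨X.snd, X.fst⟩
  map {X Y} f := TensorProduct.comm R (X.fst ⟶ Y.fst) (X.snd ⟶ Y.snd) f
  map_id X := rfl
  map_comp {X Y Z} f g := by
    induction f using hom_induction with
    | h0 =>
      rw [Limits.zero_comp]
      exact (map_zero _).trans (Limits.zero_comp.symm.trans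
        (congrArg (· ≫ _) (map_zero (TensorProduct.comm R _ _)).symm))
    | ha a b ha hb =>
      rw [Preadditive.add_comp]
      refine (map_add (TensorProduct.comm R _ _) _ _).trans ?_
      rw [ha, hb, ← Preadditive.add_comp]
      exact congrArg (· ≫ _) (map_add (TensorProduct.comm R _ _) _ _).symm
    | ht a b =>
      induction g using hom_induction with
      | h0 =>
        rw [Limits.comp_zero]
        exact (map_zero _).trans (Limits.comp_zero.symm.trans
          (congrArg (_ ≫ ·) (map_zero (TensorProduct.comm R _ _)).symm))
      | ha a b ha hb =>
        rw [Preadditive.comp_add]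
        refine (map_add (TensorProduct.comm R _ _) _ _).trans ?_
        rw [ha, hb, ← Preadditive.comp_add]
        exact congrArg (_ ≫ ·) (map_add (TensorProduct.comm R _ _) _ _).symm
      | ht c d => rfl

instance : (swap R C D).Additive where
  map_add := map_add (TensorProduct.comm R _ _) _ _

instance : (swap R C D).Linear R where
  map_smul f r := map_smul (TensorProduct.comm R _ _) r f

instance : (swap R C D).IsEquivalence where
  faithful := ⟨fun {X Y} _ _ h =>
    (TensorProduct.comm R (X.fst ⟶ Y.fst) (X.snd ⟶ Y.snd)).injective h⟩
  full := ⟨fun {X Y} f => (TensorProduct.comm R (X.fst ⟶ Y.fst) (X.snd ⟶ Y.snd)).surjective f⟩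
  essSurj := ⟨fun Y => ⟨⟨Y.snd, Y.fst⟩, ⟨Iso.refl _⟩⟩⟩

end LinTensor

end

end

section

/-! ### Tensor products of diagrams -/

section

variable {R : Type} [CommRing R] {E : Type u} [Bicategory.{u, u} E]

lemma comp_square {C : Type*} [Category* C] {X Y Z X' Y' Z' : C} {f : X ⟶ Y} {g : Y ⟶ Z}
    {f' : X' ⟶ Y'} {g' : Y' ⟶ Z'} {a : X ⟶ X'} {b : Y ⟶ Y'} {c : Z ⟶ Z'} (h₁ : f ≫ b = a ≫ f')
    (h₂ : g ≫ c = b ≫ g') : (f ≫ g) ≫ c = a ≫ f' ≫ g' := by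
  rw [Category.assoc, h₂, reassoc_of% h₁]

/-- The constant diagram at a linear category. -/
@[simps C map map₂ mapId mapComp, reducible]
def LinDiag.const (R : Type) [CommRing R] (E : Type u) [Bicategory.{u, u} E] (Y : Type u)
    [Category.{u} Y] [Preadditive Y] [Linear R Y] : LinDiag.{u} R E where
  C _ := Y
  map _ := 𝟭 Y
  map₂ _ := 𝟙 _
  mapId _ := Iso.refl _
  mapComp _ _ := (Functor.leftUnitor _).symm
  map₂_id _ _ := rfl
  map₂_comp _ _ _ := by simp
  whiskerLeft _ _ _ _ _ := by simp
  whiskerRight _ _ _ := by simp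
  associator _ _ _ _ := by simp
  leftUnitor _ _ := by simp
  rightUnitor _ _ := by simp

/-- The cocone under a constant diagram with identity legs. -/
@[simps leg iso, reducible]
def LinCocone.const (R : Type) [CommRing R] (E : Type u) [Bicategory.{u, u} E] (Y : Type u)
    [Category.{u} Y] [Preadditive Y] [Linear R Y] : LinCocone (LinDiag.const R E Y) Y where
  leg _ := 𝟭 Y
  leg_additive _ := inferInstanceAs (𝟭 Y).Additive
  leg_linear _ := inferInstanceAs ((𝟭 Y).Linear R)
  iso _ := Functor.leftUnitor _
  map₂ _ _ := by simp
  id _ _ := by simp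
  comp _ _ _ := by simp

/-- The tensor product of two diagrams, formed pointwise. -/
@[simps C map map₂ mapId mapComp, reducible]
def LinDiag.tensor (D D' : LinDiag.{u} R E) : LinDiag.{u} R E where
  C e := LinTensor R (D.C e) (D'.C e)
  map f := LinTensor.mapFunctor (R := R) (D.map f) (D'.map f)
  map₂ η := LinTensor.mapNat (D.map₂ η) (D'.map₂ η)
  mapId e := LinTensor.natIsoMk _ _
    (fun X => LinTensor.isoMk (X := ⟨_, _⟩) (Y := X) ((D.mapId e).app X.fst)
      ((D'.mapId e).app X.snd))
    (fun X Y a b => LinTensor.tmul_congr (X := ⟨_, _⟩) ((D.mapId e).hom.naturality a)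
      ((D'.mapId e).hom.naturality b))
  mapComp f g := LinTensor.natIsoMk _ _
    (fun X => LinTensor.isoMk (X := ⟨_, _⟩) (Y := ⟨_, _⟩) ((D.mapComp f g).app X.fst)
      ((D'.mapComp f g).app X.snd))
    (fun X Y a b => LinTensor.tmul_congr (X := ⟨_, _⟩) (Y := ⟨_, _⟩)
      ((D.mapComp f g).hom.naturality a) ((D'.mapComp f g).hom.naturality b))
  map₂_id f x := LinTensor.tmul_congr (D.map₂_id f x.fst) (D'.map₂_id f x.snd)
  map₂_comp η θ x := LinTensor.tmul_congr (D.map₂_comp η θ x.fst) (D'.map₂_comp η θ x.snd)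
  whiskerLeft f _ _ η x := LinTensor.tmul_congr (X := ⟨_, _⟩) (Y := ⟨_, _⟩)
    (D.whiskerLeft f η x.fst) (D'.whiskerLeft f η x.snd)
  whiskerRight η h x := LinTensor.tmul_congr (X := ⟨_, _⟩) (Y := ⟨_, _⟩)
    (D.whiskerRight η h x.fst) (D'.whiskerRight η h x.snd)
  associator f g h x := LinTensor.tmul_congr (X := ⟨_, _⟩) (Y := ⟨_, _⟩)
    (D.associator f g h x.fst) (D'.associator f g h x.snd)
  leftUnitor f x := LinTensor.tmul_congr (D.leftUnitor f x.fst) (D'.leftUnitor f x.snd)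
  rightUnitor f x := LinTensor.tmul_congr (D.rightUnitor f x.fst) (D'.rightUnitor f x.snd)

namespace LinCocone

variable {D D' : LinDiag.{u} R E}
variable {L : Type u} [Category.{u} L] [Preadditive L] [Linear R L]
variable {L' : Type u} [Category.{u} L'] [Preadditive L'] [Linear R L']

/-- The tensor product of two cocones, formed pointwise. -/
@[simps leg, simps! iso, reducible]
def tensor (d : LinCocone D L) (d' : LinCocone D' L') :
    LinCocone (D.tensor D') (LinTensor R L L') where
  leg e := LinTensor.mapFunctor (R := R) (d.leg e) (d'.leg e)
  leg_additive e := inferInstanceAs (LinTensor.mapFunctor (d.leg e) (d'.leg e)).Additive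
  leg_linear e := inferInstanceAs ((LinTensor.mapFunctor (d.leg e) (d'.leg e)).Linear R)
  iso {e e'} f := LinTensor.natIsoMk (LinTensor.mapFunctor (R := R) (D.map f) (D'.map f) ⋙
      LinTensor.mapFunctor (R := R) (d.leg e') (d'.leg e'))
    (LinTensor.mapFunctor (R := R) (d.leg e) (d'.leg e))
    (fun X => LinTensor.isoMk (X := ⟨_, _⟩) (Y := ⟨_, _⟩) ((d.iso f).app X.fst)
      ((d'.iso f).app X.snd))
    (fun X Y a b => LinTensor.tmul_congr (X := ⟨_, _⟩) (Y := ⟨_, _⟩)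
      ((d.iso f).hom.naturality a) ((d'.iso f).hom.naturality b))
  map₂ η x := LinTensor.tmul_congr (X := ⟨_, _⟩) (Y := ⟨_, _⟩)
    (d.map₂ η x.fst) (d'.map₂ η x.snd)
  id e x := LinTensor.tmul_congr (X := ⟨_, _⟩) (Y := ⟨_, _⟩) (d.id e x.fst) (d'.id e x.snd)
  comp f g x := LinTensor.tmul_congr (X := ⟨_, _⟩) (Y := ⟨_, _⟩)
    (d.comp f g x.fst) (d'.comp f g x.snd)

variable {T : Type u} [Category.{u} T] [Preadditive T] [Linear R T]
variable {Y : Type u} [Category.{u} Y] [Preadditive Y] [Linear R Y]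

/-- A leg of a cocone under a tensor product with a fixed category. -/
abbrev constLeg (t : LinCocone ((LinDiag.const R E Y).tensor D) T) (e : E) :
    LinTensor R Y (D.C e) ⥤ T :=
  t.leg e

instance (t : LinCocone ((LinDiag.const R E Y).tensor D) T) (e : E) : (t.constLeg e).Additive :=
  t.leg_additive e

instance (t : LinCocone ((LinDiag.const R E Y).tensor D) T) (e : E) : (t.constLeg e).Linear R :=
  t.leg_linear e

open LinTensor in
/-- Cocones under a tensor product with a fixed category, as cocones with vertex a category of
functors. -/
def curry (t : LinCocone ((LinDiag.const R E Y).tensor D) T) : LinCocone D (LinFun R Y T) where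
  leg e := LinTensor.curry (t.constLeg e)
  leg_additive e := inferInstanceAs (LinTensor.curry (t.constLeg e)).Additive
  leg_linear e := inferInstanceAs ((LinTensor.curry (t.constLeg e)).Linear R)
  iso {e e'} f := NatIso.ofComponents (fun x => ObjectProperty.isoMk _
    (NatIso.ofComponents (fun y => (t.iso f).app ⟨y, x⟩) (fun {y y'} a => by
      have := (t.iso f).hom.naturality (X := ⟨y, x⟩) (Y := ⟨y', x⟩) (tmul a (𝟙 x))
      simp only [Functor.comp_map, LinTensor.mapFunctor_map_tmul] at this
      erw [(D.map f).map_id] at this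
      exact this))) (fun {x x'} b => by
      ext y
      have := (t.iso f).hom.naturality (X := ⟨y, x⟩) (Y := ⟨y, x'⟩) (tmul (𝟙 y) b)
      simp only [Functor.comp_map, LinTensor.mapFunctor_map_tmul] at this
      exact this)
  map₂ η x := by
    ext y
    exact t.map₂ η ⟨y, x⟩
  id e x := by
    ext y
    exact t.id e ⟨y, x⟩
  comp f g x := by
    ext y
    exact t.comp f g ⟨y, x⟩

/-- Tensoring with a fixed linear category preserves bicolimits. -/
lemma IsColim.tensorLeft {d : LinCocone D L} (h : d.IsColim) (Y : Type u) [Category.{u} Y]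
    [Preadditive Y] [Linear R Y] : ((const R E Y).tensor d).IsColim := by
  refine ⟨fun X => ?_, fun T _ _ _ t => ?_, fun T _ _ _ F G _ _ _ _ θ hθ => ?_⟩
  · obtain ⟨e, x, ⟨i⟩⟩ := h.ess X.snd
    exact ⟨e, ⟨X.fst, x⟩, ⟨LinTensor.isoMk (X := ⟨_, _⟩) (Iso.refl _) i⟩⟩
  · obtain ⟨F, _, _, σ, hσ⟩ := h.desc _ t.curry
    have hnat {e : E} {x x' : D.C e} (b : x ⟶ x') (y : Y) :
        (F.map ((d.leg e).map b)).hom.app y ≫ ((σ e).hom.app x').hom.app y =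
          ((σ e).hom.app x).hom.app y ≫
            (t.leg e).map (LinTensor.tmul (X := ⟨y, x⟩) (Y := ⟨y, x'⟩) (𝟙 y) b) :=
      congrArg (fun γ => γ.hom.app y) ((σ e).hom.naturality b)
    have hnat' {e : E} (x : D.C e) {y y' : Y} (a : y ⟶ y') :
        (F.obj ((d.leg e).obj x)).obj.map a ≫ ((σ e).hom.app x).hom.app y' =
          ((σ e).hom.app x).hom.app y ≫
            (t.leg e).map (LinTensor.tmul (X := ⟨y, x⟩) (Y := ⟨y', x⟩) a (𝟙 x)) :=
      ((σ e).hom.app x).hom.naturality a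
    refine ⟨LinTensor.uncurry F, inferInstance, inferInstance, fun e =>
      LinTensor.natIsoMk (LinTensor.mapFunctor (R := R) (𝟭 Y) (d.leg e) ⋙ LinTensor.uncurry F)
        (t.leg e) (fun X => (ObjectProperty.ι _ ⋙ (evaluation Y T).obj X.fst).mapIso
          ((σ e).app X.snd)) (fun X X' a b => ?_), fun e e' f X => ?_⟩
    · have h₁ := hnat b X.fst
      have h₂ := hnat' X'.snd a
      rw [LinTensor.map_tmul_eq (t.leg e)]
      exact comp_square h₁ h₂
    · have h₁ := congrArg (fun γ => γ.hom.app X.fst) (hσ f X.snd)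
      refine h₁.trans ?_
      refine congrArg (· ≫ _) ?_
      refine Eq.trans ?_ (LinTensor.uncurry_map_tmul F (X := ⟨_, _⟩) (Y := ⟨_, _⟩) _ _).symm
      exact (Category.comp_id _).symm.trans
        (congrArg _ (((F.obj ((d.leg e).obj X.snd)).obj.map_id X.fst).symm))
  · have hnat {e : E} {X X' : LinTensor R Y (D.C e)} (g : X ⟶ X') :
        F.map ((LinTensor.mapFunctor (R := R) (𝟭 Y) (d.leg e)).map g) ≫ (θ e).hom.app X' =
          (θ e).hom.app X ≫ G.map ((LinTensor.mapFunctor (R := R) (𝟭 Y) (d.leg e)).map g) :=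
      (θ e).hom.naturality g
    obtain ⟨α, hα⟩ := h.ext _ (LinTensor.curry F) (LinTensor.curry G)
      (fun e => NatIso.ofComponents (fun x => ObjectProperty.isoMk _
        (NatIso.ofComponents (fun y => (θ e).app ⟨y, x⟩) (fun {y y'} a => by
          have := hnat (X := ⟨y, x⟩) (X' := ⟨y', x⟩) (LinTensor.tmul a (𝟙 x))
          rw [LinTensor.mapFunctor_map_tmul, (d.leg e).map_id] at this
          exact this))) (fun {x x'} b => by
        ext y
        exact hnat (X := ⟨y, x⟩) (X' := ⟨y, x'⟩) (LinTensor.tmul (𝟙 y) b)))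
      (fun e e' f x => by
        ext y
        exact hθ f ⟨y, x⟩)
    refine ⟨LinTensor.natIsoMk F G (fun X => (ObjectProperty.ι _ ⋙
      (evaluation Y T).obj X.fst).mapIso (α.app X.snd)) (fun X X' a b => ?_), fun e X => ?_⟩
    · have h₁ := congrArg (fun γ => γ.hom.app X.fst) (α.hom.naturality b)
      have h₂ := (α.hom.app X'.snd).hom.naturality a
      rw [LinTensor.map_tmul_eq F, LinTensor.map_tmul_eq G]
      exact comp_square h₁ h₂
    · exact congrArg (fun γ => γ.hom.app X.fst) (hα e X.snd)

end LinCocone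

end

end

section

section

variable {R : Type} [CommRing R] {E : Type u} [Bicategory.{u, u} E]
variable {D : LinDiag.{u} R E}
variable {L : Type u} [Category.{u} L] [Preadditive L] [Linear R L]

namespace LinDiag.Equiv

lemma comp_eq_comp_ids {C : Type*} [Category* C] {X Y : C} (f : X ⟶ Y) {g h : Y ⟶ Y} (hg : g = 𝟙 Y)
    (hh : h = 𝟙 Y) : 𝟙 X ≫ f = f ≫ g ≫ h := by
  subst hg hh
  simp

/-- The equivalence of diagrams exchanging the factors of a tensor product. -/
@[reducible] def swap (D D' : LinDiag.{u} R E) : LinDiag.Equiv (D.tensor D') (D'.tensor D) where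
  F e := LinTensor.swap R (D.C e) (D'.C e)
  additive e := inferInstanceAs (LinTensor.swap R (D.C e) (D'.C e)).Additive
  linear e := inferInstanceAs ((LinTensor.swap R (D.C e) (D'.C e)).Linear R)
  isEquivalence e := inferInstanceAs (LinTensor.swap R (D.C e) (D'.C e)).IsEquivalence
  iso {e e'} f := LinTensor.natIsoMk
    (LinTensor.mapFunctor (R := R) (D.map f) (D'.map f) ⋙ LinTensor.swap R (D.C e') (D'.C e'))
    (LinTensor.swap R (D.C e) (D'.C e) ⋙ LinTensor.mapFunctor (R := R) (D'.map f) (D.map f))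
    (fun X => Iso.refl _) (fun X Y a b => (Category.comp_id _).trans (Category.id_comp _).symm)
  map₂ η x := (Category.comp_id _).trans (Category.id_comp _).symm
  id e x := Category.id_comp _
  comp f g x := comp_eq_comp_ids (C := LinTensor R _ _) _ rfl (CategoryTheory.Functor.map_id _ _)

end LinDiag.Equiv

namespace LinCocone

/-- Tensoring with a fixed linear category on the right preserves bicolimits. -/
lemma IsColim.tensorRight {d : LinCocone D L} (h : d.IsColim) (Y : Type u) [Category.{u} Y]
    [Preadditive Y] [Linear R Y] : (d.tensor (const R E Y)).IsColim := by
  refine ((h.tensorLeft Y).pullback (LinDiag.Equiv.swap D (LinDiag.const R E Y))).of_equivalence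
    (d.tensor (const R E Y)) (LinTensor.swap R Y L)
    (fun e => LinTensor.natIsoMk ((LinTensor.swap R (D.C e) Y ⋙
      LinTensor.mapFunctor (R := R) (𝟭 Y) (d.leg e)) ⋙ LinTensor.swap R Y L)
      (LinTensor.mapFunctor (R := R) (d.leg e) (𝟭 Y)) (fun X => Iso.refl _)
      (fun X X' a b => (Category.comp_id _).trans (Category.id_comp _).symm)) (fun e e' f X => ?_)
  refine (Category.id_comp _).trans (Eq.trans ?_ (Category.comp_id _).symm)
  have h₁ : (((const R E Y).tensor d).leg e').map (𝟙 (⟨X.snd, (D.map f).obj X.fst⟩ :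
    LinTensor R Y (D.C e'))) = 𝟙 _ := CategoryTheory.Functor.map_id _ _
  refine Eq.trans ?_ (congrArg (fun γ => (LinTensor.swap R Y L).map
    (γ ≫ (((const R E Y).tensor d).iso f).hom.app ⟨X.snd, X.fst⟩)) h₁.symm)
  exact congrArg (LinTensor.swap R Y L).map (Category.id_comp
    ((((const R E Y).tensor d).iso f).hom.app ⟨X.snd, X.fst⟩)).symm

end LinCocone

end

/-! ### Base change of diagrams -/

/-- The linear structure obtained by restriction of scalars. -/
@[reducible] def Linear.restrictScalars (R S : Type) [CommRing R] [CommRing S] [Algebra R S]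
    (T : Type u) [Category.{u} T] [Preadditive T] [Linear S T] : Linear R T where
  homModule X Y := Module.compHom _ (algebraMap R S)
  smul_comp X Y Z r f g := Linear.smul_comp X Y Z (algebraMap R S r) f g
  comp_smul X Y Z f r g := Linear.comp_smul X Y Z f (algebraMap R S r) g

/-- Two linear structures are compatible with the structure map of an algebra. -/
class CompatibleScalars (R S : Type) [CommRing R] [CommRing S] [Algebra R S] (T : Type u)
    [Category.{u} T] [Preadditive T] [Linear R T] [Linear S T] : Prop where
  algebraMap_smul {X Y : T} (r : R) (f : X ⟶ Y) : algebraMap R S r • f = r • f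

section

variable {R : Type} [CommRing R] {S : Type} [CommRing S] [Algebra R S]
variable {C : Type u} [Category.{u} C] [Preadditive C] [Linear R C]
variable {T : Type u} [Category.{u} T] [Preadditive T] [Linear R T] [Linear S T]
  [CompatibleScalars R S T]

namespace BaseChange

lemma tmul_add {X Y : BaseChange R S C} (s : S) (f g : X.of ⟶ Y.of) :
    (tmul s (f + g) : X ⟶ Y) = tmul s f + tmul s g :=
  TensorProduct.tmul_add _ _ _

lemma smul_tmul {X Y : BaseChange R S C} (r s : S) (f : X.of ⟶ Y.of) :
    r • (tmul s f : X ⟶ Y) = tmul (r * s) f :=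
  TensorProduct.smul_tmul' r s f

lemma tmul_eq_smul {X Y : BaseChange R S C} (s : S) (f : X.of ⟶ Y.of) :
    (tmul s f : X ⟶ Y) = s • tmul 1 f := by
  rw [smul_tmul, mul_one]

lemma tmul_smul {X Y : BaseChange R S C} (s : S) (r : R) (f : X.of ⟶ Y.of) :
    (tmul s (r • f) : X ⟶ Y) = algebraMap R S r • tmul s f := by
  rw [smul_tmul, ← Algebra.smul_def]
  exact (TensorProduct.smul_tmul r s f).symm

variable (R S C) in
/-- The functor from a linear category to its base change. -/
@[simps, reducible] def incl : C ⥤ BaseChange R S C where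
  obj X := ⟨X⟩
  map f := tmul (X := ⟨_⟩) (Y := ⟨_⟩) 1 f
  map_id X := tmul_id ⟨X⟩
  map_comp {X Y Z} f g := tmul_one_comp (X := ⟨X⟩) (Y := ⟨Y⟩) (Z := ⟨Z⟩) f g

instance (G : BaseChange R S C ⥤ T) [G.Additive] : (incl R S C ⋙ G).Additive where
  map_add {X Y f g} := by
    rw [Functor.comp_map, incl_map, tmul_add, G.map_add]; rfl

instance (G : BaseChange R S C ⥤ T) [G.Additive] [G.Linear S] : (incl R S C ⋙ G).Linear R where
  map_smul {X Y} f r := by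
    rw [Functor.comp_map, incl_map, tmul_smul, G.map_smul,
      CompatibleScalars.algebraMap_smul]; rfl

/-- The action on morphisms of the extension of a functor along base change. -/
@[reducible] def extendMap (F : C ⥤ T) [F.Additive] [F.Linear R] (X Y : BaseChange R S C) :
    S ⊗[R] (X.of ⟶ Y.of) →ₗ[R] (F.obj X.of ⟶ F.obj Y.of) :=
  TensorProduct.lift (LinearMap.mk₂ R
    (fun (s : S) (a : X.of ⟶ Y.of) => s • F.map a)
    (fun s s' a => add_smul _ _ _)
    (fun r s a => by rw [Algebra.smul_def, mul_smul, CompatibleScalars.algebraMap_smul])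
    (fun s a a' => by rw [F.map_add, smul_add])
    (fun r s a => by
      rw [F.map_smul, ← CompatibleScalars.algebraMap_smul (S := S) r (F.map a),
        ← CompatibleScalars.algebraMap_smul (S := S) r (s • F.map a), smul_comm]))

variable (S) in
/-- The extension of a functor along base change. -/
@[simps obj] def extend (F : C ⥤ T) [F.Additive] [F.Linear R] : BaseChange R S C ⥤ T where
  obj X := F.obj X.of
  map {X Y} f := extendMap F X Y f
  map_id X := by
    change (1 : S) • F.map (𝟙 X.of) = _
    simp
  map_comp {X Y Z} f g := by
    induction f using hom_induction with
    | h0 => simp only [Limits.zero_comp]; exact (map_zero _).trans (Limits.zero_comp.symm.trans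
        (congrArg (· ≫ _) (map_zero (extendMap F _ _)).symm))
    | ha a b ha hb =>
      rw [Preadditive.add_comp]
      refine (map_add (extendMap F _ _) _ _).trans ?_
      rw [ha, hb, ← Preadditive.add_comp]
      exact congrArg (· ≫ _) (map_add (extendMap F _ _) _ _).symm
    | ht s a =>
      induction g using hom_induction with
      | h0 => simp only [Limits.comp_zero]; exact (map_zero _).trans (Limits.comp_zero.symm.trans
          (congrArg (_ ≫ ·) (map_zero (extendMap F _ _)).symm))
      | ha a b ha hb =>
        rw [Preadditive.comp_add]
        refine (map_add (extendMap F _ _) _ _).trans ?_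
        rw [ha, hb, ← Preadditive.comp_add]
        exact congrArg (_ ≫ ·) (map_add (extendMap F _ _) _ _).symm
      | ht t b =>
        change (s * t) • F.map (a ≫ b) = (s • F.map a) ≫ (t • F.map b)
        simp [mul_smul]
        rw [smul_comm]

variable (F : C ⥤ T) [F.Additive] [F.Linear R]

@[simp] lemma extend_map_tmul {X Y : BaseChange R S C} (s : S) (f : X.of ⟶ Y.of) :
    (extend (R := R) S F).map (tmul s f : X ⟶ Y) = s • F.map f := rfl

instance : (extend (R := R) S F).Additive where
  map_add := map_add (extendMap F _ _) _ _

instance : (extend (R := R) S F).Linear S where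
  map_smul {X Y} f r := by
    induction f using hom_induction with
    | h0 => simp
    | ha a b ha hb => rw [smul_add, Functor.map_add, ha, hb, Functor.map_add, smul_add]
    | ht s a => rw [smul_tmul, extend_map_tmul, extend_map_tmul, mul_smul]; rfl

end BaseChange

variable {E : Type u} [Bicategory.{u, u} E]
variable {L : Type u} [Category.{u} L] [Preadditive L] [Linear R L]

/-- The base change of a diagram of linear categories. -/
@[simps C map map₂ mapId mapComp, reducible]
def LinDiag.baseChange (S : Type) [CommRing S] [Algebra R S] (D : LinDiag.{u} R E) :
    LinDiag.{u} S E where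
  C e := BaseChange R S (D.C e)
  map f := BaseChange.mapFunctor S (D.map f)
  map₂ η := BaseChange.mapNat (D.map₂ η)
  mapId e := BaseChange.natIsoMk _ _
    (fun X => BaseChange.isoMk (X := ⟨_⟩) (Y := X) ((D.mapId e).app X.of))
    (fun X Y s a => by
      refine congrArg₂ (BaseChange.tmul (X := ⟨_⟩)) ?_ ((D.mapId e).hom.naturality a)
      exact (mul_one s).trans (one_mul s).symm)
  mapComp f g := BaseChange.natIsoMk _ _
    (fun X => BaseChange.isoMk (X := ⟨_⟩) (Y := ⟨_⟩) ((D.mapComp f g).app X.of))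
    (fun X Y s a => by
      refine congrArg₂ (BaseChange.tmul (X := ⟨_⟩) (Y := ⟨_⟩)) ?_ ((D.mapComp f g).hom.naturality a)
      exact (mul_one s).trans (one_mul s).symm)
  map₂_id f x := congrArg (BaseChange.tmul 1) (D.map₂_id f x.of)
  map₂_comp η θ x := (congrArg (BaseChange.tmul 1) (D.map₂_comp η θ x.of)).trans
    (BaseChange.tmul_one_comp (Y := ⟨_⟩) _ _)
  whiskerLeft f _ _ η x := (BaseChange.tmul_one_comp _ _).symm.trans
    ((congrArg (BaseChange.tmul 1) (D.whiskerLeft f η x.of)).trans (BaseChange.tmul_one_comp _ _))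
  whiskerRight η h x := (BaseChange.tmul_one_comp _ _).symm.trans
    ((congrArg (BaseChange.tmul 1) (D.whiskerRight η h x.of)).trans (BaseChange.tmul_one_comp _ _))
  associator f g h x := ((congrArg (_ ≫ ·) (BaseChange.tmul_one_comp _ _).symm).trans
    (BaseChange.tmul_one_comp _ _).symm).trans ((congrArg (BaseChange.tmul 1)
      (D.associator f g h x.of)).trans (BaseChange.tmul_one_comp _ _))
  leftUnitor f x := (congrArg (BaseChange.tmul 1) (D.leftUnitor f x.of)).trans
    (BaseChange.tmul_one_comp _ _)
  rightUnitor f x := (congrArg (BaseChange.tmul 1) (D.rightUnitor f x.of)).trans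
    (BaseChange.tmul_one_comp _ _)

namespace LinCocone

variable {D : LinDiag.{u} R E}

/-- The base change of a cocone. -/
@[simps leg, simps! iso, reducible]
def baseChange (S : Type) [CommRing S] [Algebra R S] (d : LinCocone D L) :
    LinCocone (D.baseChange S) (BaseChange R S L) where
  leg e := BaseChange.mapFunctor S (d.leg e)
  leg_additive e := inferInstanceAs (BaseChange.mapFunctor S (d.leg e)).Additive
  leg_linear e := inferInstanceAs ((BaseChange.mapFunctor S (d.leg e)).Linear S)
  iso {e e'} f := BaseChange.natIsoMk
    (BaseChange.mapFunctor S (D.map f) ⋙ BaseChange.mapFunctor S (d.leg e'))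
    (BaseChange.mapFunctor S (d.leg e))
    (fun X => BaseChange.isoMk (X := ⟨_⟩) (Y := ⟨_⟩) ((d.iso f).app X.of))
    (fun X Y s a => by
      refine congrArg₂ (BaseChange.tmul (X := ⟨_⟩) (Y := ⟨_⟩)) ?_ ((d.iso f).hom.naturality a)
      exact (mul_one s).trans (one_mul s).symm)
  map₂ η x := (BaseChange.tmul_one_comp _ _).symm.trans
    (congrArg (BaseChange.tmul 1) (d.map₂ η x.of))
  id e x := congrArg (BaseChange.tmul 1) (d.id e x.of)
  comp f g x := (congrArg (BaseChange.tmul 1) (d.comp f g x.of)).trans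
    ((BaseChange.tmul_one_comp _ _).trans (congrArg (_ ≫ ·) (BaseChange.tmul_one_comp _ _)))

/-- A leg of a cocone under a base change. -/
abbrev baseChangeLeg (t : LinCocone (D.baseChange S) T) (e : E) : BaseChange R S (D.C e) ⥤ T :=
  t.leg e

instance (t : LinCocone (D.baseChange S) T) (e : E) : (t.baseChangeLeg e).Additive :=
  t.leg_additive e

instance (t : LinCocone (D.baseChange S) T) (e : E) : (t.baseChangeLeg e).Linear S :=
  t.leg_linear e

/-- The restriction of a cocone under a base change to the original diagram. -/
def ofBaseChange (t : LinCocone (D.baseChange S) T) : LinCocone D T where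
  leg e := BaseChange.incl R S (D.C e) ⋙ t.baseChangeLeg e
  iso {e e'} f := NatIso.ofComponents (fun x => (t.iso f).app ⟨x⟩)
    (fun {x y} a => (t.iso f).hom.naturality (X := ⟨x⟩) (Y := ⟨y⟩) (BaseChange.tmul 1 a))
  map₂ η x := t.map₂ η ⟨x⟩
  id e x := t.id e ⟨x⟩
  comp f g x := t.comp f g ⟨x⟩

/-- Base change preserves bicolimits. -/
lemma IsColim.baseChange {d : LinCocone D L} (h : d.IsColim) (S : Type) [CommRing S]
    [Algebra R S] : (d.baseChange S).IsColim := by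
  refine ⟨fun X => ?_, fun T _ _ _ t => ?_, fun T _ _ _ F G _ _ _ _ θ hθ => ?_⟩
  · obtain ⟨e, x, ⟨i⟩⟩ := h.ess X.of
    exact ⟨e, ⟨x⟩, ⟨BaseChange.isoMk (X := ⟨_⟩) i⟩⟩
  · let _ : Linear R T := Linear.restrictScalars R S T
    have : CompatibleScalars R S T := ⟨fun _ _ => rfl⟩
    obtain ⟨F, _, _, σ, hσ⟩ := h.desc T t.ofBaseChange
    have hnat {e : E} {x y : D.C e} (a : x ⟶ y) : F.map ((d.leg e).map a) ≫ (σ e).hom.app y =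
        (σ e).hom.app x ≫ (t.baseChangeLeg e).map (BaseChange.tmul (X := ⟨x⟩) (Y := ⟨y⟩) 1 a) :=
      (σ e).hom.naturality a
    refine ⟨BaseChange.extend (R := R) S F, inferInstance, inferInstance, fun e =>
      BaseChange.natIsoMk
      (BaseChange.mapFunctor S (d.leg e) ⋙ BaseChange.extend (R := R) S F) (t.baseChangeLeg e)
      (fun X => (σ e).app X.of) (fun X Y s a => ?_), fun e e' f x => ?_⟩
    · conv_rhs => rw [BaseChange.tmul_eq_smul, (t.baseChangeLeg e).map_smul, Linear.comp_smul]
      refine Eq.trans ?_ (congrArg (s • ·) (hnat a))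
      exact Linear.smul_comp (R := S) (C := T) _ _ _ s (F.map ((d.leg e).map a))
        ((σ e).hom.app Y.of)
    · refine (hσ f x.of).trans (congrArg (· ≫ _) ?_)
      exact (one_smul S _).symm
  · let _ : Linear R T := Linear.restrictScalars R S T
    have : CompatibleScalars R S T := ⟨fun _ _ => rfl⟩
    have hnat {e : E} {x y : D.C e} (a : x ⟶ y) :
        F.map (BaseChange.tmul (X := ⟨_⟩) (Y := ⟨_⟩) 1 ((d.leg e).map a)) ≫ (θ e).hom.app ⟨y⟩ =
        (θ e).hom.app ⟨x⟩ ≫ G.map (BaseChange.tmul (X := ⟨_⟩) (Y := ⟨_⟩) 1 ((d.leg e).map a)) :=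
      (θ e).hom.naturality (X := ⟨x⟩) (Y := ⟨y⟩) (BaseChange.tmul 1 a)
    obtain ⟨α, hα⟩ := h.ext T (BaseChange.incl R S L ⋙ F) (BaseChange.incl R S L ⋙ G)
      (fun e => NatIso.ofComponents (fun x => (θ e).app ⟨x⟩) (fun a => hnat a))
      (fun e e' f x => hθ f ⟨x⟩)
    refine ⟨BaseChange.natIsoMk F G (fun X => α.app X.of) (fun X Y s a => ?_),
      fun e x => hα e x.of⟩
    rw [BaseChange.tmul_eq_smul, F.map_smul, G.map_smul, Linear.comp_smul, Linear.smul_comp]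
    exact congrArg (s • ·) (α.hom.naturality a)

end LinCocone

end

end

section

/-! ### Diagrams of linear categories as pseudofunctors -/

/-- Small `R`-linear categories. -/
structure LinCat (R : Type) [CommRing R] where
  carrier : Type u
  [cat : Category.{u} carrier]
  [preadditive : Preadditive carrier]
  [linear : Linear R carrier]

namespace LinCat

attribute [instance] cat preadditive linear

section

variable {R : Type} [CommRing R]

/-- Linear functors. -/
structure Hom (C D : LinCat.{u} R) where
  functor : C.carrier ⥤ D.carrier
  [additive : functor.Additive]
  [linear : functor.Linear R]

attribute [instance] Hom.additive Hom.linear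

instance : CategoryStruct (LinCat.{u} R) where
  Hom := Hom
  id C := ⟨𝟭 C.carrier⟩
  comp F G := ⟨F.functor ⋙ G.functor⟩

/-- Natural isomorphisms of linear functors. -/
@[ext] structure Hom₂ {C D : LinCat.{u} R} (F G : C ⟶ D) where
  iso : F.functor ≅ G.functor

instance homCategory (C D : LinCat.{u} R) : Category (C ⟶ D) where
  Hom F G := Hom₂ F G
  id F := ⟨Iso.refl _⟩
  comp α β := ⟨α.iso ≪≫ β.iso⟩

variable {C D : LinCat.{u} R}

@[simp] lemma id_iso (F : C ⟶ D) : Hom₂.iso (𝟙 F) = Iso.refl _ := rfl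

@[simp] lemma comp_iso {F G H : C ⟶ D} (α : F ⟶ G) (β : G ⟶ H) :
    Hom₂.iso (α ≫ β) = α.iso ≪≫ β.iso := rfl

lemma hom₂_ext {F G : C ⟶ D} {α β : F ⟶ G} (h : ∀ x, α.iso.hom.app x = β.iso.hom.app x) :
    α = β :=
  Hom₂.ext (Iso.ext (NatTrans.ext (funext h)))

/-- An invertible 2-cell from a natural isomorphism. -/
@[simps] def isoMk {F G : C ⟶ D} (α : F.functor ≅ G.functor) : F ≅ G where
  hom := ⟨α⟩
  inv := ⟨α.symm⟩
  hom_inv_id := hom₂_ext fun x => α.hom_inv_id_app x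
  inv_hom_id := hom₂_ext fun x => α.inv_hom_id_app x

instance : Bicategory (LinCat.{u} R) where
  homCategory := homCategory
  whiskerLeft F _ _ α := Hom₂.mk (Functor.isoWhiskerLeft F.functor α.iso)
  whiskerRight α G := Hom₂.mk (Functor.isoWhiskerRight α.iso G.functor)
  associator F G H := isoMk (F := (F ≫ G) ≫ H) (G := F ≫ G ≫ H)
    (Functor.associator F.functor G.functor H.functor)
  leftUnitor F := isoMk (F := 𝟙 _ ≫ F) F.functor.leftUnitor
  rightUnitor F := isoMk (F := F ≫ 𝟙 _) F.functor.rightUnitor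
  whiskerLeft_id F G := hom₂_ext fun x => rfl
  whiskerLeft_comp F _ _ _ α β := hom₂_ext fun x => rfl
  id_whiskerLeft α := hom₂_ext fun x => ((Category.id_comp _).trans (Category.comp_id _)).symm
  comp_whiskerLeft F G _ _ α := hom₂_ext fun x =>
    ((Category.id_comp _).trans (Category.comp_id _)).symm
  id_whiskerRight F G := hom₂_ext fun x => G.functor.map_id _
  comp_whiskerRight α β G := hom₂_ext fun x => G.functor.map_comp _ _
  whiskerRight_id α := hom₂_ext fun x => ((Category.id_comp _).trans (Category.comp_id _)).symm
  whiskerRight_comp α G H := hom₂_ext fun x =>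
    ((Category.id_comp _).trans (Category.comp_id _)).symm
  whisker_assoc F _ _ α H := hom₂_ext fun x =>
    ((Category.id_comp _).trans (Category.comp_id _)).symm
  whisker_exchange α β := hom₂_ext fun x =>
    (NatTrans.naturality (Iso.hom (Hom₂.iso β)) ((Hom₂.iso α).hom.app x)).symm
  pentagon {A B C D E} F G H K := hom₂_ext fun x => by
    change K.functor.map (𝟙 (H.functor.obj (G.functor.obj (F.functor.obj x)))) ≫
      𝟙 (K.functor.obj (H.functor.obj (G.functor.obj (F.functor.obj x)))) ≫ 𝟙 _ = 𝟙 _ ≫ 𝟙 _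
    simp
  triangle {A B C} F G := hom₂_ext fun x => by
    change 𝟙 (G.functor.obj (F.functor.obj x)) ≫ 𝟙 (G.functor.obj (F.functor.obj x)) =
      G.functor.map (𝟙 _)
    simp

lemma isIso₂ {F G : C ⟶ D} (α : F ⟶ G) : IsIso α :=
  (isoMk α.iso).isIso_hom

instance : IsLocallyGroupoid (LinCat.{u} R) := fun C D => ⟨fun α => isIso₂ α⟩

end

end LinCat

section

variable {R : Type} [CommRing R] {E : Type u} [Bicategory.{u, u} E] [IsLocallyGroupoid E]

/-- The invertible natural transformation induced by a 2-cell of a locally groupoidal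
indexing bicategory. -/
@[simps] def LinDiag.map₂Iso (D : LinDiag.{u} R E) {e e' : E} {f g : e ⟶ e'} (η : f ⟶ g) :
    D.map f ≅ D.map g where
  hom := D.map₂ η
  inv := D.map₂ (CategoryTheory.inv η)
  hom_inv_id := by
    ext x
    simp [← D.map₂_comp, D.map₂_id]
  inv_hom_id := by
    ext x
    simp [← D.map₂_comp, D.map₂_id]

lemma eq_comp_of_comp_comp_eq {C : Type*} [Category* C] {X Y Z W V : C} {a : X ⟶ Y} {b : Y ≅ Z}
    {c : Z ≅ W} {d : X ⟶ V} {e : V ⟶ W} (h : a ≫ b.hom ≫ c.hom = d ≫ e) :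
    a = d ≫ e ≫ 𝟙 W ≫ c.inv ≫ b.inv := by
  rw [← reassoc_of% h]
  simp

/-- The pseudofunctor corresponding to a diagram. -/
@[simps, reducible] def LinDiag.toPseudofunctor (D : LinDiag.{u} R E) : E ⥤ᵖ LinCat.{u} R where
  obj e := ⟨D.C e⟩
  map {e e'} f := LinCat.Hom.mk (C := ⟨D.C e⟩) (D := ⟨D.C e'⟩) (D.map f)
  map₂ η := LinCat.Hom₂.mk (D.map₂Iso η)
  mapId e := LinCat.isoMk (C := ⟨D.C e⟩) (D := ⟨D.C e⟩)
    (F := LinCat.Hom.mk (C := ⟨D.C e⟩) (D := ⟨D.C e⟩) (D.map (𝟙 e)))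
    (G := LinCat.Hom.mk (C := ⟨D.C e⟩) (D := ⟨D.C e⟩) (𝟭 (D.C e))) (D.mapId e)
  mapComp {e e' e''} f g := LinCat.isoMk (C := ⟨D.C e⟩) (D := ⟨D.C e''⟩)
    (F := LinCat.Hom.mk (C := ⟨D.C e⟩) (D := ⟨D.C e''⟩) (D.map (f ≫ g)))
    (G := LinCat.Hom.mk (C := ⟨D.C e⟩) (D := ⟨D.C e''⟩) (D.map f ⋙ D.map g)) (D.mapComp f g)
  map₂_id f := LinCat.hom₂_ext fun x => D.map₂_id f x
  map₂_comp η θ := LinCat.hom₂_ext fun x => D.map₂_comp η θ x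
  map₂_whisker_left f _ _ η := LinCat.hom₂_ext fun x =>
    ((Iso.eq_comp_inv ((D.mapComp f _).app x)).2 (D.whiskerLeft f η x)).trans (Category.assoc _ _ _)
  map₂_whisker_right η h := LinCat.hom₂_ext fun x =>
    ((Iso.eq_comp_inv ((D.mapComp _ h).app x)).2 (D.whiskerRight η h x)).trans
      (Category.assoc _ _ _)
  map₂_associator f g h := LinCat.hom₂_ext fun x =>
    eq_comp_of_comp_comp_eq (b := (D.mapComp f (g ≫ h)).app x)
      (c := (D.mapComp g h).app ((D.map f).obj x)) (D.associator f g h x)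
  map₂_left_unitor f := LinCat.hom₂_ext fun x =>
    (D.leftUnitor f x).trans (congrArg (_ ≫ ·) (Category.comp_id _).symm)
  map₂_right_unitor f := LinCat.hom₂_ext fun x =>
    (D.rightUnitor f x).trans (congrArg (_ ≫ ·) (Category.comp_id _).symm)

namespace LinCocone

variable {D : LinDiag.{u} R E}

/-- The pseudo-cocone corresponding to a cocone of linear categories. -/
@[reducible] def toBiCocone {T : Type u} [Category.{u} T] [Preadditive T] [Linear R T]
    (t : LinCocone D T) : BiCocone D.toPseudofunctor (LinCat.mk (R := R) T) where
  leg e := LinCat.Hom.mk (C := ⟨D.C e⟩) (D := ⟨T⟩) (t.leg e)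
  legIso {e e'} f := LinCat.isoMk (C := ⟨D.C e⟩) (D := ⟨T⟩)
    (F := LinCat.Hom.mk (C := ⟨D.C e⟩) (D := ⟨T⟩) (D.map f ⋙ t.leg e'))
    (G := LinCat.Hom.mk (C := ⟨D.C e⟩) (D := ⟨T⟩) (t.leg e)) (t.iso f)
  naturality η := LinCat.hom₂_ext fun x => t.map₂ η x
  legIso_id e := LinCat.hom₂_ext fun x => (t.id e x).trans (Category.comp_id _).symm
  legIso_comp f g := LinCat.hom₂_ext fun x => (t.comp f g x).trans
    (congrArg (_ ≫ ·) (Category.id_comp _).symm)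

/-- The cocone of linear categories corresponding to a pseudo-cocone. -/
@[reducible] def ofBiCocone {T : LinCat.{u} R} (c : BiCocone D.toPseudofunctor T) :
    LinCocone D T.carrier where
  leg e := LinCat.Hom.functor (c.leg e)
  leg_additive e := LinCat.Hom.additive (c.leg e)
  leg_linear e := LinCat.Hom.linear (c.leg e)
  iso f := LinCat.Hom₂.iso (c.legIso f).hom
  map₂ η x := congrArg (fun γ => (LinCat.Hom₂.iso γ).hom.app x) (c.naturality η)
  id e x := (congrArg (fun γ => (LinCat.Hom₂.iso γ).hom.app x) (c.legIso_id e)).trans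
    (Category.comp_id _)
  comp f g x := (congrArg (fun γ => (LinCat.Hom₂.iso γ).hom.app x) (c.legIso_comp f g)).trans
    (congrArg (_ ≫ ·) (Category.id_comp _))

end LinCocone

end

end

section

/-! ### Sifted diagrams of linear categories -/

section

variable {R : Type} [CommRing R] {E : Type u} [Bicategory.{u, u} E]

/-- The restriction of a diagram to the diagonal. -/
@[reducible] def LinDiag.diag (K : LinDiag.{u} R (E × E)) : LinDiag.{u} R E where
  C e := K.C (e, e)
  map {e e'} f := K.map (e := (e, e)) (e' := (e', e')) (f, f)
  map₂ {e e' f g} η := K.map₂ (e := (e, e)) (e' := (e', e')) (f := (f, f)) (g := (g, g)) (η, η)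
  mapId e := K.mapId (e, e)
  mapComp {e e' e''} f g := K.mapComp (e := (e, e)) (e' := (e', e')) (e'' := (e'', e'')) (f, f)
    (g, g)
  map₂_id {e e'} f x := K.map₂_id (e := (e, e)) (e' := (e', e')) (f, f) x
  map₂_comp {e e' f g h} η θ x := K.map₂_comp (e := (e, e)) (e' := (e', e')) (f := (f, f))
    (g := (g, g)) (h := (h, h)) (η, η) (θ, θ) x
  whiskerLeft {e e' e''} f {g h} η x := K.whiskerLeft (e := (e, e)) (e' := (e', e'))
    (e'' := (e'', e'')) (f, f) (g := (g, g)) (h := (h, h)) (η, η) x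
  whiskerRight {e e' e'' f g} η h x := K.whiskerRight (e := (e, e)) (e' := (e', e'))
    (e'' := (e'', e'')) (f := (f, f)) (g := (g, g)) (η, η) (h, h) x
  associator {e₁ e₂ e₃ e₄} f g h x := K.associator (e₁ := (e₁, e₁)) (e₂ := (e₂, e₂))
    (e₃ := (e₃, e₃)) (e₄ := (e₄, e₄)) (f, f) (g, g) (h, h) x
  leftUnitor {e e'} f x := K.leftUnitor (e := (e, e)) (e' := (e', e')) (f, f) x
  rightUnitor {e e'} f x := K.rightUnitor (e := (e, e)) (e' := (e', e')) (f, f) x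

/-- The restriction of a cocone to the diagonal. -/
@[reducible] def LinCocone.diag {K : LinDiag.{u} R (E × E)} {T : Type u} [Category.{u} T]
    [Preadditive T] [Linear R T] (t : LinCocone K T) : LinCocone K.diag T where
  leg e := t.leg (e, e)
  leg_additive e := t.leg_additive (e, e)
  leg_linear e := t.leg_linear (e, e)
  iso {e e'} f := t.iso (e := (e, e)) (e' := (e', e')) (f, f)
  map₂ {e e' f g} η x := t.map₂ (e := (e, e)) (e' := (e', e')) (f := (f, f)) (g := (g, g)) (η, η) x
  id e x := t.id (e, e) x
  comp {e e' e''} f g x := t.comp (e := (e, e)) (e' := (e', e')) (e'' := (e'', e'')) (f, f) (g, g) x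

namespace IsSifted₂₁

instance prod_locallyGroupoid [h : IsSifted₂₁ E] : IsLocallyGroupoid (E × E) := fun a b =>
  ⟨fun {f g} η => by
    have := IsSifted₂₁.locallyGroupoid (E := E)
    exact ⟨(CategoryTheory.inv η.1, CategoryTheory.inv η.2), Prod.ext (IsIso.hom_inv_id η.1)
      (IsIso.hom_inv_id η.2), Prod.ext (IsIso.inv_hom_id η.1) (IsIso.inv_hom_id η.2)⟩⟩

variable [IsSifted₂₁ E] {K : LinDiag.{u} R (E × E)}
variable {T : Type u} [Category.{u} T] [Preadditive T] [Linear R T]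

/-- A leg of a cocone under the restriction of a diagram to the diagonal. -/
@[reducible] def diagLeg (t : LinCocone K.diag T) (e : E) :
    LinCat.mk (R := R) (K.C (e, e)) ⟶ LinCat.mk (R := R) T :=
  LinCat.Hom.mk (C := ⟨K.C (e, e)⟩) (D := ⟨T⟩) (t.leg e) (additive := t.leg_additive e)
    (linear := t.leg_linear e)

/-- A cocone under the restriction of a diagram to the diagonal, as a pseudo-cocone. -/
@[reducible] def toBiCoconeDiag (t : LinCocone K.diag T) :
    BiCocone ((diagonal E).comp K.toPseudofunctor) (LinCat.mk (R := R) T) where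
  leg e := diagLeg t e
  legIso {e e'} f := LinCat.isoMk (C := ⟨K.C (e, e)⟩) (D := ⟨T⟩)
    (F := ((diagonal E).comp K.toPseudofunctor).map f ≫ diagLeg t e') (G := diagLeg t e) (t.iso f)
  naturality η := LinCat.hom₂_ext fun x => t.map₂ η x
  legIso_id e := LinCat.hom₂_ext fun x => (t.id e x).trans <| Eq.trans (by
    refine congrArg (t.leg e).map ?_
    refine Eq.trans (Category.id_comp _).symm (congrArg (· ≫ _) ?_)
    exact (K.map₂_id (e := (e, e)) (e' := (e, e)) (𝟙 (e, e)) x).symm) (Category.comp_id _).symm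
  legIso_comp {e e' e''} f g := LinCat.hom₂_ext fun x => (t.comp f g x).trans <| by
    refine congrArg₂ (· ≫ ·) ?_ (Category.id_comp _).symm
    refine congrArg (t.leg _).map ?_
    refine Eq.trans (Category.id_comp _).symm (congrArg (· ≫ _) ?_)
    exact (K.map₂_id (e := (e, e)) (e' := (e'', e'')) (f ≫ g, f ≫ g) x).symm

/-- Cocones under a diagram restricted to the diagonal extend. -/
lemma exists_extension (t : LinCocone K.diag T) :
    ∃ (s : LinCocone K T) (φ : ∀ e, s.leg (e, e) ≅ t.leg e), ∀ ⦃e e' : E⦄ (f : e ⟶ e')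
      (x : K.C (e, e)), (φ e').hom.app ((K.diag.map f).obj x) ≫ (t.iso f).hom.app x =
        (s.iso (e := (e, e)) (e' := (e', e')) (f, f)).hom.app x ≫ (φ e).hom.app x := by
  have := IsSifted₂₁.cofinal_diagonal (E := E) (LinCat.{u} R) K.toPseudofunctor ⟨T⟩
  let c := (BiCocone.restrict (diagonal E) K.toPseudofunctor ⟨T⟩).objPreimage (toBiCoconeDiag t)
  let φ := (BiCocone.restrict (diagonal E) K.toPseudofunctor ⟨T⟩).objObjPreimageIso
    (toBiCoconeDiag t)
  refine ⟨LinCocone.ofBiCocone c, fun e => LinCat.Hom₂.iso (BiCocone.Hom.app φ.hom e),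
    fun e e' f x => ?_⟩
  exact congrArg (fun γ => (LinCat.Hom₂.iso γ).hom.app x) (BiCocone.Hom.comm φ.hom f)

/-- Isomorphisms between the restrictions of two cocones to the diagonal extend. -/
lemma exists_iso_extension (t₁ t₂ : LinCocone K T)
    (θ : ∀ e : E, t₁.leg (e, e) ≅ t₂.leg (e, e))
    (hθ : ∀ ⦃e e' : E⦄ (f : e ⟶ e') (x : K.C (e, e)),
      (θ e').hom.app ((K.diag.map f).obj x) ≫
        (t₂.iso (e := (e, e)) (e' := (e', e')) (f, f)).hom.app x =
      (t₁.iso (e := (e, e)) (e' := (e', e')) (f, f)).hom.app x ≫ (θ e).hom.app x) :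
    ∃ Θ : ∀ p, t₁.leg p ≅ t₂.leg p, (∀ ⦃p q : E × E⦄ (f : p ⟶ q) (x : K.C p),
      (Θ q).hom.app ((K.map f).obj x) ≫ (t₂.iso f).hom.app x =
        (t₁.iso f).hom.app x ≫ (Θ p).hom.app x) ∧ ∀ e x, (Θ (e, e)).hom.app x = (θ e).hom.app x :=
          by
  have := IsSifted₂₁.cofinal_diagonal (E := E) (LinCat.{u} R) K.toPseudofunctor ⟨T⟩
  let φ : (BiCocone.restrict (diagonal E) K.toPseudofunctor ⟨T⟩).obj t₁.toBiCocone ⟶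
      (BiCocone.restrict (diagonal E) K.toPseudofunctor ⟨T⟩).obj t₂.toBiCocone :=
    { app := fun e => LinCat.Hom₂.mk (θ e)
      comm := fun f => LinCat.hom₂_ext fun x => hθ f x }
  let Φ := (BiCocone.restrict (diagonal E) K.toPseudofunctor ⟨T⟩).preimage φ
  refine ⟨fun p => LinCat.Hom₂.iso (BiCocone.Hom.app Φ p), fun p q f x =>
    congrArg (fun γ => (LinCat.Hom₂.iso γ).hom.app x) (BiCocone.Hom.comm Φ f), fun e x => ?_⟩
  have h := (BiCocone.restrict (diagonal E) K.toPseudofunctor ⟨T⟩).map_preimage φ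
  exact congrArg (fun γ => (LinCat.Hom₂.iso (BiCocone.Hom.app γ e)).hom.app x) h

end IsSifted₂₁

end

end

section

section

variable {E : Type u} [Bicategory.{u, u} E]

/-- The pseudofunctor to sets with values the truth values of the existence of 1-cells out of two
given objects. -/
@[reducible] def reachable (a b : E) : E × E ⥤ᵖ LocallyDiscrete (Type u) where
  obj p := ⟨ULift (PLift (Nonempty (a ⟶ p.1) ∧ Nonempty (b ⟶ p.2)))⟩
  map {p q} f := ⟨↾fun h => ⟨⟨⟨h.down.down.1.some ≫ f.1⟩, ⟨h.down.down.2.some ≫ f.2⟩⟩⟩⟩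
  map₂ η := eqToHom (by congr 1)
  mapId p := eqToIso (by
    apply Discrete.ext
    ext; apply Subsingleton.elim)
  mapComp f g := eqToIso (by
    apply Discrete.ext
    ext; apply Subsingleton.elim)
  map₂_id _ := Subsingleton.elim _ _
  map₂_comp _ _ := Subsingleton.elim _ _
  map₂_whisker_left _ _ _ _ := Subsingleton.elim _ _
  map₂_whisker_right _ _ := Subsingleton.elim _ _
  map₂_associator _ _ _ := Subsingleton.elim _ _
  map₂_left_unitor _ := Subsingleton.elim _ _
  map₂_right_unitor _ := Subsingleton.elim _ _

/-- The constant pseudo-cocones under `reachable`. -/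
@[reducible] def reachableCocone (a b : E) (z : Bool) :
    BiCocone (reachable a b) ⟨ULift.{u} Bool⟩ where
  leg p := ⟨↾fun _ => ⟨z⟩⟩
  legIso f := eqToIso rfl
  naturality _ := Subsingleton.elim _ _
  legIso_id _ := Subsingleton.elim _ _
  legIso_comp _ _ := Subsingleton.elim _ _

namespace IsSifted₂₁

lemma locallyDiscrete_isLocallyGroupoid (C : Type*) [Category* C] :
    IsLocallyGroupoid (LocallyDiscrete C) := fun _ _ =>
  ⟨fun {f g} η => ⟨eqToHom (Discrete.ext (Discrete.eq_of_hom η).symm), Subsingleton.elim _ _,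
    Subsingleton.elim _ _⟩⟩

/-- Any two objects of a sifted (2,1)-category map to a common object. -/
lemma exists_cospan [IsSifted₂₁ E] (a b : E) : ∃ e : E, Nonempty (a ⟶ e) ∧ Nonempty (b ⟶ e) := by
  by_contra hne
  have := locallyDiscrete_isLocallyGroupoid (Type u)
  have := IsSifted₂₁.cofinal_diagonal (E := E) (LocallyDiscrete (Type u)) (reachable a b)
    ⟨ULift Bool⟩
  let φ : (BiCocone.restrict (diagonal E) (reachable a b) ⟨ULift Bool⟩).obj
      (reachableCocone a b true) ⟶
      (BiCocone.restrict (diagonal E) (reachable a b) ⟨ULift Bool⟩).obj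
        (reachableCocone a b false) :=
    { app := fun e => eqToHom (by
        apply Discrete.ext
        ext h
        exact absurd ⟨e, h.down.down⟩ hne)
      comm := fun _ => Subsingleton.elim _ _ }
  have h := Discrete.eq_of_hom (BiCocone.Hom.app
    ((BiCocone.restrict (diagonal E) (reachable a b) ⟨ULift Bool⟩).preimage φ) (a, b))
  have h' := congrArg (fun γ => (γ ⟨⟨⟨𝟙 a⟩, ⟨𝟙 b⟩⟩⟩ : ULift Bool).down) h
  exact Bool.noConfusion h'

variable {R : Type} [CommRing R]

/-- The restriction of a bicolimit to the diagonal is a bicolimit. -/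
lemma isColim_diag [IsSifted₂₁ E] {K : LinDiag.{u} R (E × E)} {L : Type u} [Category.{u} L]
    [Preadditive L] [Linear R L] {d : LinCocone K L} (h : d.IsColim) : d.diag.IsColim := by
  refine ⟨fun X => ?_, fun T _ _ _ t => ?_, fun T _ _ _ F G _ _ _ _ θ hθ => ?_⟩
  · obtain ⟨⟨a, b⟩, x, ⟨i⟩⟩ := h.ess X
    obtain ⟨e, ⟨f⟩, ⟨g⟩⟩ := exists_cospan a b
    let p : (a, b) ⟶ (e, e) := (f, g)
    exact ⟨e, (K.map p).obj x, ⟨(d.iso p).app x ≪≫ i⟩⟩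
  · obtain ⟨s, φ, hφ⟩ := exists_extension t
    obtain ⟨F, _, _, σ, hσ⟩ := h.desc T s
    refine ⟨F, inferInstance, inferInstance, fun e => σ (e, e) ≪≫ φ e, fun e e' f x => ?_⟩
    have h₁ := hσ (e := (e, e)) (e' := (e', e')) (f, f) x
    have h₂ := hφ f x
    change ((σ (e', e')).hom.app _ ≫ (φ e').hom.app _) ≫ _ = _ ≫ (σ (e, e)).hom.app x ≫ _
    rw [Category.assoc]
    exact (congrArg (_ ≫ ·) h₂).trans ((Category.assoc _ _ _).symm.trans
      ((congrArg (· ≫ _) h₁).trans (Category.assoc _ _ _)))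
  · obtain ⟨Θ, hΘ, hΘ'⟩ := exists_iso_extension (d.whisker F) (d.whisker G) θ
      (fun e e' f x => hθ f x)
    obtain ⟨α, hα⟩ := h.ext T F G Θ (fun e e' f x => hΘ f x)
    exact ⟨α, fun e x => (hα (e, e) x).trans (hΘ' e x)⟩

end IsSifted₂₁

end

end

section

section

variable {R : Type} [CommRing R] {E : Type u} [Bicategory.{u, u} E]
variable {T : Type u} [Category.{u} T] [Preadditive T] [Linear R T]
variable {Y : Type u} [Category.{u} Y] [Preadditive Y] [Linear R Y]

namespace LinCocone

/-- The restriction of a cocone under a constant diagram along the first projection. -/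
@[reducible] def constFst (t : LinCocone (LinDiag.const R E Y) T) :
    LinCocone (LinDiag.const R (E × E) Y) T where
  leg p := t.leg p.1
  leg_additive p := t.leg_additive p.1
  leg_linear p := t.leg_linear p.1
  iso f := t.iso f.1
  map₂ η x := t.map₂ η.1 x
  id p x := t.id p.1 x
  comp f g x := t.comp f.1 g.1 x

/-- The restriction of a cocone under a constant diagram along the second projection. -/
@[reducible] def constSnd (t : LinCocone (LinDiag.const R E Y) T) :
    LinCocone (LinDiag.const R (E × E) Y) T where
  leg p := t.leg p.2
  leg_additive p := t.leg_additive p.2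
  leg_linear p := t.leg_linear p.2
  iso f := t.iso f.2
  map₂ η x := t.map₂ η.2 x
  id p x := t.id p.2 x
  comp f g x := t.comp f.2 g.2 x

end LinCocone

/-- A linear category is the bicolimit of the constant sifted diagram at it. -/
lemma IsSifted₂₁.isColim_const [IsSifted₂₁ E] : (LinCocone.const R E Y).IsColim := by
  obtain ⟨e₀⟩ := IsSifted₂₁.nonempty (E := E)
  refine ⟨fun X => ⟨e₀, X, ⟨Iso.refl _⟩⟩, fun T _ _ _ t => ?_, fun T _ _ _ F G _ _ _ _ θ hθ => ?_⟩
  · obtain ⟨Θ, hΘ, -⟩ := IsSifted₂₁.exists_iso_extension t.constFst t.constSnd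
      (fun e => Iso.refl _) (fun e e' f x => (Category.id_comp _).trans (Category.comp_id _).symm)
    refine ⟨t.leg e₀, t.leg_additive e₀, t.leg_linear e₀,
      fun e => Functor.leftUnitor _ ≪≫ Θ (e₀, e), fun e e' f x => ?_⟩
    have h₁ := hΘ (p := (e₀, e)) (q := (e₀, e')) (𝟙 e₀, f) x
    have h₂ : (t.iso (𝟙 e₀)).hom.app x = 𝟙 _ := (t.id e₀ x).trans
      (CategoryTheory.Functor.map_id _ _)
    have h₃ : (t.leg e₀).map (𝟙 x) = 𝟙 _ := CategoryTheory.Functor.map_id _ _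
    refine (congrArg (· ≫ _) (Category.id_comp _)).trans (h₁.trans ?_)
    refine (congrArg (· ≫ _) (h₂.trans h₃.symm)).trans (congrArg (_ ≫ ·) (Category.id_comp _).symm)
  · have hθ' {e e' : E} (f : e ⟶ e') (x : Y) : (θ e').hom.app x = (θ e).hom.app x := by
      have h₁ := hθ f x
      have h₂ : F.map (𝟙 x) = 𝟙 _ := F.map_id x
      have h₃ : G.map (𝟙 x) = 𝟙 _ := G.map_id x
      refine (Category.comp_id _).symm.trans ((congrArg (_ ≫ ·) h₃.symm).trans (h₁.trans ?_))
      exact (congrArg (· ≫ _) h₂).trans (Category.id_comp _)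
    refine ⟨θ e₀, fun e x => ?_⟩
    obtain ⟨e', ⟨f⟩, ⟨g⟩⟩ := IsSifted₂₁.exists_cospan e₀ e
    exact (hθ' f x).symm.trans (hθ' g x)

end

/-! ### Products of bicolimits -/

section

variable {R : Type} [CommRing R] {E : Type u} [Bicategory.{u, u} E] {E' : Type u}
  [Bicategory.{u, u} E']

/-- The external tensor product of two diagrams. -/
@[reducible] def LinDiag.extTensor (D : LinDiag.{u} R E) (D' : LinDiag.{u} R E') :
    LinDiag.{u} R (E × E') where
  C e := LinTensor R (D.C e.1) (D'.C e.2)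
  map f := LinTensor.mapFunctor (R := R) (D.map f.1) (D'.map f.2)
  map₂ η := LinTensor.mapNat (D.map₂ η.1) (D'.map₂ η.2)
  mapId e := LinTensor.natIsoMk _ _
    (fun X => LinTensor.isoMk (X := ⟨_, _⟩) (Y := X) ((D.mapId e.1).app X.fst)
      ((D'.mapId e.2).app X.snd))
    (fun X Y a b => LinTensor.tmul_congr (X := ⟨_, _⟩) ((D.mapId e.1).hom.naturality a)
      ((D'.mapId e.2).hom.naturality b))
  mapComp f g := LinTensor.natIsoMk _ _
    (fun X => LinTensor.isoMk (X := ⟨_, _⟩) (Y := ⟨_, _⟩) ((D.mapComp f.1 g.1).app X.fst)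
      ((D'.mapComp f.2 g.2).app X.snd))
    (fun X Y a b => LinTensor.tmul_congr (X := ⟨_, _⟩) (Y := ⟨_, _⟩)
      ((D.mapComp f.1 g.1).hom.naturality a) ((D'.mapComp f.2 g.2).hom.naturality b))
  map₂_id f x := LinTensor.tmul_congr (D.map₂_id f.1 x.fst) (D'.map₂_id f.2 x.snd)
  map₂_comp η θ x := LinTensor.tmul_congr (D.map₂_comp η.1 θ.1 x.fst) (D'.map₂_comp η.2 θ.2 x.snd)
  whiskerLeft f _ _ η x := LinTensor.tmul_congr (X := ⟨_, _⟩) (Y := ⟨_, _⟩)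
    (D.whiskerLeft f.1 η.1 x.fst) (D'.whiskerLeft f.2 η.2 x.snd)
  whiskerRight η h x := LinTensor.tmul_congr (X := ⟨_, _⟩) (Y := ⟨_, _⟩)
    (D.whiskerRight η.1 h.1 x.fst) (D'.whiskerRight η.2 h.2 x.snd)
  associator f g h x := LinTensor.tmul_congr (X := ⟨_, _⟩) (Y := ⟨_, _⟩)
    (D.associator f.1 g.1 h.1 x.fst) (D'.associator f.2 g.2 h.2 x.snd)
  leftUnitor f x := LinTensor.tmul_congr (D.leftUnitor f.1 x.fst) (D'.leftUnitor f.2 x.snd)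
  rightUnitor f x := LinTensor.tmul_congr (D.rightUnitor f.1 x.fst) (D'.rightUnitor f.2 x.snd)

variable {D : LinDiag.{u} R E} {D' : LinDiag.{u} R E'}
variable {L : Type u} [Category.{u} L] [Preadditive L] [Linear R L]
variable {L' : Type u} [Category.{u} L'] [Preadditive L'] [Linear R L']
variable {T : Type u} [Category.{u} T] [Preadditive T] [Linear R T]

namespace LinCocone

/-- The external tensor product of two cocones. -/
@[reducible] def extTensor (d : LinCocone D L) (d' : LinCocone D' L') :
    LinCocone (D.extTensor D') (LinTensor R L L') where
  leg e := LinTensor.mapFunctor (R := R) (d.leg e.1) (d'.leg e.2)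
  leg_additive e := inferInstanceAs (LinTensor.mapFunctor (d.leg e.1) (d'.leg e.2)).Additive
  leg_linear e := inferInstanceAs ((LinTensor.mapFunctor (d.leg e.1) (d'.leg e.2)).Linear R)
  iso {e e'} f := LinTensor.natIsoMk
    (LinTensor.mapFunctor (R := R) (D.map f.1) (D'.map f.2) ⋙
      LinTensor.mapFunctor (R := R) (d.leg e'.1) (d'.leg e'.2))
    (LinTensor.mapFunctor (R := R) (d.leg e.1) (d'.leg e.2))
    (fun X => LinTensor.isoMk (X := ⟨_, _⟩) (Y := ⟨_, _⟩) ((d.iso f.1).app X.fst)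
      ((d'.iso f.2).app X.snd))
    (fun X Y a b => LinTensor.tmul_congr (X := ⟨_, _⟩) (Y := ⟨_, _⟩)
      ((d.iso f.1).hom.naturality a) ((d'.iso f.2).hom.naturality b))
  map₂ η x := LinTensor.tmul_congr (X := ⟨_, _⟩) (Y := ⟨_, _⟩)
    (d.map₂ η.1 x.fst) (d'.map₂ η.2 x.snd)
  id e x := LinTensor.tmul_congr (X := ⟨_, _⟩) (Y := ⟨_, _⟩) (d.id e.1 x.fst) (d'.id e.2 x.snd)
  comp f g x := LinTensor.tmul_congr (X := ⟨_, _⟩) (Y := ⟨_, _⟩)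
    (d.comp f.1 g.1 x.fst) (d'.comp f.2 g.2 x.snd)

end LinCocone

end

end

section

section

variable {R : Type} [CommRing R]
variable {C C' T : Type u} [Category.{u} C] [Preadditive C] [Linear R C]
  [Category.{u} C'] [Preadditive C'] [Linear R C'] [Category.{u} T] [Preadditive T] [Linear R T]

namespace LinTensor

/-- The value of a functor on a tensor product at a pair of objects. -/
abbrev objPair (G : LinTensor R C C' ⥤ T) (x : C) (y : C') : T := G.obj ⟨x, y⟩

/-- The value of a functor on a tensor product at a pair of morphisms. -/
def mapPair (G : LinTensor R C C' ⥤ T) {x x' : C} {y y' : C'} (u : x ⟶ x') (v : y ⟶ y') :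
    objPair G x y ⟶ objPair G x' y' :=
  G.map (tmul (X := ⟨x, y⟩) (Y := ⟨x', y'⟩) u v)

variable (G : LinTensor R C C' ⥤ T)

@[simp] lemma mapPair_id (x : C) (y : C') : mapPair G (𝟙 x) (𝟙 y) = 𝟙 (objPair G x y) :=
  G.map_id ⟨x, y⟩

lemma mapPair_comp {x x' x'' : C} {y y' y'' : C'} (u : x ⟶ x') (u' : x' ⟶ x'') (v : y ⟶ y')
    (v' : y' ⟶ y'') : mapPair G (u ≫ u') (v ≫ v') = mapPair G u v ≫ mapPair G u' v' :=
  G.map_comp (tmul (X := ⟨x, y⟩) (Y := ⟨x', y'⟩) u v) (tmul (X := ⟨x', y'⟩) (Y := ⟨x'', y''⟩) u' v')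

/-- The value of a functor on a tensor product at a pair of isomorphisms. -/
@[simps] def mapIsoPair {x x' : C} {y y' : C'} (u : x ≅ x') (v : y ≅ y') :
    objPair G x y ≅ objPair G x' y' where
  hom := mapPair G u.hom v.hom
  inv := mapPair G u.inv v.inv
  hom_inv_id := by rw [← mapPair_comp]; simp
  inv_hom_id := by rw [← mapPair_comp]; simp

lemma mapPair_mapPair_assoc {x x' x'' : C} {y y' y'' : C'} (u : x ⟶ x') (u' : x' ⟶ x'')
    (v : y ⟶ y') (v' : y' ⟶ y'') {Z : T} (h : objPair G x'' y'' ⟶ Z) :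
    mapPair G u v ≫ mapPair G u' v' ≫ h = mapPair G (u ≫ u') (v ≫ v') ≫ h := by
  rw [mapPair_comp, Category.assoc]

instance {x x' : C} {y y' : C'} (u : x ⟶ x') (v : y ⟶ y') [IsIso u] [IsIso v] :
    IsIso (mapPair G u v) :=
  (mapIsoPair G (asIso u) (asIso v)).isIso_hom

end LinTensor

end

open LinTensor

section

variable {R : Type} [CommRing R] {E : Type u} [Bicategory.{u, u} E] {E' : Type u}
  [Bicategory.{u, u} E']
variable {D : LinDiag.{u} R E} {D' : LinDiag.{u} R E'}
variable {L : Type u} [Category.{u} L] [Preadditive L] [Linear R L]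
variable {L' : Type u} [Category.{u} L'] [Preadditive L'] [Linear R L']
variable {T : Type u} [Category.{u} T] [Preadditive T] [Linear R T]

namespace LinCocone

/-- A leg of a cocone under an external tensor product. -/
abbrev extLeg (t : LinCocone (D.extTensor D') T) (a : E) (b : E') :
    LinTensor R (D.C a) (D'.C b) ⥤ T :=
  t.leg (a, b)

instance (t : LinCocone (D.extTensor D') T) (a : E) (b : E') : (t.extLeg a b).Additive :=
  t.leg_additive (a, b)

/-- The component of a structure isomorphism of a cocone under an external tensor product. -/
def extIso (t : LinCocone (D.extTensor D') T) {a a' : E} {b b' : E'} (f : a ⟶ a') (g : b ⟶ b')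
    (x : D.C a) (y : D'.C b) :
    objPair (t.extLeg a' b') ((D.map f).obj x) ((D'.map g).obj y) ≅ objPair (t.extLeg a b) x y :=
  (t.iso (e := (a, b)) (e' := (a', b')) (f, g)).app ⟨x, y⟩

variable (t : LinCocone (D.extTensor D') T)

lemma extIso_naturality {a a' : E} {b b' : E'} (f : a ⟶ a') (g : b ⟶ b') {x x' : D.C a}
    {y y' : D'.C b} (u : x ⟶ x') (v : y ⟶ y') :
    mapPair (t.extLeg a' b') ((D.map f).map u) ((D'.map g).map v) ≫ (t.extIso f g x' y').hom =
      (t.extIso f g x y).hom ≫ mapPair (t.extLeg a b) u v :=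
  (t.iso (e := (a, b)) (e' := (a', b')) (f, g)).hom.naturality
    (X := ⟨x, y⟩) (Y := ⟨x', y'⟩) (LinTensor.tmul u v)

lemma extIso_map₂ {a a' : E} {b b' : E'} {f f' : a ⟶ a'} {g g' : b ⟶ b'} (η : f ⟶ f') (θ : g ⟶ g')
    (x : D.C a) (y : D'.C b) :
    mapPair (t.extLeg a' b') ((D.map₂ η).app x) ((D'.map₂ θ).app y) ≫ (t.extIso f' g' x y).hom =
      (t.extIso f g x y).hom :=
  t.map₂ (e := (a, b)) (e' := (a', b')) (f := (f, g)) (g := (f', g')) (η, θ) ⟨x, y⟩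

lemma extIso_id (a : E) (b : E') (x : D.C a) (y : D'.C b) : (t.extIso (𝟙 a) (𝟙 b) x y).hom =
    mapPair (t.extLeg a b) ((D.mapId a).app x).hom ((D'.mapId b).app y).hom :=
  t.id (a, b) ⟨x, y⟩

lemma extIso_comp {a a' a'' : E} {b b' b'' : E'} (f : a ⟶ a') (f' : a' ⟶ a'') (g : b ⟶ b')
    (g' : b' ⟶ b'') (x : D.C a) (y : D'.C b) : (t.extIso (f ≫ f') (g ≫ g') x y).hom =
      mapPair (t.extLeg a'' b'') ((D.mapComp f f').app x).hom ((D'.mapComp g g').app y).hom ≫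
        (t.extIso f' g' ((D.map f).obj x) ((D'.map g).obj y)).hom ≫ (t.extIso f g x y).hom :=
  t.comp (e := (a, b)) (e' := (a', b')) (e'' := (a'', b'')) (f, g) (f', g') ⟨x, y⟩

/-- The component of the structure isomorphism for a morphism in the second variable. -/
def rowIso (a : E) {b b' : E'} (g : b ⟶ b') (x : D.C a) (y : D'.C b) :
    objPair (t.extLeg a b') x ((D'.map g).obj y) ≅ objPair (t.extLeg a b) x y :=
  mapIsoPair (t.extLeg a b') ((D.mapId a).app x).symm (Iso.refl _) ≪≫ t.extIso (𝟙 a) g x y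

/-- The component of the structure isomorphism for a morphism in the first variable. -/
def colIso {a a' : E} (f : a ⟶ a') (b : E') (x : D.C a) (y : D'.C b) :
    objPair (t.extLeg a' b) ((D.map f).obj x) y ≅ objPair (t.extLeg a b) x y :=
  mapIsoPair (t.extLeg a' b) (Iso.refl _) ((D'.mapId b).app y).symm ≪≫ t.extIso f (𝟙 b) x y

lemma rowIso_hom (a : E) {b b' : E'} (g : b ⟶ b') (x : D.C a) (y : D'.C b) :
    (t.rowIso a g x y).hom = mapPair (t.extLeg a b') ((D.mapId a).app x).inv (𝟙 _) ≫
      (t.extIso (𝟙 a) g x y).hom := rfl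

lemma colIso_hom {a a' : E} (f : a ⟶ a') (b : E') (x : D.C a) (y : D'.C b) :
    (t.colIso f b x y).hom = mapPair (t.extLeg a' b) (𝟙 _) ((D'.mapId b).app y).inv ≫
      (t.extIso f (𝟙 b) x y).hom := rfl

lemma rowIso_naturality (a : E) {b b' : E'} (g : b ⟶ b') {x x' : D.C a} {y y' : D'.C b}
    (u : x ⟶ x') (v : y ⟶ y') :
    mapPair (t.extLeg a b') u ((D'.map g).map v) ≫ (t.rowIso a g x' y').hom =
      (t.rowIso a g x y).hom ≫ mapPair (t.extLeg a b) u v := by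
  rw [rowIso_hom, rowIso_hom, Category.assoc, ← extIso_naturality, ← Category.assoc,
    ← Category.assoc, ← mapPair_comp, ← mapPair_comp]
  have h : u ≫ ((D.mapId a).app x').inv = ((D.mapId a).app x).inv ≫ (D.map (𝟙 a)).map u :=
    (D.mapId a).inv.naturality u
  rw [h, Category.comp_id, Category.id_comp]

lemma colIso_naturality {a a' : E} (f : a ⟶ a') (b : E') {x x' : D.C a} {y y' : D'.C b}
    (u : x ⟶ x') (v : y ⟶ y') :
    mapPair (t.extLeg a' b) ((D.map f).map u) v ≫ (t.colIso f b x' y').hom =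
      (t.colIso f b x y).hom ≫ mapPair (t.extLeg a b) u v := by
  rw [colIso_hom, colIso_hom, Category.assoc, ← extIso_naturality, ← Category.assoc,
    ← Category.assoc, ← mapPair_comp, ← mapPair_comp]
  have h : v ≫ ((D'.mapId b).app y').inv = ((D'.mapId b).app y).inv ≫ (D'.map (𝟙 b)).map v :=
    (D'.mapId b).inv.naturality v
  rw [h, Category.comp_id, Category.id_comp]

lemma rowIso_map₂ (a : E) {b b' : E'} {g g' : b ⟶ b'} (θ : g ⟶ g') (x : D.C a) (y : D'.C b) :
    mapPair (t.extLeg a b') (𝟙 x) ((D'.map₂ θ).app y) ≫ (t.rowIso a g' x y).hom =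
      (t.rowIso a g x y).hom := by
  rw [rowIso_hom, rowIso_hom, ← t.extIso_map₂ (𝟙 (𝟙 a)) θ, ← Category.assoc,
    ← Category.assoc, ← mapPair_comp, ← mapPair_comp, D.map₂_id]
  simp only [Category.comp_id, Category.id_comp]

lemma colIso_map₂ {a a' : E} {f f' : a ⟶ a'} (η : f ⟶ f') (b : E') (x : D.C a) (y : D'.C b) :
    mapPair (t.extLeg a' b) ((D.map₂ η).app x) (𝟙 y) ≫ (t.colIso f' b x y).hom =
      (t.colIso f b x y).hom := by
  rw [colIso_hom, colIso_hom, ← t.extIso_map₂ η (𝟙 (𝟙 b)), ← Category.assoc,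
    ← Category.assoc, ← mapPair_comp, ← mapPair_comp, D'.map₂_id]
  simp only [Category.comp_id, Category.id_comp]

lemma rowIso_id (a : E) (b : E') (x : D.C a) (y : D'.C b) :
    (t.rowIso a (𝟙 b) x y).hom = mapPair (t.extLeg a b) (𝟙 x) ((D'.mapId b).app y).hom := by
  rw [rowIso_hom, extIso_id, ← mapPair_comp, Category.id_comp, Iso.inv_hom_id]
  rfl

lemma colIso_id (a : E) (b : E') (x : D.C a) (y : D'.C b) :
    (t.colIso (𝟙 a) b x y).hom = mapPair (t.extLeg a b) ((D.mapId a).app x).hom (𝟙 y) := by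
  rw [colIso_hom, extIso_id, ← mapPair_comp, Category.id_comp, Iso.inv_hom_id]
  rfl

lemma extIso_comp_id_fst (a : E) {b b' b'' : E'} (g : b ⟶ b') (g' : b' ⟶ b'') (x : D.C a)
    (y : D'.C b) : mapPair (t.extLeg a b'') ((D.map (𝟙 a)).map ((D.mapId a).app x).hom) (𝟙 _) ≫
      (t.extIso (𝟙 a) (g ≫ g') x y).hom =
    mapPair (t.extLeg a b'') (𝟙 _) ((D'.mapComp g g').app y).hom ≫
      (t.extIso (𝟙 a) g' ((D.map (𝟙 a)).obj x) ((D'.map g).obj y)).hom ≫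
        (t.extIso (𝟙 a) g x y).hom := by
  have h₁ := t.extIso_map₂ (λ_ (𝟙 a)).hom (𝟙 (g ≫ g')) x y
  rw [t.extIso_comp, D'.map₂_id, D.leftUnitor] at h₁
  rw [← cancel_epi (mapIsoPair (t.extLeg a b'') ((D.mapComp (𝟙 a) (𝟙 a)).app x) (Iso.refl _)).hom]
  simp only [mapIsoPair_hom, Iso.refl_hom]
  rw [← Category.assoc, ← Category.assoc, ← mapPair_comp, ← mapPair_comp]
  simp only [Category.comp_id, Category.id_comp]
  erw [Category.comp_id]
  exact h₁

lemma extIso_comp_id_snd {a a' a'' : E} (f : a ⟶ a') (f' : a' ⟶ a'') (b : E') (x : D.C a)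
    (y : D'.C b) : mapPair (t.extLeg a'' b) (𝟙 _) ((D'.map (𝟙 b)).map ((D'.mapId b).app y).hom) ≫
      (t.extIso (f ≫ f') (𝟙 b) x y).hom =
    mapPair (t.extLeg a'' b) ((D.mapComp f f').app x).hom (𝟙 _) ≫
      (t.extIso f' (𝟙 b) ((D.map f).obj x) ((D'.map (𝟙 b)).obj y)).hom ≫
        (t.extIso f (𝟙 b) x y).hom := by
  have h₁ := t.extIso_map₂ (𝟙 (f ≫ f')) (λ_ (𝟙 b)).hom x y
  rw [t.extIso_comp, D.map₂_id, D'.leftUnitor] at h₁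
  rw [← cancel_epi (mapIsoPair (t.extLeg a'' b) (Iso.refl _) ((D'.mapComp (𝟙 b) (𝟙 b)).app y)).hom]
  simp only [mapIsoPair_hom, Iso.refl_hom]
  rw [← Category.assoc, ← Category.assoc, ← mapPair_comp, ← mapPair_comp]
  simp only [Category.comp_id, Category.id_comp]
  erw [Category.comp_id]
  exact h₁

lemma rowIso_comp (a : E) {b b' b'' : E'} (g : b ⟶ b') (g' : b' ⟶ b'') (x : D.C a) (y : D'.C b) :
    (t.rowIso a (g ≫ g') x y).hom =
      mapPair (t.extLeg a b'') (𝟙 x) ((D'.mapComp g g').app y).hom ≫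
        (t.rowIso a g' x ((D'.map g).obj y)).hom ≫ (t.rowIso a g x y).hom := by
  have h₁ := t.extIso_comp_id_fst a g g' x y
  have h₂ := t.extIso_naturality (𝟙 a) g' ((D.mapId a).app x).inv (𝟙 ((D'.map g).obj y))
  have h₃ : (t.extIso (𝟙 a) (g ≫ g') x y).hom =
      mapPair (t.extLeg a b'') ((D.map (𝟙 a)).map ((D.mapId a).app x).inv) (𝟙 _) ≫
        mapPair (t.extLeg a b'') (𝟙 _) ((D'.mapComp g g').app y).hom ≫
          (t.extIso (𝟙 a) g' ((D.map (𝟙 a)).obj x) ((D'.map g).obj y)).hom ≫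
            (t.extIso (𝟙 a) g x y).hom := by
    rw [← h₁, ← Category.assoc, ← mapPair_comp, ← Functor.map_comp, Iso.inv_hom_id]
    simp
  rw [rowIso_hom, rowIso_hom, rowIso_hom, h₃]
  simp only [Category.assoc]
  rw [← reassoc_of% h₂]
  simp only [← Category.assoc, ← mapPair_comp]
  simp only [Category.id_comp, Category.comp_id, CategoryTheory.Functor.map_id]
  erw [Category.comp_id]

lemma colIso_comp {a a' a'' : E} (f : a ⟶ a') (f' : a' ⟶ a'') (b : E') (x : D.C a) (y : D'.C b) :
    (t.colIso (f ≫ f') b x y).hom =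
      mapPair (t.extLeg a'' b) ((D.mapComp f f').app x).hom (𝟙 y) ≫
        (t.colIso f' b ((D.map f).obj x) y).hom ≫ (t.colIso f b x y).hom := by
  have h₁ := t.extIso_comp_id_snd f f' b x y
  have h₂ := t.extIso_naturality f' (𝟙 b) (𝟙 ((D.map f).obj x)) ((D'.mapId b).app y).inv
  have h₃ : (t.extIso (f ≫ f') (𝟙 b) x y).hom =
      mapPair (t.extLeg a'' b) (𝟙 _) ((D'.map (𝟙 b)).map ((D'.mapId b).app y).inv) ≫
        mapPair (t.extLeg a'' b) ((D.mapComp f f').app x).hom (𝟙 _) ≫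
          (t.extIso f' (𝟙 b) ((D.map f).obj x) ((D'.map (𝟙 b)).obj y)).hom ≫
            (t.extIso f (𝟙 b) x y).hom := by
    rw [← h₁, ← Category.assoc, ← mapPair_comp, ← Functor.map_comp, Iso.inv_hom_id]
    simp
  rw [colIso_hom, colIso_hom, colIso_hom, h₃]
  simp only [Category.assoc]
  rw [← reassoc_of% h₂]
  simp only [← Category.assoc, ← mapPair_comp]
  simp only [Category.id_comp, Category.comp_id, CategoryTheory.Functor.map_id]
  erw [Category.comp_id]

lemma rowIso_colIso {a a' : E} (f : a ⟶ a') {b b' : E'} (g : b ⟶ b') (x : D.C a) (y : D'.C b) :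
    (t.rowIso a' g ((D.map f).obj x) y).hom ≫ (t.colIso f b x y).hom = (t.extIso f g x y).hom := by
  have h₁ := t.extIso_map₂ (ρ_ f).hom (λ_ g).hom x y
  rw [t.extIso_comp, D.rightUnitor, D'.leftUnitor, mapPair_comp, Category.assoc] at h₁
  have h₂ := (cancel_epi (mapIsoPair (t.extLeg a' b') ((D.mapComp f (𝟙 a')).app x)
    ((D'.mapComp (𝟙 b) g).app y)).hom).1 h₁
  have h₃ := t.extIso_naturality (𝟙 a') g (𝟙 ((D.map f).obj x)) ((D'.mapId b).app y).inv
  have h₄ : (t.extIso f g x y).hom = mapPair (t.extLeg a' b')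
      ((D.mapId a').app ((D.map f).obj x)).inv ((D'.map g).map ((D'.mapId b).app y).inv) ≫
        (t.extIso (𝟙 a') g ((D.map f).obj x) ((D'.map (𝟙 b)).obj y)).hom ≫
          (t.extIso f (𝟙 b) x y).hom := by
    rw [← h₂]
    exact ((mapIsoPair (t.extLeg a' b') ((D.mapId a').app ((D.map f).obj x))
      ((D'.map g).mapIso ((D'.mapId b).app y))).inv_hom_id_assoc _).symm
  rw [rowIso_hom, colIso_hom, h₄, Category.assoc, ← reassoc_of% h₃]
  simp only [← Category.assoc, ← mapPair_comp]
  simp only [Category.id_comp, Category.comp_id, CategoryTheory.Functor.map_id]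

lemma colIso_rowIso {a a' : E} (f : a ⟶ a') {b b' : E'} (g : b ⟶ b') (x : D.C a) (y : D'.C b) :
    (t.colIso f b' x ((D'.map g).obj y)).hom ≫ (t.rowIso a g x y).hom = (t.extIso f g x y).hom := by
  have h₁ := t.extIso_map₂ (λ_ f).hom (ρ_ g).hom x y
  rw [t.extIso_comp, D.leftUnitor, D'.rightUnitor, mapPair_comp, Category.assoc] at h₁
  have h₂ := (cancel_epi (mapIsoPair (t.extLeg a' b') ((D.mapComp (𝟙 a) f).app x)
    ((D'.mapComp g (𝟙 b')).app y)).hom).1 h₁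
  have h₃ := t.extIso_naturality f (𝟙 b') ((D.mapId a).app x).inv (𝟙 ((D'.map g).obj y))
  have h₄ : (t.extIso f g x y).hom = mapPair (t.extLeg a' b')
      ((D.map f).map ((D.mapId a).app x).inv) ((D'.mapId b').app ((D'.map g).obj y)).inv ≫
        (t.extIso f (𝟙 b') ((D.map (𝟙 a)).obj x) ((D'.map g).obj y)).hom ≫
          (t.extIso (𝟙 a) g x y).hom := by
    rw [← h₂]
    exact ((mapIsoPair (t.extLeg a' b') ((D.map f).mapIso ((D.mapId a).app x))
      ((D'.mapId b').app ((D'.map g).obj y))).inv_hom_id_assoc _).symm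
  rw [rowIso_hom, colIso_hom, h₄, Category.assoc, ← reassoc_of% h₃]
  simp only [← Category.assoc, ← mapPair_comp]
  simp only [Category.id_comp, Category.comp_id, CategoryTheory.Functor.map_id]

end LinCocone

end

end

section

open LinTensor

section

variable {R : Type} [CommRing R] {E : Type u} [Bicategory.{u, u} E] {E' : Type u}
  [Bicategory.{u, u} E']
variable {D : LinDiag.{u} R E} {D' : LinDiag.{u} R E'}
variable {L : Type u} [Category.{u} L] [Preadditive L] [Linear R L]
variable {L' : Type u} [Category.{u} L'] [Preadditive L'] [Linear R L']
variable {T : Type u} [Category.{u} T] [Preadditive T] [Linear R T]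

namespace LinTensor

variable {C C' : Type u} [Category.{u} C] [Preadditive C] [Linear R C]
  [Category.{u} C'] [Preadditive C'] [Linear R C']

/-- A natural isomorphism of functors on a tensor product, from its components at pairs. -/
def natIsoPair (F G : LinTensor R C C' ⥤ T) [F.Additive] [G.Additive]
    (app : ∀ x y, objPair F x y ≅ objPair G x y)
    (h : ∀ {x x' y y'} (u : x ⟶ x') (v : y ⟶ y'),
      mapPair F u v ≫ (app x' y').hom = (app x y).hom ≫ mapPair G u v) : F ≅ G :=
  natIsoMk F G (fun X => app X.fst X.snd) (fun X Y a b => h a b)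

end LinTensor

namespace LinCocone

lemma comp_eq_comp_assoc {C : Type*} [Category* C] {X Y Z W V : C} {a : X ⟶ Y} {b : Y ⟶ Z}
    {c : X ⟶ W} {d : W ⟶ Z} (h : a ≫ b = c ≫ d) (r : Z ⟶ V) : a ≫ b ≫ r = c ≫ d ≫ r := by
  rw [← Category.assoc, h, Category.assoc]

lemma comp_square' {C : Type*} [Category* C] {X Y Z X' Y' Z' : C} {f : X ⟶ Y} {g : Y ⟶ Z}
    {f' : X' ⟶ Y'} {g' : Y' ⟶ Z'} {a : X ⟶ X'} {b : Y ⟶ Y'} {c : Z ⟶ Z'} (h₁ : a ≫ f' = f ≫ b)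
    (h₂ : b ≫ g' = g ≫ c) : a ≫ f' ≫ g' = (f ≫ g) ≫ c := by
  rw [Category.assoc, ← h₂, reassoc_of% h₁]

lemma IsColim.forall_of_leg {d : LinCocone D L} (h : d.IsColim) {P : L → Prop}
    (hP : ∀ z z', (z ≅ z') → P z → P z') (H : ∀ e x, P ((d.leg e).obj x)) (z : L) : P z := by
  obtain ⟨e, x, ⟨i⟩⟩ := h.ess z
  exact hP _ _ i (H e x)

/-- The cocone in the second variable obtained from a cocone under an external tensor product by
fixing an object in the first variable. -/
@[reducible] def row (t : LinCocone (D.extTensor D') T) (a : E) :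
    LinCocone ((LinDiag.const R E' (D.C a)).tensor D') T where
  leg b := t.extLeg a b
  leg_additive b := t.leg_additive (a, b)
  leg_linear b := t.leg_linear (a, b)
  iso {b b'} g := natIsoPair (mapFunctor (R := R) (𝟭 (D.C a)) (D'.map g) ⋙ t.extLeg a b')
    (t.extLeg a b) (fun x y => t.rowIso a g x y) (fun u v => t.rowIso_naturality a g u v)
  map₂ θ X := t.rowIso_map₂ a θ X.fst X.snd
  id b X := t.rowIso_id a b X.fst X.snd
  comp g g' X := t.rowIso_comp a g g' X.fst X.snd

lemma IsColim.exists_row {d' : LinCocone D' L'} (h' : d'.IsColim)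
    (t : LinCocone (D.extTensor D') T) (a : E) :
    ∃ (F : LinTensor R (D.C a) L' ⥤ T) (_ : F.Additive) (_ : F.Linear R)
      (s : ∀ b x y, objPair F x ((d'.leg b).obj y) ≅ objPair (t.extLeg a b) x y),
      (∀ b x x' y y' (u : x ⟶ x') (v : y ⟶ y'), mapPair F u ((d'.leg b).map v) ≫ (s b x' y').hom =
        (s b x y).hom ≫ mapPair (t.extLeg a b) u v) ∧
      ∀ b b' (g : b ⟶ b') x y, (s b' x ((D'.map g).obj y)).hom ≫ (t.rowIso a g x y).hom =
        mapPair F (𝟙 x) ((d'.iso g).app y).hom ≫ (s b x y).hom := by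
  obtain ⟨F, _, _, σ, hσ⟩ := (h'.tensorLeft (D.C a)).desc T (t.row a)
  refine ⟨F, inferInstance, inferInstance, fun b x y => (σ b).app ⟨x, y⟩, fun b x x' y y' u v => ?_,
    fun b b' g x y => hσ g ⟨x, y⟩⟩
  exact (σ b).hom.naturality (X := ⟨x, y⟩) (Y := ⟨x', y'⟩) (tmul u v)

lemma IsColim.extPair {d' : LinCocone D' L'} (h' : d'.IsColim) {C Y Y' : Type u} [Category.{u} C]
    [Preadditive C] [Linear R C] [Category.{u} Y] [Preadditive Y] [Linear R Y] [Category.{u} Y']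
    [Preadditive Y'] [Linear R Y'] (P : C ⥤ Y) [P.Additive] [P.Linear R] (Q : C ⥤ Y') [Q.Additive]
    [Q.Linear R] (F : LinTensor R Y L' ⥤ T) (G : LinTensor R Y' L' ⥤ T) [F.Additive] [F.Linear R]
    [G.Additive] [G.Linear R]
    (θ : ∀ b x y, objPair F (P.obj x) ((d'.leg b).obj y) ≅ objPair G (Q.obj x) ((d'.leg b).obj y))
    (hθ : ∀ b x x' y y' (u : x ⟶ x') (v : y ⟶ y'),
      mapPair F (P.map u) ((d'.leg b).map v) ≫ (θ b x' y').hom =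
        (θ b x y).hom ≫ mapPair G (Q.map u) ((d'.leg b).map v))
    (hθ' : ∀ b b' (g : b ⟶ b') x y, (θ b' x ((D'.map g).obj y)).hom ≫
        mapPair G (𝟙 (Q.obj x)) ((d'.iso g).app y).hom =
      mapPair F (𝟙 (P.obj x)) ((d'.iso g).app y).hom ≫ (θ b x y).hom) :
    ∃ α : ∀ x z, objPair F (P.obj x) z ≅ objPair G (Q.obj x) z,
      (∀ x x' z z' (u : x ⟶ x') (v : z ⟶ z'), mapPair F (P.map u) v ≫ (α x' z').hom =
        (α x z).hom ≫ mapPair G (Q.map u) v) ∧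
      ∀ b x y, (α x ((d'.leg b).obj y)).hom = (θ b x y).hom := by
  obtain ⟨α, hα⟩ := (h'.tensorLeft C).ext T (mapFunctor (R := R) P (𝟭 L') ⋙ F)
    (mapFunctor (R := R) Q (𝟭 L') ⋙ G)
    (fun b => natIsoPair
      (mapFunctor (R := R) (𝟭 C) (d'.leg b) ⋙ mapFunctor (R := R) P (𝟭 L') ⋙ F)
      (mapFunctor (R := R) (𝟭 C) (d'.leg b) ⋙ mapFunctor (R := R) Q (𝟭 L') ⋙ G) (θ b)
      (fun u v => hθ b _ _ _ _ u v))
    (fun b b' g X => by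
      have h₁ := hθ' b b' g X.fst X.snd
      rw [← P.map_id, ← Q.map_id] at h₁
      exact h₁)
  exact ⟨fun x z => α.app ⟨x, z⟩, fun x x' z z' u v =>
    α.hom.naturality (X := ⟨x, z⟩) (Y := ⟨x', z'⟩) (tmul u v), fun b x y => hα b ⟨x, y⟩⟩

/-- The bicolimit of an external tensor product is the tensor product of the bicolimits. -/
lemma IsColim.extTensor {d : LinCocone D L} (h : d.IsColim) {d' : LinCocone D' L'}
    (h' : d'.IsColim) : (d.extTensor d').IsColim := by
  refine ⟨fun X => ?_, fun T _ _ _ t => ?_, fun T _ _ _ F G _ _ _ _ θ hθ => ?_⟩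
  · obtain ⟨a, x, ⟨i⟩⟩ := h.ess X.fst
    obtain ⟨b, y, ⟨j⟩⟩ := h'.ess X.snd
    exact ⟨(a, b), ⟨x, y⟩, ⟨LinTensor.isoMk (X := ⟨_, _⟩) i j⟩⟩
  · choose F hF hF' s hs hs' using fun a => h'.exists_row t a
    let ψ (a a' : E) (f : a ⟶ a') (b : E') (x : D.C a) (y : D'.C b) :
        objPair (F a') ((D.map f).obj x) ((d'.leg b).obj y) ≅
          objPair (F a) x ((d'.leg b).obj y) :=
      s a' b ((D.map f).obj x) y ≪≫ t.colIso f b x y ≪≫ (s a b x y).symm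
    have hψ (a a' : E) (f : a ⟶ a') (b : E') (x : D.C a) (y : D'.C b) :
        (ψ a a' f b x y).hom ≫ (s a b x y).hom =
          (s a' b ((D.map f).obj x) y).hom ≫ (t.colIso f b x y).hom := by
      change (_ ≫ _ ≫ (s a b x y).inv) ≫ _ = _
      simp
    have key (a a' : E) (f : a ⟶ a') :
        ∃ α : ∀ x z, objPair (F a') ((D.map f).obj x) z ≅ objPair (F a) x z,
          (∀ x x' z z' (u : x ⟶ x') (v : z ⟶ z'), mapPair (F a') ((D.map f).map u) v ≫
            (α x' z').hom = (α x z).hom ≫ mapPair (F a) u v) ∧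
          ∀ b x y, (α x ((d'.leg b).obj y)).hom = (ψ a a' f b x y).hom := by
      refine h'.extPair (D.map f) (𝟭 _) (F a') (F a) (ψ a a' f)
        (fun b x x' y y' u v => ?_) (fun b b' g x y => ?_)
      · change _ = (ψ a a' f b x y).hom ≫ mapPair (F a) u ((d'.leg b).map v)
        have h₁ := hs a' b _ _ _ _ ((D.map f).map u) v
        have h₂ := t.colIso_naturality f b u v
        rw [← cancel_mono (s a b x' y').hom, Category.assoc, Category.assoc, hψ, hs,
          reassoc_of% (hψ a a' f b x y), reassoc_of% h₁, h₂]
      · change _ ≫ mapPair (F a) (𝟙 x) ((d'.iso g).app y).hom = _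
        have h₁ := hs' a b b' g x y
        have h₂ := hs' a' b b' g ((D.map f).obj x) y
        have h₃ := (t.colIso_rowIso f g x y).trans (t.rowIso_colIso f g x y).symm
        rw [← cancel_mono (s a b x y).hom, Category.assoc, Category.assoc, hψ, ← h₁,
          reassoc_of% (hψ a a' f b' x ((D'.map g).obj y)), h₃, reassoc_of% h₂]
    choose α hα₁ hα' using key
    have hα'' (a a' : E) (f : a ⟶ a') (b : E') (x : D.C a) (y : D'.C b) :
        (α a a' f x ((d'.leg b).obj y)).hom ≫ (s a b x y).hom =
          (s a' b ((D.map f).obj x) y).hom ≫ (t.colIso f b x y).hom := by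
      rw [hα', hψ]
    have hα₂ (a a' : E) (f : a ⟶ a') (x : D.C a) (z z' : L') (v : z ⟶ z') :
        mapPair (F a') (𝟙 ((D.map f).obj x)) v ≫ (α a a' f x z').hom =
          (α a a' f x z).hom ≫ mapPair (F a) (𝟙 x) v := by
      rw [← hα₁, (D.map f).map_id]
    let t' : LinCocone (D.tensor (LinDiag.const R E L')) T :=
      { leg := F
        leg_additive := hF
        leg_linear := hF'
        iso := fun {a a'} f => natIsoPair (mapFunctor (R := R) (D.map f) (𝟭 L') ⋙ F a') (F a)
          (α a a' f) (fun u v => hα₁ a a' f _ _ _ _ u v)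
        map₂ := fun {a a' f f'} η X => by
          refine h'.forall_of_leg (P := fun z => mapPair (F a') ((D.map₂ η).app X.fst) (𝟙 z) ≫
            (α a a' f' X.fst z).hom = (α a a' f X.fst z).hom) ?_ ?_ X.snd
          · intro z z' i hz
            rw [← cancel_epi (mapPair (F a') (𝟙 _) i.hom), hα₂, ← hz, ← Category.assoc,
              ← mapPair_comp, Category.assoc, ← hα₂, ← Category.assoc, ← mapPair_comp]
            simp only [Category.id_comp, Category.comp_id]
          · intro b y
            have h₁ := hs a' b _ _ _ _ ((D.map₂ η).app X.fst) (𝟙 y)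
            rw [← cancel_mono (s a b X.fst y).hom, Category.assoc, hα'', hα'', ← t.colIso_map₂ η,
              ← reassoc_of% h₁, (d'.leg b).map_id]
        id := fun a X => by
          refine h'.forall_of_leg (P := fun z => (α a a (𝟙 a) X.fst z).hom =
            mapPair (F a) ((D.mapId a).app X.fst).hom (𝟙 z)) ?_ ?_ X.snd
          · intro z z' i hz
            rw [← cancel_epi (mapPair (F a) (𝟙 _) i.hom), hα₂, hz, ← mapPair_comp, ← mapPair_comp]
            simp only [Category.id_comp, Category.comp_id]
            erw [Category.comp_id]
          · intro b y
            have h₁ := hs a b _ _ _ _ ((D.mapId a).app X.fst).hom (𝟙 y)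
            rw [← cancel_mono (s a b X.fst y).hom, hα'', t.colIso_id]
            refine h₁.symm.trans ?_
            rw [(d'.leg b).map_id]
            rfl
        comp := fun {a a' a''} f f' X => by
          refine h'.forall_of_leg (P := fun z => (α a a'' (f ≫ f') X.fst z).hom =
            mapPair (F a'') ((D.mapComp f f').app X.fst).hom (𝟙 z) ≫
              (α a' a'' f' ((D.map f).obj X.fst) z).hom ≫ (α a a' f X.fst z).hom) ?_ ?_ X.snd
          · intro z z' i hz
            rw [← cancel_epi (mapPair (F a'') (𝟙 _) i.hom), hα₂, hz]
            simp only [Category.assoc]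
            rw [← hα₂, ← reassoc_of% (hα₂ a' a'' f' ((D.map f).obj X.fst) z z' i.hom),
              mapPair_mapPair_assoc, mapPair_mapPair_assoc]
            simp only [Category.id_comp, Category.comp_id]
            erw [Category.comp_id]
          · intro b y
            have h₁ := hs a'' b _ _ _ _ ((D.mapComp f f').app X.fst).hom (𝟙 y)
            rw [(d'.leg b).map_id] at h₁
            rw [← cancel_mono (s a b X.fst y).hom, hα'', t.colIso_comp]
            simp only [Category.assoc]
            rw [hα'', reassoc_of% (hα'' a' a'' f' b ((D.map f).obj X.fst) y)]
            exact (comp_eq_comp_assoc h₁ _).symm }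
    obtain ⟨G, hG, hG', τ, hτ⟩ := (h.tensorRight L').desc T t'
    let τ' (a : E) (x : D.C a) (z : L') : objPair G ((d.leg a).obj x) z ≅ objPair (F a) x z :=
      (τ a).app ⟨x, z⟩
    have hτ₁ (a a' : E) (f : a ⟶ a') (x : D.C a) (z : L') :
        (τ' a' ((D.map f).obj x) z).hom ≫ (α a a' f x z).hom =
          mapPair G ((d.iso f).app x).hom (𝟙 z) ≫ (τ' a x z).hom := hτ f ⟨x, z⟩
    have hτ₂ (a : E) (x x' : D.C a) (z z' : L') (u : x ⟶ x') (v : z ⟶ z') :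
        mapPair G ((d.leg a).map u) v ≫ (τ' a x' z').hom =
          (τ' a x z).hom ≫ mapPair (F a) u v :=
      (τ a).hom.naturality (X := ⟨x, z⟩) (Y := ⟨x', z'⟩) (tmul u v)
    refine ⟨G, hG, hG', fun p => natIsoPair (mapFunctor (R := R) (d.leg p.1) (d'.leg p.2) ⋙ G)
      (t.extLeg p.1 p.2) (fun x y => τ' p.1 x ((d'.leg p.2).obj y) ≪≫ s p.1 p.2 x y)
      (fun {x x' y y'} u v => ?_), fun p q k X => ?_⟩
    · have h₁ := hτ₂ p.1 x x' _ _ u ((d'.leg p.2).map v)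
      have h₂ := hs p.1 p.2 x x' y y' u v
      exact comp_square' h₁ h₂
    · have h₁ := t.rowIso_colIso k.1 k.2 X.fst X.snd
      have h₂ := hs' q.1 p.2 q.2 k.2 ((D.map k.1).obj X.fst) X.snd
      have h₃ := hα'' p.1 q.1 k.1 p.2 X.fst X.snd
      have h₄ := hτ₁ p.1 q.1 k.1 X.fst ((d'.leg p.2).obj X.snd)
      have h₅ := hτ₂ q.1 _ _ _ _ (𝟙 ((D.map k.1).obj X.fst)) ((d'.iso k.2).app X.snd).hom
      have h₆ : mapPair G ((d.iso k.1).app X.fst).hom ((d'.iso k.2).app X.snd).hom =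
          mapPair G ((d.leg q.1).map (𝟙 _)) ((d'.iso k.2).app X.snd).hom ≫
            mapPair G ((d.iso k.1).app X.fst).hom (𝟙 _) := by
        rw [← mapPair_comp, Category.comp_id, (d.leg q.1).map_id]
        erw [Category.id_comp]
      change ((τ' q.1 ((D.map k.1).obj X.fst) ((d'.leg q.2).obj ((D'.map k.2).obj X.snd))).hom ≫
        (s q.1 q.2 ((D.map k.1).obj X.fst) ((D'.map k.2).obj X.snd)).hom) ≫
          (t.extIso k.1 k.2 X.fst X.snd).hom =
        mapPair G ((d.iso k.1).app X.fst).hom ((d'.iso k.2).app X.snd).hom ≫ _ ≫ _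
      rw [h₆]
      simp only [Category.assoc]
      rw [← reassoc_of% h₄, reassoc_of% h₅, h₃, ← reassoc_of% h₂, h₁]
  · let θ' (a : E) (b : E') (x : D.C a) (y : D'.C b) :
        objPair F ((d.leg a).obj x) ((d'.leg b).obj y) ≅
          objPair G ((d.leg a).obj x) ((d'.leg b).obj y) := (θ (a, b)).app ⟨x, y⟩
    have hθ₁ (a : E) (b : E') (x x' : D.C a) (y y' : D'.C b) (u : x ⟶ x') (v : y ⟶ y') :
        mapPair F ((d.leg a).map u) ((d'.leg b).map v) ≫ (θ' a b x' y').hom =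
          (θ' a b x y).hom ≫ mapPair G ((d.leg a).map u) ((d'.leg b).map v) :=
      (θ (a, b)).hom.naturality (X := ⟨x, y⟩) (Y := ⟨x', y'⟩) (tmul u v)
    have hθ₂ (a a' : E) (b b' : E') (f : a ⟶ a') (g : b ⟶ b') (x : D.C a) (y : D'.C b) :
        (θ' a' b' ((D.map f).obj x) ((D'.map g).obj y)).hom ≫
          mapPair G ((d.iso f).app x).hom ((d'.iso g).app y).hom =
        mapPair F ((d.iso f).app x).hom ((d'.iso g).app y).hom ≫ (θ' a b x y).hom :=
      hθ (e := (a, b)) (e' := (a', b')) (f, g) ⟨x, y⟩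
    have key (a : E) := h'.extPair (d.leg a) (d.leg a) F G (θ' a) (hθ₁ a) (fun b b' g x y => by
      have h₁ := hθ₂ a a b b' (𝟙 a) g x y
      have h₂ := hθ₁ a b' _ _ _ _ ((D.mapId a).app x).inv (𝟙 ((D'.map g).obj y))
      have h₃ : (d.leg a).map ((D.mapId a).app x).inv ≫ ((d.iso (𝟙 a)).app x).hom =
          𝟙 ((d.leg a).obj x) := by
        refine (congrArg (_ ≫ ·) (d.id a x)).trans ?_
        refine ((d.leg a).map_comp _ _).symm.trans ?_
        exact (congrArg (d.leg a).map ((D.mapId a).app x).inv_hom_id).trans ((d.leg a).map_id _)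
      rw [← h₃, ← Category.id_comp ((d'.iso g).app y).hom, mapPair_comp, mapPair_comp,
        Category.assoc, ← h₁]
      rw [(d'.leg b').map_id] at h₂
      exact (comp_eq_comp_assoc h₂ _).symm)
    choose ψ hψ hψ' using key
    obtain ⟨α, hα⟩ := (h.tensorRight L').ext T F G
      (fun a => natIsoPair (mapFunctor (R := R) (d.leg a) (𝟭 L') ⋙ F)
        (mapFunctor (R := R) (d.leg a) (𝟭 L') ⋙ G) (ψ a) (fun u v => hψ a _ _ _ _ u v))
      (fun a a' f X => by
        refine h'.forall_of_leg (P := fun z => (ψ a' ((D.map f).obj X.fst) z).hom ≫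
          mapPair G ((d.iso f).app X.fst).hom (𝟙 z) =
            mapPair F ((d.iso f).app X.fst).hom (𝟙 z) ≫ (ψ a X.fst z).hom) ?_ ?_ X.snd
        · intro z z' i hz
          have h₁ (a : E) (x : D.C a) := hψ a x x z z' (𝟙 x) i.hom
          simp only [CategoryTheory.Functor.map_id] at h₁
          have h₂ : mapPair G ((d.iso f).app X.fst).hom (𝟙 z) ≫ mapPair G (𝟙 _) i.hom =
              mapPair G (𝟙 _) i.hom ≫ mapPair G ((d.iso f).app X.fst).hom (𝟙 z') := by
            rw [← mapPair_comp, ← mapPair_comp]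
            simp only [Category.id_comp, Category.comp_id]
          have h₃ : mapPair F (𝟙 _) i.hom ≫ mapPair F ((d.iso f).app X.fst).hom (𝟙 z') =
              mapPair F ((d.iso f).app X.fst).hom (𝟙 z) ≫ mapPair F (𝟙 _) i.hom := by
            rw [← mapPair_comp, ← mapPair_comp]
            simp only [Category.id_comp, Category.comp_id]
          rw [← cancel_epi (mapPair F (𝟙 ((d.leg a').obj ((D.map f).obj X.fst))) i.hom),
            reassoc_of% (h₁ a' ((D.map f).obj X.fst))]
          refine (congrArg (_ ≫ ·) h₂.symm).trans ?_
          rw [reassoc_of% hz, ← h₁ a X.fst]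
          exact (comp_eq_comp_assoc h₃ _).symm
        · intro b y
          have h₁ := hθ₂ a a' b b f (𝟙 b) X.fst y
          have h₂ := hθ₁ a' b _ _ _ _ (𝟙 ((D.map f).obj X.fst)) ((D'.mapId b).app y).inv
          have h₃ : (d'.leg b).map ((D'.mapId b).app y).inv ≫ ((d'.iso (𝟙 b)).app y).hom =
              𝟙 ((d'.leg b).obj y) := by
            refine (congrArg (_ ≫ ·) (d'.id b y)).trans ?_
            refine ((d'.leg b).map_comp _ _).symm.trans ?_
            exact (congrArg (d'.leg b).map ((D'.mapId b).app y).inv_hom_id).trans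
              ((d'.leg b).map_id _)
          rw [(d.leg a').map_id] at h₂
          rw [hψ', hψ', ← h₃, ← Category.id_comp ((d.iso f).app X.fst).hom, mapPair_comp,
            mapPair_comp, Category.assoc, ← h₁]
          exact (comp_eq_comp_assoc h₂ _).symm)
    exact ⟨α, fun p X => (hα p.1 ⟨X.fst, (d'.leg p.2).obj X.snd⟩).trans
      (hψ' p.1 p.2 X.fst X.snd)⟩

end LinCocone

end

end

section

section

variable {R : Type} [CommRing R] {E : Type u} [Bicategory.{u, u} E] [IsSifted₂₁ E]
variable {D D' : LinDiag.{u} R E}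
variable {L : Type u} [Category.{u} L] [Preadditive L] [Linear R L]
variable {L' : Type u} [Category.{u} L'] [Preadditive L'] [Linear R L']

/-- Sifted bicolimits of linear categories commute with tensor products. -/
lemma LinCocone.IsColim.tensor {d : LinCocone D L} (h : d.IsColim) {d' : LinCocone D' L'}
    (h' : d'.IsColim) : (d.tensor d').IsColim :=
  IsSifted₂₁.isColim_diag (h.extTensor h')

/-- A coherent family of objects of a linear category, indexed by a sifted (2,1)-category, is
isomorphic to a constant one. -/
lemma IsSifted₂₁.exists_point (R : Type) [CommRing R] [Linear R L] (q : E → L)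
    (i : ∀ {e e' : E}, (e ⟶ e') → (q e' ≅ q e))
    (h₂ : ∀ {e e' : E} {f g : e ⟶ e'}, (f ⟶ g) → (i f).hom = (i g).hom)
    (hid : ∀ e, (i (𝟙 e)).hom = 𝟙 (q e))
    (hcomp : ∀ {e e' e'' : E} (f : e ⟶ e') (g : e' ⟶ e''), (i (f ≫ g)).hom = (i g).hom ≫ (i f).hom)
      :
    ∃ (z : L) (j : ∀ e, z ≅ q e), ∀ {e e' : E} (f : e ⟶ e'), (j e').hom ≫ (i f).hom = (j e).hom :=
      by
  let Y : Type u := Free R (Discrete PUnit.{u + 1})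
  let l (e : E) : Y ⥤ L := Free.lift R (Functor.fromPUnit (q e))
  have hl (e : E) : (l e).Additive := Free.lift_additive R _
  have hl' (e : E) : (l e).Linear R := Free.lift_linear R _
  let ι {e e' : E} (f : e ⟶ e') : l e' ≅ l e :=
    Free.ext R (NatIso.ofComponents (fun _ => i f) (fun {X Y} g => by
      obtain rfl : X = Y := Subsingleton.elim _ _
      obtain rfl : g = 𝟙 _ := Subsingleton.elim _ _
      rw [CategoryTheory.Functor.map_id, CategoryTheory.Functor.map_id, Category.comp_id]
      exact Category.id_comp _))
  let t : LinCocone (LinDiag.const R E Y) L :=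
    { leg := l
      leg_additive := hl
      leg_linear := hl'
      iso := fun {e e'} f => Functor.leftUnitor _ ≪≫ ι f
      map₂ := fun {e e' f g} η x => by
        refine (congrArg (· ≫ _) ((l e').map_id _)).trans ((Category.id_comp _).trans ?_)
        exact congrArg (𝟙 _ ≫ ·) (h₂ η).symm
      id := fun e x => by
        refine (Category.id_comp _).trans ?_
        exact (hid e).trans ((l e).map_id x).symm
      comp := fun {e e' e''} f g x => by
        refine (Category.id_comp _).trans ((hcomp f g).trans ?_)
        refine Eq.trans ?_ (congrArg (· ≫ _) ((l e'').map_id x).symm)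
        refine Eq.trans ?_ (Category.id_comp _).symm
        exact congrArg₂ (· ≫ ·) (Category.id_comp _).symm (Category.id_comp _).symm }
  obtain ⟨F, _, _, σ, hσ⟩ := (IsSifted₂₁.isColim_const (R := R) (E := E) (Y := Y)).desc L t
  let y : Y := Free.of R ⟨PUnit.unit⟩
  refine ⟨F.obj y, fun e => (σ e).app y, fun {e e'} f => ?_⟩
  have h := hσ f y
  refine (congrArg (_ ≫ ·) (Category.id_comp _).symm).trans (h.trans ?_)
  exact (congrArg (· ≫ _) (F.map_id y)).trans (Category.id_comp _)

end

/-! ### Uniqueness of bicolimits -/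

section

universe w₁ v₁ u₁ w₂ v₂ u₂

variable {E : Type u₁} [Bicategory.{w₁, v₁} E] {B : Type u₂} [Bicategory.{w₂, v₂} B]
  {J : E ⥤ᵖ B}

namespace BiCocone

/-- Construct an isomorphism of pseudo-cocones from isomorphisms of the legs. -/
@[simps] def isoMk {X : B} {c d : BiCocone J X} (φ : ∀ e, c.leg e ≅ d.leg e)
    (h : ∀ {e e' : E} (f : e ⟶ e'), J.map f ◁ (φ e').hom ≫ (d.legIso f).hom =
      (c.legIso f).hom ≫ (φ e).hom) : c ≅ d where
  hom := { app := fun e => (φ e).hom, comm := h }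
  inv :=
    { app := fun e => (φ e).inv
      comm := fun {e e'} f => by
        rw [← cancel_epi (J.map f ◁ (φ e').hom), reassoc_of% (h f), ← Category.assoc,
          ← whiskerLeft_comp]
        simp }
  hom_inv_id := hom_ext fun e => (φ e).hom_inv_id
  inv_hom_id := hom_ext fun e => (φ e).inv_hom_id

/-- The components of an isomorphism of pseudo-cocones. -/
@[simps] def appIso {X : B} {c d : BiCocone J X} (φ : c ≅ d) (e : E) : c.leg e ≅ d.leg e where
  hom := Hom.app φ.hom e
  inv := Hom.app φ.inv e
  hom_inv_id := congrArg (fun γ => Hom.app γ e) φ.hom_inv_id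
  inv_hom_id := congrArg (fun γ => Hom.app γ e) φ.inv_hom_id

/-- Whiskering an isomorphism of pseudo-cocones. -/
def whiskerIso {X Y : B} {c d : BiCocone J X} (φ : c ≅ d) (h : X ⟶ Y) :
    c.whisker h ≅ d.whisker h :=
  isoMk (fun e => whiskerRightIso (appIso φ e) h) (fun {e e'} f => by
    have h₁ := congrArg (· ▷ h) (Hom.comm φ.hom f)
    simp only [comp_whiskerRight] at h₁
    change J.map f ◁ Hom.app φ.hom e' ▷ h ≫ (α_ (J.map f) (d.leg e') h).inv ≫
      (d.legIso f).hom ▷ h = ((α_ (J.map f) (c.leg e') h).inv ≫ (c.legIso f).hom ▷ h) ≫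
        Hom.app φ.hom e ▷ h
    rw [Category.assoc, ← h₁]
    simp)

/-- Whiskering a pseudo-cocone twice. -/
def whiskerComp {X Y Z : B} (c : BiCocone J X) (h : X ⟶ Y) (g : Y ⟶ Z) :
    c.whisker (h ≫ g) ≅ (c.whisker h).whisker g :=
  isoMk (fun e => (α_ (c.leg e) h g).symm) (fun {e e'} f => by
    change J.map f ◁ (α_ (c.leg e') h g).inv ≫ (α_ (J.map f) (c.leg e' ≫ h) g).inv ≫
      ((α_ (J.map f) (c.leg e') h).inv ≫ (c.legIso f).hom ▷ h) ▷ g =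
        ((α_ (J.map f) (c.leg e') (h ≫ g)).inv ≫ (c.legIso f).hom ▷ (h ≫ g)) ≫
          (α_ (c.leg e) h g).inv
    simp)

/-- Whiskering a pseudo-cocone with an identity. -/
def whiskerId {X : B} (c : BiCocone J X) : c.whisker (𝟙 X) ≅ c :=
  isoMk (fun e => ρ_ (c.leg e)) (fun {e e'} f => by
    change J.map f ◁ (ρ_ (c.leg e')).hom ≫ (c.legIso f).hom =
      ((α_ (J.map f) (c.leg e') (𝟙 X)).inv ≫ (c.legIso f).hom ▷ 𝟙 X) ≫ (ρ_ (c.leg e)).hom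
    simp)

lemma IsBicolimit.nonempty_iso_id {X X' : B} {c : BiCocone J X} {c' : BiCocone J X'}
    (hc : c.IsBicolimit) {h : X ⟶ X'} {g : X' ⟶ X} (φ : c.whisker h ≅ c') (ψ : c'.whisker g ≅ c) :
    Nonempty (h ≫ g ≅ 𝟙 X) := by
  have := hc X
  exact ⟨(c.whiskering X).preimageIso (c.whiskerComp h g ≪≫ whiskerIso φ g ≪≫ ψ ≪≫
    c.whiskerId.symm)⟩

/-- Bicolimits are unique up to equivalence. -/
lemma IsBicolimit.exists_equivalence {X X' : B} {c : BiCocone J X} {c' : BiCocone J X'}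
    (hc : c.IsBicolimit) (hc' : c'.IsBicolimit) :
    ∃ (h : X ⟶ X') (g : X' ⟶ X) (φ : c.whisker h ≅ c'), Nonempty (h ≫ g ≅ 𝟙 X) ∧
      Nonempty (g ≫ h ≅ 𝟙 X') := by
  have := hc X'
  have := hc' X
  let φ := (c.whiskering X').objObjPreimageIso c'
  let ψ := (c'.whiskering X).objObjPreimageIso c
  exact ⟨_, _, φ, hc.nonempty_iso_id φ ψ, hc'.nonempty_iso_id ψ φ⟩

end BiCocone

end

end

section

/-! ### Sifted bicolimits of pointed linear categories -/

section

variable {E : Type*} [Bicategory E] {B : Type*} [Bicategory B] (J : E ⥤ᵖ B)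

lemma CategoryTheory.Pseudofunctor.map₂_whiskerLeft_comp_mapComp {a b c : E} (f : a ⟶ b)
    {g h : b ⟶ c} (η : g ⟶ h) :
    J.map₂ (f ◁ η) ≫ (J.mapComp f h).hom = (J.mapComp f g).hom ≫ J.map f ◁ J.map₂ η := by
  simp

lemma CategoryTheory.Pseudofunctor.map₂_whiskerRight_comp_mapComp {a b c : E} {f g : a ⟶ b}
    (η : f ⟶ g) (h : b ⟶ c) :
    J.map₂ (η ▷ h) ≫ (J.mapComp g h).hom = (J.mapComp f h).hom ≫ J.map₂ η ▷ J.map h := by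
  simp

lemma CategoryTheory.Pseudofunctor.map₂_associator_comp_mapComp {a b c d : E} (f : a ⟶ b)
    (g : b ⟶ c) (h : c ⟶ d) :
    J.map₂ (α_ f g h).hom ≫ (J.mapComp f (g ≫ h)).hom ≫ J.map f ◁ (J.mapComp g h).hom =
      ((J.mapComp (f ≫ g) h).hom ≫ (J.mapComp f g).hom ▷ J.map h) ≫ (α_ _ _ _).hom := by
  simp [J.map₂_associator]

end

section

variable {R : Type} [CommRing R] {E : Type u} [Bicategory.{u, u} E]

/-- The natural isomorphism underlying an invertible 2-cell of pointed linear categories. -/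
@[simps] def PtLin.natIso {C D : PtLin.{u} R} {F G : C ⟶ D} (α : F ≅ G) :
    F.functor ≅ G.functor where
  hom := PtLin.Hom₂.nat α.hom
  inv := PtLin.Hom₂.nat α.inv
  hom_inv_id := congrArg PtLin.Hom₂.nat α.hom_inv_id
  inv_hom_id := congrArg PtLin.Hom₂.nat α.inv_hom_id

/-- The diagram of linear categories underlying a diagram of pointed linear categories. -/
@[reducible] def LinDiag.ofPtLin (J : E ⥤ᵖ Pith (PtLin.{u} R)) : LinDiag.{u} R E where
  C e := (J.obj e).as.carrier
  map f := (J.map f).of.functor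
  map₂ η := PtLin.Hom₂.nat (J.map₂ η).iso.hom
  mapId e := PtLin.natIso (J.mapId e).hom.iso
  mapComp f g := PtLin.natIso (J.mapComp f g).hom.iso
  map₂_id f x := congrArg (fun γ => (PtLin.Hom₂.nat γ.iso.hom).app x) (J.map₂_id f)
  map₂_comp η θ x := congrArg (fun γ => (PtLin.Hom₂.nat γ.iso.hom).app x) (J.map₂_comp η θ)
  whiskerLeft f _ _ η x := congrArg (fun γ => (PtLin.Hom₂.nat γ.iso.hom).app x)
    (J.map₂_whiskerLeft_comp_mapComp f η)
  whiskerRight η h x := congrArg (fun γ => (PtLin.Hom₂.nat γ.iso.hom).app x)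
    (J.map₂_whiskerRight_comp_mapComp η h)
  associator f g h x := (congrArg (fun γ => (PtLin.Hom₂.nat γ.iso.hom).app x)
    (J.map₂_associator_comp_mapComp f g h)).trans (Category.comp_id _)
  leftUnitor f x := (congrArg (fun γ => (PtLin.Hom₂.nat γ.iso.hom).app x)
    (J.map₂_left_unitor f)).trans (congrArg (_ ≫ ·) (Category.comp_id _))
  rightUnitor f x := (congrArg (fun γ => (PtLin.Hom₂.nat γ.iso.hom).app x)
    (J.map₂_right_unitor f)).trans (congrArg (_ ≫ ·) (Category.comp_id _))

variable {J : E ⥤ᵖ Pith (PtLin.{u} R)}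

/-- The cocone of linear categories underlying a pseudo-cocone of pointed linear categories. -/
@[reducible] def LinCocone.ofPtLin {X : Pith (PtLin.{u} R)} (c : BiCocone J X) :
    LinCocone (LinDiag.ofPtLin J) X.as.carrier where
  leg e := (c.leg e).of.functor
  leg_additive e := (c.leg e).of.additive
  leg_linear e := (c.leg e).of.linear
  iso f := PtLin.natIso (c.legIso f).hom.iso
  map₂ η x := congrArg (fun γ => (PtLin.Hom₂.nat γ.iso.hom).app x) (c.naturality η)
  id e x := (congrArg (fun γ => (PtLin.Hom₂.nat γ.iso.hom).app x) (c.legIso_id e)).trans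
    (Category.comp_id _)
  comp f g x := (congrArg (fun γ => (PtLin.Hom₂.nat γ.iso.hom).app x) (c.legIso_comp f g)).trans
    (congrArg (_ ≫ ·) (Category.id_comp _))

namespace PtLin

open LinCocone (comp_eq_comp_assoc)

/-- The isomorphism between the distinguished object of the vertex of a pseudo-cocone and the image
of the distinguished object of a member of the diagram. -/
@[reducible] def coconePt {X : Pith (PtLin.{u} R)} (c : BiCocone J X) (e : E) :
    X.as.pt ≅ ((LinCocone.ofPtLin c).leg e).obj (J.obj e).as.pt :=
  (c.leg e).of.ptIso

lemma coconePt_comp_iso {X : Pith (PtLin.{u} R)} (c : BiCocone J X) {e e' : E} (f : e ⟶ e') :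
    (coconePt c e').hom ≫ ((LinCocone.ofPtLin c).leg e').map (J.map f).of.ptIso.hom ≫
      ((LinCocone.ofPtLin c).iso f).hom.app (J.obj e).as.pt = (coconePt c e).hom :=
  (Category.assoc _ _ _).symm.trans (c.legIso f).hom.iso.hom.pt

/-- A pseudo-cocone of pointed linear categories, from its underlying cocone. -/
@[reducible] def mkCocone (X : Pith (PtLin.{u} R)) (d : LinCocone (LinDiag.ofPtLin J) X.as.carrier)
    (j : ∀ e, X.as.pt ≅ (d.leg e).obj (J.obj e).as.pt)
    (hj : ∀ {e e' : E} (f : e ⟶ e'), (j e').hom ≫ (d.leg e').map (J.map f).of.ptIso.hom ≫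
      (d.iso f).hom.app (J.obj e).as.pt = (j e).hom) : BiCocone J X where
  leg e := Core.mk
    { functor := d.leg e
      additive := d.leg_additive e
      linear := d.leg_linear e
      ptIso := j e }
  legIso {e e'} f := Core.isoMk (PtLin.isoMk (d.iso f) ((Category.assoc _ _ _).trans (hj f)))
  naturality η := Pith.hom₂_ext _ (PtLin.hom₂_ext fun x => d.map₂ η x)
  legIso_id e := Pith.hom₂_ext _ (PtLin.hom₂_ext fun x => (d.id e x).trans
    (Category.comp_id _).symm)
  legIso_comp f g := Pith.hom₂_ext _ (PtLin.hom₂_ext fun x => (d.comp f g x).trans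
    (congrArg (_ ≫ ·) (Category.id_comp _).symm))

variable [IsSifted₂₁ E]

lemma eq_of_comp_eq {P : E → Prop} (h : ∀ {e e' : E}, (e ⟶ e') → (P e' ↔ P e)) {e₀ : E} (h₀ : P e₀)
    (e : E) : P e := by
  obtain ⟨e', ⟨f⟩, ⟨g⟩⟩ := IsSifted₂₁.exists_cospan e₀ e
  exact (h g).1 ((h f).2 h₀)

/-- A pseudo-cocone of pointed linear categories is a bicolimit if its underlying cocone is. -/
lemma isBicolimit_of_isColim {X : Pith (PtLin.{u} R)} (c : BiCocone J X)
    (hc : (LinCocone.ofPtLin c).IsColim) : c.IsBicolimit := by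
  obtain ⟨e₀⟩ := IsSifted₂₁.nonempty (E := E)
  intro Y
  have key (h h' : X ⟶ Y) (α : h.of.functor ≅ h'.of.functor)
      (ha : (c.leg e₀ ≫ h).of.ptIso.hom ≫ α.hom.app ((c.leg e₀).of.functor.obj (J.obj e₀).as.pt) =
        (c.leg e₀ ≫ h').of.ptIso.hom) :
      h.of.ptIso.hom ≫ α.hom.app X.as.pt = h'.of.ptIso.hom := by
    have h₁ := α.hom.naturality (coconePt c e₀).hom
    have h₂ : (h.of.ptIso.hom ≫ h.of.functor.map (coconePt c e₀).hom) ≫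
      α.hom.app ((c.leg e₀).of.functor.obj (J.obj e₀).as.pt) =
        h'.of.ptIso.hom ≫ h'.of.functor.map (coconePt c e₀).hom := ha
    rw [Category.assoc, h₁, ← Category.assoc] at h₂
    exact (cancel_mono _).1 h₂
  refine ⟨⟨fun {h h'} α β hαβ => ?_⟩, ⟨fun {h h'} φ => ?_⟩, ⟨fun t => ?_⟩⟩
  · refine Pith.hom₂_ext _ (PtLin.Hom₂.ext ?_)
    refine hc.hom_ext (F := h.of.functor) (G := h'.of.functor) fun e x => ?_
    exact congrArg (fun γ : c.whisker h ⟶ c.whisker h' =>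
      (PtLin.Hom₂.nat (BiCocone.Hom.app γ e).iso.hom).app x) hαβ
  · obtain ⟨α, hα⟩ := hc.ext Y.as.carrier h.of.functor h'.of.functor
      (fun e => PtLin.natIso (BiCocone.Hom.app φ e).iso) (fun e e' f x => by
        have h₁ := congrArg (fun γ => (PtLin.Hom₂.nat γ.iso.hom).app x) (BiCocone.Hom.comm φ f)
        have h₂ := (congrArg (_ ≫ ·) (Category.id_comp _)).symm.trans
          (h₁.trans (congrArg (· ≫ _) (Category.id_comp _)))
        exact h₂)
    refine ⟨CoreHom.mk (PtLin.isoMk α (key h h' α ?_)), ?_⟩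
    · rw [hα]
      exact (BiCocone.Hom.app φ e₀).iso.hom.pt
    · exact BiCocone.hom_ext fun e => Pith.hom₂_ext _ (PtLin.hom₂_ext fun x => hα e x)
  · obtain ⟨F, hF, hF', σ, hσ⟩ := hc.desc Y.as.carrier (LinCocone.ofPtLin t)
    let i : Y.as.pt ≅ F.obj X.as.pt := coconePt t e₀ ≪≫ ((σ e₀).app (J.obj e₀).as.pt).symm ≪≫
      F.mapIso (coconePt c e₀).symm
    have hi (e : E) : (i.hom ≫ F.map (coconePt c e).hom) ≫ (σ e).hom.app (J.obj e).as.pt =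
        (coconePt t e).hom := by
      refine eq_of_comp_eq (e₀ := e₀) (P := fun e => (i.hom ≫ F.map (coconePt c e).hom) ≫
        (σ e).hom.app (J.obj e).as.pt = (coconePt t e).hom) (fun {e e'} f => ?_) ?_ e
      · have h₁ := hσ f (J.obj e).as.pt
        have h₂ := (σ e').hom.naturality (J.map f).of.ptIso.hom
        have h₃ : ((i.hom ≫ F.map (coconePt c e').hom) ≫ (σ e').hom.app (J.obj e').as.pt) ≫
            ((LinCocone.ofPtLin t).leg e').map (J.map f).of.ptIso.hom ≫
              ((LinCocone.ofPtLin t).iso f).hom.app (J.obj e).as.pt =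
            (i.hom ≫ F.map (coconePt c e).hom) ≫ (σ e).hom.app (J.obj e).as.pt := by
          rw [← coconePt_comp_iso c f, Functor.map_comp, Functor.map_comp]
          simp only [Category.assoc]
          rw [← h₁]
          exact congrArg (fun γ => i.hom ≫ F.map (coconePt c e').hom ≫ γ)
            (comp_eq_comp_assoc h₂.symm _)
        rw [← h₃, ← coconePt_comp_iso t f]
        exact (cancel_mono _).symm
      · simp [i, ← Functor.map_comp]
    let h : X ⟶ Y := Core.mk { functor := F, ptIso := i }
    refine ⟨h, ⟨BiCocone.isoMk (fun e => Core.isoMk (PtLin.isoMk (σ e) (hi e)))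
      (fun {e e'} f => Pith.hom₂_ext _ (PtLin.hom₂_ext fun x => ?_))⟩⟩
    refine (hσ f x).trans (congrArg (· ≫ _) (Category.id_comp _).symm)

end PtLin

end

end

section

section

variable {R : Type} [CommRing R] {E : Type u} [Bicategory.{u, u} E] [IsSifted₂₁ E]

open LinCocone (comp_eq_comp_assoc)

/-- Compatible points of the members of a sifted diagram induce a point of the vertex of a
cocone. -/
lemma LinCocone.exists_point {D : LinDiag.{u} R E} {L : Type u} [Category.{u} L] [Preadditive L]
    [Linear R L] (d : LinCocone D L) (p : ∀ e, D.C e)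
    (π : ∀ {e e' : E} (f : e ⟶ e'), p e' ≅ (D.map f).obj (p e))
    (π₂ : ∀ {e e' : E} {f g : e ⟶ e'} (η : f ⟶ g),
      (π f).hom ≫ (D.map₂ η).app (p e) = (π g).hom)
    (πid : ∀ e, (π (𝟙 e)).hom ≫ (D.mapId e).hom.app (p e) = 𝟙 (p e))
    (πcomp : ∀ {e e' e'' : E} (f : e ⟶ e') (g : e' ⟶ e''),
      (π (f ≫ g)).hom ≫ (D.mapComp f g).hom.app (p e) = (π g).hom ≫ (D.map g).map (π f).hom) :
    ∃ (z : L) (j : ∀ e, z ≅ (d.leg e).obj (p e)), ∀ {e e' : E} (f : e ⟶ e'),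
      (j e').hom ≫ (d.leg e').map (π f).hom ≫ (d.iso f).hom.app (p e) = (j e).hom := by
  refine IsSifted₂₁.exists_point R (fun e => (d.leg e).obj (p e))
    (fun {e e'} f => (d.leg e').mapIso (π f) ≪≫ (d.iso f).app (p e))
    (fun {e e' f g} η => ?_) (fun e => ?_) (fun {e e' e''} f g => ?_)
  · change (d.leg e').map (π f).hom ≫ (d.iso f).hom.app (p e) =
      (d.leg e').map (π g).hom ≫ (d.iso g).hom.app (p e)
    rw [← d.map₂ η, ← π₂ η, Functor.map_comp, Category.assoc]
  · change (d.leg e).map (π (𝟙 e)).hom ≫ (d.iso (𝟙 e)).hom.app (p e) = _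
    rw [d.id, ← Functor.map_comp]
    exact (congrArg (d.leg e).map (πid e)).trans (CategoryTheory.Functor.map_id _ _)
  · change (d.leg e'').map (π (f ≫ g)).hom ≫ (d.iso (f ≫ g)).hom.app (p e) =
      ((d.leg e'').map (π g).hom ≫ (d.iso g).hom.app (p e')) ≫
        (d.leg e').map (π f).hom ≫ (d.iso f).hom.app (p e)
    have h₁ := d.iso_naturality g (π f).hom
    rw [d.comp, Category.assoc, ← reassoc_of% h₁, ← Category.assoc, ← Functor.map_comp, πcomp,
      Functor.map_comp, Category.assoc]

namespace PtLin

variable {J : E ⥤ᵖ Pith (PtLin.{u} R)}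

lemma exists_isColim (J : E ⥤ᵖ Pith (PtLin.{u} R)) :
    ∃ (X : Pith (PtLin.{u} R)) (c : BiCocone J X), (LinCocone.ofPtLin c).IsColim := by
  let D := LinDiag.ofPtLin J
  obtain ⟨z, j, hj⟩ := (LinDiag.Colim.cocone D).exists_point (fun e => (J.obj e).as.pt)
    (fun f => (J.map f).of.ptIso)
    (fun η => (J.map₂ η).iso.hom.pt) (fun e => (J.mapId e).hom.iso.hom.pt)
    (fun f g => (J.mapComp f g).hom.iso.hom.pt)
  exact ⟨⟨⟨LinDiag.Colim D, z⟩⟩, mkCocone _ (LinDiag.Colim.cocone D) j hj,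
    LinDiag.Colim.isColim_cocone⟩

lemma isEquivalence_of_iso_id {X X' : Pith (PtLin.{u} R)} {h : X ⟶ X'} {g : X' ⟶ X}
    (i : h ≫ g ≅ 𝟙 X) (i' : g ≫ h ≅ 𝟙 X') : h.of.functor.IsEquivalence :=
  (CategoryTheory.Equivalence.mk h.of.functor g.of.functor (natIso i.hom.iso).symm
    (natIso i'.hom.iso)).isEquivalence_functor

/-- A sifted pseudo-cocone of pointed linear categories is a bicolimit if and only if its
underlying cocone is. -/
lemma isBicolimit_iff {X : Pith (PtLin.{u} R)} (c : BiCocone J X) :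
    c.IsBicolimit ↔ (LinCocone.ofPtLin c).IsColim := by
  refine ⟨fun hc => ?_, isBicolimit_of_isColim c⟩
  obtain ⟨X', c', hc'⟩ := exists_isColim J
  obtain ⟨h, g, φ, ⟨i⟩, ⟨i'⟩⟩ := (isBicolimit_of_isColim c' hc').exists_equivalence hc
  have := isEquivalence_of_iso_id i i'
  refine hc'.of_equivalence (LinCocone.ofPtLin c) h.of.functor
    (fun e => natIso (BiCocone.Hom.app φ.hom e).iso) (fun e e' f x => ?_)
  have h₁ := congrArg (fun γ => (PtLin.Hom₂.nat γ.iso.hom).app x) (BiCocone.Hom.comm φ.hom f)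
  exact h₁.trans (congrArg (· ≫ _) (Category.id_comp _))

end PtLin

end

end

section

open MonoidalCategory

/-! ### Monoidal structures from jointly surjective families of functors -/

section

variable {L : Type*} [Category* L] [MonoidalCategoryStruct L]

variable (L) in
/-- The functoriality of the tensor product and the naturality of the structure isomorphisms of a
monoidal category. -/
structure IsPreMonoidal : Prop where
  whiskerLeft_eq {Y Z : L} (X : L) (f : Y ⟶ Z) : X ◁ f = 𝟙 X ⊗ₘ f
  whiskerRight_eq {Y Z : L} (f : Y ⟶ Z) (X : L) : f ▷ X = f ⊗ₘ 𝟙 X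
  id_tensor_id (X Y : L) : 𝟙 X ⊗ₘ 𝟙 Y = 𝟙 (X ⊗ Y)
  comp {X₁ Y₁ Z₁ X₂ Y₂ Z₂ : L} (f₁ : X₁ ⟶ Y₁) (f₂ : X₂ ⟶ Y₂) (g₁ : Y₁ ⟶ Z₁) (g₂ : Y₂ ⟶ Z₂) :
    (f₁ ⊗ₘ f₂) ≫ (g₁ ⊗ₘ g₂) = (f₁ ≫ g₁) ⊗ₘ (f₂ ≫ g₂)
  assoc {X₁ X₂ X₃ Y₁ Y₂ Y₃ : L} (f₁ : X₁ ⟶ Y₁) (f₂ : X₂ ⟶ Y₂) (f₃ : X₃ ⟶ Y₃) :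
    ((f₁ ⊗ₘ f₂) ⊗ₘ f₃) ≫ (α_ Y₁ Y₂ Y₃).hom = (α_ X₁ X₂ X₃).hom ≫ (f₁ ⊗ₘ (f₂ ⊗ₘ f₃))
  left {X Y : L} (f : X ⟶ Y) : (𝟙 (𝟙_ L) ⊗ₘ f) ≫ (λ_ Y).hom = (λ_ X).hom ≫ f
  right {X Y : L} (f : X ⟶ Y) : (f ⊗ₘ 𝟙 (𝟙_ L)) ≫ (ρ_ Y).hom = (ρ_ X).hom ≫ f

namespace IsPreMonoidal

lemma isIso_tensor (h : IsPreMonoidal L) {X₁ Y₁ X₂ Y₂ : L} (f₁ : X₁ ⟶ Y₁) (f₂ : X₂ ⟶ Y₂) [IsIso f₁]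
    [IsIso f₂] :
    IsIso (f₁ ⊗ₘ f₂) :=
  ⟨inv f₁ ⊗ₘ inv f₂, by simp [h.comp, h.id_tensor_id], by simp [h.comp, h.id_tensor_id]⟩

lemma pentagon_of_iso (h : IsPreMonoidal L) {W X Y Z W' X' Y' Z' : L} (w : W ≅ W') (x : X ≅ X')
    (y : Y ≅ Y') (z : Z ≅ Z')
    (H : ((α_ W X Y).hom ⊗ₘ 𝟙 Z) ≫ (α_ W (X ⊗ Y) Z).hom ≫ (𝟙 W ⊗ₘ (α_ X Y Z).hom) =
      (α_ (W ⊗ X) Y Z).hom ≫ (α_ W X (Y ⊗ Z)).hom) :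
    ((α_ W' X' Y').hom ⊗ₘ 𝟙 Z') ≫ (α_ W' (X' ⊗ Y') Z').hom ≫ (𝟙 W' ⊗ₘ (α_ X' Y' Z').hom) =
      (α_ (W' ⊗ X') Y' Z').hom ≫ (α_ W' X' (Y' ⊗ Z')).hom := by
  have := h.isIso_tensor w.hom x.hom
  have := h.isIso_tensor (w.hom ⊗ₘ x.hom) y.hom
  have := h.isIso_tensor ((w.hom ⊗ₘ x.hom) ⊗ₘ y.hom) z.hom
  have h₁ : (((w.hom ⊗ₘ x.hom) ⊗ₘ y.hom) ⊗ₘ z.hom) ≫ ((α_ W' X' Y').hom ⊗ₘ 𝟙 Z') =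
      ((α_ W X Y).hom ⊗ₘ 𝟙 Z) ≫ ((w.hom ⊗ₘ (x.hom ⊗ₘ y.hom)) ⊗ₘ z.hom) := by
    rw [h.comp, h.comp, h.assoc, Category.comp_id, Category.id_comp]
  have h₂ : (w.hom ⊗ₘ ((x.hom ⊗ₘ y.hom) ⊗ₘ z.hom)) ≫ (𝟙 W' ⊗ₘ (α_ X' Y' Z').hom) =
      (𝟙 W ⊗ₘ (α_ X Y Z).hom) ≫ (w.hom ⊗ₘ (x.hom ⊗ₘ (y.hom ⊗ₘ z.hom))) := by
    rw [h.comp, h.comp, h.assoc, Category.comp_id, Category.id_comp]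
  rw [← cancel_epi (((w.hom ⊗ₘ x.hom) ⊗ₘ y.hom) ⊗ₘ z.hom), reassoc_of% h₁,
    ← Category.assoc _ (α_ W' (X' ⊗ Y') Z').hom, h.assoc, Category.assoc, h₂, reassoc_of% H,
    ← Category.assoc _ (α_ (W' ⊗ X') Y' Z').hom, h.assoc, Category.assoc, h.assoc]

lemma triangle_of_iso (h : IsPreMonoidal L) {X Y X' Y' : L} (x : X ≅ X') (y : Y ≅ Y')
    (H : (α_ X (𝟙_ L) Y).hom ≫ (𝟙 X ⊗ₘ (λ_ Y).hom) = (ρ_ X).hom ⊗ₘ 𝟙 Y) :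
    (α_ X' (𝟙_ L) Y').hom ≫ (𝟙 X' ⊗ₘ (λ_ Y').hom) = (ρ_ X').hom ⊗ₘ 𝟙 Y' := by
  have := h.isIso_tensor x.hom (𝟙 (𝟙_ L))
  have := h.isIso_tensor (x.hom ⊗ₘ 𝟙 (𝟙_ L)) y.hom
  rw [← cancel_epi ((x.hom ⊗ₘ 𝟙 (𝟙_ L)) ⊗ₘ y.hom), ← Category.assoc, h.assoc, Category.assoc,
    h.comp, h.comp, h.left, h.right, Category.comp_id, Category.comp_id,
    ← Category.id_comp x.hom, ← h.comp, reassoc_of% H, h.comp]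
  simp

lemma hexagon_of_iso (h : IsPreMonoidal L) (b : ∀ X Y : L, X ⊗ Y ≅ Y ⊗ X)
    (hb : ∀ {X X' Y Y' : L} (f : X ⟶ X') (g : Y ⟶ Y'), (f ⊗ₘ g) ≫ (b X' Y').hom =
      (b X Y).hom ≫ (g ⊗ₘ f)) {X Y Z X' Y' Z' : L} (x : X ≅ X') (y : Y ≅ Y') (z : Z ≅ Z')
    (H : (α_ X Y Z).hom ≫ (b X (Y ⊗ Z)).hom ≫ (α_ Y Z X).hom =
      ((b X Y).hom ⊗ₘ 𝟙 Z) ≫ (α_ Y X Z).hom ≫ (𝟙 Y ⊗ₘ (b X Z).hom)) :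
    (α_ X' Y' Z').hom ≫ (b X' (Y' ⊗ Z')).hom ≫ (α_ Y' Z' X').hom =
      ((b X' Y').hom ⊗ₘ 𝟙 Z') ≫ (α_ Y' X' Z').hom ≫ (𝟙 Y' ⊗ₘ (b X' Z').hom) := by
  have := h.isIso_tensor x.hom y.hom
  have := h.isIso_tensor (x.hom ⊗ₘ y.hom) z.hom
  have h₁ : ((x.hom ⊗ₘ y.hom) ⊗ₘ z.hom) ≫ ((b X' Y').hom ⊗ₘ 𝟙 Z') =
      ((b X Y).hom ⊗ₘ 𝟙 Z) ≫ ((y.hom ⊗ₘ x.hom) ⊗ₘ z.hom) := by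
    rw [h.comp, h.comp, hb, Category.comp_id, Category.id_comp]
  have h₂ : (y.hom ⊗ₘ (x.hom ⊗ₘ z.hom)) ≫ (𝟙 Y' ⊗ₘ (b X' Z').hom) =
      (𝟙 Y ⊗ₘ (b X Z).hom) ≫ (y.hom ⊗ₘ (z.hom ⊗ₘ x.hom)) := by
    rw [h.comp, h.comp, hb, Category.comp_id, Category.id_comp]
  have h₃ := h.assoc x.hom y.hom z.hom
  have h₄ := hb x.hom (y.hom ⊗ₘ z.hom)
  have h₅ := h.assoc y.hom z.hom x.hom
  have h₆ := h.assoc y.hom x.hom z.hom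
  rw [← cancel_epi ((x.hom ⊗ₘ y.hom) ⊗ₘ z.hom), reassoc_of% h₁, reassoc_of% h₃, reassoc_of% h₄, h₅,
    reassoc_of% h₆, h₂, reassoc_of% H]

end IsPreMonoidal

/-- The structure isomorphisms of a monoidal functor, and their compatibility with the structure
isomorphisms of the target. -/
structure PreMonoidalFunctor {C : Type*} [Category* C] [MonoidalCategory C] (F : C ⥤ L) where
  unit : 𝟙_ L ≅ F.obj (𝟙_ C)
  mul (x y : C) : F.obj x ⊗ F.obj y ≅ F.obj (x ⊗ y)
  natural {x x' y y' : C} (a : x ⟶ x') (b : y ⟶ y') :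
    (F.map a ⊗ₘ F.map b) ≫ (mul x' y').hom = (mul x y).hom ≫ F.map (a ⊗ₘ b)
  associativity (x y z : C) :
    ((mul x y).hom ⊗ₘ 𝟙 (F.obj z)) ≫ (mul (x ⊗ y) z).hom ≫ F.map (α_ x y z).hom =
      (α_ (F.obj x) (F.obj y) (F.obj z)).hom ≫ (𝟙 (F.obj x) ⊗ₘ (mul y z).hom) ≫ (mul x (y ⊗ z)).hom
  left_unitality (x : C) :
    (λ_ (F.obj x)).hom = (unit.hom ⊗ₘ 𝟙 (F.obj x)) ≫ (mul (𝟙_ C) x).hom ≫ F.map (λ_ x).hom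
  right_unitality (x : C) :
    (ρ_ (F.obj x)).hom = (𝟙 (F.obj x) ⊗ₘ unit.hom) ≫ (mul x (𝟙_ C)).hom ≫ F.map (ρ_ x).hom

namespace PreMonoidalFunctor

variable {C : Type*} [Category* C] [MonoidalCategory C] {F : C ⥤ L}

lemma natural_left (φ : PreMonoidalFunctor F) {x x' : C} (a : x ⟶ x') (y : C) :
    (F.map a ⊗ₘ 𝟙 (F.obj y)) ≫ (φ.mul x' y).hom = (φ.mul x y).hom ≫ F.map (a ▷ y) := by
  rw [← F.map_id, φ.natural, tensorHom_id]

lemma natural_right (φ : PreMonoidalFunctor F) (x : C) {y y' : C} (b : y ⟶ y') :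
    (𝟙 (F.obj x) ⊗ₘ F.map b) ≫ (φ.mul x y').hom = (φ.mul x y).hom ≫ F.map (x ◁ b) := by
  rw [← F.map_id, φ.natural, id_tensorHom]

lemma pentagon (φ : PreMonoidalFunctor F) (h : IsPreMonoidal L) (w x y z : C) :
    ((α_ (F.obj w) (F.obj x) (F.obj y)).hom ⊗ₘ 𝟙 (F.obj z)) ≫
      (α_ (F.obj w) (F.obj x ⊗ F.obj y) (F.obj z)).hom ≫
        (𝟙 (F.obj w) ⊗ₘ (α_ (F.obj x) (F.obj y) (F.obj z)).hom) =
      (α_ (F.obj w ⊗ F.obj x) (F.obj y) (F.obj z)).hom ≫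
        (α_ (F.obj w) (F.obj x) (F.obj y ⊗ F.obj z)).hom := by
  have := h.isIso_tensor (𝟙 (F.obj x)) (φ.mul y z).hom
  have := h.isIso_tensor (𝟙 (F.obj w)) (𝟙 (F.obj x) ⊗ₘ (φ.mul y z).hom)
  have := h.isIso_tensor (𝟙 (F.obj w)) (φ.mul x (y ⊗ z)).hom
  have a₁ : (𝟙 (F.obj w) ⊗ₘ (α_ (F.obj x) (F.obj y) (F.obj z)).hom) ≫
      (𝟙 (F.obj w) ⊗ₘ (𝟙 (F.obj x) ⊗ₘ (φ.mul y z).hom)) ≫ (𝟙 (F.obj w) ⊗ₘ (φ.mul x (y ⊗ z)).hom) =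
      (𝟙 (F.obj w) ⊗ₘ ((φ.mul x y).hom ⊗ₘ 𝟙 (F.obj z))) ≫
        (𝟙 (F.obj w) ⊗ₘ (φ.mul (x ⊗ y) z).hom) ≫ (𝟙 (F.obj w) ⊗ₘ F.map (α_ x y z).hom) := by
    simp only [h.comp, φ.associativity, Category.comp_id]
  have a₂ := h.assoc (𝟙 (F.obj w)) (φ.mul x y).hom (𝟙 (F.obj z))
  have a₃ := φ.associativity w (x ⊗ y) z
  have a₄ : ((α_ (F.obj w) (F.obj x) (F.obj y)).hom ⊗ₘ 𝟙 (F.obj z)) ≫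
      ((𝟙 (F.obj w) ⊗ₘ (φ.mul x y).hom) ⊗ₘ 𝟙 (F.obj z)) ≫
        ((φ.mul w (x ⊗ y)).hom ⊗ₘ 𝟙 (F.obj z)) =
      (((φ.mul w x).hom ⊗ₘ 𝟙 (F.obj y)) ⊗ₘ 𝟙 (F.obj z)) ≫
        ((φ.mul (w ⊗ x) y).hom ⊗ₘ 𝟙 (F.obj z)) ≫ (F.map (α_ w x y).hom ⊗ₘ 𝟙 (F.obj z)) := by
    simp only [h.comp, φ.associativity, Category.comp_id]
  have b₁ := h.assoc (𝟙 (F.obj w)) (𝟙 (F.obj x)) (φ.mul y z).hom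
  have b₂ := φ.associativity w x (y ⊗ z)
  have b₃ : ((𝟙 (F.obj w) ⊗ₘ 𝟙 (F.obj x)) ⊗ₘ (φ.mul y z).hom) ≫
      ((φ.mul w x).hom ⊗ₘ 𝟙 (F.obj (y ⊗ z))) =
      ((φ.mul w x).hom ⊗ₘ (𝟙 (F.obj y) ⊗ₘ 𝟙 (F.obj z))) ≫ (𝟙 (F.obj (w ⊗ x)) ⊗ₘ (φ.mul y z).hom) :=
        by
    simp only [h.comp, h.id_tensor_id, Category.comp_id, Category.id_comp]
  have b₄ := h.assoc (φ.mul w x).hom (𝟙 (F.obj y)) (𝟙 (F.obj z))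
  have b₅ := φ.associativity (w ⊗ x) y z
  rw [← cancel_mono ((𝟙 (F.obj w) ⊗ₘ (𝟙 (F.obj x) ⊗ₘ (φ.mul y z).hom)) ≫
    (𝟙 (F.obj w) ⊗ₘ (φ.mul x (y ⊗ z)).hom) ≫ (φ.mul w (x ⊗ y ⊗ z)).hom)]
  simp only [Category.assoc]
  rw [reassoc_of% a₁, φ.natural_right, ← reassoc_of% a₂, ← reassoc_of% a₃, reassoc_of% a₄,
    reassoc_of% (φ.natural_left (α_ w x y).hom z), ← reassoc_of% b₁, ← b₂, reassoc_of% b₃,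
    ← reassoc_of% b₄, ← reassoc_of% b₅, ← F.map_comp, ← F.map_comp, ← F.map_comp,
    MonoidalCategory.pentagon]

lemma triangle (φ : PreMonoidalFunctor F) (h : IsPreMonoidal L) (x y : C) :
    (α_ (F.obj x) (𝟙_ L) (F.obj y)).hom ≫
    (𝟙 (F.obj x) ⊗ₘ (λ_ (F.obj y)).hom) = (ρ_ (F.obj x)).hom ⊗ₘ 𝟙 (F.obj y) := by
  have a₁ : (𝟙 (F.obj x) ⊗ₘ (λ_ (F.obj y)).hom) =
      (𝟙 (F.obj x) ⊗ₘ (φ.unit.hom ⊗ₘ 𝟙 (F.obj y))) ≫ (𝟙 (F.obj x) ⊗ₘ (φ.mul (𝟙_ C) y).hom) ≫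
        (𝟙 (F.obj x) ⊗ₘ F.map (λ_ y).hom) := by
    simp only [h.comp, φ.left_unitality, Category.comp_id]
  have a₂ : ((ρ_ (F.obj x)).hom ⊗ₘ 𝟙 (F.obj y)) =
      ((𝟙 (F.obj x) ⊗ₘ φ.unit.hom) ⊗ₘ 𝟙 (F.obj y)) ≫ ((φ.mul x (𝟙_ C)).hom ⊗ₘ 𝟙 (F.obj y)) ≫
        (F.map (ρ_ x).hom ⊗ₘ 𝟙 (F.obj y)) := by
    simp only [h.comp, φ.right_unitality, Category.comp_id]
  have a₃ := h.assoc (𝟙 (F.obj x)) φ.unit.hom (𝟙 (F.obj y))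
  have a₄ := φ.associativity x (𝟙_ C) y
  rw [← cancel_mono (φ.mul x y).hom, a₁, a₂]
  simp only [Category.assoc]
  rw [φ.natural_left, φ.natural_right, ← reassoc_of% a₃, ← reassoc_of% a₄, ← F.map_comp,
    MonoidalCategory.triangle]

lemma hexagon (φ : PreMonoidalFunctor F) (h : IsPreMonoidal L) [SymmetricCategory C]
    (b : ∀ X Y : L, X ⊗ Y ≅ Y ⊗ X)
    (hb : ∀ {X X' Y Y' : L} (f : X ⟶ X') (g : Y ⟶ Y'), (f ⊗ₘ g) ≫ (b X' Y').hom =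
      (b X Y).hom ≫ (g ⊗ₘ f))
    (hb' : ∀ x y, (φ.mul x y).hom ≫ F.map (β_ x y).hom = (b (F.obj x) (F.obj y)).hom ≫
      (φ.mul y x).hom)
    (x y z : C) :
    (α_ (F.obj x) (F.obj y) (F.obj z)).hom ≫ (b (F.obj x) (F.obj y ⊗ F.obj z)).hom ≫
      (α_ (F.obj y) (F.obj z) (F.obj x)).hom =
    ((b (F.obj x) (F.obj y)).hom ⊗ₘ 𝟙 (F.obj z)) ≫ (α_ (F.obj y) (F.obj x) (F.obj z)).hom ≫
      (𝟙 (F.obj y) ⊗ₘ (b (F.obj x) (F.obj z)).hom) := by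
  have := h.isIso_tensor (𝟙 (F.obj y)) (φ.mul z x).hom
  have a₁ := φ.associativity y z x
  have a₂ := hb (𝟙 (F.obj x)) (φ.mul y z).hom
  have a₃ := hb' x (y ⊗ z)
  have a₄ := φ.associativity x y z
  have b₁ : (𝟙 (F.obj y) ⊗ₘ (b (F.obj x) (F.obj z)).hom) ≫ (𝟙 (F.obj y) ⊗ₘ (φ.mul z x).hom) =
      (𝟙 (F.obj y) ⊗ₘ (φ.mul x z).hom) ≫ (𝟙 (F.obj y) ⊗ₘ F.map (β_ x z).hom) := by
    simp only [h.comp, hb']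
  have b₂ := φ.associativity y x z
  have b₃ : ((b (F.obj x) (F.obj y)).hom ⊗ₘ 𝟙 (F.obj z)) ≫ ((φ.mul y x).hom ⊗ₘ 𝟙 (F.obj z)) =
      ((φ.mul x y).hom ⊗ₘ 𝟙 (F.obj z)) ≫ (F.map (β_ x y).hom ⊗ₘ 𝟙 (F.obj z)) := by
    simp only [h.comp, hb']
  rw [← cancel_mono ((𝟙 (F.obj y) ⊗ₘ (φ.mul z x).hom) ≫ (φ.mul y (z ⊗ x)).hom)]
  simp only [Category.assoc]
  rw [← a₁, ← reassoc_of% a₂, ← reassoc_of% a₃, ← reassoc_of% a₄, reassoc_of% b₁,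
    φ.natural_right, ← reassoc_of% b₂, reassoc_of% b₃, reassoc_of% (φ.natural_left (β_ x y).hom z),
    ← F.map_comp, ← F.map_comp, ← F.map_comp, ← F.map_comp, BraidedCategory.hexagon_forward]

lemma symmetry (φ : PreMonoidalFunctor F) [SymmetricCategory C] (b : ∀ X Y : L, X ⊗ Y ≅ Y ⊗ X)
    (hb' : ∀ x y, (φ.mul x y).hom ≫ F.map (β_ x y).hom = (b (F.obj x) (F.obj y)).hom ≫
      (φ.mul y x).hom)
    (x y : C) : (b (F.obj x) (F.obj y)).hom ≫ (b (F.obj y) (F.obj x)).hom = 𝟙 _ := by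
  rw [← cancel_mono (φ.mul x y).hom, Category.assoc, ← hb', ← reassoc_of% (hb' x y), ← F.map_comp]
  simp

end PreMonoidalFunctor

end

section

variable {L : Type*} [Category* L] [MonoidalCategoryStruct L]

/-- A monoidal category, from a family of functors respecting the structure isomorphisms such that
each quadruple of objects is in the image of one of them up to isomorphism. -/
@[reducible] def IsPreMonoidal.monoidalCategory (h : IsPreMonoidal L) {I : Type*} {C : I → Type*}
    [∀ i, Category* (C i)] [∀ i, MonoidalCategory (C i)] {F : ∀ i, C i ⥤ L}
    (φ : ∀ i, PreMonoidalFunctor (F i))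
    (ess : ∀ W X Y Z : L, ∃ (i : I) (w x y z : C i), Nonempty ((F i).obj w ≅ W) ∧
      Nonempty ((F i).obj x ≅ X) ∧ Nonempty ((F i).obj y ≅ Y) ∧ Nonempty ((F i).obj z ≅ Z)) :
    MonoidalCategory L where
  tensorHom_def f g := by
    rw [h.whiskerLeft_eq, h.whiskerRight_eq, h.comp, Category.comp_id, Category.id_comp]
  id_tensorHom_id := h.id_tensor_id
  tensorHom_comp_tensorHom := h.comp
  whiskerLeft_id X Y := by rw [h.whiskerLeft_eq, h.id_tensor_id]
  id_whiskerRight X Y := by rw [h.whiskerRight_eq, h.id_tensor_id]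
  associator_naturality := h.assoc
  leftUnitor_naturality f := by rw [h.whiskerLeft_eq, h.left]
  rightUnitor_naturality f := by rw [h.whiskerRight_eq, h.right]
  pentagon W X Y Z := by
    rw [h.whiskerLeft_eq, h.whiskerRight_eq]
    obtain ⟨i, w, x, y, z, ⟨a⟩, ⟨b⟩, ⟨c⟩, ⟨d⟩⟩ := ess W X Y Z
    exact h.pentagon_of_iso a b c d ((φ i).pentagon h w x y z)
  triangle X Y := by
    rw [h.whiskerLeft_eq, h.whiskerRight_eq]
    obtain ⟨i, w, x, y, z, ⟨a⟩, ⟨b⟩, ⟨c⟩, ⟨d⟩⟩ := ess X X Y Y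
    exact h.triangle_of_iso a d ((φ i).triangle h w z)

end

section

variable {L : Type*} [Category* L] [MonoidalCategory L]

lemma IsPreMonoidal.of_monoidalCategory : IsPreMonoidal L where
  whiskerLeft_eq X f := (id_tensorHom X f).symm
  whiskerRight_eq f X := (tensorHom_id f X).symm
  id_tensor_id := id_tensorHom_id
  comp := tensorHom_comp_tensorHom
  assoc := associator_naturality
  left f := by rw [id_tensorHom, MonoidalCategory.leftUnitor_naturality]
  right f := by rw [tensorHom_id, MonoidalCategory.rightUnitor_naturality]

/-- A symmetric monoidal category, from a family of functors respecting the braiding such that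
each triple of objects is in the image of one of them up to isomorphism. -/
@[reducible] def symmetricCategoryOfFamily (b : ∀ X Y : L, X ⊗ Y ≅ Y ⊗ X)
    (hb : ∀ {X X' Y Y' : L} (f : X ⟶ X') (g : Y ⟶ Y'), (f ⊗ₘ g) ≫ (b X' Y').hom =
      (b X Y).hom ≫ (g ⊗ₘ f))
    {I : Type*} {C : I → Type*}
    [∀ i, Category* (C i)] [∀ i, MonoidalCategory (C i)] [∀ i, SymmetricCategory (C i)]
    {F : ∀ i, C i ⥤ L} (φ : ∀ i, PreMonoidalFunctor (F i))
    (hb' : ∀ i x y, ((φ i).mul x y).hom ≫ (F i).map (β_ x y).hom =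
      (b ((F i).obj x) ((F i).obj y)).hom ≫ ((φ i).mul y x).hom)
    (ess : ∀ X Y Z : L, ∃ (i : I) (x y z : C i), Nonempty ((F i).obj x ≅ X) ∧
      Nonempty ((F i).obj y ≅ Y) ∧ Nonempty ((F i).obj z ≅ Z)) :
    SymmetricCategory L :=
  have hs (X Y : L) : (b X Y).hom ≫ (b Y X).hom = 𝟙 (X ⊗ Y) := by
    obtain ⟨i, x, y, z, ⟨a⟩, ⟨c⟩, -⟩ := ess X Y Y
    have h := (φ i).symmetry b (hb' i) x y
    rw [← cancel_epi (a.hom ⊗ₘ c.hom), reassoc_of% (hb a.hom c.hom), hb, reassoc_of% h,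
      Category.comp_id]
  have hs' (X Y : L) : (b X Y).inv = (b Y X).hom := by
    rw [← cancel_epi (b X Y).hom, hs, Iso.hom_inv_id]
  have hf (X Y Z : L) : (α_ X Y Z).hom ≫ (b X (Y ⊗ Z)).hom ≫ (α_ Y Z X).hom =
      ((b X Y).hom ▷ Z) ≫ (α_ Y X Z).hom ≫ (Y ◁ (b X Z).hom) := by
    rw [← id_tensorHom, ← tensorHom_id]
    obtain ⟨i, x, y, z, ⟨a⟩, ⟨c⟩, ⟨d⟩⟩ := ess X Y Z
    exact IsPreMonoidal.of_monoidalCategory.hexagon_of_iso b hb a c d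
      ((φ i).hexagon IsPreMonoidal.of_monoidalCategory b hb (hb' i) x y z)
  { braiding := b
    braiding_naturality_right := fun X Y Z f => by
      rw [← id_tensorHom, ← tensorHom_id, hb]
    braiding_naturality_left := fun f Z => by
      rw [← id_tensorHom, ← tensorHom_id, hb]
    hexagon_forward := hf
    hexagon_reverse := fun X Y Z => by
      have h : (α_ Z X Y ≪≫ b Z (X ⊗ Y) ≪≫ α_ X Y Z).inv =
          (whiskerRightIso (b Z X) Y ≪≫ α_ X Z Y ≪≫ whiskerLeftIso X (b Z Y)).inv :=
        congrArg Iso.inv (Iso.ext (hf Z X Y))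
      simpa [hs'] using h
    symmetry := hs }

end

end

section

open LinTensor

/-! ### Extending natural isomorphisms along tensor products of bicolimits -/

section

variable {R : Type} [CommRing R]
variable {C C' C'' : Type u} [Category.{u} C] [Preadditive C] [Linear R C]
  [Category.{u} C'] [Preadditive C'] [Linear R C'] [Category.{u} C''] [Preadditive C'']
  [Linear R C'']

namespace LinTensor

/-- The associativity functor of the tensor product of linear categories. -/
@[simps! obj] def assoc (R : Type) [CommRing R] (C C' C'' : Type u) [Category.{u} C] [Preadditive C]
    [Linear R C] [Category.{u} C'] [Preadditive C'] [Linear R C'] [Category.{u} C'']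
    [Preadditive C''] [Linear R C''] :
    LinTensor R (LinTensor R C C') C'' ⥤ LinTensor R C (LinTensor R C' C'') :=
  mkFunctor (fun X => ⟨X.fst.fst, ⟨X.fst.snd, X.snd⟩⟩)
    (fun X Y => TensorProduct.curry (TensorProduct.assoc R (X.fst.fst ⟶ Y.fst.fst)
      (X.fst.snd ⟶ Y.fst.snd) (X.snd ⟶ Y.snd)).toLinearMap)
    (fun X => rfl)
    (fun X Y Z a b a' b' => by
      induction a using hom_induction with
      | h0 =>
        rw [Limits.zero_comp, map_zero, map_zero, LinearMap.zero_apply, LinearMap.zero_apply,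
          Limits.zero_comp]
      | ha u v hu hv =>
        rw [Preadditive.add_comp, map_add, map_add, LinearMap.add_apply, LinearMap.add_apply,
          Preadditive.add_comp, hu, hv]
      | ht u v =>
        induction a' using hom_induction with
        | h0 =>
          rw [Limits.comp_zero, map_zero, map_zero, LinearMap.zero_apply, LinearMap.zero_apply,
            Limits.comp_zero]
        | ha u' v' hu hv =>
          rw [Preadditive.comp_add, map_add, map_add, LinearMap.add_apply, LinearMap.add_apply,
            Preadditive.comp_add, hu, hv]
        | ht u' v' => rfl)

instance : (assoc R C C' C'').Additive where
  map_add := map_add (TensorProduct.assoc R _ _ _) _ _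

instance : (assoc R C C' C'').Linear R where
  map_smul f r := map_smul (TensorProduct.assoc R _ _ _) r f

end LinTensor

end

section

variable {R : Type} [CommRing R] {E : Type u} [Bicategory.{u, u} E]
variable {D : LinDiag.{u} R E}
variable {L : Type u} [Category.{u} L] [Preadditive L] [Linear R L]
variable {T : Type u} [Category.{u} T] [Preadditive T] [Linear R T]

namespace LinCocone

/-- The naturality of a family of isomorphisms obtained by conjugating the image of a morphism
under the legs of a cocone. -/
lemma conj_modif (d : LinCocone D L) {e e' : E} (f : e ⟶ e') {T : Type*} [Category* T] (F : L ⥤ T)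
    {x y : D.C e} {x' y' : D.C e'}
    {X Y X' Y' : T} (P : X ⟶ F.obj ((d.leg e).obj x)) (P' : X' ⟶ F.obj ((d.leg e').obj x'))
    (Q : Y ≅ F.obj ((d.leg e).obj y)) (Q' : Y' ≅ F.obj ((d.leg e').obj y'))
    {m : x' ⟶ (D.map f).obj x} {n : y' ⟶ (D.map f).obj y} {A : x ⟶ y} {A' : x' ⟶ y'}
    {U : X' ⟶ X} {V : Y' ⟶ Y}
    (h₁ : P' ≫ F.map ((d.leg e').map m) ≫ F.map ((d.iso f).hom.app x) = U ≫ P)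
    (h₂ : Q'.hom ≫ F.map ((d.leg e').map n) ≫ F.map ((d.iso f).hom.app y) = V ≫ Q.hom)
    (h₃ : m ≫ (D.map f).map A = A' ≫ n) :
    (P' ≫ F.map ((d.leg e').map A') ≫ Q'.inv) ≫ V = U ≫ P ≫ F.map ((d.leg e).map A) ≫ Q.inv := by
  rw [← reassoc_of% h₁, ← cancel_mono Q.hom]
  simp only [Category.assoc, Iso.inv_hom_id, Category.comp_id]
  rw [← h₂, Iso.inv_hom_id_assoc]
  have h₄ := congrArg F.map (d.iso_naturality f A)
  have h₅ := congrArg (fun γ => F.map ((d.leg e').map γ)) h₃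
  simp only [Functor.map_comp] at h₄ h₅
  rw [← h₄, reassoc_of% h₅]

lemma conj_naturality {C L T : Type*} [Category* C] [Category* L] [Category* T] (l : C ⥤ L)
    (F : L ⥤ T) {x y x' y' : C}
    {X Y X' Y' : T} (P : X ⟶ F.obj (l.obj x)) (P' : X' ⟶ F.obj (l.obj x'))
    (Q : Y ≅ F.obj (l.obj y)) (Q' : Y' ≅ F.obj (l.obj y'))
    {m : x' ⟶ x} {n : y' ⟶ y} {A : x ⟶ y} {A' : x' ⟶ y'} {U : X' ⟶ X} {V : Y' ⟶ Y}
    (h₁ : P' ≫ F.map (l.map m) = U ≫ P) (h₂ : Q'.hom ≫ F.map (l.map n) = V ≫ Q.hom)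
    (h₃ : m ≫ A = A' ≫ n) :
    U ≫ P ≫ F.map (l.map A) ≫ Q.inv = (P' ≫ F.map (l.map A') ≫ Q'.inv) ≫ V := by
  rw [← reassoc_of% h₁, ← cancel_mono Q.hom]
  simp only [Category.assoc, Iso.inv_hom_id, Category.comp_id]
  rw [← h₂, Iso.inv_hom_id_assoc]
  simp only [← F.map_comp, ← l.map_comp, h₃]

variable [IsSifted₂₁ E]

/-- Functors on the tensor product of two copies of a sifted bicolimit are isomorphic if their
restrictions to the members of the diagram are. -/
lemma IsColim.exists_iso_pair {d : LinCocone D L} (h : d.IsColim) (F G : LinTensor R L L ⥤ T)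
    [F.Additive] [F.Linear R] [G.Additive] [G.Linear R]
    (θ : ∀ e x y, objPair F ((d.leg e).obj x) ((d.leg e).obj y) ≅
      objPair G ((d.leg e).obj x) ((d.leg e).obj y))
    (hθ : ∀ e {x x' y y'} (u : x ⟶ x') (v : y ⟶ y'),
      mapPair F ((d.leg e).map u) ((d.leg e).map v) ≫ (θ e x' y').hom =
        (θ e x y).hom ≫ mapPair G ((d.leg e).map u) ((d.leg e).map v))
    (hθ' : ∀ {e e'} (f : e ⟶ e') x y, (θ e' ((D.map f).obj x) ((D.map f).obj y)).hom ≫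
        mapPair G ((d.iso f).hom.app x) ((d.iso f).hom.app y) =
      mapPair F ((d.iso f).hom.app x) ((d.iso f).hom.app y) ≫ (θ e x y).hom) :
    ∃ a : ∀ X Y, objPair F X Y ≅ objPair G X Y,
      (∀ {X X' Y Y'} (u : X ⟶ X') (v : Y ⟶ Y'),
        mapPair F u v ≫ (a X' Y').hom = (a X Y).hom ≫ mapPair G u v) ∧
      ∀ e x y, (a ((d.leg e).obj x) ((d.leg e).obj y)).hom = (θ e x y).hom := by
  obtain ⟨α, hα⟩ := (h.tensor h).ext T F G
    (fun e => natIsoPair (mapFunctor (R := R) (d.leg e) (d.leg e) ⋙ F)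
      (mapFunctor (R := R) (d.leg e) (d.leg e) ⋙ G) (θ e) (fun u v => hθ e u v))
    (fun e e' f X => hθ' f X.fst X.snd)
  exact ⟨fun X Y => α.app ⟨X, Y⟩, fun {X X' Y Y'} u v =>
    α.hom.naturality (X := ⟨X, Y⟩) (Y := ⟨X', Y'⟩) (tmul u v), fun e x y => hα e ⟨x, y⟩⟩

/-- An associativity isomorphism for a functor on the tensor product of two copies of a sifted
bicolimit, from its components at the members of the diagram. -/
lemma IsColim.exists_associator {d : LinCocone D L} (h : d.IsColim) (M : LinTensor R L L ⥤ L)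
    [M.Additive] [M.Linear R]
    (θ : ∀ e x y z, objPair M (objPair M ((d.leg e).obj x) ((d.leg e).obj y)) ((d.leg e).obj z) ≅
      objPair M ((d.leg e).obj x) (objPair M ((d.leg e).obj y) ((d.leg e).obj z)))
    (hθ : ∀ e {x x' y y' z z'} (u : x ⟶ x') (v : y ⟶ y') (w : z ⟶ z'),
      mapPair M (mapPair M ((d.leg e).map u) ((d.leg e).map v)) ((d.leg e).map w) ≫
          (θ e x' y' z').hom =
        (θ e x y z).hom ≫
          mapPair M ((d.leg e).map u) (mapPair M ((d.leg e).map v) ((d.leg e).map w)))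
    (hθ' : ∀ {e e'} (f : e ⟶ e') x y z,
      (θ e' ((D.map f).obj x) ((D.map f).obj y) ((D.map f).obj z)).hom ≫
        mapPair M ((d.iso f).hom.app x)
          (mapPair M ((d.iso f).hom.app y) ((d.iso f).hom.app z)) =
      mapPair M (mapPair M ((d.iso f).hom.app x) ((d.iso f).hom.app y)) ((d.iso f).hom.app z) ≫
        (θ e x y z).hom) :
    ∃ a : ∀ X Y Z, objPair M (objPair M X Y) Z ≅ objPair M X (objPair M Y Z),
      (∀ {X X' Y Y' Z Z'} (u : X ⟶ X') (v : Y ⟶ Y') (w : Z ⟶ Z'),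
        mapPair M (mapPair M u v) w ≫ (a X' Y' Z').hom =
          (a X Y Z).hom ≫ mapPair M u (mapPair M v w)) ∧
      ∀ e x y z, (a ((d.leg e).obj x) ((d.leg e).obj y) ((d.leg e).obj z)).hom =
        (θ e x y z).hom := by
  let F : LinTensor R (LinTensor R L L) L ⥤ L := mapFunctor (R := R) M (𝟭 L) ⋙ M
  let G : LinTensor R (LinTensor R L L) L ⥤ L :=
    LinTensor.assoc R L L L ⋙ mapFunctor (R := R) (𝟭 L) M ⋙ M
  have hF : F.Additive := inferInstanceAs (mapFunctor (R := R) M (𝟭 L) ⋙ M).Additive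
  have hF' : F.Linear R := inferInstanceAs ((mapFunctor (R := R) M (𝟭 L) ⋙ M).Linear R)
  have hG : G.Additive :=
    inferInstanceAs (LinTensor.assoc R L L L ⋙ mapFunctor (R := R) (𝟭 L) M ⋙ M).Additive
  have hG' : G.Linear R :=
    inferInstanceAs ((LinTensor.assoc R L L L ⋙ mapFunctor (R := R) (𝟭 L) M ⋙ M).Linear R)
  have key (e : E) {X Y : LinTensor R (D.C e) (D.C e)} {z z' : D.C e} (u : X ⟶ Y) (w : z ⟶ z') :
      mapPair (mapFunctor (R := R) (mapFunctor (R := R) (d.leg e) (d.leg e)) (d.leg e) ⋙ F) u w ≫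
          (θ e Y.fst Y.snd z').hom = (θ e X.fst X.snd z).hom ≫
        mapPair (mapFunctor (R := R) (mapFunctor (R := R) (d.leg e) (d.leg e)) (d.leg e) ⋙ G)
          u w := by
    induction u using hom_induction with
    | h0 =>
      unfold mapPair
      rw [LinTensor.zero_tmul, Functor.map_zero, Functor.map_zero]
      exact Limits.zero_comp.trans Limits.comp_zero.symm
    | ha u v hu hv =>
      unfold mapPair at hu hv ⊢
      rw [LinTensor.add_tmul, Functor.map_add, Functor.map_add]
      exact (Preadditive.add_comp _ _ _ _ _ _).trans ((congrArg₂ (· + ·) hu hv).trans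
        (Preadditive.comp_add _ _ _ _ _ _).symm)
    | ht u v => exact hθ e u v w
  obtain ⟨α, hα⟩ := ((h.tensor h).tensor h).ext L F G
    (fun e => natIsoPair (mapFunctor (R := R) (mapFunctor (R := R) (d.leg e) (d.leg e)) (d.leg e) ⋙
      F)
      (mapFunctor (R := R) (mapFunctor (R := R) (d.leg e) (d.leg e)) (d.leg e) ⋙ G)
      (fun X z => θ e X.fst X.snd z) (fun u w => key e u w))
    (fun e e' f X => hθ' f X.fst.fst X.fst.snd X.snd)
  exact ⟨fun X Y Z => α.app ⟨⟨X, Y⟩, Z⟩, fun {X X' Y Y' Z Z'} u v w =>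
    let U : (⟨X, Y⟩ : LinTensor R L L) ⟶ ⟨X', Y'⟩ := tmul u v
    let V : (⟨⟨X, Y⟩, Z⟩ : LinTensor R (LinTensor R L L) L) ⟶ ⟨⟨X', Y'⟩, Z'⟩ := tmul U w
    α.hom.naturality V,
    fun e x y z => hα e ⟨⟨x, y⟩, z⟩⟩

lemma IsColim.ess_four {d : LinCocone D L} (h : d.IsColim) (W X Y Z : L) :
    ∃ (e : E) (w x y z : D.C e), Nonempty ((d.leg e).obj w ≅ W) ∧
      Nonempty ((d.leg e).obj x ≅ X) ∧ Nonempty ((d.leg e).obj y ≅ Y) ∧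
        Nonempty ((d.leg e).obj z ≅ Z) := by
  obtain ⟨a, w, ⟨iw⟩⟩ := h.ess W
  obtain ⟨b, x, ⟨ix⟩⟩ := h.ess X
  obtain ⟨c, y, ⟨iy⟩⟩ := h.ess Y
  obtain ⟨c', z, ⟨iz⟩⟩ := h.ess Z
  obtain ⟨e₁, ⟨f₁⟩, ⟨f₂⟩⟩ := IsSifted₂₁.exists_cospan a b
  obtain ⟨e₂, ⟨f₃⟩, ⟨f₄⟩⟩ := IsSifted₂₁.exists_cospan c c'
  obtain ⟨e, ⟨g₁⟩, ⟨g₂⟩⟩ := IsSifted₂₁.exists_cospan e₁ e₂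
  exact ⟨e, _, _, _, _, ⟨(d.iso (f₁ ≫ g₁)).app w ≪≫ iw⟩, ⟨(d.iso (f₂ ≫ g₁)).app x ≪≫ ix⟩,
    ⟨(d.iso (f₃ ≫ g₂)).app y ≪≫ iy⟩, ⟨(d.iso (f₄ ≫ g₂)).app z ≪≫ iz⟩⟩

end LinCocone

end

/-! ### Diagrams of symmetric monoidal linear categories -/

section

open MonoidalCategory

variable {R : Type} [CommRing R]

/-- The bilinear tensor product of morphisms of a monoidal linear category. -/
def tensorHomLinear (R : Type) [CommRing R] {C : Type u} [Category.{u} C] [Preadditive C]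
    [Linear R C] [MonoidalCategory C] [MonoidalPreadditive C] [MonoidalLinear R C]
    (X X' Y Y' : C) : (X ⟶ X') →ₗ[R] (Y ⟶ Y') →ₗ[R] (X ⊗ Y ⟶ X' ⊗ Y') :=
  LinearMap.mk₂ R (fun a b => a ⊗ₘ b)
    (fun a a' b => MonoidalPreadditive.add_tensor a a' b)
    (fun r a b => by simp [MonoidalCategory.tensorHom_def])
    (fun a b b' => MonoidalPreadditive.tensor_add a b b')
    (fun r a b => by simp [MonoidalCategory.tensorHom_def])

/-- The tensor product of a monoidal linear category, as a functor on a tensor product. -/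
@[simps! obj] def tensorFunctor (R : Type) [CommRing R] (C : Type u) [Category.{u} C]
    [Preadditive C]
    [Linear R C] [MonoidalCategory C] [MonoidalPreadditive C] [MonoidalLinear R C] :
    LinTensor R C C ⥤ C :=
  mkFunctor (fun X => X.fst ⊗ X.snd)
    (fun X Y => tensorHomLinear R X.fst Y.fst X.snd Y.snd)
    (fun X => id_tensorHom_id _ _)
    (fun X Y Z a b a' b' => (tensorHom_comp_tensorHom a b a' b').symm)

section

variable {C : Type u} [Category.{u} C] [Preadditive C]
    [Linear R C] [MonoidalCategory C] [MonoidalPreadditive C] [MonoidalLinear R C]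

instance : (tensorFunctor R C).Additive where
  map_add {X Y f g} :=
    map_add (TensorProduct.lift (tensorHomLinear R X.fst Y.fst X.snd Y.snd)) f g

instance : (tensorFunctor R C).Linear R where
  map_smul {X Y} f r :=
    map_smul (TensorProduct.lift (tensorHomLinear R X.fst Y.fst X.snd Y.snd)) r f

end

variable {E : Type u} [Bicategory.{u, u} E]

/-- Symmetric monoidal structures on the members of a diagram of linear categories, compatible
with the structure of the diagram. -/
class LinDiag.Symm (D : LinDiag.{u} R E) where
  [monoidal (e : E) : MonoidalCategory (D.C e)]
  [symmetric (e : E) : SymmetricCategory (D.C e)]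
  [monoidalPreadditive (e : E) : MonoidalPreadditive (D.C e)]
  [monoidalLinear (e : E) : MonoidalLinear R (D.C e)]
  [braided {e e' : E} (f : e ⟶ e') : (D.map f).Braided]
  [map₂ {e e' : E} {f g : e ⟶ e'} (η : f ⟶ g) : (D.map₂ η).IsMonoidal]
  [mapId (e : E) : (D.mapId e).hom.IsMonoidal]
  [mapComp {e e' e'' : E} (f : e ⟶ e') (g : e' ⟶ e'') : (D.mapComp f g).hom.IsMonoidal]

attribute [instance] LinDiag.Symm.monoidal LinDiag.Symm.symmetric LinDiag.Symm.monoidalPreadditive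
  LinDiag.Symm.monoidalLinear LinDiag.Symm.braided LinDiag.Symm.map₂ LinDiag.Symm.mapId
  LinDiag.Symm.mapComp

/-- A symmetric monoidal structure on a cocone under a diagram of symmetric monoidal linear
categories. -/
class LinCocone.Symm {D : LinDiag.{u} R E} [D.Symm] {L : Type u} [Category.{u} L] [Preadditive L]
    [Linear R L] [MonoidalCategory L] [SymmetricCategory L] (d : LinCocone D L) where
  [braided (e : E) : (d.leg e).Braided]
  [iso {e e' : E} (f : e ⟶ e') : (d.iso f).hom.IsMonoidal]

attribute [instance] LinCocone.Symm.braided LinCocone.Symm.iso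

variable {D : LinDiag.{u} R E} [D.Symm]
variable {L : Type u} [Category.{u} L] [Preadditive L] [Linear R L]

open Functor

namespace LinCocone

lemma map₂_tensor {e e' : E} {f g : e ⟶ e'} (η : f ⟶ g) (x y : D.C e) :
    LaxMonoidal.μ (D.map f) x y ≫ (D.map₂ η).app (x ⊗ y) =
      ((D.map₂ η).app x ⊗ₘ (D.map₂ η).app y) ≫ LaxMonoidal.μ (D.map g) x y :=
  NatTrans.IsMonoidal.tensor x y

lemma mapId_tensor (e : E) (x y : D.C e) :
    LaxMonoidal.μ (D.map (𝟙 e)) x y ≫ (D.mapId e).hom.app (x ⊗ y) =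
      (D.mapId e).hom.app x ⊗ₘ (D.mapId e).hom.app y :=
  (NatTrans.IsMonoidal.tensor (τ := (D.mapId e).hom) x y).trans (Category.comp_id _)

lemma mapComp_tensor {e e' e'' : E} (f : e ⟶ e') (g : e' ⟶ e'') (x y : D.C e) :
    LaxMonoidal.μ (D.map (f ≫ g)) x y ≫ (D.mapComp f g).hom.app (x ⊗ y) =
      ((D.mapComp f g).hom.app x ⊗ₘ (D.mapComp f g).hom.app y) ≫
        LaxMonoidal.μ (D.map g) _ _ ≫ (D.map g).map (LaxMonoidal.μ (D.map f) x y) :=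
  NatTrans.IsMonoidal.tensor (τ := (D.mapComp f g).hom) x y

/-- The cocone under the pointwise tensor square of a diagram of symmetric monoidal linear
categories induced by the tensor products. -/
@[reducible] def mul (d : LinCocone D L) : LinCocone (D.tensor D) L where
  leg e := tensorFunctor R (D.C e) ⋙ d.leg e
  iso {e e'} f := natIsoPair
    (mapFunctor (R := R) (D.map f) (D.map f) ⋙ tensorFunctor R (D.C e') ⋙ d.leg e')
    (tensorFunctor R (D.C e) ⋙ d.leg e)
    (fun x y => (d.leg e').mapIso (Monoidal.μIso (D.map f) x y) ≪≫ (d.iso f).app (x ⊗ y))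
    (fun {x x' y y'} u v => by
      change (d.leg e').map ((D.map f).map u ⊗ₘ (D.map f).map v) ≫
        (d.leg e').map (LaxMonoidal.μ (D.map f) x' y') ≫ (d.iso f).hom.app (x' ⊗ y') =
        ((d.leg e').map (LaxMonoidal.μ (D.map f) x y) ≫ (d.iso f).hom.app (x ⊗ y)) ≫
          (d.leg e).map (u ⊗ₘ v)
      rw [Category.assoc, ← d.iso_naturality, ← Functor.map_comp_assoc, ← Functor.map_comp_assoc,
        LaxMonoidal.μ_natural])
  map₂ {e e' f g} η x := by
    change (d.leg e').map ((D.map₂ η).app x.fst ⊗ₘ (D.map₂ η).app x.snd) ≫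
      (d.leg e').map (LaxMonoidal.μ (D.map g) x.fst x.snd) ≫ (d.iso g).hom.app (x.fst ⊗ x.snd) =
      (d.leg e').map (LaxMonoidal.μ (D.map f) x.fst x.snd) ≫ (d.iso f).hom.app (x.fst ⊗ x.snd)
    rw [← d.map₂ η, ← Functor.map_comp_assoc, ← Functor.map_comp_assoc, map₂_tensor]
  id e x := by
    change (d.leg e).map (LaxMonoidal.μ (D.map (𝟙 e)) x.fst x.snd) ≫
      (d.iso (𝟙 e)).hom.app (x.fst ⊗ x.snd) =
      (d.leg e).map ((D.mapId e).hom.app x.fst ⊗ₘ (D.mapId e).hom.app x.snd)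
    rw [d.id, ← Functor.map_comp, mapId_tensor]
  comp {e e' e''} f g x := by
    change (d.leg e'').map (LaxMonoidal.μ (D.map (f ≫ g)) x.fst x.snd) ≫
      (d.iso (f ≫ g)).hom.app (x.fst ⊗ x.snd) =
      (d.leg e'').map ((D.mapComp f g).hom.app x.fst ⊗ₘ (D.mapComp f g).hom.app x.snd) ≫
        ((d.leg e'').map (LaxMonoidal.μ (D.map g) ((D.map f).obj x.fst) ((D.map f).obj x.snd)) ≫
          (d.iso g).hom.app ((D.map f).obj x.fst ⊗ (D.map f).obj x.snd)) ≫
        (d.leg e').map (LaxMonoidal.μ (D.map f) x.fst x.snd) ≫ (d.iso f).hom.app (x.fst ⊗ x.snd)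
    rw [d.comp, ← Functor.map_comp_assoc, mapComp_tensor, Category.assoc,
      ← reassoc_of% d.iso_naturality g]
    simp only [Functor.map_comp, Category.assoc]

variable [IsSifted₂₁ E]

/-- The multiplication on a sifted bicolimit of symmetric monoidal linear categories. -/
lemma IsColim.exists_mul {d : LinCocone D L} (h : d.IsColim) :
    ∃ (M : LinTensor R L L ⥤ L) (_ : M.Additive) (_ : M.Linear R)
      (m : ∀ e x y, objPair M ((d.leg e).obj x) ((d.leg e).obj y) ≅ (d.leg e).obj (x ⊗ y)),
      (∀ e {x x' y y'} (u : x ⟶ x') (v : y ⟶ y'),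
        mapPair M ((d.leg e).map u) ((d.leg e).map v) ≫ (m e x' y').hom =
          (m e x y).hom ≫ (d.leg e).map (u ⊗ₘ v)) ∧
      ∀ {e e'} (f : e ⟶ e') x y, (m e' ((D.map f).obj x) ((D.map f).obj y)).hom ≫
        (d.leg e').map (LaxMonoidal.μ (D.map f) x y) ≫ (d.iso f).hom.app (x ⊗ y) =
          mapPair M ((d.iso f).hom.app x) ((d.iso f).hom.app y) ≫ (m e x y).hom := by
  obtain ⟨M, h₁, h₂, σ, hσ⟩ := (h.tensor h).desc L d.mul
  exact ⟨M, h₁, h₂, fun e x y => (σ e).app ⟨x, y⟩, fun e {x x' y y'} u v =>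
    (σ e).hom.naturality (X := ⟨x, y⟩) (Y := ⟨x', y'⟩) (tmul u v), fun f x y => hσ f ⟨x, y⟩⟩

end LinCocone

end

end

section

open LinTensor MonoidalCategory Functor

section

variable {C L : Type*} [Category* C] [MonoidalCategory C] [Category* L] [MonoidalCategory L]

namespace PreMonoidalFunctor

/-- The monoidal structure on a functor given by its structure isomorphisms. -/
@[reducible] def coreMonoidal {F : C ⥤ L} (φ : PreMonoidalFunctor F) : F.CoreMonoidal where
  εIso := φ.unit
  μIso := φ.mul
  μIso_hom_natural_left f X := by
    have := φ.natural_left f X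
    rwa [tensorHom_id] at this
  μIso_hom_natural_right X f := by
    have := φ.natural_right X f
    rwa [id_tensorHom] at this
  associativity X Y Z := by
    have := φ.associativity X Y Z
    rwa [tensorHom_id, id_tensorHom] at this
  left_unitality X := by
    have := φ.left_unitality X
    rwa [tensorHom_id] at this
  right_unitality X := by
    have := φ.right_unitality X
    rwa [id_tensorHom] at this

/-- The braided structure on a functor given by its structure isomorphisms. -/
@[reducible] def braidedFunctor [BraidedCategory C] [BraidedCategory L] {F : C ⥤ L}
    (φ : PreMonoidalFunctor F)
    (h : ∀ x y, (φ.mul x y).hom ≫ F.map (β_ x y).hom = (β_ (F.obj x) (F.obj y)).hom ≫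
      (φ.mul y x).hom) : F.Braided where
  toMonoidal := φ.coreMonoidal.toMonoidal
  braided := h

end PreMonoidalFunctor

end

/-! ### Sifted bicolimits of symmetric monoidal linear categories -/

section

variable {R : Type} [CommRing R] {E : Type u} [Bicategory.{u, u} E]
variable {D : LinDiag.{u} R E} [D.Symm]
variable {L : Type u} [Category.{u} L] [Preadditive L] [Linear R L]

namespace LinCocone

lemma map₂_unit {e e' : E} {f g : e ⟶ e'} (η : f ⟶ g) :
    LaxMonoidal.ε (D.map f) ≫ (D.map₂ η).app (𝟙_ (D.C e)) = LaxMonoidal.ε (D.map g) :=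
  NatTrans.IsMonoidal.unit

lemma mapId_unit (e : E) :
    LaxMonoidal.ε (D.map (𝟙 e)) ≫ (D.mapId e).hom.app (𝟙_ (D.C e)) = 𝟙 (𝟙_ (D.C e)) :=
  NatTrans.IsMonoidal.unit (τ := (D.mapId e).hom)

lemma mapComp_unit {e e' e'' : E} (f : e ⟶ e') (g : e' ⟶ e'') :
    LaxMonoidal.ε (D.map (f ≫ g)) ≫ (D.mapComp f g).hom.app (𝟙_ (D.C e)) =
      LaxMonoidal.ε (D.map g) ≫ (D.map g).map (LaxMonoidal.ε (D.map f)) :=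
  NatTrans.IsMonoidal.unit (τ := (D.mapComp f g).hom)

variable [IsSifted₂₁ E]

lemma exists_unit (d : LinCocone D L) : ∃ (z : L) (j : ∀ e, z ≅ (d.leg e).obj (𝟙_ (D.C e))),
    ∀ {e e' : E} (f : e ⟶ e'), (j e').hom ≫ (d.leg e').map (LaxMonoidal.ε (D.map f)) ≫
      (d.iso f).hom.app (𝟙_ (D.C e)) = (j e).hom :=
  d.exists_point (fun e => 𝟙_ (D.C e)) (fun f => Monoidal.εIso (D.map f))
    (fun η => map₂_unit η) mapId_unit mapComp_unit

section

variable {d : LinCocone D L} {M : LinTensor R L L ⥤ L}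
  {m : ∀ e x y, objPair M ((d.leg e).obj x) ((d.leg e).obj y) ≅ (d.leg e).obj (x ⊗ y)}
  {z : L} {j : ∀ e, z ≅ (d.leg e).obj (𝟙_ (D.C e))}

lemma IsColim.exists_braiding (h : d.IsColim) [M.Additive] [M.Linear R]
    (hm : ∀ e {x x' y y'} (u : x ⟶ x') (v : y ⟶ y'),
      mapPair M ((d.leg e).map u) ((d.leg e).map v) ≫ (m e x' y').hom =
        (m e x y).hom ≫ (d.leg e).map (u ⊗ₘ v))
    (hm' : ∀ {e e'} (f : e ⟶ e') x y, (m e' ((D.map f).obj x) ((D.map f).obj y)).hom ≫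
        (d.leg e').map (LaxMonoidal.μ (D.map f) x y) ≫ (d.iso f).hom.app (x ⊗ y) =
          mapPair M ((d.iso f).hom.app x) ((d.iso f).hom.app y) ≫ (m e x y).hom) :
    ∃ b : ∀ X Y, objPair M X Y ≅ objPair M Y X,
      (∀ {X X' Y Y'} (u : X ⟶ X') (v : Y ⟶ Y'),
        mapPair M u v ≫ (b X' Y').hom = (b X Y).hom ≫ mapPair M v u) ∧
      ∀ e x y, (m e x y).hom ≫ (d.leg e).map (β_ x y).hom =
        (b ((d.leg e).obj x) ((d.leg e).obj y)).hom ≫ (m e y x).hom := by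
  obtain ⟨b, hb, hb'⟩ := h.exists_iso_pair M (swap R L L ⋙ M)
    (fun e x y => m e x y ≪≫ (d.leg e).mapIso (β_ x y) ≪≫ (m e y x).symm)
    (fun e {x x' y y'} u v => conj_naturality (d.leg e) (𝟭 L) (m e x' y').hom (m e x y).hom
      (m e y' x') (m e y x) (m := u ⊗ₘ v) (n := v ⊗ₘ u) (A := (β_ x' y').hom) (A' := (β_ x y).hom)
      (hm e u v).symm (hm e v u).symm (BraidedCategory.braiding_naturality u v))
    (fun {e e'} f x y => d.conj_modif f (𝟭 L) (m e x y).hom (m e' _ _).hom (m e y x) (m e' _ _)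
      (A := (β_ x y).hom) (A' := (β_ _ _).hom)
      (hm' f x y) (hm' f y x) (LaxBraided.braided x y))
  let b' (X Y : L) : objPair M X Y ≅ objPair M Y X := b X Y
  have h₀ (e : E) (x y : D.C e) : (b' ((d.leg e).obj x) ((d.leg e).obj y)).hom =
    (m e x y).hom ≫ (d.leg e).map (β_ x y).hom ≫ (m e y x).inv := hb' e x y
  refine ⟨b', hb, fun e x y => ?_⟩
  rw [h₀]
  simp

lemma IsColim.exists_leftUnitor (h : d.IsColim) [M.Additive] [M.Linear R]
    (hm : ∀ e {x x' y y'} (u : x ⟶ x') (v : y ⟶ y'),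
      mapPair M ((d.leg e).map u) ((d.leg e).map v) ≫ (m e x' y').hom =
        (m e x y).hom ≫ (d.leg e).map (u ⊗ₘ v))
    (hm' : ∀ {e e'} (f : e ⟶ e') x y, (m e' ((D.map f).obj x) ((D.map f).obj y)).hom ≫
        (d.leg e').map (LaxMonoidal.μ (D.map f) x y) ≫ (d.iso f).hom.app (x ⊗ y) =
          mapPair M ((d.iso f).hom.app x) ((d.iso f).hom.app y) ≫ (m e x y).hom)
    (hj : ∀ {e e' : E} (f : e ⟶ e'), (j e').hom ≫ (d.leg e').map (LaxMonoidal.ε (D.map f)) ≫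
      (d.iso f).hom.app (𝟙_ (D.C e)) = (j e).hom) :
    ∃ l : ∀ X, objPair M z X ≅ X,
      (∀ {X X'} (u : X ⟶ X'), mapPair M (𝟙 z) u ≫ (l X').hom = (l X).hom ≫ u) ∧
      ∀ e x, (l ((d.leg e).obj x)).hom =
        mapPair M (j e).hom (𝟙 _) ≫ (m e (𝟙_ (D.C e)) x).hom ≫ (d.leg e).map (λ_ x).hom := by
  have hj' {e : E} {x y : D.C e} (u : x ⟶ y) :
      (mapPair M (j e).hom (𝟙 _) ≫ (m e (𝟙_ (D.C e)) x).hom) ≫ (d.leg e).map (𝟙 (𝟙_ _) ⊗ₘ u) =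
        mapPair M (𝟙 z) ((d.leg e).map u) ≫ mapPair M (j e).hom (𝟙 _) ≫
          (m e (𝟙_ (D.C e)) y).hom := by
    rw [mapPair_mapPair_assoc, Category.id_comp, Category.comp_id, Category.assoc, ← hm,
      mapPair_mapPair_assoc, Category.id_comp, (d.leg e).map_id, Category.comp_id]
  obtain ⟨α, hα⟩ := h.ext L (fixSnd (swap R L L ⋙ M) z) (𝟭 L)
    (fun e => NatIso.ofComponents
      (fun x => mapIsoPair M (j e) (Iso.refl _) ≪≫ m e (𝟙_ (D.C e)) x ≪≫ (d.leg e).mapIso (λ_ x))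
      (fun {x y} u => by
        change mapPair M (𝟙 z) ((d.leg e).map u) ≫ mapPair M (j e).hom (𝟙 _) ≫
          (m e (𝟙_ (D.C e)) y).hom ≫ (d.leg e).map (λ_ y).hom =
          (mapPair M (j e).hom (𝟙 _) ≫ (m e (𝟙_ (D.C e)) x).hom ≫ (d.leg e).map (λ_ x).hom) ≫
            (d.leg e).map u
        have := hj' u
        simp only [Category.assoc] at this ⊢
        rw [← reassoc_of% this, ← Functor.map_comp, ← Functor.map_comp, id_tensorHom,
          MonoidalCategory.leftUnitor_naturality]))
    (fun e e' f x => by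
      change (mapPair M (j e').hom (𝟙 _) ≫ (m e' (𝟙_ (D.C e')) ((D.map f).obj x)).hom ≫
          (d.leg e').map (λ_ ((D.map f).obj x)).hom) ≫ (d.iso f).hom.app x =
        mapPair M (𝟙 z) ((d.iso f).hom.app x) ≫ mapPair M (j e).hom (𝟙 _) ≫
          (m e (𝟙_ (D.C e)) x).hom ≫ (d.leg e).map (λ_ x).hom
      have h₁ : LaxMonoidal.ε (D.map f) ▷ (D.map f).obj x =
        LaxMonoidal.ε (D.map f) ⊗ₘ 𝟙 ((D.map f).obj x) := (tensorHom_id _ _).symm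
      rw [LaxMonoidal.left_unitality, h₁, Functor.map_comp, Functor.map_comp]
      simp only [Category.assoc]
      rw [d.iso_naturality, ← reassoc_of% (hm e'), reassoc_of% (hm' f), mapPair_mapPair_assoc,
        mapPair_mapPair_assoc, mapPair_mapPair_assoc, (d.leg e').map_id]
      simp only [Category.id_comp, Category.comp_id, Category.assoc, hj])
  exact ⟨fun X => α.app X, fun u => α.hom.naturality u, fun e x => hα e x⟩

lemma IsColim.exists_associativity (h : d.IsColim) [M.Additive] [M.Linear R]
    (hm : ∀ e {x x' y y'} (u : x ⟶ x') (v : y ⟶ y'),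
      mapPair M ((d.leg e).map u) ((d.leg e).map v) ≫ (m e x' y').hom =
        (m e x y).hom ≫ (d.leg e).map (u ⊗ₘ v))
    (hm' : ∀ {e e'} (f : e ⟶ e') x y, (m e' ((D.map f).obj x) ((D.map f).obj y)).hom ≫
        (d.leg e').map (LaxMonoidal.μ (D.map f) x y) ≫ (d.iso f).hom.app (x ⊗ y) =
          mapPair M ((d.iso f).hom.app x) ((d.iso f).hom.app y) ≫ (m e x y).hom) :
    ∃ a : ∀ X Y Z, objPair M (objPair M X Y) Z ≅ objPair M X (objPair M Y Z),
      (∀ {X X' Y Y' Z Z'} (u : X ⟶ X') (v : Y ⟶ Y') (w : Z ⟶ Z'),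
        mapPair M (mapPair M u v) w ≫ (a X' Y' Z').hom =
          (a X Y Z).hom ≫ mapPair M u (mapPair M v w)) ∧
      ∀ e x y z, mapPair M (m e x y).hom (𝟙 _) ≫ (m e (x ⊗ y) z).hom ≫
          (d.leg e).map (α_ x y z).hom =
        (a ((d.leg e).obj x) ((d.leg e).obj y) ((d.leg e).obj z)).hom ≫
          mapPair M (𝟙 _) (m e y z).hom ≫ (m e x (y ⊗ z)).hom := by
  have nat₁ (e : E) {x x' y y' z z' : D.C e} (u : x ⟶ x') (v : y ⟶ y') (w : z ⟶ z') :
      (mapPair M (m e x y).hom (𝟙 _) ≫ (m e (x ⊗ y) z).hom) ≫ (d.leg e).map ((u ⊗ₘ v) ⊗ₘ w) =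
        mapPair M (mapPair M ((d.leg e).map u) ((d.leg e).map v)) ((d.leg e).map w) ≫
          mapPair M (m e x' y').hom (𝟙 _) ≫ (m e (x' ⊗ y') z').hom := by
    rw [Category.assoc, ← hm, mapPair_mapPair_assoc, mapPair_mapPair_assoc, hm, Category.id_comp,
      Category.comp_id]
  have nat₂ (e : E) {x x' y y' z z' : D.C e} (u : x ⟶ x') (v : y ⟶ y') (w : z ⟶ z') :
      (mapPair M (𝟙 _) (m e y z).hom ≫ (m e x (y ⊗ z)).hom) ≫ (d.leg e).map (u ⊗ₘ (v ⊗ₘ w)) =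
        mapPair M ((d.leg e).map u) (mapPair M ((d.leg e).map v) ((d.leg e).map w)) ≫
          mapPair M (𝟙 _) (m e y' z').hom ≫ (m e x' (y' ⊗ z')).hom := by
    rw [Category.assoc, ← hm, mapPair_mapPair_assoc, mapPair_mapPair_assoc, hm, Category.id_comp,
      Category.comp_id]
  have mod₁ {e e' : E} (f : e ⟶ e') (x y z : D.C e) :
      (mapPair M (m e' _ _).hom (𝟙 _) ≫ (m e' ((D.map f).obj x ⊗ (D.map f).obj y)
          ((D.map f).obj z)).hom) ≫
        (d.leg e').map ((LaxMonoidal.μ (D.map f) x y ⊗ₘ 𝟙 _) ≫ LaxMonoidal.μ (D.map f) (x ⊗ y) z) ≫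
          (d.iso f).hom.app ((x ⊗ y) ⊗ z) =
      mapPair M (mapPair M ((d.iso f).hom.app x) ((d.iso f).hom.app y)) ((d.iso f).hom.app z) ≫
        mapPair M (m e x y).hom (𝟙 _) ≫ (m e (x ⊗ y) z).hom := by
    rw [Functor.map_comp]
    simp only [Category.assoc]
    rw [← reassoc_of% (hm e'), hm', mapPair_mapPair_assoc, mapPair_mapPair_assoc,
      mapPair_mapPair_assoc, (d.leg e').map_id, ← hm']
    simp only [Category.id_comp, Category.comp_id, Category.assoc]
  have mod₂ {e e' : E} (f : e ⟶ e') (x y z : D.C e) :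
      (mapPair M (𝟙 _) (m e' _ _).hom ≫ (m e' ((D.map f).obj x) ((D.map f).obj y ⊗
          (D.map f).obj z)).hom) ≫
        (d.leg e').map ((𝟙 _ ⊗ₘ LaxMonoidal.μ (D.map f) y z) ≫ LaxMonoidal.μ (D.map f) x (y ⊗ z)) ≫
          (d.iso f).hom.app (x ⊗ y ⊗ z) =
      mapPair M ((d.iso f).hom.app x) (mapPair M ((d.iso f).hom.app y) ((d.iso f).hom.app z)) ≫
        mapPair M (𝟙 _) (m e y z).hom ≫ (m e x (y ⊗ z)).hom := by
    rw [Functor.map_comp]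
    simp only [Category.assoc]
    rw [← reassoc_of% (hm e'), hm', mapPair_mapPair_assoc, mapPair_mapPair_assoc,
      mapPair_mapPair_assoc, (d.leg e').map_id, ← hm']
    simp only [Category.id_comp, Category.comp_id, Category.assoc]
  let P (e : E) (x y z : D.C e) := mapIsoPair M (m e x y) (Iso.refl ((d.leg e).obj z)) ≪≫
    m e (x ⊗ y) z
  let Q (e : E) (x y z : D.C e) := mapIsoPair M (Iso.refl ((d.leg e).obj x)) (m e y z) ≪≫
    m e x (y ⊗ z)
  obtain ⟨a, ha, ha'⟩ := h.exists_associator M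
    (fun e x y z => P e x y z ≪≫ (d.leg e).mapIso (α_ x y z) ≪≫ (Q e x y z).symm)
    (fun e {x x' y y' z z'} u v w => conj_naturality (d.leg e) (𝟭 L) (P e x' y' z').hom
      (P e x y z).hom (Q e x' y' z') (Q e x y z)
      (A := (α_ x' y' z').hom) (A' := (α_ x y z).hom) (nat₁ e u v w) (nat₂ e u v w)
      (associator_naturality u v w))
    (fun {e e'} f x y z => d.conj_modif f (𝟭 L) (P e x y z).hom (P e' _ _ _).hom (Q e x y z)
      (Q e' _ _ _) (A := (α_ x y z).hom) (A' := (MonoidalCategory.associator _ _ _).hom)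
      (m := (LaxMonoidal.μ (D.map f) x y ⊗ₘ 𝟙 _) ≫ LaxMonoidal.μ (D.map f) (x ⊗ y) z)
      (n := (𝟙 _ ⊗ₘ LaxMonoidal.μ (D.map f) y z) ≫ LaxMonoidal.μ (D.map f) x (y ⊗ z))
      (mod₁ f x y z) (mod₂ f x y z) (by
        have := LaxMonoidal.associativity (D.map f) x y z
        rw [← tensorHom_id, ← id_tensorHom] at this
        exact (Category.assoc _ _ _).trans this))
  refine ⟨a, ha, fun e x y z => ?_⟩
  have := ha' e x y z
  rw [← cancel_mono (Q e x y z).hom] at this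
  refine Eq.trans ?_ this.symm
  simp [P]

end

end LinCocone

end

end

section

open LinTensor MonoidalCategory Functor

section

variable {R : Type} [CommRing R] {E : Type u} [Bicategory.{u, u} E]
variable {D : LinDiag.{u} R E} [D.Symm]
variable {L : Type u} [Category.{u} L] [Preadditive L] [Linear R L]

namespace LinCocone

/-- The structure isomorphisms of a symmetric monoidal structure on the vertex of a cocone which
is compatible with the legs. -/
structure SymmData (d : LinCocone D L) where
  M : LinTensor R L L ⥤ L
  [additive : M.Additive]
  [linear : M.Linear R]
  m (e : E) (x y : D.C e) :
    objPair M ((d.leg e).obj x) ((d.leg e).obj y) ≅ (d.leg e).obj (x ⊗ y)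
  z : L
  j (e : E) : z ≅ (d.leg e).obj (𝟙_ (D.C e))
  b (X Y : L) : objPair M X Y ≅ objPair M Y X
  l (X : L) : objPair M z X ≅ X
  a (X Y Z : L) : objPair M (objPair M X Y) Z ≅ objPair M X (objPair M Y Z)
  m_natural (e : E) {x x' y y' : D.C e} (u : x ⟶ x') (v : y ⟶ y') :
    mapPair M ((d.leg e).map u) ((d.leg e).map v) ≫ (m e x' y').hom =
      (m e x y).hom ≫ (d.leg e).map (u ⊗ₘ v)
  m_iso {e e' : E} (f : e ⟶ e') (x y : D.C e) : (m e' ((D.map f).obj x) ((D.map f).obj y)).hom ≫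
      (d.leg e').map (LaxMonoidal.μ (D.map f) x y) ≫ (d.iso f).hom.app (x ⊗ y) =
    mapPair M ((d.iso f).hom.app x) ((d.iso f).hom.app y) ≫ (m e x y).hom
  j_iso {e e' : E} (f : e ⟶ e') : (j e').hom ≫ (d.leg e').map (LaxMonoidal.ε (D.map f)) ≫
    (d.iso f).hom.app (𝟙_ (D.C e)) = (j e).hom
  b_natural {X X' Y Y' : L} (u : X ⟶ X') (v : Y ⟶ Y') :
    mapPair M u v ≫ (b X' Y').hom = (b X Y).hom ≫ mapPair M v u
  b_leg (e : E) (x y : D.C e) : (m e x y).hom ≫ (d.leg e).map (β_ x y).hom =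
    (b ((d.leg e).obj x) ((d.leg e).obj y)).hom ≫ (m e y x).hom
  l_natural {X X' : L} (u : X ⟶ X') : mapPair M (𝟙 z) u ≫ (l X').hom = (l X).hom ≫ u
  l_leg (e : E) (x : D.C e) : (l ((d.leg e).obj x)).hom =
    mapPair M (j e).hom (𝟙 _) ≫ (m e (𝟙_ (D.C e)) x).hom ≫ (d.leg e).map (λ_ x).hom
  a_natural {X X' Y Y' Z Z' : L} (u : X ⟶ X') (v : Y ⟶ Y') (w : Z ⟶ Z') :
    mapPair M (mapPair M u v) w ≫ (a X' Y' Z').hom = (a X Y Z).hom ≫ mapPair M u (mapPair M v w)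
  a_leg (e : E) (x y z : D.C e) : mapPair M (m e x y).hom (𝟙 _) ≫ (m e (x ⊗ y) z).hom ≫
      (d.leg e).map (α_ x y z).hom =
    (a ((d.leg e).obj x) ((d.leg e).obj y) ((d.leg e).obj z)).hom ≫
      mapPair M (𝟙 _) (m e y z).hom ≫ (m e x (y ⊗ z)).hom

attribute [instance] SymmData.additive SymmData.linear

lemma IsColim.nonempty_symmData [IsSifted₂₁ E] {d : LinCocone D L} (h : d.IsColim) :
    Nonempty d.SymmData := by
  obtain ⟨M, _, _, m, hm, hm'⟩ := h.exists_mul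
  obtain ⟨z, j, hj⟩ := d.exists_unit
  obtain ⟨b, hb, hb'⟩ := h.exists_braiding hm hm'
  obtain ⟨l, hl, hl'⟩ := h.exists_leftUnitor hm hm' hj
  obtain ⟨a, ha, ha'⟩ := h.exists_associativity hm hm'
  exact ⟨⟨M, m, z, j, b, l, a, hm, hm', hj, hb, hb', hl, hl', ha, ha'⟩⟩

namespace SymmData

variable {d : LinCocone D L} (S : d.SymmData)

/-- The tensor product and the structure isomorphisms on the vertex. -/
@[reducible] def struct : MonoidalCategoryStruct L where
  tensorObj X Y := objPair S.M X Y
  whiskerLeft X _ _ f := mapPair S.M (𝟙 X) f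
  whiskerRight f Y := mapPair S.M f (𝟙 Y)
  tensorHom f g := mapPair S.M f g
  tensorUnit := S.z
  associator := S.a
  leftUnitor := S.l
  rightUnitor X := S.b X S.z ≪≫ S.l X

lemma isPreMonoidal : @IsPreMonoidal L _ S.struct :=
  let := S.struct
  { whiskerLeft_eq := fun X f => rfl
    whiskerRight_eq := fun f X => rfl
    id_tensor_id := fun X Y => mapPair_id S.M X Y
    comp := fun f₁ f₂ g₁ g₂ => (mapPair_comp S.M f₁ g₁ f₂ g₂).symm
    assoc := fun f₁ f₂ f₃ => S.a_natural f₁ f₂ f₃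
    left := fun f => S.l_natural f
    right := fun {X Y} f => by
      change mapPair S.M f (𝟙 S.z) ≫ (S.b Y S.z).hom ≫ (S.l Y).hom =
        ((S.b X S.z).hom ≫ (S.l X).hom) ≫ f
      rw [reassoc_of% (S.b_natural f (𝟙 S.z)), S.l_natural, Category.assoc] }

/-- The legs respect the structure isomorphisms. -/
@[reducible] def preMonoidalFunctor (e : E) : @PreMonoidalFunctor L _ S.struct _ _ _ (d.leg e) :=
  let := S.struct
  { unit := S.j e
    mul := S.m e
    natural := S.m_natural e
    associativity := S.a_leg e
    left_unitality := S.l_leg e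
    right_unitality := fun x => by
      change (S.b _ S.z).hom ≫ (S.l _).hom = mapPair S.M (𝟙 _) (S.j e).hom ≫
        (S.m e x (𝟙_ (D.C e))).hom ≫ (d.leg e).map (ρ_ x).hom
      rw [S.l_leg, ← reassoc_of% S.b_natural, ← reassoc_of% S.b_leg, ← Functor.map_comp,
        braiding_leftUnitor] }

variable [IsSifted₂₁ E] (h : d.IsColim)

/-- The monoidal structure on the vertex. -/
@[reducible] def monoidalCategory (h : d.IsColim) : MonoidalCategory L :=
  let := S.struct
  S.isPreMonoidal.monoidalCategory S.preMonoidalFunctor h.ess_four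

/-- The symmetric monoidal structure on the vertex. -/
@[reducible] def symmetricCategory (h : d.IsColim) :
    @SymmetricCategory L _ (S.monoidalCategory h) :=
  let := S.monoidalCategory h
  symmetricCategoryOfFamily S.b S.b_natural S.preMonoidalFunctor S.b_leg
    (fun X Y Z => by
      obtain ⟨e, w, x, y, z, i, i', i'', -⟩ := h.ess_four X Y Z Z
      exact ⟨e, w, x, y, i, i', i''⟩)

end SymmData

/-- A sifted bicolimit of symmetric monoidal linear categories is symmetric monoidal. -/
lemma IsColim.exists_symm [IsSifted₂₁ E] {d : LinCocone D L} (h : d.IsColim) :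
    ∃ (_ : MonoidalCategory L) (_ : SymmetricCategory L) (_ : MonoidalPreadditive L)
      (_ : MonoidalLinear R L), Nonempty d.Symm := by
  obtain ⟨S⟩ := h.nonempty_symmData
  let := S.monoidalCategory h
  let := S.symmetricCategory h
  have h₀ {X X' Y Y' : L} (u : X ⟶ X') : mapPair S.M u (0 : Y ⟶ Y') = 0 := by
    unfold mapPair
    rw [LinTensor.tmul_zero, Functor.map_zero]
  have h₀' {X X' Y Y' : L} (u : Y ⟶ Y') : mapPair S.M (0 : X ⟶ X') u = 0 := by
    unfold mapPair
    rw [LinTensor.zero_tmul, Functor.map_zero]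
  have h₁ {X X' Y Y' : L} (u : X ⟶ X') (v w : Y ⟶ Y') :
      mapPair S.M u (v + w) = mapPair S.M u v + mapPair S.M u w := by
    unfold mapPair
    rw [LinTensor.tmul_add, Functor.map_add]
  have h₁' {X X' Y Y' : L} (u : Y ⟶ Y') (v w : X ⟶ X') :
      mapPair S.M (v + w) u = mapPair S.M v u + mapPair S.M w u := by
    unfold mapPair
    rw [LinTensor.add_tmul, Functor.map_add]
  have h₂ {X X' Y Y' : L} (r : R) (u : X ⟶ X') (v : Y ⟶ Y') :
      mapPair S.M u (r • v) = r • mapPair S.M u v := by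
    unfold mapPair
    rw [LinTensor.tmul_smul, Functor.map_smul]
  have h₂' {X X' Y Y' : L} (r : R) (u : X ⟶ X') (v : Y ⟶ Y') :
      mapPair S.M (r • u) v = r • mapPair S.M u v := by
    unfold mapPair
    rw [LinTensor.smul_tmul', Functor.map_smul]
  let hP : MonoidalPreadditive L :=
    { whiskerLeft_zero := h₀ _
      zero_whiskerRight := h₀' _
      whiskerLeft_add := fun f g => h₁ _ f g
      add_whiskerRight := fun f g => h₁' _ f g }
  refine ⟨S.monoidalCategory h, S.symmetricCategory h, hP,
    { whiskerLeft_smul := fun X _ _ r f => h₂ r (𝟙 X) f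
      smul_whiskerRight := fun r _ _ f X => h₂' r f (𝟙 X) }, ⟨?_⟩⟩
  let (e : E) : (d.leg e).Braided := (S.preMonoidalFunctor e).braidedFunctor (S.b_leg e)
  exact
    { braided := inferInstance
      iso := fun {e e'} f =>
        { unit := (Category.assoc _ _ _).trans (S.j_iso f)
          tensor := fun x y => (Category.assoc _ _ _).trans (S.m_iso f x y) } }

end LinCocone

end

end

section

open LinTensor MonoidalCategory Functor

section

variable {C L T : Type*} [Category* C] [MonoidalCategory C] [Category* L] [MonoidalCategory L]
  [Category* T] [MonoidalCategory T] {F : L ⥤ T}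
  {φ : ∀ X Y, F.obj X ⊗ F.obj Y ≅ F.obj (X ⊗ Y)}

namespace MonoidalExtension

lemma associativity_of_iso
    (hφ : ∀ {X X' Y Y'} (u : X ⟶ X') (v : Y ⟶ Y'),
      (F.map u ⊗ₘ F.map v) ≫ (φ X' Y').hom = (φ X Y).hom ≫ F.map (u ⊗ₘ v))
    {X Y Z X' Y' Z' : L} (x : X ≅ X') (y : Y ≅ Y') (z : Z ≅ Z')
    (H : ((φ X Y).hom ⊗ₘ 𝟙 (F.obj Z)) ≫ (φ (X ⊗ Y) Z).hom ≫ F.map (α_ X Y Z).hom =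
      (MonoidalCategory.associator _ _ _).hom ≫ (𝟙 (F.obj X) ⊗ₘ (φ Y Z).hom) ≫ (φ X (Y ⊗ Z)).hom) :
    ((φ X' Y').hom ⊗ₘ 𝟙 (F.obj Z')) ≫ (φ (X' ⊗ Y') Z').hom ≫ F.map (α_ X' Y' Z').hom =
      (MonoidalCategory.associator _ _ _).hom ≫ (𝟙 (F.obj X') ⊗ₘ (φ Y' Z').hom) ≫
        (φ X' (Y' ⊗ Z')).hom := by
  have h₁ : ((F.map x.hom ⊗ₘ F.map y.hom) ⊗ₘ F.map z.hom) ≫ ((φ X' Y').hom ⊗ₘ 𝟙 (F.obj Z')) =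
      ((φ X Y).hom ⊗ₘ 𝟙 (F.obj Z)) ≫ (F.map (x.hom ⊗ₘ y.hom) ⊗ₘ F.map z.hom) := by
    simp only [tensorHom_comp_tensorHom, hφ, Category.comp_id, Category.id_comp]
  have h₂ : (F.map x.hom ⊗ₘ (F.map y.hom ⊗ₘ F.map z.hom)) ≫ (𝟙 (F.obj X') ⊗ₘ (φ Y' Z').hom) =
      (𝟙 (F.obj X) ⊗ₘ (φ Y Z).hom) ≫ (F.map x.hom ⊗ₘ F.map (y.hom ⊗ₘ z.hom)) := by
    simp only [tensorHom_comp_tensorHom, hφ, Category.comp_id, Category.id_comp]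
  have h₃ := congrArg F.map (associator_naturality x.hom y.hom z.hom)
  have h₄ := associator_naturality (F.map x.hom) (F.map y.hom) (F.map z.hom)
  simp only [Functor.map_comp] at h₃
  rw [← cancel_epi ((F.map x.hom ⊗ₘ F.map y.hom) ⊗ₘ F.map z.hom), reassoc_of% h₁,
    reassoc_of% hφ, h₃, reassoc_of% h₄, reassoc_of% h₂, hφ, reassoc_of% H]

lemma associativity_of_comp
    (hφ : ∀ {X X' Y Y'} (u : X ⟶ X') (v : Y ⟶ Y'),
      (F.map u ⊗ₘ F.map v) ≫ (φ X' Y').hom = (φ X Y).hom ≫ F.map (u ⊗ₘ v))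
    (l : C ⥤ L) [l.Monoidal] (t : C ⥤ T) [t.Monoidal] (σ : l ⋙ F ≅ t)
    (hσ : ∀ x y, (φ (l.obj x) (l.obj y)).hom ≫ F.map (LaxMonoidal.μ l x y) ≫ σ.hom.app (x ⊗ y) =
      (σ.hom.app x ⊗ₘ σ.hom.app y) ≫ LaxMonoidal.μ t x y) (x y z : C) :
    ((φ (l.obj x) (l.obj y)).hom ⊗ₘ 𝟙 (F.obj (l.obj z))) ≫ (φ (l.obj x ⊗ l.obj y) (l.obj z)).hom ≫
        F.map (α_ (l.obj x) (l.obj y) (l.obj z)).hom =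
      (MonoidalCategory.associator _ _ _).hom ≫ (𝟙 (F.obj (l.obj x)) ⊗ₘ
        (φ (l.obj y) (l.obj z)).hom) ≫
        (φ (l.obj x) (l.obj y ⊗ l.obj z)).hom := by
  have h₁ := congrArg F.map (LaxMonoidal.associativity l x y z)
  rw [← tensorHom_id, ← id_tensorHom] at h₁
  simp only [Functor.map_comp] at h₁
  have h₂ := LaxMonoidal.associativity t x y z
  rw [← tensorHom_id, ← id_tensorHom] at h₂
  have h₃ := σ.hom.naturality (α_ x y z).hom
  have h₃' : F.map (l.map (α_ x y z).hom) ≫ σ.hom.app (x ⊗ y ⊗ z) =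
    σ.hom.app ((x ⊗ y) ⊗ z) ≫ t.map (α_ x y z).hom := h₃
  have h₄ := hφ (𝟙 (l.obj x)) (LaxMonoidal.μ l y z)
  have h₅ := hφ (LaxMonoidal.μ l x y) (𝟙 (l.obj z))
  have h₆ : ((φ (l.obj x) (l.obj y)).hom ⊗ₘ 𝟙 (F.obj (l.obj z))) ≫
      (F.map (LaxMonoidal.μ l x y) ⊗ₘ F.map (𝟙 (l.obj z))) ≫
        (σ.hom.app (x ⊗ y) ⊗ₘ σ.hom.app z) =
      ((σ.hom.app x ⊗ₘ σ.hom.app y) ⊗ₘ σ.hom.app z) ≫ (LaxMonoidal.μ t x y ⊗ₘ 𝟙 (t.obj z)) := by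
    simp only [tensorHom_comp_tensorHom, CategoryTheory.Functor.map_id]
    rw [hσ]
    exact congrArg _ (by simp)
  have h₇ : (𝟙 (F.obj (l.obj x)) ⊗ₘ (φ (l.obj y) (l.obj z)).hom) ≫
      (F.map (𝟙 (l.obj x)) ⊗ₘ F.map (LaxMonoidal.μ l y z)) ≫
        (σ.hom.app x ⊗ₘ σ.hom.app (y ⊗ z)) =
      (σ.hom.app x ⊗ₘ (σ.hom.app y ⊗ₘ σ.hom.app z)) ≫ (𝟙 (t.obj x) ⊗ₘ LaxMonoidal.μ t y z) := by
    simp only [tensorHom_comp_tensorHom, CategoryTheory.Functor.map_id]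
    rw [hσ]
    exact congrArg (· ⊗ₘ _) (by simp)
  have h₈ := associator_naturality (σ.hom.app x) (σ.hom.app y) (σ.hom.app z)
  rw [← cancel_mono (F.map (𝟙 (l.obj x) ⊗ₘ LaxMonoidal.μ l y z) ≫
    F.map (LaxMonoidal.μ l x (y ⊗ z)) ≫ σ.hom.app (x ⊗ y ⊗ z))]
  simp only [Category.assoc]
  rw [← reassoc_of% h₁, h₃', ← reassoc_of% h₅, reassoc_of% hσ, reassoc_of% h₆, h₂,
    ← reassoc_of% h₄, hσ, reassoc_of% h₇]
  exact LinCocone.comp_eq_comp_assoc h₈ _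

lemma left_unitality_of_iso {i : 𝟙_ T ≅ F.obj (𝟙_ L)}
    (hφ : ∀ {X X' Y Y'} (u : X ⟶ X') (v : Y ⟶ Y'),
      (F.map u ⊗ₘ F.map v) ≫ (φ X' Y').hom = (φ X Y).hom ≫ F.map (u ⊗ₘ v))
    {X X' : L} (x : X ≅ X')
    (H : (λ_ (F.obj X)).hom = (i.hom ⊗ₘ 𝟙 _) ≫ (φ (𝟙_ L) X).hom ≫ F.map (λ_ X).hom) :
    (λ_ (F.obj X')).hom = (i.hom ⊗ₘ 𝟙 _) ≫ (φ (𝟙_ L) X').hom ≫ F.map (λ_ X').hom := by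
  have h₁ : (𝟙 (𝟙_ T) ⊗ₘ F.map x.hom) ≫ (i.hom ⊗ₘ 𝟙 (F.obj X')) =
      (i.hom ⊗ₘ 𝟙 (F.obj X)) ≫ (F.map (𝟙 (𝟙_ L)) ⊗ₘ F.map x.hom) := by
    simp only [tensorHom_comp_tensorHom, Category.comp_id, Category.id_comp,
      CategoryTheory.Functor.map_id]
  have h₂ := congrArg F.map (MonoidalCategory.leftUnitor_naturality x.hom)
  rw [← id_tensorHom] at h₂
  simp only [Functor.map_comp] at h₂
  rw [← cancel_epi (𝟙 (𝟙_ T) ⊗ₘ F.map x.hom), reassoc_of% h₁, reassoc_of% hφ, h₂, id_tensorHom,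
    MonoidalCategory.leftUnitor_naturality, H]
  simp only [Category.assoc]

lemma right_unitality_of_iso {i : 𝟙_ T ≅ F.obj (𝟙_ L)}
    (hφ : ∀ {X X' Y Y'} (u : X ⟶ X') (v : Y ⟶ Y'),
      (F.map u ⊗ₘ F.map v) ≫ (φ X' Y').hom = (φ X Y).hom ≫ F.map (u ⊗ₘ v))
    {X X' : L} (x : X ≅ X')
    (H : (ρ_ (F.obj X)).hom = (𝟙 _ ⊗ₘ i.hom) ≫ (φ X (𝟙_ L)).hom ≫ F.map (ρ_ X).hom) :
    (ρ_ (F.obj X')).hom = (𝟙 _ ⊗ₘ i.hom) ≫ (φ X' (𝟙_ L)).hom ≫ F.map (ρ_ X').hom := by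
  have h₁ : (F.map x.hom ⊗ₘ 𝟙 (𝟙_ T)) ≫ (𝟙 (F.obj X') ⊗ₘ i.hom) =
      (𝟙 (F.obj X) ⊗ₘ i.hom) ≫ (F.map x.hom ⊗ₘ F.map (𝟙 (𝟙_ L))) := by
    simp only [tensorHom_comp_tensorHom, Category.comp_id, Category.id_comp,
      CategoryTheory.Functor.map_id]
  have h₂ := congrArg F.map (MonoidalCategory.rightUnitor_naturality x.hom)
  rw [← tensorHom_id] at h₂
  simp only [Functor.map_comp] at h₂
  rw [← cancel_epi (F.map x.hom ⊗ₘ 𝟙 (𝟙_ T)), reassoc_of% h₁, reassoc_of% hφ, h₂, tensorHom_id,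
    MonoidalCategory.rightUnitor_naturality, H]
  simp only [Category.assoc]

lemma left_unitality_of_comp {i : 𝟙_ T ≅ F.obj (𝟙_ L)}
    (hφ : ∀ {X X' Y Y'} (u : X ⟶ X') (v : Y ⟶ Y'),
      (F.map u ⊗ₘ F.map v) ≫ (φ X' Y').hom = (φ X Y).hom ≫ F.map (u ⊗ₘ v))
    (l : C ⥤ L) [l.Monoidal] (t : C ⥤ T) [t.Monoidal] (σ : l ⋙ F ≅ t)
    (hσ : ∀ x y, (φ (l.obj x) (l.obj y)).hom ≫ F.map (LaxMonoidal.μ l x y) ≫ σ.hom.app (x ⊗ y) =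
      (σ.hom.app x ⊗ₘ σ.hom.app y) ≫ LaxMonoidal.μ t x y)
    (hi : i.hom ≫ F.map (LaxMonoidal.ε l) ≫ σ.hom.app (𝟙_ C) = LaxMonoidal.ε t) (x : C) :
    (λ_ (F.obj (l.obj x))).hom =
      (i.hom ⊗ₘ 𝟙 _) ≫ (φ (𝟙_ L) (l.obj x)).hom ≫ F.map (λ_ (l.obj x)).hom := by
  have h₁ := congrArg F.map (LaxMonoidal.left_unitality l x)
  rw [← tensorHom_id] at h₁
  simp only [Functor.map_comp] at h₁
  have h₂ := LaxMonoidal.left_unitality t x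
  rw [← tensorHom_id] at h₂
  have h₃ : F.map (l.map (λ_ x).hom) ≫ σ.hom.app x = σ.hom.app (𝟙_ C ⊗ x) ≫ t.map (λ_ x).hom :=
    σ.hom.naturality (λ_ x).hom
  have h₄ : (i.hom ⊗ₘ 𝟙 (F.obj (l.obj x))) ≫ (F.map (LaxMonoidal.ε l) ⊗ₘ F.map (𝟙 (l.obj x))) ≫
      (σ.hom.app (𝟙_ C) ⊗ₘ σ.hom.app x) = (𝟙 _ ⊗ₘ σ.hom.app x) ≫
        (LaxMonoidal.ε t ⊗ₘ 𝟙 (t.obj x)) := by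
    simp only [tensorHom_comp_tensorHom, CategoryTheory.Functor.map_id, hi]
    exact congrArg₂ (· ⊗ₘ ·) (by simp) (by simp)
  have h₅ : (𝟙 (𝟙_ T) ⊗ₘ σ.hom.app x) ≫ (λ_ (t.obj x)).hom =
      (λ_ (F.obj (l.obj x))).hom ≫ σ.hom.app x := by
    rw [id_tensorHom, MonoidalCategory.leftUnitor_naturality]
    rfl
  rw [← cancel_mono (σ.hom.app x), ← h₅, h₂]
  simp only [Category.assoc]
  rw [h₁]
  simp only [Category.assoc]
  rw [h₃, ← reassoc_of% hφ, reassoc_of% hσ, reassoc_of% h₄]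

lemma right_unitality_of_comp {i : 𝟙_ T ≅ F.obj (𝟙_ L)}
    (hφ : ∀ {X X' Y Y'} (u : X ⟶ X') (v : Y ⟶ Y'),
      (F.map u ⊗ₘ F.map v) ≫ (φ X' Y').hom = (φ X Y).hom ≫ F.map (u ⊗ₘ v))
    (l : C ⥤ L) [l.Monoidal] (t : C ⥤ T) [t.Monoidal] (σ : l ⋙ F ≅ t)
    (hσ : ∀ x y, (φ (l.obj x) (l.obj y)).hom ≫ F.map (LaxMonoidal.μ l x y) ≫ σ.hom.app (x ⊗ y) =
      (σ.hom.app x ⊗ₘ σ.hom.app y) ≫ LaxMonoidal.μ t x y)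
    (hi : i.hom ≫ F.map (LaxMonoidal.ε l) ≫ σ.hom.app (𝟙_ C) = LaxMonoidal.ε t) (x : C) :
    (ρ_ (F.obj (l.obj x))).hom =
      (𝟙 _ ⊗ₘ i.hom) ≫ (φ (l.obj x) (𝟙_ L)).hom ≫ F.map (ρ_ (l.obj x)).hom := by
  have h₁ := congrArg F.map (LaxMonoidal.right_unitality l x)
  rw [← id_tensorHom] at h₁
  simp only [Functor.map_comp] at h₁
  have h₂ := LaxMonoidal.right_unitality t x
  rw [← id_tensorHom] at h₂
  have h₃ : F.map (l.map (ρ_ x).hom) ≫ σ.hom.app x = σ.hom.app (x ⊗ 𝟙_ C) ≫ t.map (ρ_ x).hom :=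
    σ.hom.naturality (ρ_ x).hom
  have h₄ : (𝟙 (F.obj (l.obj x)) ⊗ₘ i.hom) ≫ (F.map (𝟙 (l.obj x)) ⊗ₘ F.map (LaxMonoidal.ε l)) ≫
      (σ.hom.app x ⊗ₘ σ.hom.app (𝟙_ C)) = (σ.hom.app x ⊗ₘ 𝟙 _) ≫
        (𝟙 (t.obj x) ⊗ₘ LaxMonoidal.ε t) := by
    simp only [tensorHom_comp_tensorHom, CategoryTheory.Functor.map_id, hi]
    exact congrArg₂ (· ⊗ₘ ·) (by simp) (by simp)
  have h₅ : (σ.hom.app x ⊗ₘ 𝟙 (𝟙_ T)) ≫ (ρ_ (t.obj x)).hom =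
      (ρ_ (F.obj (l.obj x))).hom ≫ σ.hom.app x := by
    rw [tensorHom_id, MonoidalCategory.rightUnitor_naturality]
    rfl
  rw [← cancel_mono (σ.hom.app x), ← h₅, h₂]
  simp only [Category.assoc]
  rw [h₁]
  simp only [Category.assoc]
  rw [h₃, ← reassoc_of% hφ, reassoc_of% hσ, reassoc_of% h₄]

variable [BraidedCategory L] [BraidedCategory T]

lemma braided_of_iso
    (hφ : ∀ {X X' Y Y'} (u : X ⟶ X') (v : Y ⟶ Y'),
      (F.map u ⊗ₘ F.map v) ≫ (φ X' Y').hom = (φ X Y).hom ≫ F.map (u ⊗ₘ v))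
    {X X' Y Y' : L} (x : X ≅ X') (y : Y ≅ Y')
    (H : (φ X Y).hom ≫ F.map (β_ X Y).hom = (β_ (F.obj X) (F.obj Y)).hom ≫ (φ Y X).hom) :
    (φ X' Y').hom ≫ F.map (β_ X' Y').hom = (β_ (F.obj X') (F.obj Y')).hom ≫ (φ Y' X').hom := by
  have h₁ := congrArg F.map (BraidedCategory.braiding_naturality x.hom y.hom)
  simp only [Functor.map_comp] at h₁
  have h₂ := BraidedCategory.braiding_naturality (F.map x.hom) (F.map y.hom)
  rw [← cancel_epi (F.map x.hom ⊗ₘ F.map y.hom), reassoc_of% hφ, h₁, reassoc_of% h₂, hφ,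
    reassoc_of% H]

lemma braided_of_comp [BraidedCategory C] (l : C ⥤ L) [l.Braided] (t : C ⥤ T) [t.Braided]
    (σ : l ⋙ F ≅ t)
    (hσ : ∀ x y, (φ (l.obj x) (l.obj y)).hom ≫ F.map (LaxMonoidal.μ l x y) ≫ σ.hom.app (x ⊗ y) =
      (σ.hom.app x ⊗ₘ σ.hom.app y) ≫ LaxMonoidal.μ t x y) (x y : C) :
    (φ (l.obj x) (l.obj y)).hom ≫ F.map (β_ (l.obj x) (l.obj y)).hom =
      (β_ _ _).hom ≫ (φ (l.obj y) (l.obj x)).hom := by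
  have h₁ := congrArg F.map (LaxBraided.braided (F := l) x y)
  simp only [Functor.map_comp] at h₁
  have h₂ := LaxBraided.braided (F := t) x y
  have h₃ : F.map (l.map (β_ x y).hom) ≫ σ.hom.app (y ⊗ x) =
    σ.hom.app (x ⊗ y) ≫ t.map (β_ x y).hom := σ.hom.naturality (β_ x y).hom
  have h₄ := BraidedCategory.braiding_naturality (σ.hom.app x) (σ.hom.app y)
  rw [← cancel_mono (F.map (LaxMonoidal.μ l y x) ≫ σ.hom.app (y ⊗ x))]
  simp only [Category.assoc]
  rw [← reassoc_of% h₁, h₃, reassoc_of% hσ, h₂, hσ]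
  exact LinCocone.comp_eq_comp_assoc h₄ _

end MonoidalExtension

end

section

variable {R : Type} [CommRing R] {E : Type u} [Bicategory.{u, u} E] [IsSifted₂₁ E]
variable {D : LinDiag.{u} R E} [D.Symm]
variable {L : Type u} [Category.{u} L] [Preadditive L] [Linear R L] [MonoidalCategory L]
  [SymmetricCategory L]
variable {T : Type u} [Category.{u} T] [Preadditive T] [Linear R T] [MonoidalCategory T]
  [SymmetricCategory T]

namespace LinCocone

lemma iso_unit (t : LinCocone D T) [t.Symm] {e e' : E} (f : e ⟶ e') :
    LaxMonoidal.ε (t.leg e') ≫ (t.leg e').map (LaxMonoidal.ε (D.map f)) ≫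
      (t.iso f).hom.app (𝟙_ (D.C e)) = LaxMonoidal.ε (t.leg e) :=
  (Category.assoc _ _ _).symm.trans (NatTrans.IsMonoidal.unit (τ := (t.iso f).hom))

lemma iso_tensor (t : LinCocone D T) [t.Symm] {e e' : E} (f : e ⟶ e') (x y : D.C e) :
    LaxMonoidal.μ (t.leg e') ((D.map f).obj x) ((D.map f).obj y) ≫
        (t.leg e').map (LaxMonoidal.μ (D.map f) x y) ≫ (t.iso f).hom.app (x ⊗ y) =
      ((t.iso f).hom.app x ⊗ₘ (t.iso f).hom.app y) ≫ LaxMonoidal.μ (t.leg e) x y :=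
  (Category.assoc _ _ _).symm.trans (NatTrans.IsMonoidal.tensor (τ := (t.iso f).hom) x y)

/-- A natural transformation between monoidal functors on a sifted bicolimit is monoidal if its
restrictions along the legs are. -/
lemma IsColim.isMonoidal_of_leg {d : LinCocone D L} [d.Symm] (h : d.IsColim) {F G : L ⥤ T}
    [F.Monoidal] [G.Monoidal] (α : F ⟶ G)
    (hα : ∀ e, (Functor.whiskerLeft (d.leg e) α).IsMonoidal) : α.IsMonoidal where
  unit := by
    obtain ⟨e⟩ := IsSifted₂₁.nonempty (E := E)
    have h₁ : (LaxMonoidal.ε F ≫ F.map (LaxMonoidal.ε (d.leg e))) ≫ α.app _ =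
        LaxMonoidal.ε G ≫ G.map (LaxMonoidal.ε (d.leg e)) := (hα e).unit
    rw [Category.assoc, α.naturality, ← Category.assoc] at h₁
    exact (cancel_mono _).1 h₁
  tensor X Y := by
    obtain ⟨e, -, -, x, y, -, -, ⟨i⟩, ⟨i'⟩⟩ := h.ess_four X X X Y
    have h₁ : (LaxMonoidal.μ F _ _ ≫ F.map (LaxMonoidal.μ (d.leg e) x y)) ≫ α.app _ =
        (α.app _ ⊗ₘ α.app _) ≫ LaxMonoidal.μ G _ _ ≫ G.map (LaxMonoidal.μ (d.leg e) x y) :=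
      (hα e).tensor x y
    rw [Category.assoc, α.naturality, ← Category.assoc, ← Category.assoc] at h₁
    have h₂ := (cancel_mono _).1 h₁
    have h₃ : (F.map i.hom ⊗ₘ F.map i'.hom) ≫ (α.app X ⊗ₘ α.app Y) =
        (α.app _ ⊗ₘ α.app _) ≫ (G.map i.hom ⊗ₘ G.map i'.hom) := by
      simp only [tensorHom_comp_tensorHom, α.naturality]
    rw [← cancel_epi (F.map i.hom ⊗ₘ F.map i'.hom), LaxMonoidal.μ_natural_assoc, α.naturality,
      reassoc_of% h₂, reassoc_of% h₃, LaxMonoidal.μ_natural]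

variable [MonoidalPreadditive L] [MonoidalLinear R L] [MonoidalPreadditive T] [MonoidalLinear R T]

/-- A functor on a sifted bicolimit whose restrictions along the legs are symmetric monoidal, is
symmetric monoidal. -/
lemma IsColim.exists_braided {d : LinCocone D L} [d.Symm] (h : d.IsColim) (t : LinCocone D T)
    [t.Symm] (F : L ⥤ T) [F.Additive] [F.Linear R] (σ : ∀ e, d.leg e ⋙ F ≅ t.leg e)
    (hσ : d.Desc F t σ) : ∃ _ : F.Braided, ∀ e, (σ e).hom.IsMonoidal := by
  have hσn {e : E} {x y : D.C e} (u : x ⟶ y) : F.map ((d.leg e).map u) ≫ (σ e).hom.app y =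
      (σ e).hom.app x ≫ (t.leg e).map u := (σ e).hom.naturality u
  let W (e : E) (x y : D.C e) : F.obj ((d.leg e).obj x) ⊗ F.obj ((d.leg e).obj y) ≅
      (t.leg e).obj (x ⊗ y) := ((σ e).app x ⊗ᵢ (σ e).app y) ≪≫ Monoidal.μIso (t.leg e) x y
  let V (e : E) (x y : D.C e) : F.obj ((d.leg e).obj x ⊗ (d.leg e).obj y) ≅
      (t.leg e).obj (x ⊗ y) := F.mapIso (Monoidal.μIso (d.leg e) x y) ≪≫ (σ e).app (x ⊗ y)
  have hW (e : E) (x y : D.C e) : (W e x y).hom =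
    ((σ e).hom.app x ⊗ₘ (σ e).hom.app y) ≫ LaxMonoidal.μ (t.leg e) x y := rfl
  have hV (e : E) (x y : D.C e) : (V e x y).hom =
    F.map (LaxMonoidal.μ (d.leg e) x y) ≫ (σ e).hom.app (x ⊗ y) := rfl
  obtain ⟨φ', hφ', hφl'⟩ := h.exists_iso_pair (mapFunctor (R := R) F F ⋙ tensorFunctor R T)
    (tensorFunctor R L ⋙ F)
    (fun e x y => W e x y ≪≫ (t.leg e).mapIso (Iso.refl _) ≪≫ (V e x y).symm)
    (fun e {x x' y y'} u v => conj_naturality (t.leg e) (𝟭 T) (W e x' y').hom (W e x y).hom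
      (V e x' y') (V e x y) (m := u ⊗ₘ v) (n := u ⊗ₘ v) (A := 𝟙 _) (A' := 𝟙 _)
      (by
        change (W e x y).hom ≫ (t.leg e).map (u ⊗ₘ v) =
          (F.map ((d.leg e).map u) ⊗ₘ F.map ((d.leg e).map v)) ≫ (W e x' y').hom
        rw [hW, hW, tensorHom_comp_tensorHom_assoc, hσn, hσn, Category.assoc,
          ← LaxMonoidal.μ_natural, tensorHom_comp_tensorHom_assoc])
      (by
        change (V e x y).hom ≫ (t.leg e).map (u ⊗ₘ v) =
          F.map ((d.leg e).map u ⊗ₘ (d.leg e).map v) ≫ (V e x' y').hom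
        rw [hV, hV, Category.assoc, ← hσn, ← F.map_comp_assoc, ← F.map_comp_assoc,
          LaxMonoidal.μ_natural])
      (by rw [Category.comp_id, Category.id_comp]))
    (fun {e e'} f x y => t.conj_modif f (𝟭 T) (W e x y).hom (W e' _ _).hom (V e x y) (V e' _ _)
      (m := LaxMonoidal.μ (D.map f) x y) (n := LaxMonoidal.μ (D.map f) x y)
      (A := 𝟙 _) (A' := 𝟙 _)
      (by
        change (W e' _ _).hom ≫ (t.leg e').map (LaxMonoidal.μ (D.map f) x y) ≫
          (t.iso f).hom.app (x ⊗ y) =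
          (F.map ((d.iso f).hom.app x) ⊗ₘ F.map ((d.iso f).hom.app y)) ≫ (W e x y).hom
        rw [hW, hW, Category.assoc, iso_tensor, tensorHom_comp_tensorHom_assoc,
          tensorHom_comp_tensorHom_assoc, hσ, hσ])
      (by
        change (V e' _ _).hom ≫ (t.leg e').map (LaxMonoidal.μ (D.map f) x y) ≫
          (t.iso f).hom.app (x ⊗ y) =
          F.map ((d.iso f).hom.app x ⊗ₘ (d.iso f).hom.app y) ≫ (V e x y).hom
        rw [hV, hV, Category.assoc, ← reassoc_of% hσn, hσ, ← F.map_comp_assoc, ← F.map_comp_assoc,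
          ← F.map_comp_assoc, Category.assoc, iso_tensor])
      (by rw [CategoryTheory.Functor.map_id, Category.comp_id, Category.id_comp]))
  let φ (X Y : L) : F.obj X ⊗ F.obj Y ≅ F.obj (X ⊗ Y) := φ' X Y
  have hφ {X X' Y Y' : L} (u : X ⟶ X') (v : Y ⟶ Y') :
    (F.map u ⊗ₘ F.map v) ≫ (φ X' Y').hom = (φ X Y).hom ≫ F.map (u ⊗ₘ v) := hφ' u v
  have hφl (e : E) (x y : D.C e) : (φ ((d.leg e).obj x) ((d.leg e).obj y)).hom ≫
      F.map (LaxMonoidal.μ (d.leg e) x y) ≫ (σ e).hom.app (x ⊗ y) =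
        ((σ e).hom.app x ⊗ₘ (σ e).hom.app y) ≫ LaxMonoidal.μ (t.leg e) x y := by
    have h₁ : (φ ((d.leg e).obj x) ((d.leg e).obj y)).hom =
      (W e x y).hom ≫ (t.leg e).map (𝟙 _) ≫ (V e x y).inv := hφl' e x y
    rw [h₁, ← hV, ← hW]
    simp
  obtain ⟨e₀⟩ := IsSifted₂₁.nonempty (E := E)
  let i : 𝟙_ T ≅ F.obj (𝟙_ L) := Monoidal.εIso (t.leg e₀) ≪≫ ((σ e₀).app (𝟙_ _)).symm ≪≫
    F.mapIso (Monoidal.εIso (d.leg e₀)).symm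
  have hi (e : E) : i.hom ≫ F.map (LaxMonoidal.ε (d.leg e)) ≫ (σ e).hom.app (𝟙_ _) =
      LaxMonoidal.ε (t.leg e) := by
    refine PtLin.eq_of_comp_eq (e₀ := e₀) (P := fun e => i.hom ≫
      F.map (LaxMonoidal.ε (d.leg e)) ≫ (σ e).hom.app (𝟙_ _) = LaxMonoidal.ε (t.leg e))
      (fun {e e'} f => ?_) ?_ e
    · have h₁ := hσ f (𝟙_ (D.C e))
      have h₂ : (i.hom ≫ F.map (LaxMonoidal.ε (d.leg e')) ≫ (σ e').hom.app (𝟙_ _)) ≫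
          (t.leg e').map (LaxMonoidal.ε (D.map f)) ≫ (t.iso f).hom.app (𝟙_ _) =
          i.hom ≫ F.map (LaxMonoidal.ε (d.leg e)) ≫ (σ e).hom.app (𝟙_ _) := by
        rw [← d.iso_unit f, F.map_comp, F.map_comp]
        simp only [Category.assoc]
        rw [← h₁, reassoc_of% hσn]
      rw [← h₂, ← t.iso_unit f]
      exact (cancel_mono _).symm
    · simp [i, ← F.map_comp_assoc]
  let P : PreMonoidalFunctor F :=
    { unit := i
      mul := φ
      natural := hφ
      associativity := fun X Y Z => by
        obtain ⟨e, -, x, y, z, -, ⟨a⟩, ⟨b⟩, ⟨c⟩⟩ := h.ess_four X X Y Z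
        exact MonoidalExtension.associativity_of_iso hφ a b c
          (MonoidalExtension.associativity_of_comp hφ (d.leg e) (t.leg e) (σ e) (hφl e) x y z)
      left_unitality := fun X => by
        obtain ⟨e, x, ⟨a⟩⟩ := h.ess X
        exact MonoidalExtension.left_unitality_of_iso hφ a
          (MonoidalExtension.left_unitality_of_comp hφ (d.leg e) (t.leg e) (σ e) (hφl e) (hi e) x)
      right_unitality := fun X => by
        obtain ⟨e, x, ⟨a⟩⟩ := h.ess X
        exact MonoidalExtension.right_unitality_of_iso hφ a
          (MonoidalExtension.right_unitality_of_comp hφ (d.leg e) (t.leg e) (σ e) (hφl e) (hi e)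
            x) }
  let hF : F.Braided := P.braidedFunctor fun X Y => by
    obtain ⟨e, -, -, x, y, -, -, ⟨a⟩, ⟨b⟩⟩ := h.ess_four X X X Y
    exact MonoidalExtension.braided_of_iso hφ a b
      (MonoidalExtension.braided_of_comp (d.leg e) (t.leg e) (σ e) (hφl e) x y)
  exact ⟨hF, fun e =>
    { unit := (Category.assoc _ _ _).trans (hi e)
      tensor := fun x y => (Category.assoc _ _ _).trans (hφl e x y) }⟩

end LinCocone

end

end

section

open MonoidalCategory Functor

/-! ### Sifted bicolimits in the 2-category of symmetric monoidal linear categories -/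

section

variable {R : Type} [CommRing R] {E : Type u} [Bicategory.{u, u} E]

/-- The natural isomorphism underlying an invertible 2-cell of symmetric monoidal linear
categories. -/
@[simps] def SMLin.natIso {C D : SMLin.{u} R} {F G : C ⟶ D} (α : F ≅ G) :
    F.functor ≅ G.functor where
  hom := SMLin.Hom₂.nat α.hom
  inv := SMLin.Hom₂.nat α.inv
  hom_inv_id := congrArg SMLin.Hom₂.nat α.hom_inv_id
  inv_hom_id := congrArg SMLin.Hom₂.nat α.inv_hom_id

/-- The diagram of linear categories underlying a diagram of symmetric monoidal linear
categories. -/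
@[reducible] def LinDiag.ofSMLin (J : E ⥤ᵖ Pith (SMLin.{u} R)) : LinDiag.{u} R E where
  C e := (J.obj e).as.carrier
  map f := (J.map f).of.functor
  map₂ η := SMLin.Hom₂.nat (J.map₂ η).iso.hom
  mapId e := SMLin.natIso (J.mapId e).hom.iso
  mapComp f g := SMLin.natIso (J.mapComp f g).hom.iso
  map₂_id f x := congrArg (fun γ => (SMLin.Hom₂.nat γ.iso.hom).app x) (J.map₂_id f)
  map₂_comp η θ x := congrArg (fun γ => (SMLin.Hom₂.nat γ.iso.hom).app x) (J.map₂_comp η θ)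
  whiskerLeft f _ _ η x := congrArg (fun γ => (SMLin.Hom₂.nat γ.iso.hom).app x)
    (J.map₂_whiskerLeft_comp_mapComp f η)
  whiskerRight η h x := congrArg (fun γ => (SMLin.Hom₂.nat γ.iso.hom).app x)
    (J.map₂_whiskerRight_comp_mapComp η h)
  associator f g h x := (congrArg (fun γ => (SMLin.Hom₂.nat γ.iso.hom).app x)
    (J.map₂_associator_comp_mapComp f g h)).trans (Category.comp_id _)
  leftUnitor f x := (congrArg (fun γ => (SMLin.Hom₂.nat γ.iso.hom).app x)
    (J.map₂_left_unitor f)).trans (congrArg (_ ≫ ·) (Category.comp_id _))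
  rightUnitor f x := (congrArg (fun γ => (SMLin.Hom₂.nat γ.iso.hom).app x)
    (J.map₂_right_unitor f)).trans (congrArg (_ ≫ ·) (Category.comp_id _))

instance (J : E ⥤ᵖ Pith (SMLin.{u} R)) : (LinDiag.ofSMLin J).Symm where
  monoidal e := (J.obj e).as.monoidal
  symmetric e := (J.obj e).as.symmetric
  monoidalPreadditive e := (J.obj e).as.monoidalPreadditive
  monoidalLinear e := (J.obj e).as.monoidalLinear
  braided f := (J.map f).of.braided
  map₂ η := (J.map₂ η).iso.hom.isMonoidal
  mapId e := (J.mapId e).hom.iso.hom.isMonoidal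
  mapComp f g := (J.mapComp f g).hom.iso.hom.isMonoidal

variable {J : E ⥤ᵖ Pith (SMLin.{u} R)}

/-- The cocone of linear categories underlying a pseudo-cocone of symmetric monoidal linear
categories. -/
@[reducible] def LinCocone.ofSMLin {X : Pith (SMLin.{u} R)} (c : BiCocone J X) :
    LinCocone (LinDiag.ofSMLin J) X.as.carrier where
  leg e := (c.leg e).of.functor
  leg_additive e := (c.leg e).of.additive
  leg_linear e := (c.leg e).of.linear
  iso f := SMLin.natIso (c.legIso f).hom.iso
  map₂ η x := congrArg (fun γ => (SMLin.Hom₂.nat γ.iso.hom).app x) (c.naturality η)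
  id e x := (congrArg (fun γ => (SMLin.Hom₂.nat γ.iso.hom).app x) (c.legIso_id e)).trans
    (Category.comp_id _)
  comp f g x := (congrArg (fun γ => (SMLin.Hom₂.nat γ.iso.hom).app x) (c.legIso_comp f g)).trans
    (congrArg (_ ≫ ·) (Category.id_comp _))

instance {X : Pith (SMLin.{u} R)} (c : BiCocone J X) : (LinCocone.ofSMLin c).Symm where
  braided e := (c.leg e).of.braided
  iso f := (c.legIso f).hom.iso.hom.isMonoidal

namespace SMLin

/-- A pseudo-cocone of symmetric monoidal linear categories, from its underlying cocone. -/
@[reducible] def mkCocone (X : Pith (SMLin.{u} R)) (d : LinCocone (LinDiag.ofSMLin J) X.as.carrier)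
    (s : d.Symm) : BiCocone J X where
  leg e := Core.mk
    { functor := d.leg e
      additive := d.leg_additive e
      linear := d.leg_linear e
      braided := s.braided e }
  legIso {e e'} f := Core.isoMk (SMLin.isoMk (d.iso f) (s.iso f))
  naturality η := Pith.hom₂_ext _ (SMLin.hom₂_ext fun x => d.map₂ η x)
  legIso_id e := Pith.hom₂_ext _ (SMLin.hom₂_ext fun x => (d.id e x).trans
    (Category.comp_id _).symm)
  legIso_comp f g := Pith.hom₂_ext _ (SMLin.hom₂_ext fun x => (d.comp f g x).trans
    (congrArg (_ ≫ ·) (Category.id_comp _).symm))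

variable [IsSifted₂₁ E]

lemma exists_isColim (J : E ⥤ᵖ Pith (SMLin.{u} R)) :
    ∃ (X : Pith (SMLin.{u} R)) (c : BiCocone J X), (LinCocone.ofSMLin c).IsColim := by
  obtain ⟨m, s, p, l, ⟨hs⟩⟩ :=
    (LinDiag.Colim.isColim_cocone (D := LinDiag.ofSMLin J)).exists_symm
  exact ⟨⟨⟨LinDiag.Colim (LinDiag.ofSMLin J)⟩⟩,
    mkCocone ⟨⟨LinDiag.Colim (LinDiag.ofSMLin J)⟩⟩ (LinDiag.Colim.cocone _) hs,
    LinDiag.Colim.isColim_cocone⟩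

/-- A pseudo-cocone of symmetric monoidal linear categories is a bicolimit if its underlying cocone
is. -/
lemma isBicolimit_of_isColim {X : Pith (SMLin.{u} R)} (c : BiCocone J X)
    (hc : (LinCocone.ofSMLin c).IsColim) : c.IsBicolimit := by
  intro Y
  refine ⟨⟨fun {h h'} α β hαβ => ?_⟩, ⟨fun {h h'} φ => ?_⟩, ⟨fun t => ?_⟩⟩
  · refine Pith.hom₂_ext _ (SMLin.Hom₂.ext ?_)
    refine hc.hom_ext (F := h.of.functor) (G := h'.of.functor) fun e x => ?_
    exact congrArg (fun γ : c.whisker h ⟶ c.whisker h' =>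
      (SMLin.Hom₂.nat (BiCocone.Hom.app γ e).iso.hom).app x) hαβ
  · obtain ⟨α, hα⟩ := hc.ext Y.as.carrier h.of.functor h'.of.functor
      (fun e => SMLin.natIso (BiCocone.Hom.app φ e).iso) (fun e e' f x => by
        have h₁ := congrArg (fun γ => (SMLin.Hom₂.nat γ.iso.hom).app x) (BiCocone.Hom.comm φ f)
        have h₂ := (congrArg (_ ≫ ·) (Category.id_comp _)).symm.trans
          (h₁.trans (congrArg (· ≫ _) (Category.id_comp _)))
        exact h₂)
    have hα' (e : E) : Functor.whiskerLeft ((LinCocone.ofSMLin c).leg e) α.hom =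
        SMLin.Hom₂.nat (BiCocone.Hom.app φ e).iso.hom := NatTrans.ext (funext fun x => hα e x)
    refine ⟨CoreHom.mk (SMLin.isoMk α (hc.isMonoidal_of_leg α.hom fun e => ?_)), ?_⟩
    · rw [hα']
      exact (BiCocone.Hom.app φ e).iso.hom.isMonoidal
    · exact BiCocone.hom_ext fun e => Pith.hom₂_ext _ (SMLin.hom₂_ext fun x => hα e x)
  · obtain ⟨F, hF, hF', σ, hσ⟩ := hc.desc Y.as.carrier (LinCocone.ofSMLin t)
    obtain ⟨hb, hσ'⟩ := hc.exists_braided (LinCocone.ofSMLin t) F σ hσ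
    let h : X ⟶ Y := Core.mk { functor := F }
    refine ⟨h, ⟨BiCocone.isoMk (fun e => Core.isoMk (SMLin.isoMk (σ e) (hσ' e)))
      (fun {e e'} f => Pith.hom₂_ext _ (SMLin.hom₂_ext fun x => ?_))⟩⟩
    refine (hσ f x).trans (congrArg (· ≫ _) (Category.id_comp _).symm)

lemma isEquivalence_of_iso_id {X X' : Pith (SMLin.{u} R)} {h : X ⟶ X'} {g : X' ⟶ X}
    (i : h ≫ g ≅ 𝟙 X) (i' : g ≫ h ≅ 𝟙 X') : h.of.functor.IsEquivalence :=
  (CategoryTheory.Equivalence.mk h.of.functor g.of.functor (natIso i.hom.iso).symm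
    (natIso i'.hom.iso)).isEquivalence_functor

/-- A sifted pseudo-cocone of symmetric monoidal linear categories is a bicolimit if and only if its
underlying cocone is. -/
lemma isBicolimit_iff {X : Pith (SMLin.{u} R)} (c : BiCocone J X) :
    c.IsBicolimit ↔ (LinCocone.ofSMLin c).IsColim := by
  refine ⟨fun hc => ?_, isBicolimit_of_isColim c⟩
  obtain ⟨X', c', hc'⟩ := exists_isColim J
  obtain ⟨h, g, φ, ⟨i⟩, ⟨i'⟩⟩ := (isBicolimit_of_isColim c' hc').exists_equivalence hc
  have := isEquivalence_of_iso_id i i'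
  refine hc'.of_equivalence (LinCocone.ofSMLin c) h.of.functor
    (fun e => natIso (BiCocone.Hom.app φ.hom e).iso) (fun e e' f x => ?_)
  have h₁ := congrArg (fun γ => (SMLin.Hom₂.nat γ.iso.hom).app x) (BiCocone.Hom.comm φ.hom f)
  exact h₁.trans (congrArg (· ≫ _) (Category.id_comp _))

end SMLin

end

end

section

variable {R k : Type} [CommRing R] [CommRing k] [Algebra R k]
variable {E : Type u} [Bicategory.{u, u} E]
namespace GluedCat

/-- The first components of a diagram. -/
abbrev fstDiag (J : E ⥤ᵖ Pith (GluedCat.{u} R k)) : E ⥤ᵖ Pith (PtLin.{u} R) :=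
  J.comp (pithMap (PsPullback.fstFunctor (baseChange R k) (toPt k)))

/-- The second components of a diagram. -/
abbrev sndDiag (J : E ⥤ᵖ Pith (GluedCat.{u} R k)) : E ⥤ᵖ Pith (SMLin.{u} k) :=
  J.comp (pithMap (PsPullback.sndFunctor (baseChange R k) (toPt k)))

variable (J : E ⥤ᵖ Pith (GluedCat.{u} R k))

lemma fstDiag_mapId_app (e : E) (x : (J.obj e).as.fst.carrier) :
    ((LinDiag.ofPtLin (fstDiag J)).mapId e).hom.app x =
      (PtLin.Hom₂.nat (J.mapId e).hom.iso.hom.fst).app x :=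
  (congrArg (_ ≫ ·) (Category.comp_id _)).trans (Category.comp_id _)

lemma fstDiag_mapComp_app {e e' e'' : E} (f : e ⟶ e') (g : e' ⟶ e'')
    (x : (J.obj e).as.fst.carrier) :
    ((LinDiag.ofPtLin (fstDiag J)).mapComp f g).hom.app x =
      (PtLin.Hom₂.nat (J.mapComp f g).hom.iso.hom.fst).app x :=
  (congrArg (_ ≫ ·) (Category.comp_id _)).trans (Category.comp_id _)

lemma sndDiag_mapId_app (e : E) (x : (J.obj e).as.snd.carrier) :
    ((LinDiag.ofSMLin (sndDiag J)).mapId e).hom.app x =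
      (SMLin.Hom₂.nat (J.mapId e).hom.iso.hom.snd).app x :=
  (congrArg (_ ≫ ·) (Category.comp_id _)).trans (Category.comp_id _)

lemma sndDiag_mapComp_app {e e' e'' : E} (f : e ⟶ e') (g : e' ⟶ e'')
    (x : (J.obj e).as.snd.carrier) :
    ((LinDiag.ofSMLin (sndDiag J)).mapComp f g).hom.app x =
      (SMLin.Hom₂.nat (J.mapComp f g).hom.iso.hom.snd).app x :=
  (congrArg (_ ≫ ·) (Category.comp_id _)).trans (Category.comp_id _)

variable {J}

lemma fst_iso_app {X : Pith (GluedCat.{u} R k)} (c : BiCocone J X) {e e' : E} (f : e ⟶ e')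
    (x : (J.obj e).as.fst.carrier) :
    ((LinCocone.ofPtLin (c.map (pithMap (PsPullback.fstFunctor (baseChange R k) (toPt k))))).iso
      f).hom.app x = (PtLin.Hom₂.nat (c.legIso f).hom.iso.hom.fst).app x :=
  (congrArg (· ≫ _) (Category.comp_id _)).trans (Category.id_comp _)

lemma snd_iso_app {X : Pith (GluedCat.{u} R k)} (c : BiCocone J X) {e e' : E} (f : e ⟶ e')
    (x : (J.obj e).as.snd.carrier) :
    ((LinCocone.ofSMLin (c.map (pithMap (PsPullback.sndFunctor (baseChange R k) (toPt k))))).iso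
      f).hom.app x = (SMLin.Hom₂.nat (c.legIso f).hom.iso.hom.snd).app x :=
  (congrArg (· ≫ _) (Category.comp_id _)).trans (Category.id_comp _)

section

variable (X : GluedCat.{u} R k)

/-- The restriction of the gluing equivalence to the category before base change. -/
@[reducible] def glue : X.fst.carrier ⥤ X.snd.carrier :=
  BaseChange.incl R k X.fst.carrier ⋙ X.glFunctor

open MonoidalCategory in
/-- The image of the distinguished object under the gluing equivalence is the unit. -/
@[reducible] def gluePt : 𝟙_ X.snd.carrier ≅ X.glue.obj X.fst.pt := X.gl.ptIso

end

section

variable {X Y Z : GluedCat.{u} R k}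

/-- The isomorphism relating the two components of a 1-cell. -/
def glueIso (F : X ⟶ Y) (x : X.fst.carrier) :
    Y.glue.obj (F.fst.functor.obj x) ≅ F.snd.functor.obj (X.glue.obj x) :=
  (isoFunctor F).app ⟨x⟩

lemma glueIso_natural (F : X ⟶ Y) {x y : X.fst.carrier} (a : x ⟶ y) :
    Y.glue.map (F.fst.functor.map a) ≫ (glueIso F y).hom =
      (glueIso F x).hom ≫ F.snd.functor.map (X.glue.map a) :=
  (isoFunctor F).hom.naturality (X := ⟨x⟩) (Y := ⟨y⟩) (BaseChange.tmul 1 a)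

lemma glueIso_id (x : X.fst.carrier) : (glueIso (𝟙 X) x).hom = 𝟙 _ :=
  isoFunctor_id_app X ⟨x⟩

lemma glueIso_comp (F : X ⟶ Y) (G : Y ⟶ Z) (x : X.fst.carrier) : (glueIso (F ≫ G) x).hom =
    (glueIso G (F.fst.functor.obj x)).hom ≫ G.snd.functor.map (glueIso F x).hom :=
  isoFunctor_comp_app F G ⟨x⟩

lemma glueIso_app {F G : X ⟶ Y} (α : F ⟶ G) (x : X.fst.carrier) :
    Y.glue.map ((PtLin.Hom₂.nat α.fst).app x) ≫ (glueIso G x).hom =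
      (glueIso F x).hom ≫ (SMLin.Hom₂.nat α.snd).app (X.glue.obj x) :=
  congrArg (fun γ => (PtLin.Hom₂.nat (C := (baseChange R k).obj X.fst) γ).app ⟨x⟩) α.comm

lemma glueIso_pt (F : X ⟶ Y) : (Y.gluePt.hom ≫ Y.glue.map F.fst.ptIso.hom) ≫
    (glueIso F X.fst.pt).hom =
      Functor.LaxMonoidal.ε F.snd.functor ≫ F.snd.functor.map X.gluePt.hom :=
  F.iso.hom.pt

lemma comm_of_glueIso {F G : X ⟶ Y} (α : F.fst ⟶ G.fst) (β : F.snd ⟶ G.snd)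
    (h : ∀ x, Y.glue.map ((PtLin.Hom₂.nat α).app x) ≫ (glueIso G x).hom =
      (glueIso F x).hom ≫ (SMLin.Hom₂.nat β).app (X.glue.obj x)) :
    (baseChange R k).map₂ α ▷ Y.gl ≫ G.iso.hom = F.iso.hom ≫ X.gl ◁ (toPt k).map₂ β :=
  comm_of_app α β fun x => h x.of

end

/-- The gluing equivalences of the members of a diagram. -/
@[reducible] def glueEquiv (J : E ⥤ᵖ Pith (GluedCat.{u} R k)) :
    LinDiag.Equiv ((LinDiag.ofPtLin (fstDiag J)).baseChange k) (LinDiag.ofSMLin (sndDiag J)) where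
  F e := (J.obj e).as.glFunctor
  additive e := inferInstanceAs (J.obj e).as.glFunctor.Additive
  linear e := inferInstanceAs ((J.obj e).as.glFunctor.Linear k)
  isEquivalence e := inferInstanceAs (J.obj e).as.glFunctor.IsEquivalence
  iso f := isoFunctor (J.map f).of
  map₂ η x := glueIso_app (J.map₂ η).iso.hom x.of
  id e x := by
    have h := glueIso_app (J.mapId e).hom.iso.hom x.of
    refine ((congrArg (_ ≫ ·) (sndDiag_mapId_app J e _)).trans h.symm).trans ?_
    refine ((congrArg (_ ≫ ·) (glueIso_id _)).trans (Category.comp_id _)).trans ?_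
    exact congrArg (J.obj e).as.glue.map (fstDiag_mapId_app J e x.of).symm
  comp {e e' e''} f g x := by
    have h := glueIso_app (J.mapComp f g).hom.iso.hom x.of
    refine ((congrArg (_ ≫ ·) (sndDiag_mapComp_app J f g _)).trans h.symm).trans ?_
    exact congrArg₂ (· ≫ ·)
      (congrArg (J.obj e'').as.glue.map (fstDiag_mapComp_app J f g x.of).symm)
      (glueIso_comp (J.map f).of (J.map g).of x.of)

end GluedCat

namespace BaseChange

variable {C : Type u} [Category.{u} C] [Preadditive C] [Linear R C]
variable {T : Type u} [Category.{u} T] [Preadditive T] [Linear k T]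

/-- A natural isomorphism of linear functors on a base change, from its restriction. -/
def natIsoOfIncl (F G : BaseChange R k C ⥤ T) [F.Additive] [F.Linear k] [G.Additive] [G.Linear k]
    (app : ∀ x : C, F.obj ⟨x⟩ ≅ G.obj ⟨x⟩)
    (h : ∀ {x y : C} (a : x ⟶ y), (incl R k C ⋙ F).map a ≫ (app y).hom =
      (app x).hom ≫ (incl R k C ⋙ G).map a) : F ≅ G :=
  natIsoMk F G (fun X => app X.of) (fun X Y s a => by
    rw [tmul_eq_smul, F.map_smul, G.map_smul, Linear.smul_comp, Linear.comp_smul]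
    exact congrArg (s • ·) (h a))

end BaseChange

namespace LinCocone

variable {D : LinDiag.{u} R E} {L : Type u} [Category.{u} L] [Preadditive L] [Linear R L]
variable {T : Type u} [Category.{u} T] [Preadditive T] [Linear k T]

lemma IsColim.exists_iso_baseChange {d : LinCocone D L} (h : d.IsColim)
    (F G : BaseChange R k L ⥤ T) [F.Additive] [F.Linear k] [G.Additive] [G.Linear k]
    (θ : ∀ e x, (BaseChange.incl R k L ⋙ F).obj ((d.leg e).obj x) ≅
      (BaseChange.incl R k L ⋙ G).obj ((d.leg e).obj x))
    (hθ : ∀ e {x y : D.C e} (a : x ⟶ y),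
      (BaseChange.incl R k L ⋙ F).map ((d.leg e).map a) ≫ (θ e y).hom =
        (θ e x).hom ≫ (BaseChange.incl R k L ⋙ G).map ((d.leg e).map a))
    (hθ' : ∀ {e e'} (f : e ⟶ e') x, (θ e' ((D.map f).obj x)).hom ≫
        (BaseChange.incl R k L ⋙ G).map ((d.iso f).hom.app x) =
      (BaseChange.incl R k L ⋙ F).map ((d.iso f).hom.app x) ≫ (θ e x).hom) :
    ∃ α : F ≅ G, ∀ e x, α.hom.app ⟨(d.leg e).obj x⟩ = (θ e x).hom := by
  obtain ⟨α, hα⟩ := (h.baseChange k).ext T F G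
    (fun e => BaseChange.natIsoOfIncl (BaseChange.mapFunctor k (d.leg e) ⋙ F)
      (BaseChange.mapFunctor k (d.leg e) ⋙ G) (θ e) (fun a => hθ e a))
    (fun e e' f x => hθ' f x.of)
  exact ⟨α, fun e x => hα e ⟨x⟩⟩

end LinCocone

end

section

section

variable {R k : Type} [CommRing R] [CommRing k] [Algebra R k]
variable {E : Type u} [Bicategory.{u, u} E]

namespace GluedCat

variable {J : E ⥤ᵖ Pith (GluedCat.{u} R k)} {X Y : Pith (GluedCat.{u} R k)}

/-- The first component of a pseudo-cocone. -/
abbrev fstCocone (c : BiCocone J X) : BiCocone (fstDiag J) (Pith.mk X.as.fst) :=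
  c.map (pithMap (PsPullback.fstFunctor (baseChange R k) (toPt k)))

/-- The second component of a pseudo-cocone. -/
abbrev sndCocone (c : BiCocone J X) : BiCocone (sndDiag J) (Pith.mk X.as.snd) :=
  c.map (pithMap (PsPullback.sndFunctor (baseChange R k) (toPt k)))

/-- The first component of a 1-cell. -/
abbrev fstHom (h : X ⟶ Y) : (Pith.mk X.as.fst : Pith (PtLin.{u} R)) ⟶ Pith.mk Y.as.fst :=
  Core.mk h.of.fst

/-- The second component of a 1-cell. -/
abbrev sndHom (h : X ⟶ Y) : (Pith.mk X.as.snd : Pith (SMLin.{u} k)) ⟶ Pith.mk Y.as.snd :=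
  Core.mk h.of.snd

/-- The first component of an invertible 2-cell. -/
@[reducible] def fstIso {X Y : GluedCat.{u} R k} {F G : X ⟶ Y} (α : F ≅ G) : F.fst ≅ G.fst where
  hom := α.hom.fst
  inv := α.inv.fst
  hom_inv_id := congrArg PsPullback.Hom₂.fst α.hom_inv_id
  inv_hom_id := congrArg PsPullback.Hom₂.fst α.inv_hom_id

/-- The second component of an invertible 2-cell. -/
@[reducible] def sndIso {X Y : GluedCat.{u} R k} {F G : X ⟶ Y} (α : F ≅ G) : F.snd ≅ G.snd where
  hom := α.hom.snd
  inv := α.inv.snd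
  hom_inv_id := congrArg PsPullback.Hom₂.snd α.hom_inv_id
  inv_hom_id := congrArg PsPullback.Hom₂.snd α.inv_hom_id

/-- The first component of a morphism between whiskered pseudo-cocones. -/
def fstWhisker {c : BiCocone J X} {h h' : X ⟶ Y} (φ : c.whisker h ⟶ c.whisker h') :
    (fstCocone c).whisker (fstHom h) ⟶ (fstCocone c).whisker (fstHom h') where
  app e := CoreHom.mk (fstIso (BiCocone.Hom.app φ e).iso)
  comm {e e'} f := Pith.hom₂_ext _ (PtLin.hom₂_ext fun x => by
    have h₁ := congrArg (fun γ => (PtLin.Hom₂.nat γ.iso.hom.fst).app x) (BiCocone.Hom.comm φ f)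
    exact (congrArg (fun l => _ ≫ 𝟙 _ ≫ h'.of.fst.functor.map l) (fst_iso_app c f x)).trans
      (h₁.trans (congrArg (fun l => (𝟙 _ ≫ h.of.fst.functor.map l) ≫ _)
        (fst_iso_app c f x).symm)))

/-- The second component of a morphism between whiskered pseudo-cocones. -/
def sndWhisker {c : BiCocone J X} {h h' : X ⟶ Y} (φ : c.whisker h ⟶ c.whisker h') :
    (sndCocone c).whisker (sndHom h) ⟶ (sndCocone c).whisker (sndHom h') where
  app e := CoreHom.mk (sndIso (BiCocone.Hom.app φ e).iso)
  comm {e e'} f := Pith.hom₂_ext _ (SMLin.hom₂_ext fun x => by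
    have h₁ := congrArg (fun γ => (SMLin.Hom₂.nat γ.iso.hom.snd).app x) (BiCocone.Hom.comm φ f)
    exact (congrArg (fun l => _ ≫ 𝟙 _ ≫ h'.of.snd.functor.map l) (snd_iso_app c f x)).trans
      (h₁.trans (congrArg (fun l => (𝟙 _ ≫ h.of.snd.functor.map l) ≫ _)
        (snd_iso_app c f x).symm)))

/-- The compatibility of the two components of the structure isomorphisms of a pseudo-cocone. -/
lemma glue_legIso (c : BiCocone J X) {e e' : E} (f : e ⟶ e') (x : (J.obj e).as.fst.carrier) :
    X.as.glue.map (((LinCocone.ofPtLin (fstCocone c)).iso f).hom.app x) ≫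
        (glueIso (c.leg e).of x).hom =
      (glueIso (c.leg e').of ((J.map f).of.fst.functor.obj x)).hom ≫
        (c.leg e').of.snd.functor.map (glueIso (J.map f).of x).hom ≫
          ((LinCocone.ofSMLin (sndCocone c)).iso f).hom.app ((J.obj e).as.glue.obj x) := by
  have h := glueIso_app (c.legIso f).hom.iso.hom x
  refine (congrArg (· ≫ _) (congrArg X.as.glue.map (fst_iso_app c f x))).trans (h.trans ?_)
  refine (congrArg₂ (· ≫ ·) (glueIso_comp (J.map f).of (c.leg e').of x)
    (snd_iso_app c f _).symm).trans (Category.assoc _ _ _)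

/-- Extending an isomorphism filling the gluing square along a bicolimit. -/
lemma exists_glueIso (c : BiCocone J X) (hc : (LinCocone.ofPtLin (fstCocone c)).IsColim)
    (t : BiCocone J Y) (F₁ : X.as.fst.carrier ⥤ Y.as.fst.carrier) [F₁.Additive] [F₁.Linear R]
    (F₂ : X.as.snd.carrier ⥤ Y.as.snd.carrier) [F₂.Additive] [F₂.Linear k]
    (ψ₁ : ∀ e, (c.leg e).of.fst.functor ⋙ F₁ ≅ (t.leg e).of.fst.functor)
    (ψ₂ : ∀ e, (c.leg e).of.snd.functor ⋙ F₂ ≅ (t.leg e).of.snd.functor)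
    (h₁ : (LinCocone.ofPtLin (fstCocone c)).Desc F₁ (LinCocone.ofPtLin (fstCocone t)) ψ₁)
    (h₂ : (LinCocone.ofSMLin (sndCocone c)).Desc F₂ (LinCocone.ofSMLin (sndCocone t)) ψ₂) :
    ∃ α : BaseChange.mapFunctor k F₁ ⋙ Y.as.glFunctor ≅ X.as.glFunctor ⋙ F₂, ∀ e x,
      α.hom.app ⟨(c.leg e).of.fst.functor.obj x⟩ ≫ F₂.map (glueIso (c.leg e).of x).hom ≫
        (ψ₂ e).hom.app ((J.obj e).as.glue.obj x) =
      Y.as.glue.map ((ψ₁ e).hom.app x) ≫ (glueIso (t.leg e).of x).hom := by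
  let K (e : E) (x : (J.obj e).as.fst.carrier) :
      F₂.obj (X.as.glue.obj ((c.leg e).of.fst.functor.obj x)) ≅
        (t.leg e).of.snd.functor.obj ((J.obj e).as.glue.obj x) :=
    F₂.mapIso (glueIso (c.leg e).of x) ≪≫ (ψ₂ e).app ((J.obj e).as.glue.obj x)
  let θ (e : E) (x : (J.obj e).as.fst.carrier) :
      Y.as.glue.obj (F₁.obj ((c.leg e).of.fst.functor.obj x)) ≅
        F₂.obj (X.as.glue.obj ((c.leg e).of.fst.functor.obj x)) :=
    Y.as.glue.mapIso ((ψ₁ e).app x) ≪≫ glueIso (t.leg e).of x ≪≫ (K e x).symm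
  have hK (e : E) (x : (J.obj e).as.fst.carrier) : (K e x).hom =
      F₂.map (glueIso (c.leg e).of x).hom ≫ (ψ₂ e).hom.app ((J.obj e).as.glue.obj x) := rfl
  have hθ (e : E) (x : (J.obj e).as.fst.carrier) : (θ e x).hom ≫ (K e x).hom =
      Y.as.glue.map ((ψ₁ e).hom.app x) ≫ (glueIso (t.leg e).of x).hom := by
    simp [θ]
  have nat₁ {e : E} {x y : (J.obj e).as.fst.carrier} (a : x ⟶ y) :
      F₁.map ((c.leg e).of.fst.functor.map a) ≫ (ψ₁ e).hom.app y =
        (ψ₁ e).hom.app x ≫ (t.leg e).of.fst.functor.map a := (ψ₁ e).hom.naturality a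
  have nat₂ {e : E} {x y : (J.obj e).as.snd.carrier} (a : x ⟶ y) :
      F₂.map ((c.leg e).of.snd.functor.map a) ≫ (ψ₂ e).hom.app y =
        (ψ₂ e).hom.app x ≫ (t.leg e).of.snd.functor.map a := (ψ₂ e).hom.naturality a
  have hθ₁ (e : E) {x y : (J.obj e).as.fst.carrier} (a : x ⟶ y) :
      Y.as.glue.map (F₁.map ((c.leg e).of.fst.functor.map a)) ≫ (θ e y).hom =
        (θ e x).hom ≫ F₂.map (X.as.glue.map ((c.leg e).of.fst.functor.map a)) := by
    rw [← cancel_mono (K e y).hom, Category.assoc, Category.assoc, hθ, hK, ← F₂.map_comp_assoc,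
      glueIso_natural, F₂.map_comp_assoc, nat₂, ← Category.assoc (F₂.map _), ← hK, ← Category.assoc,
      ← Category.assoc, hθ, ← Functor.map_comp, nat₁, Functor.map_comp, Category.assoc,
      Category.assoc, glueIso_natural]
  have hθ₂ {e e' : E} (f : e ⟶ e') (x : (J.obj e).as.fst.carrier) :
      (θ e' ((J.map f).of.fst.functor.obj x)).hom ≫
        F₂.map (X.as.glue.map (((LinCocone.ofPtLin (fstCocone c)).iso f).hom.app x)) =
      Y.as.glue.map (F₁.map (((LinCocone.ofPtLin (fstCocone c)).iso f).hom.app x)) ≫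
        (θ e x).hom := by
    have key (c₁ : (c.leg e').of.fst.functor.obj ((J.map f).of.fst.functor.obj x) ⟶
          (c.leg e).of.fst.functor.obj x)
        (t₁ : (t.leg e').of.fst.functor.obj ((J.map f).of.fst.functor.obj x) ⟶
          (t.leg e).of.fst.functor.obj x)
        (c₂ : (c.leg e').of.snd.functor.obj
            ((J.map f).of.snd.functor.obj ((J.obj e).as.glue.obj x)) ⟶
          (c.leg e).of.snd.functor.obj ((J.obj e).as.glue.obj x))
        (t₂ : (t.leg e').of.snd.functor.obj
            ((J.map f).of.snd.functor.obj ((J.obj e).as.glue.obj x)) ⟶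
          (t.leg e).of.snd.functor.obj ((J.obj e).as.glue.obj x))
        (e₁ : (ψ₁ e').hom.app ((J.map f).of.fst.functor.obj x) ≫ t₁ =
          F₁.map c₁ ≫ (ψ₁ e).hom.app x)
        (e₂ : (ψ₂ e').hom.app ((J.map f).of.snd.functor.obj ((J.obj e).as.glue.obj x)) ≫ t₂ =
          F₂.map c₂ ≫ (ψ₂ e).hom.app ((J.obj e).as.glue.obj x))
        (g : X.as.glue.map c₁ ≫ (glueIso (c.leg e).of x).hom =
          (glueIso (c.leg e').of ((J.map f).of.fst.functor.obj x)).hom ≫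
            (c.leg e').of.snd.functor.map (glueIso (J.map f).of x).hom ≫ c₂)
        (g' : Y.as.glue.map t₁ ≫ (glueIso (t.leg e).of x).hom =
          (glueIso (t.leg e').of ((J.map f).of.fst.functor.obj x)).hom ≫
            (t.leg e').of.snd.functor.map (glueIso (J.map f).of x).hom ≫ t₂) :
        (θ e' ((J.map f).of.fst.functor.obj x)).hom ≫ F₂.map (X.as.glue.map c₁) =
          Y.as.glue.map (F₁.map c₁) ≫ (θ e x).hom := by
      have e₃ := congrArg F₂.map g
      rw [F₂.map_comp, F₂.map_comp, F₂.map_comp] at e₃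
      have e₄ := nat₂ (glueIso (J.map f).of x).hom
      have e₅ := hθ e' ((J.map f).of.fst.functor.obj x)
      rw [hK] at e₅
      have e₆ := congrArg Y.as.glue.map e₁
      rw [Functor.map_comp, Functor.map_comp] at e₆
      rw [← cancel_mono (K e x).hom, Category.assoc, Category.assoc, hθ, hK,
        ← Category.assoc (F₂.map (X.as.glue.map c₁)), e₃, Category.assoc, Category.assoc, ← e₂,
        ← Category.assoc (F₂.map ((c.leg e').of.snd.functor.map _)), e₄, Category.assoc,
        ← Category.assoc (F₂.map (glueIso (c.leg e').of _).hom), ← Category.assoc, e₅,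
        Category.assoc, ← g', ← Category.assoc, e₆, Category.assoc]
    exact key _ _ _ _ (h₁ f x) (h₂ f ((J.obj e).as.glue.obj x)) (glue_legIso c f x)
      (glue_legIso t f x)
  obtain ⟨α, hα⟩ := hc.exists_iso_baseChange (BaseChange.mapFunctor k F₁ ⋙ Y.as.glFunctor)
    (X.as.glFunctor ⋙ F₂) θ (fun e {x y} a => hθ₁ e a) (fun {e e'} f x => hθ₂ f x)
  refine ⟨α, fun e x => ?_⟩
  have h := hα e x
  exact (congrArg (· ≫ _) h).trans (hθ e x)

end GluedCat

end

end

section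

section

variable {R k : Type} [CommRing R] [CommRing k] [Algebra R k]
variable {E : Type u} [Bicategory.{u, u} E]

namespace GluedCat

variable {J : E ⥤ᵖ Pith (GluedCat.{u} R k)} {X Y : Pith (GluedCat.{u} R k)}

lemma glue_app_comp_glueIso (c : BiCocone J X) (hc : (LinCocone.ofPtLin (fstCocone c)).IsColim)
    {h h' : X ⟶ Y} (φ : c.whisker h ⟶ c.whisker h')
    (α : h.of.fst ≅ h'.of.fst) (β : h.of.snd ≅ h'.of.snd)
    (hα : ∀ e x, (PtLin.Hom₂.nat α.hom).app ((c.leg e).of.fst.functor.obj x) =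
      (PtLin.Hom₂.nat (BiCocone.Hom.app φ e).iso.hom.fst).app x)
    (hβ : ∀ e x, (SMLin.Hom₂.nat β.hom).app ((c.leg e).of.snd.functor.obj x) =
      (SMLin.Hom₂.nat (BiCocone.Hom.app φ e).iso.hom.snd).app x) (z : X.as.fst.carrier) :
    Y.as.glue.map ((PtLin.Hom₂.nat α.hom).app z) ≫ (glueIso h'.of z).hom =
      (glueIso h.of z).hom ≫ (SMLin.Hom₂.nat β.hom).app (X.as.glue.obj z) := by
  obtain ⟨e, x, ⟨i⟩⟩ : ∃ (e : E) (x : (J.obj e).as.fst.carrier),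
    Nonempty ((c.leg e).of.fst.functor.obj x ≅ z) := hc.ess z
  have h₀ : Y.as.glue.map ((PtLin.Hom₂.nat α.hom).app ((c.leg e).of.fst.functor.obj x)) ≫
      (glueIso h'.of ((c.leg e).of.fst.functor.obj x)).hom =
        (glueIso h.of ((c.leg e).of.fst.functor.obj x)).hom ≫
          (SMLin.Hom₂.nat β.hom).app (X.as.glue.obj ((c.leg e).of.fst.functor.obj x)) := by
    have h₁ : Y.as.glue.map ((PtLin.Hom₂.nat α.hom).app ((c.leg e).of.fst.functor.obj x)) ≫
        (glueIso ((c.leg e).of ≫ h'.of) x).hom = (glueIso ((c.leg e).of ≫ h.of) x).hom ≫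
      (SMLin.Hom₂.nat β.hom).app ((c.leg e).of.snd.functor.obj ((J.obj e).as.glue.obj x)) :=
      (congrArg (fun γ => Y.as.glue.map γ ≫ (glueIso ((c.leg e).of ≫ h'.of) x).hom)
        (hα e x)).trans ((glueIso_app (BiCocone.Hom.app φ e).iso.hom x).trans
          (congrArg (_ ≫ ·) (hβ e _).symm))
    have h₂ : h.of.snd.functor.map (glueIso (c.leg e).of x).hom ≫
        (SMLin.Hom₂.nat β.hom).app ((c.leg e).of.snd.functor.obj ((J.obj e).as.glue.obj x)) =
      (SMLin.Hom₂.nat β.hom).app (X.as.glue.obj ((c.leg e).of.fst.functor.obj x)) ≫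
        h'.of.snd.functor.map (glueIso (c.leg e).of x).hom :=
      (SMLin.Hom₂.nat β.hom).naturality _
    rw [glueIso_comp, glueIso_comp, Category.assoc, h₂, ← Category.assoc, ← Category.assoc] at h₁
    exact (cancel_mono (h'.of.snd.functor.map (glueIso (c.leg e).of x).hom)).1 h₁
  have n₁ : h.of.fst.functor.map i.hom ≫ (PtLin.Hom₂.nat α.hom).app z =
      (PtLin.Hom₂.nat α.hom).app _ ≫ h'.of.fst.functor.map i.hom :=
    (PtLin.Hom₂.nat α.hom).naturality _
  have n₂ : h.of.snd.functor.map (X.as.glue.map i.hom) ≫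
      (SMLin.Hom₂.nat β.hom).app (X.as.glue.obj z) =
      (SMLin.Hom₂.nat β.hom).app _ ≫ h'.of.snd.functor.map (X.as.glue.map i.hom) :=
    (SMLin.Hom₂.nat β.hom).naturality _
  have n₃ : Y.as.glue.map (h.of.fst.functor.map i.hom) ≫
      Y.as.glue.map ((PtLin.Hom₂.nat α.hom).app z) =
    Y.as.glue.map ((PtLin.Hom₂.nat α.hom).app _) ≫
      Y.as.glue.map (h'.of.fst.functor.map i.hom) :=
    (Y.as.glue.map_comp _ _).symm.trans ((congrArg Y.as.glue.map n₁).trans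
      (Y.as.glue.map_comp _ _))
  rw [← cancel_epi (Y.as.glue.map (h.of.fst.functor.map i.hom)), ← Category.assoc, n₃,
    Category.assoc, glueIso_natural h'.of i.hom, ← Category.assoc, h₀, Category.assoc, ← n₂,
    ← Category.assoc, ← glueIso_natural h.of i.hom, Category.assoc]

/-- The extension of an isomorphism filling the gluing square preserves the distinguished
objects. -/
lemma glue_pt (c : BiCocone J X) (t : BiCocone J Y) (F₁ : X.as.fst ⟶ Y.as.fst)
    (F₂ : X.as.snd ⟶ Y.as.snd) (e : E) (ψ₁ : (c.leg e).of.fst ≫ F₁ ⟶ (t.leg e).of.fst)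
    (ψ₂ : (c.leg e).of.snd ≫ F₂ ≅ (t.leg e).of.snd)
    (α : BaseChange.mapFunctor k F₁.functor ⋙ Y.as.glFunctor ≅ X.as.glFunctor ⋙ F₂.functor)
    (hα : ∀ x, α.hom.app ⟨(c.leg e).of.fst.functor.obj x⟩ ≫
        F₂.functor.map (glueIso (c.leg e).of x).hom ≫
          (SMLin.natIso ψ₂).hom.app ((J.obj e).as.glue.obj x) =
      Y.as.glue.map ((PtLin.Hom₂.nat ψ₁).app x) ≫ (glueIso (t.leg e).of x).hom) :
    (Y.as.gluePt.hom ≫ Y.as.glue.map F₁.ptIso.hom) ≫ α.hom.app ⟨X.as.fst.pt⟩ =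
      Functor.LaxMonoidal.ε F₂.functor ≫ F₂.functor.map X.as.gluePt.hom := by
  have p₁ : (F₁.ptIso.hom ≫ F₁.functor.map (c.leg e).of.fst.ptIso.hom) ≫
      (PtLin.Hom₂.nat ψ₁).app (J.obj e).as.fst.pt = (t.leg e).of.fst.ptIso.hom := ψ₁.pt
  have p₂ : (Functor.LaxMonoidal.ε F₂.functor ≫
      F₂.functor.map (Functor.LaxMonoidal.ε (c.leg e).of.snd.functor)) ≫
        (SMLin.natIso ψ₂).hom.app _ = Functor.LaxMonoidal.ε (t.leg e).of.snd.functor :=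
    ψ₂.hom.isMonoidal.unit
  have n₂ : F₂.functor.map ((c.leg e).of.snd.functor.map (J.obj e).as.gluePt.hom) ≫
      (SMLin.natIso ψ₂).hom.app ((J.obj e).as.glue.obj (J.obj e).as.fst.pt) =
    (SMLin.natIso ψ₂).hom.app _ ≫ (t.leg e).of.snd.functor.map (J.obj e).as.gluePt.hom :=
    (SMLin.natIso ψ₂).hom.naturality _
  have q₁ := glueIso_pt (c.leg e).of
  have q₂ := glueIso_pt (t.leg e).of
  have q₃ : F₂.functor.map X.as.gluePt.hom ≫
      F₂.functor.map (X.as.glue.map (c.leg e).of.fst.ptIso.hom) ≫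
        F₂.functor.map (glueIso (c.leg e).of (J.obj e).as.fst.pt).hom =
      F₂.functor.map (Functor.LaxMonoidal.ε (c.leg e).of.snd.functor) ≫
        F₂.functor.map ((c.leg e).of.snd.functor.map (J.obj e).as.gluePt.hom) := by
    rw [← F₂.functor.map_comp, ← F₂.functor.map_comp, ← F₂.functor.map_comp, ← Category.assoc]
    exact congrArg F₂.functor.map q₁
  have q₄ : Y.as.glue.map F₁.ptIso.hom ≫
      Y.as.glue.map (F₁.functor.map (c.leg e).of.fst.ptIso.hom) ≫
        Y.as.glue.map ((PtLin.Hom₂.nat ψ₁).app (J.obj e).as.fst.pt) =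
      Y.as.glue.map (t.leg e).of.fst.ptIso.hom := by
    rw [← Functor.map_comp, ← Functor.map_comp, ← Category.assoc]
    exact congrArg Y.as.glue.map p₁
  let κ : F₂.functor.obj (X.as.glue.obj X.as.fst.pt) ≅
      (t.leg e).of.snd.functor.obj ((J.obj e).as.glue.obj (J.obj e).as.fst.pt) :=
    F₂.functor.mapIso (X.as.glue.mapIso (c.leg e).of.fst.ptIso ≪≫ glueIso (c.leg e).of _) ≪≫
      (SMLin.natIso ψ₂).app _
  have hκ : κ.hom = F₂.functor.map (X.as.glue.map (c.leg e).of.fst.ptIso.hom) ≫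
      F₂.functor.map (glueIso (c.leg e).of (J.obj e).as.fst.pt).hom ≫
        (SMLin.natIso ψ₂).hom.app ((J.obj e).as.glue.obj (J.obj e).as.fst.pt) := by
    rw [← Category.assoc, ← F₂.functor.map_comp]
    rfl
  have key (a₀ : Y.as.glue.obj (F₁.functor.obj X.as.fst.pt) ⟶
        F₂.functor.obj (X.as.glue.obj X.as.fst.pt))
      (a₁ : Y.as.glue.obj (F₁.functor.obj ((c.leg e).of.fst.functor.obj (J.obj e).as.fst.pt)) ⟶
        F₂.functor.obj (X.as.glue.obj ((c.leg e).of.fst.functor.obj (J.obj e).as.fst.pt)))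
      (n₁ : Y.as.glue.map (F₁.functor.map (c.leg e).of.fst.ptIso.hom) ≫ a₁ =
        a₀ ≫ F₂.functor.map (X.as.glue.map (c.leg e).of.fst.ptIso.hom))
      (h₁ : a₁ ≫ F₂.functor.map (glueIso (c.leg e).of (J.obj e).as.fst.pt).hom ≫
          (SMLin.natIso ψ₂).hom.app ((J.obj e).as.glue.obj (J.obj e).as.fst.pt) =
        Y.as.glue.map ((PtLin.Hom₂.nat ψ₁).app (J.obj e).as.fst.pt) ≫
          (glueIso (t.leg e).of (J.obj e).as.fst.pt).hom) :
      (Y.as.gluePt.hom ≫ Y.as.glue.map F₁.ptIso.hom) ≫ a₀ =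
        Functor.LaxMonoidal.ε F₂.functor ≫ F₂.functor.map X.as.gluePt.hom := by
    have r₁ : ((Y.as.gluePt.hom ≫ Y.as.glue.map F₁.ptIso.hom) ≫ a₀) ≫ κ.hom =
        Functor.LaxMonoidal.ε (t.leg e).of.snd.functor ≫
          (t.leg e).of.snd.functor.map (J.obj e).as.gluePt.hom := by
      rw [hκ, Category.assoc, ← Category.assoc a₀, ← n₁]
      simp only [Category.assoc]
      rw [h₁, ← q₂, ← q₄]
      simp only [Category.assoc]
    have r₂ : (Functor.LaxMonoidal.ε F₂.functor ≫ F₂.functor.map X.as.gluePt.hom) ≫ κ.hom =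
        Functor.LaxMonoidal.ε (t.leg e).of.snd.functor ≫
          (t.leg e).of.snd.functor.map (J.obj e).as.gluePt.hom := by
      have r₃ := congrArg (fun γ => Functor.LaxMonoidal.ε F₂.functor ≫ γ ≫
        (SMLin.natIso ψ₂).hom.app ((J.obj e).as.glue.obj (J.obj e).as.fst.pt)) q₃
      simp only [Category.assoc] at r₃
      rw [hκ, ← p₂]
      simp only [Category.assoc]
      rw [← n₂]
      exact r₃
    exact (cancel_mono κ.hom).1 (r₁.trans r₂.symm)
  exact key _ _ (α.hom.naturality (X := ⟨X.as.fst.pt⟩) (Y := ⟨_⟩)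
    (BaseChange.tmul 1 (c.leg e).of.fst.ptIso.hom)) (hα _)

variable [IsSifted₂₁ E]

lemma isBicolimit_of_isColim (c : BiCocone J X)
    (hc₁ : (LinCocone.ofPtLin (fstCocone c)).IsColim)
    (hc₂ : (LinCocone.ofSMLin (sndCocone c)).IsColim) : c.IsBicolimit := by
  obtain ⟨e₀⟩ := IsSifted₂₁.nonempty (E := E)
  intro Y
  have b₁ := PtLin.isBicolimit_of_isColim (fstCocone c) hc₁ (Pith.mk Y.as.fst)
  have b₂ := SMLin.isBicolimit_of_isColim (sndCocone c) hc₂ (Pith.mk Y.as.snd)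
  refine ⟨⟨fun {h h'} α β hαβ => ?_⟩, ⟨fun {h h'} φ => ?_⟩, ⟨fun t => ?_⟩⟩
  · refine Pith.hom₂_ext _ (PsPullback.hom₂_ext (PtLin.Hom₂.ext ?_) (SMLin.Hom₂.ext ?_))
    · refine hc₁.hom_ext (F := h.of.fst.functor) (G := h'.of.fst.functor) fun e x => ?_
      exact congrArg (fun γ : c.whisker h ⟶ c.whisker h' =>
        (PtLin.Hom₂.nat (BiCocone.Hom.app γ e).iso.hom.fst).app x) hαβ
    · refine hc₂.hom_ext (F := h.of.snd.functor) (G := h'.of.snd.functor) fun e x => ?_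
      exact congrArg (fun γ : c.whisker h ⟶ c.whisker h' =>
        (SMLin.Hom₂.nat (BiCocone.Hom.app γ e).iso.hom.snd).app x) hαβ
  · obtain ⟨α, hα⟩ := b₁.full.map_surjective (X := fstHom h) (Y := fstHom h') (fstWhisker φ)
    obtain ⟨β, hβ⟩ := b₂.full.map_surjective (X := sndHom h) (Y := sndHom h') (sndWhisker φ)
    have hα' (e : E) (x : (J.obj e).as.fst.carrier) :
        (PtLin.Hom₂.nat α.iso.hom).app ((c.leg e).of.fst.functor.obj x) =
          (PtLin.Hom₂.nat (BiCocone.Hom.app φ e).iso.hom.fst).app x :=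
      congrArg (fun γ : (fstCocone c).whisker (fstHom h) ⟶ (fstCocone c).whisker (fstHom h') =>
        (PtLin.Hom₂.nat (BiCocone.Hom.app γ e).iso.hom).app x) hα
    have hβ' (e : E) (x : (J.obj e).as.snd.carrier) :
        (SMLin.Hom₂.nat β.iso.hom).app ((c.leg e).of.snd.functor.obj x) =
          (SMLin.Hom₂.nat (BiCocone.Hom.app φ e).iso.hom.snd).app x :=
      congrArg (fun γ : (sndCocone c).whisker (sndHom h) ⟶ (sndCocone c).whisker (sndHom h') =>
        (SMLin.Hom₂.nat (BiCocone.Hom.app γ e).iso.hom).app x) hβ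
    refine ⟨CoreHom.mk (PsPullback.isoMk α.iso β.iso
      (comm_of_glueIso α.iso.hom β.iso.hom (glue_app_comp_glueIso c hc₁ φ α.iso β.iso hα' hβ'))),
        ?_⟩
    exact BiCocone.hom_ext fun e => Pith.hom₂_ext _ (PsPullback.hom₂_ext
      (PtLin.hom₂_ext fun x => hα' e x) (SMLin.hom₂_ext fun x => hβ' e x))
  · obtain ⟨h₁, ⟨φ₁⟩⟩ := b₁.essSurj.mem_essImage (fstCocone t)
    obtain ⟨h₂, ⟨φ₂⟩⟩ := b₂.essSurj.mem_essImage (sndCocone t)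
    let ψ₁ (e : E) : (c.leg e).of.fst ≫ h₁.of ≅ (t.leg e).of.fst :=
      (BiCocone.Hom.app φ₁.hom e).iso
    let ψ₂ (e : E) : (c.leg e).of.snd ≫ h₂.of ≅ (t.leg e).of.snd :=
      (BiCocone.Hom.app φ₂.hom e).iso
    have d₁ : (LinCocone.ofPtLin (fstCocone c)).Desc h₁.of.functor
        (LinCocone.ofPtLin (fstCocone t)) (fun e => PtLin.natIso (ψ₁ e)) := fun e e' f x => by
      have h := congrArg (fun γ => (PtLin.Hom₂.nat γ.iso.hom).app x) (BiCocone.Hom.comm φ₁.hom f)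
      exact h.trans (congrArg (· ≫ _) (Category.id_comp _))
    have d₂ : (LinCocone.ofSMLin (sndCocone c)).Desc h₂.of.functor
        (LinCocone.ofSMLin (sndCocone t)) (fun e => SMLin.natIso (ψ₂ e)) := fun e e' f x => by
      have h := congrArg (fun γ => (SMLin.Hom₂.nat γ.iso.hom).app x) (BiCocone.Hom.comm φ₂.hom f)
      exact h.trans (congrArg (· ≫ _) (Category.id_comp _))
    obtain ⟨α, hα⟩ := exists_glueIso c hc₁ t h₁.of.functor h₂.of.functor
      (fun e => PtLin.natIso (ψ₁ e)) (fun e => SMLin.natIso (ψ₂ e)) d₁ d₂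
    let h : X ⟶ Y := Core.mk
      { fst := h₁.of
        snd := h₂.of
        iso := PtLin.isoMk α (glue_pt c t h₁.of h₂.of e₀ (ψ₁ e₀).hom (ψ₂ e₀) α (hα e₀)) }
    have hcomp (e : E) (x : (J.obj e).as.fst.carrier) :
        (glueIso ((c.leg e).of ≫ h.of) x).hom =
          α.hom.app ⟨(c.leg e).of.fst.functor.obj x⟩ ≫
            h₂.of.functor.map (glueIso (c.leg e).of x).hom := glueIso_comp _ _ _
    refine ⟨h, ⟨BiCocone.isoMk (fun e => Core.isoMk (PsPullback.isoMk (ψ₁ e) (ψ₂ e)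
      (comm_of_glueIso (F := (c.leg e).of ≫ h.of) (G := (t.leg e).of) (ψ₁ e).hom (ψ₂ e).hom
        fun x => ?_))) (fun {e e'} f => Pith.hom₂_ext _ (PsPullback.hom₂_ext
          (PtLin.hom₂_ext fun x => ?_) (SMLin.hom₂_ext fun x => ?_)))⟩⟩
    · exact (hα e x).symm.trans ((Category.assoc _ _ _).symm.trans
        (congrArg (· ≫ _) (hcomp e x).symm))
    · exact (congrArg (_ ≫ ·) (fst_iso_app t f x).symm).trans ((d₁ f x).trans
        (congrArg (· ≫ _) ((congrArg h₁.of.functor.map (fst_iso_app c f x)).trans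
          (Category.id_comp _).symm)))
    · exact (congrArg (_ ≫ ·) (snd_iso_app t f x).symm).trans ((d₂ f x).trans
        (congrArg (· ≫ _) ((congrArg h₂.of.functor.map (snd_iso_app c f x)).trans
          (Category.id_comp _).symm)))

end GluedCat

end

end

section

section

variable {R k : Type} [CommRing R] [CommRing k] [Algebra R k]
variable {E : Type u} [Bicategory.{u, u} E] [IsSifted₂₁ E]

namespace GluedCat

open MonoidalCategory in
/-- Compatible comparison functors between the components of a sifted diagram induce a pointed
functor on vertices of cocones. -/
lemma exists_gluePt (J : E ⥤ᵖ Pith (GluedCat.{u} R k)) {X₁ : PtLin.{u} R} {X₂ : SMLin.{u} k}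
    (F₁ : ∀ e, (J.obj e).as.fst ⟶ X₁) (F₂ : ∀ e, (J.obj e).as.snd ⟶ X₂)
    (β₁ : ∀ {e e' : E} (f : e ⟶ e'), (J.map f).of.fst ≫ F₁ e' ≅ F₁ e)
    (β₂ : ∀ {e e' : E} (f : e ⟶ e'), (J.map f).of.snd ≫ F₂ e' ≅ F₂ e)
    (G : X₁.carrier ⥤ X₂.carrier)
    (τ : ∀ e x, G.obj ((F₁ e).functor.obj x) ≅ (F₂ e).functor.obj ((J.obj e).as.glue.obj x))
    (hτ : ∀ e {x y : (J.obj e).as.fst.carrier} (a : x ⟶ y),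
      G.map ((F₁ e).functor.map a) ≫ (τ e y).hom =
        (τ e x).hom ≫ (F₂ e).functor.map ((J.obj e).as.glue.map a))
    (hτ' : ∀ {e e' : E} (f : e ⟶ e') x, (τ e' ((J.map f).of.fst.functor.obj x)).hom ≫
        (F₂ e').functor.map (glueIso (J.map f).of x).hom ≫
          (SMLin.natIso (β₂ f)).hom.app ((J.obj e).as.glue.obj x) =
      G.map ((PtLin.Hom₂.nat (β₁ f).hom).app x) ≫ (τ e x).hom) :
    ∃ i : 𝟙_ X₂.carrier ≅ G.obj X₁.pt, ∀ e,
      (i.hom ≫ G.map (F₁ e).ptIso.hom) ≫ (τ e (J.obj e).as.fst.pt).hom =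
        Functor.LaxMonoidal.ε (F₂ e).functor ≫ (F₂ e).functor.map (J.obj e).as.gluePt.hom := by
  obtain ⟨e₀⟩ := IsSifted₂₁.nonempty (E := E)
  let i : 𝟙_ X₂.carrier ≅ G.obj X₁.pt := Functor.Monoidal.εIso (F₂ e₀).functor ≪≫
    (F₂ e₀).functor.mapIso (J.obj e₀).as.gluePt ≪≫ (τ e₀ _).symm ≪≫
      G.mapIso (F₁ e₀).ptIso.symm
  refine ⟨i, fun e => PtLin.eq_of_comp_eq (e₀ := e₀) (P := fun e =>
    (i.hom ≫ G.map (F₁ e).ptIso.hom) ≫ (τ e (J.obj e).as.fst.pt).hom =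
      Functor.LaxMonoidal.ε (F₂ e).functor ≫ (F₂ e).functor.map (J.obj e).as.gluePt.hom)
    (fun {e e'} f => ?_) ?_ e⟩
  · let κ : (F₂ e').functor.obj ((J.obj e').as.glue.obj (J.obj e').as.fst.pt) ≅
        (F₂ e).functor.obj ((J.obj e).as.glue.obj (J.obj e).as.fst.pt) :=
      (F₂ e').functor.mapIso ((J.obj e').as.glue.mapIso (J.map f).of.fst.ptIso ≪≫
        glueIso (J.map f).of _) ≪≫ (SMLin.natIso (β₂ f)).app _
    have hκ : κ.hom = (F₂ e').functor.map ((J.obj e').as.glue.map (J.map f).of.fst.ptIso.hom) ≫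
        (F₂ e').functor.map (glueIso (J.map f).of _).hom ≫
          (SMLin.natIso (β₂ f)).hom.app ((J.obj e).as.glue.obj (J.obj e).as.fst.pt) := by
      rw [← Category.assoc, ← (F₂ e').functor.map_comp]
      rfl
    have p₁ : ((F₁ e').ptIso.hom ≫ (F₁ e').functor.map (J.map f).of.fst.ptIso.hom) ≫
        (PtLin.Hom₂.nat (β₁ f).hom).app (J.obj e).as.fst.pt = (F₁ e).ptIso.hom := (β₁ f).hom.pt
    have p₂ : (Functor.LaxMonoidal.ε (F₂ e').functor ≫
        (F₂ e').functor.map (Functor.LaxMonoidal.ε (J.map f).of.snd.functor)) ≫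
          (SMLin.natIso (β₂ f)).hom.app _ = Functor.LaxMonoidal.ε (F₂ e).functor :=
      (β₂ f).hom.isMonoidal.unit
    have n₂ : (F₂ e').functor.map ((J.map f).of.snd.functor.map (J.obj e).as.gluePt.hom) ≫
        (SMLin.natIso (β₂ f)).hom.app ((J.obj e).as.glue.obj (J.obj e).as.fst.pt) =
      (SMLin.natIso (β₂ f)).hom.app _ ≫ (F₂ e).functor.map (J.obj e).as.gluePt.hom :=
      (SMLin.natIso (β₂ f)).hom.naturality _
    have q₁ := congrArg (F₂ e').functor.map (glueIso_pt (J.map f).of)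
    have q₃ : (F₂ e').functor.map (J.obj e').as.gluePt.hom ≫
        (F₂ e').functor.map ((J.obj e').as.glue.map (J.map f).of.fst.ptIso.hom) ≫
          (F₂ e').functor.map (glueIso (J.map f).of (J.obj e).as.fst.pt).hom =
        (F₂ e').functor.map (Functor.LaxMonoidal.ε (J.map f).of.snd.functor) ≫
          (F₂ e').functor.map ((J.map f).of.snd.functor.map (J.obj e).as.gluePt.hom) := by
      rw [← (F₂ e').functor.map_comp, ← (F₂ e').functor.map_comp, ← (F₂ e').functor.map_comp,
        ← Category.assoc]
      exact q₁
    have r₁ : ((i.hom ≫ G.map (F₁ e').ptIso.hom) ≫ (τ e' (J.obj e').as.fst.pt).hom) ≫ κ.hom =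
        (i.hom ≫ G.map (F₁ e).ptIso.hom) ≫ (τ e (J.obj e).as.fst.pt).hom := by
      have s := hτ e' (J.map f).of.fst.ptIso.hom
      rw [hκ, Category.assoc, ← Category.assoc (τ e' _).hom, ← s]
      simp only [Category.assoc]
      rw [hτ' f, ← p₁, Functor.map_comp, Functor.map_comp]
      simp only [Category.assoc]
    have r₂ : (Functor.LaxMonoidal.ε (F₂ e').functor ≫
        (F₂ e').functor.map (J.obj e').as.gluePt.hom) ≫ κ.hom =
        Functor.LaxMonoidal.ε (F₂ e).functor ≫ (F₂ e).functor.map (J.obj e).as.gluePt.hom := by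
      have r₃ := congrArg (fun γ => Functor.LaxMonoidal.ε (F₂ e').functor ≫ γ ≫
        (SMLin.natIso (β₂ f)).hom.app ((J.obj e).as.glue.obj (J.obj e).as.fst.pt)) q₃
      simp only [Category.assoc] at r₃
      rw [hκ, ← p₂]
      simp only [Category.assoc]
      rw [← n₂]
      exact r₃
    rw [← r₁, ← r₂]
    exact (cancel_mono κ.hom).symm
  · have : G.map (F₁ e₀).ptIso.inv ≫ G.map (F₁ e₀).ptIso.hom = 𝟙 _ :=
      (G.mapIso (F₁ e₀).ptIso).inv_hom_id
    simp [i, this]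

lemma exists_isColim (J : E ⥤ᵖ Pith (GluedCat.{u} R k)) :
    ∃ (X : Pith (GluedCat.{u} R k)) (c : BiCocone J X),
      (LinCocone.ofPtLin (fstCocone c)).IsColim ∧ (LinCocone.ofSMLin (sndCocone c)).IsColim := by
  obtain ⟨X₁, c₁, h₁⟩ := PtLin.exists_isColim (fstDiag J)
  obtain ⟨X₂, c₂, h₂⟩ := SMLin.exists_isColim (sndDiag J)
  obtain ⟨G, hG, hG', σ, hσ⟩ := (h₁.baseChange k).desc X₂.as.carrier
    ((LinCocone.ofSMLin c₂).pullback (glueEquiv J))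
  have hG'' := (h₁.baseChange k).exists_equivalence (h₂.pullback (glueEquiv J)) G σ hσ
  have hσ' {e e' : E} (f : e ⟶ e') (x : (J.obj e).as.fst.carrier) :
      (σ e').hom.app ⟨(J.map f).of.fst.functor.obj x⟩ ≫
          (c₂.leg e').of.functor.map (glueIso (J.map f).of x).hom ≫
            (SMLin.natIso (c₂.legIso f).hom.iso).hom.app ((J.obj e).as.glue.obj x) =
        G.map (BaseChange.tmul (X := ⟨_⟩) (Y := ⟨_⟩) 1
          ((PtLin.natIso (c₁.legIso f).hom.iso).hom.app x)) ≫ (σ e).hom.app ⟨x⟩ := hσ f ⟨x⟩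
  obtain ⟨i, hi⟩ := exists_gluePt J (fun e => (c₁.leg e).of) (fun e => (c₂.leg e).of)
    (fun f => (c₁.legIso f).hom.iso) (fun f => (c₂.legIso f).hom.iso)
    (BaseChange.incl R k X₁.as.carrier ⋙ G) (fun e x => (σ e).app ⟨x⟩)
    (fun e x y a => (σ e).hom.naturality (X := ⟨x⟩) (Y := ⟨y⟩) (BaseChange.tmul 1 a))
    (fun f x => hσ' f x)
  let gl : (baseChange R k).obj X₁.as ⟶ (toPt k).obj X₂.as :=
    { functor := G, additive := hG, linear := hG', ptIso := i }
  have : gl.functor.IsEquivalence := hG''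
  let X : Pith (GluedCat.{u} R k) := ⟨⟨X₁.as, X₂.as, gl, PtLin.isEquivalence₁ gl⟩⟩
  let leg (e : E) : J.obj e ⟶ X := Core.mk
    { fst := (c₁.leg e).of
      snd := (c₂.leg e).of
      iso := PtLin.isoMk (σ e) (hi e) }
  let c : BiCocone J X :=
    { leg := leg
      legIso := fun {e e'} f => Core.isoMk (PsPullback.isoMk (c₁.legIso f).hom.iso
        (c₂.legIso f).hom.iso (comm_of_glueIso (F := (J.map f).of ≫ (leg e').of)
          (G := (leg e).of) (c₁.legIso f).hom.iso.hom (c₂.legIso f).hom.iso.hom fun x =>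
            (hσ' f x).symm.trans ((Category.assoc _ _ _).symm.trans
              (congrArg (· ≫ _) (glueIso_comp (J.map f).of (leg e').of x).symm))))
      naturality := fun η => Pith.hom₂_ext _ (PsPullback.hom₂_ext
        (congrArg (fun γ => γ.iso.hom) (c₁.naturality η))
        (congrArg (fun γ => γ.iso.hom) (c₂.naturality η)))
      legIso_id := fun e => Pith.hom₂_ext _ (PsPullback.hom₂_ext
        (PtLin.hom₂_ext fun x => ((LinCocone.ofPtLin c₁).id e x).trans
          ((congrArg (c₁.leg e).of.functor.map (fstDiag_mapId_app J e x)).trans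
            (Category.comp_id _).symm))
        (SMLin.hom₂_ext fun x => ((LinCocone.ofSMLin c₂).id e x).trans
          ((congrArg (c₂.leg e).of.functor.map (sndDiag_mapId_app J e x)).trans
            (Category.comp_id _).symm)))
      legIso_comp := fun {e e' e''} f g => Pith.hom₂_ext _ (PsPullback.hom₂_ext
        (PtLin.hom₂_ext fun x => ((LinCocone.ofPtLin c₁).comp f g x).trans
          (congrArg₂ (· ≫ ·) (congrArg (c₁.leg e'').of.functor.map (fstDiag_mapComp_app J f g x))
            (Category.id_comp _).symm))
        (SMLin.hom₂_ext fun x => ((LinCocone.ofSMLin c₂).comp f g x).trans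
          (congrArg₂ (· ≫ ·) (congrArg (c₂.leg e'').of.functor.map (sndDiag_mapComp_app J f g x))
            (Category.id_comp _).symm))) }
  refine ⟨X, c, ?_, ?_⟩
  · exact h₁.of_equivalence _ (𝟭 _) (fun e => Functor.rightUnitor _) fun e e' f x =>
      (Category.id_comp _).trans ((fst_iso_app c f x).trans (Category.comp_id _).symm)
  · exact h₂.of_equivalence _ (𝟭 _) (fun e => Functor.rightUnitor _) fun e e' f x =>
      (Category.id_comp _).trans ((snd_iso_app c f x).trans (Category.comp_id _).symm)

lemma isBicolimit_iff {J : E ⥤ᵖ Pith (GluedCat.{u} R k)} {X : Pith (GluedCat.{u} R k)}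
    (c : BiCocone J X) : c.IsBicolimit ↔
      (LinCocone.ofPtLin (fstCocone c)).IsColim ∧ (LinCocone.ofSMLin (sndCocone c)).IsColim := by
  refine ⟨fun hc => ?_, fun h => isBicolimit_of_isColim c h.1 h.2⟩
  obtain ⟨X', c', h₁, h₂⟩ := exists_isColim J
  obtain ⟨h, g, φ, ⟨i⟩, ⟨i'⟩⟩ := (isBicolimit_of_isColim c' h₁ h₂).exists_equivalence hc
  have e₁ : h.of.fst.functor.IsEquivalence :=
    (CategoryTheory.Equivalence.mk h.of.fst.functor g.of.fst.functor
      (PtLin.natIso (fstIso i.hom.iso)).symm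
      (PtLin.natIso (fstIso i'.hom.iso))).isEquivalence_functor
  have e₂ : h.of.snd.functor.IsEquivalence :=
    (CategoryTheory.Equivalence.mk h.of.snd.functor g.of.snd.functor
      (SMLin.natIso (sndIso i.hom.iso)).symm
      (SMLin.natIso (sndIso i'.hom.iso))).isEquivalence_functor
  constructor
  · refine h₁.of_equivalence (LinCocone.ofPtLin (fstCocone c)) h.of.fst.functor
      (fun e => PtLin.natIso (fstIso (BiCocone.Hom.app φ.hom e).iso)) (fun e e' f x => ?_)
    have h₁ := congrArg (fun γ => (PtLin.Hom₂.nat γ.iso.hom.fst).app x)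
      (BiCocone.Hom.comm φ.hom f)
    exact (congrArg (_ ≫ ·) (fst_iso_app c f x)).trans (h₁.trans (congrArg (· ≫ _)
      ((Category.id_comp _).trans (congrArg h.of.fst.functor.map (fst_iso_app c' f x).symm))))
  · refine h₂.of_equivalence (LinCocone.ofSMLin (sndCocone c)) h.of.snd.functor
      (fun e => SMLin.natIso (sndIso (BiCocone.Hom.app φ.hom e).iso)) (fun e e' f x => ?_)
    have h₁ := congrArg (fun γ => (SMLin.Hom₂.nat γ.iso.hom.snd).app x)
      (BiCocone.Hom.comm φ.hom f)
    exact (congrArg (_ ≫ ·) (snd_iso_app c f x)).trans (h₁.trans (congrArg (· ≫ _)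
      ((Category.id_comp _).trans (congrArg h.of.snd.functor.map (snd_iso_app c' f x).symm))))

variable (R k)

lemma siftedBicolimitsComponentwise :
    PsPullback.SiftedBicolimitsComponentwise (baseChange.{u} R k) (toPt.{u} k) :=
  fun E _ _ J X c => (isBicolimit_iff c).trans
    (and_congr (PtLin.isBicolimit_iff _).symm (SMLin.isBicolimit_iff _).symm)

end GluedCat

end

end

section

section

variable {R k : Type} [CommRing R] [CommRing k] [Algebra R k]

lemma comp_eq_of_eq_id {C : Type*} [Category* C] {X Y : C} (f : X ⟶ Y) {g : Y ⟶ Y}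
    (hg : g = 𝟙 Y) : f ≫ g = f := by
  rw [hg, Category.comp_id]

lemma comp_eq_of_id_eq {C : Type*} [Category* C] {X Y : C} {f : X ⟶ X} (g : X ⟶ Y)
    (hf : f = 𝟙 X) : f ≫ g = g := by
  rw [hf, Category.id_comp]

lemma id_comp_eq_comp_ids {C : Type*} [Category* C] {X Y : C} {f f' : X ⟶ Y} (hf : f = f')
    {g h : Y ⟶ Y} (hg : g = 𝟙 Y) (hh : h = 𝟙 Y) : 𝟙 X ≫ f = f' ≫ g ≫ h := by
  subst hf hg hh
  simp

namespace GluedCat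

variable (Y : GluedCat.{u} R k)

/-- Tensoring with a fixed object on the left. -/
abbrev tensorLeft : GluedCat.{u} R k ⥤ᵖ GluedCat.{u} R k :=
  (Bicategory.Prod.sectR Y (GluedCat.{u} R k)).toPseudofunctor.comp (tensor R k)

/-- Tensoring with a fixed object on the right. -/
abbrev tensorRight : GluedCat.{u} R k ⥤ᵖ GluedCat.{u} R k :=
  (Bicategory.Prod.sectL (GluedCat.{u} R k) Y).toPseudofunctor.comp (tensor R k)

section

variable {E : Type u} [Bicategory.{u, u} E] (J : E ⥤ᵖ Pith (GluedCat.{u} R k))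

lemma tensorLeft_map₂_mapId_fst {X : GluedCat.{u} R k} {F : X ⟶ X} (α : F ⟶ 𝟙 X)
    (x : LinTensor R Y.fst.carrier X.fst.carrier) :
    (PtLin.Hom₂.nat (((tensorLeft Y).map₂ α ≫ (tensorLeft Y).map₂ (𝟙 (𝟙 X)) ≫
      ((tensorLeft Y).mapId X).hom).fst)).app x =
      LinTensor.tmul (R := R) (X := ⟨x.fst, F.fst.functor.obj x.snd⟩) (Y := x) (𝟙 x.fst)
        ((PtLin.Hom₂.nat α.fst).app x.snd) :=
  comp_eq_of_eq_id (C := LinTensor R Y.fst.carrier X.fst.carrier) _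
    (comp_eq_of_eq_id (X := x) _ (Category.comp_id (X := x) (𝟙 x)))

lemma tensorLeft_map₂_mapComp_fst {X X' X'' : GluedCat.{u} R k} {F : X ⟶ X'} {G : X' ⟶ X''}
    {H : X ⟶ X''} (α : H ⟶ F ≫ G) (x : LinTensor R Y.fst.carrier X.fst.carrier) :
    (PtLin.Hom₂.nat (((tensorLeft Y).map₂ α ≫ (tensorLeft Y).map₂ (𝟙 (F ≫ G)) ≫
        ((tensorLeft Y).mapComp F G).hom).fst)).app x =
      LinTensor.tmul (R := R) (X := ⟨x.fst, H.fst.functor.obj x.snd⟩)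
        (Y := ⟨x.fst, G.fst.functor.obj (F.fst.functor.obj x.snd)⟩) (𝟙 x.fst)
        ((PtLin.Hom₂.nat α.fst).app x.snd) :=
  comp_eq_of_eq_id (C := LinTensor R Y.fst.carrier X''.fst.carrier) _
    (comp_eq_of_eq_id (X := (⟨x.fst, G.fst.functor.obj (F.fst.functor.obj x.snd)⟩ :
      LinTensor R Y.fst.carrier X''.fst.carrier)) _ (Category.comp_id
        (X := (⟨x.fst, G.fst.functor.obj (F.fst.functor.obj x.snd)⟩ :
        LinTensor R Y.fst.carrier X''.fst.carrier)) (𝟙 _)))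

lemma tensorLeft_mapComp_map₂_fst {X X' X'' : GluedCat.{u} R k} {F : X ⟶ X'} {G : X' ⟶ X''}
    {H : X ⟶ X''} (α : F ≫ G ⟶ H) (x : LinTensor R Y.fst.carrier X.fst.carrier) :
    (PtLin.Hom₂.nat (((((tensorLeft Y).mapComp F G).inv ≫ (tensorLeft Y).map₂ (𝟙 (F ≫ G))) ≫
        (tensorLeft Y).map₂ α).fst)).app x =
      LinTensor.tmul (R := R) (X := ⟨x.fst, G.fst.functor.obj (F.fst.functor.obj x.snd)⟩)
        (Y := ⟨x.fst, H.fst.functor.obj x.snd⟩) (𝟙 x.fst) ((PtLin.Hom₂.nat α.fst).app x.snd) :=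
  comp_eq_of_id_eq (C := LinTensor R Y.fst.carrier X''.fst.carrier) _
    (comp_eq_of_id_eq (Y := (⟨x.fst, G.fst.functor.obj (F.fst.functor.obj x.snd)⟩ :
      LinTensor R Y.fst.carrier X''.fst.carrier)) _ (Category.comp_id
        (X := (⟨x.fst, G.fst.functor.obj (F.fst.functor.obj x.snd)⟩ :
        LinTensor R Y.fst.carrier X''.fst.carrier)) (𝟙 _)))

lemma fstDiag_tensorLeft_mapId_app (e : E)
    (x : LinTensor R Y.fst.carrier (J.obj e).as.fst.carrier) :
    ((LinDiag.ofPtLin (fstDiag (J.comp (pithMap (tensorLeft Y))))).mapId e).hom.app x =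
      (LinDiag.mapId
        ((LinDiag.const R E Y.fst.carrier).tensor (LinDiag.ofPtLin (fstDiag J))) e).hom.app x :=
  (fstDiag_mapId_app (J.comp (pithMap (tensorLeft Y))) e x).trans
    ((tensorLeft_map₂_mapId_fst Y (J.mapId e).hom.iso.hom x).trans
      (congrArg (fun γ => LinTensor.tmul (R := R) (X := ⟨x.fst, (J.map (𝟙 e)).of.fst.functor.obj
        x.snd⟩) (Y := x) (𝟙 x.fst) γ)
        (fstDiag_mapId_app J e x.snd).symm))

lemma fstDiag_tensorLeft_mapComp_app {e e' e'' : E} (f : e ⟶ e') (g : e' ⟶ e'')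
    (x : LinTensor R Y.fst.carrier (J.obj e).as.fst.carrier) :
    ((LinDiag.ofPtLin (fstDiag (J.comp (pithMap (tensorLeft Y))))).mapComp f g).hom.app x =
      (((LinDiag.const R E Y.fst.carrier).tensor (LinDiag.ofPtLin (fstDiag J))).mapComp f
        g).hom.app x :=
  (fstDiag_mapComp_app (J.comp (pithMap (tensorLeft Y))) f g x).trans
    ((tensorLeft_map₂_mapComp_fst Y (J.mapComp f g).hom.iso.hom x).trans
      (congrArg (fun γ => LinTensor.tmul (R := R) (X := ⟨x.fst, (J.map (f ≫ g)).of.fst.functor.obj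
        x.snd⟩) (Y := ⟨x.fst, (J.map g).of.fst.functor.obj ((J.map f).of.fst.functor.obj x.snd)⟩)
        (𝟙 x.fst) γ)
        (fstDiag_mapComp_app J f g x.snd).symm))

/-- The first components of a diagram tensored on the left. -/
@[reducible] def fstDiagTensorLeft :
    LinDiag.Equiv (LinDiag.ofPtLin (fstDiag (J.comp (pithMap (tensorLeft Y)))))
      ((LinDiag.const R E Y.fst.carrier).tensor (LinDiag.ofPtLin (fstDiag J))) where
  F e := 𝟭 (LinTensor R Y.fst.carrier (J.obj e).as.fst.carrier)
  additive e := inferInstanceAs (𝟭 (LinTensor R Y.fst.carrier (J.obj e).as.fst.carrier)).Additive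
  linear e := inferInstanceAs ((𝟭 (LinTensor R Y.fst.carrier (J.obj e).as.fst.carrier)).Linear R)
  isEquivalence e :=
    inferInstanceAs (𝟭 (LinTensor R Y.fst.carrier (J.obj e).as.fst.carrier)).IsEquivalence
  iso f := Iso.refl (LinTensor.mapFunctor (R := R) (𝟭 Y.fst.carrier) (J.map f).of.fst.functor)
  map₂ η x := (Category.comp_id _).trans (Category.id_comp _).symm
  id e x := (Category.id_comp _).trans (fstDiag_tensorLeft_mapId_app Y J e x).symm
  comp {e e' e''} f g x := id_comp_eq_comp_ids (C := LinTensor R Y.fst.carrier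
    (J.obj e'').as.fst.carrier)
    (fstDiag_tensorLeft_mapComp_app Y J f g x).symm rfl (CategoryTheory.Functor.map_id _ _)

variable {J}

lemma isColim_fstCocone_tensorLeft {X : Pith (GluedCat.{u} R k)} (c : BiCocone J X)
    (h : (LinCocone.ofPtLin (fstCocone c)).IsColim) :
    (LinCocone.ofPtLin (fstCocone (c.map (pithMap (tensorLeft Y))))).IsColim := by
  let F : LinTensor R Y.fst.carrier X.as.fst.carrier ⥤
      ((pithMap (tensorLeft Y)).obj X).as.fst.carrier :=
    𝟭 (LinTensor R Y.fst.carrier X.as.fst.carrier)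
  have hF : F.Additive := inferInstanceAs (𝟭 (LinTensor R Y.fst.carrier X.as.fst.carrier)).Additive
  have hF' : F.Linear R := inferInstanceAs ((𝟭 (LinTensor R Y.fst.carrier X.as.fst.carrier)).Linear
    R)
  have : F.IsEquivalence := inferInstanceAs (𝟭 (LinTensor R Y.fst.carrier
    X.as.fst.carrier)).IsEquivalence
  refine ((h.tensorLeft Y.fst.carrier).pullback (fstDiagTensorLeft Y J)).of_equivalence _ F
    (fun e => Iso.refl (LinTensor.mapFunctor (R := R) (𝟭 Y.fst.carrier) (c.leg e).of.fst.functor))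
    (fun e e' f x => (Category.id_comp _).trans (Eq.trans ?_ (Category.comp_id _).symm))
  refine (fst_iso_app (c.map (pithMap (tensorLeft Y))) f x).trans ?_
  refine (tensorLeft_mapComp_map₂_fst Y (c.legIso f).hom.iso.hom x).trans ?_
  refine Eq.trans ?_ (comp_eq_of_id_eq (C := LinTensor R Y.fst.carrier X.as.fst.carrier)
    ((((LinCocone.const R E Y.fst.carrier).tensor (LinCocone.ofPtLin (fstCocone c))).iso f).hom.app
      x) (CategoryTheory.Functor.map_id
      (LinTensor.mapFunctor (R := R) (𝟭 Y.fst.carrier) (c.leg e').of.fst.functor)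
        ⟨x.fst, (J.map f).of.fst.functor.obj x.snd⟩)).symm
  exact congrArg (fun γ => LinTensor.tmul (R := R) (X := ⟨x.fst, (c.leg e').of.fst.functor.obj
    ((J.map f).of.fst.functor.obj x.snd)⟩) (Y := ⟨x.fst, (c.leg e).of.fst.functor.obj x.snd⟩)
    (𝟙 x.fst) γ)
    (fst_iso_app c f x.snd).symm

end

section

variable {E : Type u} [Bicategory.{u, u} E] (J : E ⥤ᵖ Pith (GluedCat.{u} R k))

lemma tensorLeft_map₂_mapId_snd {X : GluedCat.{u} R k} {F : X ⟶ X} (α : F ⟶ 𝟙 X)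
    (x : LinTensor k Y.snd.carrier X.snd.carrier) :
    (SMLin.Hom₂.nat (((tensorLeft Y).map₂ α ≫ (tensorLeft Y).map₂ (𝟙 (𝟙 X)) ≫
      ((tensorLeft Y).mapId X).hom).snd)).app x =
      LinTensor.tmul (R := k) (X := ⟨x.fst, F.snd.functor.obj x.snd⟩) (Y := x) (𝟙 x.fst)
        ((SMLin.Hom₂.nat α.snd).app x.snd) :=
  comp_eq_of_eq_id (C := LinTensor k Y.snd.carrier X.snd.carrier) _
    (comp_eq_of_eq_id (X := x) _ (Category.comp_id (X := x) (𝟙 x)))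

lemma tensorLeft_map₂_mapComp_snd {X X' X'' : GluedCat.{u} R k} {F : X ⟶ X'} {G : X' ⟶ X''}
    {H : X ⟶ X''} (α : H ⟶ F ≫ G) (x : LinTensor k Y.snd.carrier X.snd.carrier) :
    (SMLin.Hom₂.nat (((tensorLeft Y).map₂ α ≫ (tensorLeft Y).map₂ (𝟙 (F ≫ G)) ≫
        ((tensorLeft Y).mapComp F G).hom).snd)).app x =
      LinTensor.tmul (R := k) (X := ⟨x.fst, H.snd.functor.obj x.snd⟩)
        (Y := ⟨x.fst, G.snd.functor.obj (F.snd.functor.obj x.snd)⟩) (𝟙 x.fst)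
        ((SMLin.Hom₂.nat α.snd).app x.snd) :=
  comp_eq_of_eq_id (C := LinTensor k Y.snd.carrier X''.snd.carrier) _
    (comp_eq_of_eq_id (X := (⟨x.fst, G.snd.functor.obj (F.snd.functor.obj x.snd)⟩ :
      LinTensor k Y.snd.carrier X''.snd.carrier)) _ (Category.comp_id
        (X := (⟨x.fst, G.snd.functor.obj (F.snd.functor.obj x.snd)⟩ :
        LinTensor k Y.snd.carrier X''.snd.carrier)) (𝟙 _)))

lemma tensorLeft_mapComp_map₂_snd {X X' X'' : GluedCat.{u} R k} {F : X ⟶ X'} {G : X' ⟶ X''}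
    {H : X ⟶ X''} (α : F ≫ G ⟶ H) (x : LinTensor k Y.snd.carrier X.snd.carrier) :
    (SMLin.Hom₂.nat (((((tensorLeft Y).mapComp F G).inv ≫ (tensorLeft Y).map₂ (𝟙 (F ≫ G))) ≫
        (tensorLeft Y).map₂ α).snd)).app x =
      LinTensor.tmul (R := k) (X := ⟨x.fst, G.snd.functor.obj (F.snd.functor.obj x.snd)⟩)
        (Y := ⟨x.fst, H.snd.functor.obj x.snd⟩) (𝟙 x.fst) ((SMLin.Hom₂.nat α.snd).app x.snd) :=
  comp_eq_of_id_eq (C := LinTensor k Y.snd.carrier X''.snd.carrier) _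
    (comp_eq_of_id_eq (Y := (⟨x.fst, G.snd.functor.obj (F.snd.functor.obj x.snd)⟩ :
      LinTensor k Y.snd.carrier X''.snd.carrier)) _ (Category.comp_id
        (X := (⟨x.fst, G.snd.functor.obj (F.snd.functor.obj x.snd)⟩ :
        LinTensor k Y.snd.carrier X''.snd.carrier)) (𝟙 _)))

lemma sndDiag_tensorLeft_mapId_app (e : E)
    (x : LinTensor k Y.snd.carrier (J.obj e).as.snd.carrier) :
    ((LinDiag.ofSMLin (sndDiag (J.comp (pithMap (tensorLeft Y))))).mapId e).hom.app x =
      (LinDiag.mapId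
        ((LinDiag.const k E Y.snd.carrier).tensor (LinDiag.ofSMLin (sndDiag J))) e).hom.app x :=
  (sndDiag_mapId_app (J.comp (pithMap (tensorLeft Y))) e x).trans
    ((tensorLeft_map₂_mapId_snd Y (J.mapId e).hom.iso.hom x).trans
      (congrArg (fun γ => LinTensor.tmul (R := k) (X := ⟨x.fst, (J.map (𝟙 e)).of.snd.functor.obj
        x.snd⟩) (Y := x) (𝟙 x.fst) γ)
        (sndDiag_mapId_app J e x.snd).symm))

lemma sndDiag_tensorLeft_mapComp_app {e e' e'' : E} (f : e ⟶ e') (g : e' ⟶ e'')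
    (x : LinTensor k Y.snd.carrier (J.obj e).as.snd.carrier) :
    ((LinDiag.ofSMLin (sndDiag (J.comp (pithMap (tensorLeft Y))))).mapComp f g).hom.app x =
      (((LinDiag.const k E Y.snd.carrier).tensor (LinDiag.ofSMLin (sndDiag J))).mapComp f
        g).hom.app x :=
  (sndDiag_mapComp_app (J.comp (pithMap (tensorLeft Y))) f g x).trans
    ((tensorLeft_map₂_mapComp_snd Y (J.mapComp f g).hom.iso.hom x).trans
      (congrArg (fun γ => LinTensor.tmul (R := k) (X := ⟨x.fst, (J.map (f ≫ g)).of.snd.functor.obj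
        x.snd⟩) (Y := ⟨x.fst, (J.map g).of.snd.functor.obj ((J.map f).of.snd.functor.obj x.snd)⟩)
        (𝟙 x.fst) γ)
        (sndDiag_mapComp_app J f g x.snd).symm))

/-- The second components of a diagram tensored on the left. -/
@[reducible] def sndDiagTensorLeft :
    LinDiag.Equiv (LinDiag.ofSMLin (sndDiag (J.comp (pithMap (tensorLeft Y)))))
      ((LinDiag.const k E Y.snd.carrier).tensor (LinDiag.ofSMLin (sndDiag J))) where
  F e := 𝟭 (LinTensor k Y.snd.carrier (J.obj e).as.snd.carrier)
  additive e := inferInstanceAs (𝟭 (LinTensor k Y.snd.carrier (J.obj e).as.snd.carrier)).Additive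
  linear e := inferInstanceAs ((𝟭 (LinTensor k Y.snd.carrier (J.obj e).as.snd.carrier)).Linear k)
  isEquivalence e :=
    inferInstanceAs (𝟭 (LinTensor k Y.snd.carrier (J.obj e).as.snd.carrier)).IsEquivalence
  iso f := Iso.refl (LinTensor.mapFunctor (R := k) (𝟭 Y.snd.carrier) (J.map f).of.snd.functor)
  map₂ η x := (Category.comp_id _).trans (Category.id_comp _).symm
  id e x := (Category.id_comp _).trans (sndDiag_tensorLeft_mapId_app Y J e x).symm
  comp {e e' e''} f g x := id_comp_eq_comp_ids (C := LinTensor k Y.snd.carrier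
    (J.obj e'').as.snd.carrier)
    (sndDiag_tensorLeft_mapComp_app Y J f g x).symm rfl (CategoryTheory.Functor.map_id _ _)

variable {J}

lemma isColim_sndCocone_tensorLeft {X : Pith (GluedCat.{u} R k)} (c : BiCocone J X)
    (h : (LinCocone.ofSMLin (sndCocone c)).IsColim) :
    (LinCocone.ofSMLin (sndCocone (c.map (pithMap (tensorLeft Y))))).IsColim := by
  let F : LinTensor k Y.snd.carrier X.as.snd.carrier ⥤
      ((pithMap (tensorLeft Y)).obj X).as.snd.carrier :=
    𝟭 (LinTensor k Y.snd.carrier X.as.snd.carrier)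
  have hF : F.Additive := inferInstanceAs (𝟭 (LinTensor k Y.snd.carrier X.as.snd.carrier)).Additive
  have hF' : F.Linear k := inferInstanceAs ((𝟭 (LinTensor k Y.snd.carrier X.as.snd.carrier)).Linear
    k)
  have : F.IsEquivalence := inferInstanceAs (𝟭 (LinTensor k Y.snd.carrier
    X.as.snd.carrier)).IsEquivalence
  refine ((h.tensorLeft Y.snd.carrier).pullback (sndDiagTensorLeft Y J)).of_equivalence _ F
    (fun e => Iso.refl (LinTensor.mapFunctor (R := k) (𝟭 Y.snd.carrier) (c.leg e).of.snd.functor))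
    (fun e e' f x => (Category.id_comp _).trans (Eq.trans ?_ (Category.comp_id _).symm))
  refine (snd_iso_app (c.map (pithMap (tensorLeft Y))) f x).trans ?_
  refine (tensorLeft_mapComp_map₂_snd Y (c.legIso f).hom.iso.hom x).trans ?_
  refine Eq.trans ?_ (comp_eq_of_id_eq (C := LinTensor k Y.snd.carrier X.as.snd.carrier)
    ((((LinCocone.const k E Y.snd.carrier).tensor (LinCocone.ofSMLin (sndCocone c))).iso f).hom.app
      x) (CategoryTheory.Functor.map_id
      (LinTensor.mapFunctor (R := k) (𝟭 Y.snd.carrier) (c.leg e').of.snd.functor)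
        ⟨x.fst, (J.map f).of.snd.functor.obj x.snd⟩)).symm
  exact congrArg (fun γ => LinTensor.tmul (R := k) (X := ⟨x.fst, (c.leg e').of.snd.functor.obj
    ((J.map f).of.snd.functor.obj x.snd)⟩) (Y := ⟨x.fst, (c.leg e).of.snd.functor.obj x.snd⟩)
    (𝟙 x.fst) γ)
    (snd_iso_app c f x.snd).symm

end

section

variable {E : Type u} [Bicategory.{u, u} E] (J : E ⥤ᵖ Pith (GluedCat.{u} R k))

lemma tensorRight_map₂_mapId_fst {X : GluedCat.{u} R k} {F : X ⟶ X} (α : F ⟶ 𝟙 X)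
    (x : LinTensor R X.fst.carrier Y.fst.carrier) :
    (PtLin.Hom₂.nat (((tensorRight Y).map₂ α ≫ (tensorRight Y).map₂ (𝟙 (𝟙 X)) ≫
      ((tensorRight Y).mapId X).hom).fst)).app x =
      LinTensor.tmul (R := R) (X := ⟨F.fst.functor.obj x.fst, x.snd⟩) (Y := x)
        ((PtLin.Hom₂.nat α.fst).app x.fst) (𝟙 x.snd) :=
  comp_eq_of_eq_id (C := LinTensor R X.fst.carrier Y.fst.carrier) _
    (comp_eq_of_eq_id (X := x) _ (Category.comp_id (X := x) (𝟙 x)))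

lemma tensorRight_map₂_mapComp_fst {X X' X'' : GluedCat.{u} R k} {F : X ⟶ X'} {G : X' ⟶ X''}
    {H : X ⟶ X''} (α : H ⟶ F ≫ G) (x : LinTensor R X.fst.carrier Y.fst.carrier) :
    (PtLin.Hom₂.nat (((tensorRight Y).map₂ α ≫ (tensorRight Y).map₂ (𝟙 (F ≫ G)) ≫
        ((tensorRight Y).mapComp F G).hom).fst)).app x =
      LinTensor.tmul (R := R) (X := ⟨H.fst.functor.obj x.fst, x.snd⟩)
        (Y := ⟨G.fst.functor.obj (F.fst.functor.obj x.fst), x.snd⟩)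
        ((PtLin.Hom₂.nat α.fst).app x.fst) (𝟙 x.snd) :=
  comp_eq_of_eq_id (C := LinTensor R X''.fst.carrier Y.fst.carrier) _
    (comp_eq_of_eq_id (X := (⟨G.fst.functor.obj (F.fst.functor.obj x.fst), x.snd⟩ :
      LinTensor R X''.fst.carrier Y.fst.carrier)) _ (Category.comp_id
        (X := (⟨G.fst.functor.obj (F.fst.functor.obj x.fst), x.snd⟩ :
        LinTensor R X''.fst.carrier Y.fst.carrier)) (𝟙 _)))

lemma tensorRight_mapComp_map₂_fst {X X' X'' : GluedCat.{u} R k} {F : X ⟶ X'} {G : X' ⟶ X''}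
    {H : X ⟶ X''} (α : F ≫ G ⟶ H) (x : LinTensor R X.fst.carrier Y.fst.carrier) :
    (PtLin.Hom₂.nat (((((tensorRight Y).mapComp F G).inv ≫ (tensorRight Y).map₂ (𝟙 (F ≫ G))) ≫
        (tensorRight Y).map₂ α).fst)).app x =
      LinTensor.tmul (R := R) (X := ⟨G.fst.functor.obj (F.fst.functor.obj x.fst), x.snd⟩)
        (Y := ⟨H.fst.functor.obj x.fst, x.snd⟩) ((PtLin.Hom₂.nat α.fst).app x.fst) (𝟙 x.snd) :=
  comp_eq_of_id_eq (C := LinTensor R X''.fst.carrier Y.fst.carrier) _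
    (comp_eq_of_id_eq (Y := (⟨G.fst.functor.obj (F.fst.functor.obj x.fst), x.snd⟩ :
      LinTensor R X''.fst.carrier Y.fst.carrier)) _ (Category.comp_id
        (X := (⟨G.fst.functor.obj (F.fst.functor.obj x.fst), x.snd⟩ :
        LinTensor R X''.fst.carrier Y.fst.carrier)) (𝟙 _)))

lemma fstDiag_tensorRight_mapId_app (e : E)
    (x : LinTensor R (J.obj e).as.fst.carrier Y.fst.carrier) :
    ((LinDiag.ofPtLin (fstDiag (J.comp (pithMap (tensorRight Y))))).mapId e).hom.app x =
      (LinDiag.mapId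
        ((LinDiag.ofPtLin (fstDiag J)).tensor (LinDiag.const R E Y.fst.carrier)) e).hom.app x :=
  (fstDiag_mapId_app (J.comp (pithMap (tensorRight Y))) e x).trans
    ((tensorRight_map₂_mapId_fst Y (J.mapId e).hom.iso.hom x).trans
      (congrArg (fun γ => LinTensor.tmul (R := R) (X := ⟨(J.map (𝟙 e)).of.fst.functor.obj x.fst,
        x.snd⟩) (Y := x) γ (𝟙 x.snd))
        (fstDiag_mapId_app J e x.fst).symm))

lemma fstDiag_tensorRight_mapComp_app {e e' e'' : E} (f : e ⟶ e') (g : e' ⟶ e'')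
    (x : LinTensor R (J.obj e).as.fst.carrier Y.fst.carrier) :
    ((LinDiag.ofPtLin (fstDiag (J.comp (pithMap (tensorRight Y))))).mapComp f g).hom.app x =
      (((LinDiag.ofPtLin (fstDiag J)).tensor (LinDiag.const R E Y.fst.carrier)).mapComp f
        g).hom.app x :=
  (fstDiag_mapComp_app (J.comp (pithMap (tensorRight Y))) f g x).trans
    ((tensorRight_map₂_mapComp_fst Y (J.mapComp f g).hom.iso.hom x).trans
      (congrArg (fun γ => LinTensor.tmul (R := R) (X := ⟨(J.map (f ≫ g)).of.fst.functor.obj x.fst,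
        x.snd⟩) (Y := ⟨(J.map g).of.fst.functor.obj ((J.map f).of.fst.functor.obj x.fst), x.snd⟩) γ
        (𝟙 x.snd))
        (fstDiag_mapComp_app J f g x.fst).symm))

/-- The first components of a diagram tensored on the right. -/
@[reducible] def fstDiagTensorRight :
    LinDiag.Equiv (LinDiag.ofPtLin (fstDiag (J.comp (pithMap (tensorRight Y)))))
      ((LinDiag.ofPtLin (fstDiag J)).tensor (LinDiag.const R E Y.fst.carrier)) where
  F e := 𝟭 (LinTensor R (J.obj e).as.fst.carrier Y.fst.carrier)
  additive e := inferInstanceAs (𝟭 (LinTensor R (J.obj e).as.fst.carrier Y.fst.carrier)).Additive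
  linear e := inferInstanceAs ((𝟭 (LinTensor R (J.obj e).as.fst.carrier Y.fst.carrier)).Linear R)
  isEquivalence e :=
    inferInstanceAs (𝟭 (LinTensor R (J.obj e).as.fst.carrier Y.fst.carrier)).IsEquivalence
  iso f := Iso.refl (LinTensor.mapFunctor (R := R) (J.map f).of.fst.functor (𝟭 Y.fst.carrier))
  map₂ η x := (Category.comp_id _).trans (Category.id_comp _).symm
  id e x := (Category.id_comp _).trans (fstDiag_tensorRight_mapId_app Y J e x).symm
  comp {e e' e''} f g x := id_comp_eq_comp_ids (C := LinTensor R (J.obj e'').as.fst.carrier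
    Y.fst.carrier)
    (fstDiag_tensorRight_mapComp_app Y J f g x).symm rfl (CategoryTheory.Functor.map_id _ _)

variable {J}

lemma isColim_fstCocone_tensorRight {X : Pith (GluedCat.{u} R k)} (c : BiCocone J X)
    (h : (LinCocone.ofPtLin (fstCocone c)).IsColim) :
    (LinCocone.ofPtLin (fstCocone (c.map (pithMap (tensorRight Y))))).IsColim := by
  let F : LinTensor R X.as.fst.carrier Y.fst.carrier ⥤
      ((pithMap (tensorRight Y)).obj X).as.fst.carrier :=
    𝟭 (LinTensor R X.as.fst.carrier Y.fst.carrier)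
  have hF : F.Additive := inferInstanceAs (𝟭 (LinTensor R X.as.fst.carrier Y.fst.carrier)).Additive
  have hF' : F.Linear R := inferInstanceAs ((𝟭 (LinTensor R X.as.fst.carrier Y.fst.carrier)).Linear
    R)
  have : F.IsEquivalence := inferInstanceAs (𝟭 (LinTensor R X.as.fst.carrier
    Y.fst.carrier)).IsEquivalence
  refine ((h.tensorRight Y.fst.carrier).pullback (fstDiagTensorRight Y J)).of_equivalence _ F
    (fun e => Iso.refl (LinTensor.mapFunctor (R := R) (c.leg e).of.fst.functor (𝟭 Y.fst.carrier)))
    (fun e e' f x => (Category.id_comp _).trans (Eq.trans ?_ (Category.comp_id _).symm))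
  refine (fst_iso_app (c.map (pithMap (tensorRight Y))) f x).trans ?_
  refine (tensorRight_mapComp_map₂_fst Y (c.legIso f).hom.iso.hom x).trans ?_
  refine Eq.trans ?_ (comp_eq_of_id_eq (C := LinTensor R X.as.fst.carrier Y.fst.carrier)
    ((((LinCocone.ofPtLin (fstCocone c)).tensor (LinCocone.const R E Y.fst.carrier)).iso f).hom.app
      x) (CategoryTheory.Functor.map_id
      (LinTensor.mapFunctor (R := R) (c.leg e').of.fst.functor (𝟭 Y.fst.carrier))
        ⟨(J.map f).of.fst.functor.obj x.fst, x.snd⟩)).symm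
  exact congrArg (fun γ => LinTensor.tmul (R := R) (X := ⟨(c.leg e').of.fst.functor.obj
    ((J.map f).of.fst.functor.obj x.fst), x.snd⟩) (Y := ⟨(c.leg e).of.fst.functor.obj x.fst,
    x.snd⟩) γ (𝟙 x.snd))
    (fst_iso_app c f x.fst).symm

end

section

variable {E : Type u} [Bicategory.{u, u} E] (J : E ⥤ᵖ Pith (GluedCat.{u} R k))

lemma tensorRight_map₂_mapId_snd {X : GluedCat.{u} R k} {F : X ⟶ X} (α : F ⟶ 𝟙 X)
    (x : LinTensor k X.snd.carrier Y.snd.carrier) :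
    (SMLin.Hom₂.nat (((tensorRight Y).map₂ α ≫ (tensorRight Y).map₂ (𝟙 (𝟙 X)) ≫
      ((tensorRight Y).mapId X).hom).snd)).app x =
      LinTensor.tmul (R := k) (X := ⟨F.snd.functor.obj x.fst, x.snd⟩) (Y := x)
        ((SMLin.Hom₂.nat α.snd).app x.fst) (𝟙 x.snd) :=
  comp_eq_of_eq_id (C := LinTensor k X.snd.carrier Y.snd.carrier) _
    (comp_eq_of_eq_id (X := x) _ (Category.comp_id (X := x) (𝟙 x)))

lemma tensorRight_map₂_mapComp_snd {X X' X'' : GluedCat.{u} R k} {F : X ⟶ X'} {G : X' ⟶ X''}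
    {H : X ⟶ X''} (α : H ⟶ F ≫ G) (x : LinTensor k X.snd.carrier Y.snd.carrier) :
    (SMLin.Hom₂.nat (((tensorRight Y).map₂ α ≫ (tensorRight Y).map₂ (𝟙 (F ≫ G)) ≫
        ((tensorRight Y).mapComp F G).hom).snd)).app x =
      LinTensor.tmul (R := k) (X := ⟨H.snd.functor.obj x.fst, x.snd⟩)
        (Y := ⟨G.snd.functor.obj (F.snd.functor.obj x.fst), x.snd⟩)
        ((SMLin.Hom₂.nat α.snd).app x.fst) (𝟙 x.snd) :=
  comp_eq_of_eq_id (C := LinTensor k X''.snd.carrier Y.snd.carrier) _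
    (comp_eq_of_eq_id (X := (⟨G.snd.functor.obj (F.snd.functor.obj x.fst), x.snd⟩ :
      LinTensor k X''.snd.carrier Y.snd.carrier)) _ (Category.comp_id
        (X := (⟨G.snd.functor.obj (F.snd.functor.obj x.fst), x.snd⟩ :
        LinTensor k X''.snd.carrier Y.snd.carrier)) (𝟙 _)))

lemma tensorRight_mapComp_map₂_snd {X X' X'' : GluedCat.{u} R k} {F : X ⟶ X'} {G : X' ⟶ X''}
    {H : X ⟶ X''} (α : F ≫ G ⟶ H) (x : LinTensor k X.snd.carrier Y.snd.carrier) :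
    (SMLin.Hom₂.nat (((((tensorRight Y).mapComp F G).inv ≫ (tensorRight Y).map₂ (𝟙 (F ≫ G))) ≫
        (tensorRight Y).map₂ α).snd)).app x =
      LinTensor.tmul (R := k) (X := ⟨G.snd.functor.obj (F.snd.functor.obj x.fst), x.snd⟩)
        (Y := ⟨H.snd.functor.obj x.fst, x.snd⟩) ((SMLin.Hom₂.nat α.snd).app x.fst) (𝟙 x.snd) :=
  comp_eq_of_id_eq (C := LinTensor k X''.snd.carrier Y.snd.carrier) _
    (comp_eq_of_id_eq (Y := (⟨G.snd.functor.obj (F.snd.functor.obj x.fst), x.snd⟩ :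
      LinTensor k X''.snd.carrier Y.snd.carrier)) _ (Category.comp_id
        (X := (⟨G.snd.functor.obj (F.snd.functor.obj x.fst), x.snd⟩ :
        LinTensor k X''.snd.carrier Y.snd.carrier)) (𝟙 _)))

lemma sndDiag_tensorRight_mapId_app (e : E)
    (x : LinTensor k (J.obj e).as.snd.carrier Y.snd.carrier) :
    ((LinDiag.ofSMLin (sndDiag (J.comp (pithMap (tensorRight Y))))).mapId e).hom.app x =
      (LinDiag.mapId
        ((LinDiag.ofSMLin (sndDiag J)).tensor (LinDiag.const k E Y.snd.carrier)) e).hom.app x :=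
  (sndDiag_mapId_app (J.comp (pithMap (tensorRight Y))) e x).trans
    ((tensorRight_map₂_mapId_snd Y (J.mapId e).hom.iso.hom x).trans
      (congrArg (fun γ => LinTensor.tmul (R := k) (X := ⟨(J.map (𝟙 e)).of.snd.functor.obj x.fst,
        x.snd⟩) (Y := x) γ (𝟙 x.snd))
        (sndDiag_mapId_app J e x.fst).symm))

lemma sndDiag_tensorRight_mapComp_app {e e' e'' : E} (f : e ⟶ e') (g : e' ⟶ e'')
    (x : LinTensor k (J.obj e).as.snd.carrier Y.snd.carrier) :
    ((LinDiag.ofSMLin (sndDiag (J.comp (pithMap (tensorRight Y))))).mapComp f g).hom.app x =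
      (((LinDiag.ofSMLin (sndDiag J)).tensor (LinDiag.const k E Y.snd.carrier)).mapComp f
        g).hom.app x :=
  (sndDiag_mapComp_app (J.comp (pithMap (tensorRight Y))) f g x).trans
    ((tensorRight_map₂_mapComp_snd Y (J.mapComp f g).hom.iso.hom x).trans
      (congrArg (fun γ => LinTensor.tmul (R := k) (X := ⟨(J.map (f ≫ g)).of.snd.functor.obj x.fst,
        x.snd⟩) (Y := ⟨(J.map g).of.snd.functor.obj ((J.map f).of.snd.functor.obj x.fst), x.snd⟩) γ
        (𝟙 x.snd))
        (sndDiag_mapComp_app J f g x.fst).symm))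

/-- The second components of a diagram tensored on the right. -/
@[reducible] def sndDiagTensorRight :
    LinDiag.Equiv (LinDiag.ofSMLin (sndDiag (J.comp (pithMap (tensorRight Y)))))
      ((LinDiag.ofSMLin (sndDiag J)).tensor (LinDiag.const k E Y.snd.carrier)) where
  F e := 𝟭 (LinTensor k (J.obj e).as.snd.carrier Y.snd.carrier)
  additive e := inferInstanceAs (𝟭 (LinTensor k (J.obj e).as.snd.carrier Y.snd.carrier)).Additive
  linear e := inferInstanceAs ((𝟭 (LinTensor k (J.obj e).as.snd.carrier Y.snd.carrier)).Linear k)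
  isEquivalence e :=
    inferInstanceAs (𝟭 (LinTensor k (J.obj e).as.snd.carrier Y.snd.carrier)).IsEquivalence
  iso f := Iso.refl (LinTensor.mapFunctor (R := k) (J.map f).of.snd.functor (𝟭 Y.snd.carrier))
  map₂ η x := (Category.comp_id _).trans (Category.id_comp _).symm
  id e x := (Category.id_comp _).trans (sndDiag_tensorRight_mapId_app Y J e x).symm
  comp {e e' e''} f g x := id_comp_eq_comp_ids (C := LinTensor k (J.obj e'').as.snd.carrier
    Y.snd.carrier)
    (sndDiag_tensorRight_mapComp_app Y J f g x).symm rfl (CategoryTheory.Functor.map_id _ _)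

variable {J}

lemma isColim_sndCocone_tensorRight {X : Pith (GluedCat.{u} R k)} (c : BiCocone J X)
    (h : (LinCocone.ofSMLin (sndCocone c)).IsColim) :
    (LinCocone.ofSMLin (sndCocone (c.map (pithMap (tensorRight Y))))).IsColim := by
  let F : LinTensor k X.as.snd.carrier Y.snd.carrier ⥤
      ((pithMap (tensorRight Y)).obj X).as.snd.carrier :=
    𝟭 (LinTensor k X.as.snd.carrier Y.snd.carrier)
  have hF : F.Additive := inferInstanceAs (𝟭 (LinTensor k X.as.snd.carrier Y.snd.carrier)).Additive
  have hF' : F.Linear k := inferInstanceAs ((𝟭 (LinTensor k X.as.snd.carrier Y.snd.carrier)).Linear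
    k)
  have : F.IsEquivalence := inferInstanceAs (𝟭 (LinTensor k X.as.snd.carrier
    Y.snd.carrier)).IsEquivalence
  refine ((h.tensorRight Y.snd.carrier).pullback (sndDiagTensorRight Y J)).of_equivalence _ F
    (fun e => Iso.refl (LinTensor.mapFunctor (R := k) (c.leg e).of.snd.functor (𝟭 Y.snd.carrier)))
    (fun e e' f x => (Category.id_comp _).trans (Eq.trans ?_ (Category.comp_id _).symm))
  refine (snd_iso_app (c.map (pithMap (tensorRight Y))) f x).trans ?_
  refine (tensorRight_mapComp_map₂_snd Y (c.legIso f).hom.iso.hom x).trans ?_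
  refine Eq.trans ?_ (comp_eq_of_id_eq (C := LinTensor k X.as.snd.carrier Y.snd.carrier)
    ((((LinCocone.ofSMLin (sndCocone c)).tensor (LinCocone.const k E Y.snd.carrier)).iso f).hom.app
      x) (CategoryTheory.Functor.map_id
      (LinTensor.mapFunctor (R := k) (c.leg e').of.snd.functor (𝟭 Y.snd.carrier))
        ⟨(J.map f).of.snd.functor.obj x.fst, x.snd⟩)).symm
  exact congrArg (fun γ => LinTensor.tmul (R := k) (X := ⟨(c.leg e').of.snd.functor.obj
    ((J.map f).of.snd.functor.obj x.fst), x.snd⟩) (Y := ⟨(c.leg e).of.snd.functor.obj x.fst,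
    x.snd⟩) γ (𝟙 x.snd))
    (snd_iso_app c f x.fst).symm

end

variable (R k)

/-- Triples form a tensor sifted cocomplete (2,1)-category. -/
lemma isTensorSiftedCocomplete : IsTensorSiftedCocomplete (tensor.{u} R k) where
  exists_bicolimit E _ _ J := by
    obtain ⟨X, c, h⟩ := exists_isColim J
    exact ⟨X, c, (isBicolimit_iff c).2 h⟩
  tensorLeft E _ _ J X c Y hc :=
    have h := (isBicolimit_iff c).1 hc
    (isBicolimit_iff (c.map (pithMap (tensorLeft Y)))).2
      ⟨isColim_fstCocone_tensorLeft Y c h.1, isColim_sndCocone_tensorLeft Y c h.2⟩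
  tensorRight E _ _ J X c Y hc :=
    have h := (isBicolimit_iff c).1 hc
    (isBicolimit_iff (c.map (pithMap (tensorRight Y)))).2
      ⟨isColim_fstCocone_tensorRight Y c h.1, isColim_sndCocone_tensorRight Y c h.2⟩

end GluedCat

end

end

end

theorem lemma5p2 :
    (IsTensorSiftedCocomplete AP0Cat.tensor.{u} ∧
      PsPullback.SiftedBicolimitsComponentwise (baseChange.{u} (DualNumber ℂ) ℂ) (toPt.{u} ℂ)) ∧
    (IsTensorSiftedCocomplete BD0Cat.tensor.{u} ∧
      PsPullback.SiftedBicolimitsComponentwise (baseChange.{u} (PowerSeries ℂ) ℂ) (toPt.{u} ℂ)) :=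
  ⟨⟨GluedCat.isTensorSiftedCocomplete _ _, GluedCat.siftedBicolimitsComponentwise _ _⟩,
    GluedCat.isTensorSiftedCocomplete _ _, GluedCat.siftedBicolimitsComponentwise _ _⟩
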